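/- **Setting.** Fix $d,p\in\mathbb N$, $p\ge 2$, $\varsigma>0$, and write $|j|=|j_1|+\dots+|j_d|$ for $j\in\mathbb Z^d$. Let $f:(-\varsigma,\infty)\to(0,\infty)$ be $C^3$ with $f'$ having only isolated zeros, let $G:(-\varsigma,\infty)\to\mathbb R$ be $C^4$, and suppose that for some constants $c,C'>0$ and all $x\ge 0$ $$f(x)\ge c(1+x^{p/2}),\qquad |f'(x)|x^{1/2}+|f''(x)|x+|f'''(x)|x^{3/2}\le C' f(x),$$ $$|G'(x)|x^{1/2}+|G''(x)|x+|G'''(x)|x^{3/2}\le C'(1+x^{(p-1)/2}).$$ Let $F_j:[0,\infty)\to\mathbb R$ satisfy $F_j'=f_j:=(-1)^{|j|}f$ for $j\in\mathbb Z^d$ (alternated spins). Fix constants $T_{\max}$, $C_g$. For a finite set $\mathcal C\subset\mathbb Z^d$ with $N$ elements, $\mathbb C^N$ has coordinates $u=(u_j)_{j\in\mathcal C}$, $u_j=x_j+iy_j$, and symplectic form $\sum_j dx_j\wedge dy_j$; $\nabla_j=2\partial_{\bar u_j}=\partial_{x_j}+i\partial_{y_j}$, and all sums over sites run over $\mathcal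 C$. Let $0<\mathcal T_j\le T_{\max}$ for $j\in\mathcal C$, and let $g_l:\mathbb C^N\to\mathbb C$, $l\in\mathcal C$, be $C^2$, depend only on $(u_k)_{|k-l|\le 1}$, satisfy $$|g_l(u)|,\ |\partial_{u_m}g_l(u)|,\ |\partial_{\bar u_m}g_l(u)|\le C_g\Big(1+\sum_{|k-l|\le1}|u_k|^{p-1}\Big)\quad\text{for all } l,m\in\mathcal C,$$ and have second derivatives of at most polynomial growth. For $\varepsilon>0$ put $$H^\varepsilon(u)=\tfrac12\sum_jF_j(|u_j|^2)+\tfrac{\sqrt\varepsilon}{4}\sum_{|j-k|=1}G(|u_j-u_k|^2),$$ where the second sum is over ordered pairs. Let $\beta=(\beta_j)_{j\in\mathcal C}$ be a standard complex Brownian motion (the real and imaginary parts of all $\beta_j$ are independent standard real Brownian motions) and consider $$\dot u_j=i\nabla_jH^\varepsilon(u)+\varepsilon g_j(u)+\sqrt{\varepsilon\mathcal T_j}\,\dot\beta_j,\qquad j\in\mathcal C.\tag{1}$$ Let $\langle P\rangle(v)$ be the average of $P$ over the torus $\{(|v_k|e^{i\psi_k})_k\}$ with respect to the normalized Lebesgue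 measure in $\psi$. For $\tfrac12<\gamma<1$, $j\in\mathcal C$, $q>0$, put $(a\cdot b)_j=\sum_k\gamma^{|k-j|}\mathrm{Re}(a_k\bar b_k)$ and $\|a\|_{j,q}^q=\sum_k\gamma^{|k-j|}|a_k|^q$. **Theorem.** There are constants $\varepsilon_0,C>0$, $C(\gamma)$, $C(q)$, $C(\gamma,q)$, depending only on $d,p,\varsigma,f,G,(F_j),T_{\max},C_g$ and the indicated arguments (in particular not on $\mathcal C$, $N$, the positions of the sites or $\varepsilon$), such that for all $\mathcal C,(\mathcal T_j),(g_l)$ as above there are real functions $\Phi\in C^3(\mathbb C^N)$ and $H_2\in C^2(\mathbb C^N)$, independent of $\varepsilon$, with the following properties for every $0<\varepsilon\le\varepsilon_0$. Let $\Gamma$, $v\mapsto u=\Gamma(v)$, be the time-1 map of the flow of $\dot w=i\nabla(\sqrt\varepsilon\,\Phi)(w)$. It is a well-defined bijection of $\mathbb C^N$ which together with its inverse $u\mapsto v$ is $C^2$-smooth, and it is canonical (preserves the symplectic form). There is a $C^2$ function $H^\varepsilon_>$ such that $$H^\varepsilon(\Gamma(v))=H_0^\varepsilon(v)+\varepsilon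 H_2(v)+\varepsilon\sqrt\varepsilon\,H^\varepsilon_>(v),\qquad H^\varepsilon_0(v)=\tfrac12\sum_jF_j(|v_j|^2)+\tfrac{\sqrt\varepsilon}{4}\sum_{|j-k|=1}\langle G(|v_j-v_k|^2)\rangle,$$ where $H_0^\varepsilon$ depends only on the actions $\tfrac12|v_j|^2$ and is $C^4$. There is a continuous $r^\varepsilon:\mathbb C^N\to\mathbb C^N$ such that, whenever $u(t)$, $t\ge0$, is a continuous adapted solution of (1), the process $v(t)=\Gamma^{-1}(u(t))$ solves the Itô equation $$\dot v=i\nabla H^\varepsilon_0(v)+\varepsilon i\nabla H_2(v)+\varepsilon g(v)+\varepsilon\sqrt\varepsilon\,r^\varepsilon(v)+\sqrt\varepsilon\,(W^{1}(v)\dot\beta+W^{2}(v)\dot{\bar\beta}),\qquad v(0)=\Gamma^{-1}(u(0)),$$ where $W^{1}_{kl}=\sqrt{\mathcal T_l}\,\partial_{u_l}v_k$ and $W^{2}_{kl}=\sqrt{\mathcal T_l}\,\partial_{\bar u_l}v_k$. Moreover, for all $j,k,l\in\mathcal C$, $\tfrac12<\gamma<1$ and $v\in\mathbb C^N$, with $u=\Gamma(v)$: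 1. $|(i\nabla H_2\cdot v)_j|\le(1-\gamma)\,C\,\|v\|_{j,p}^p+C(\gamma)$. 2. (a) $\nabla_jH_2$ depends only on $v_n$ with $|n-j|\le2$, and $|\nabla_jH_2|\le C\sum_{|n-j|\le2}|v_n|^{p-1}+C$. (b) For every $q\ge1$, $\|r^\varepsilon(v)\|_{j,q}^q\le C(\gamma,q)+C(q)\|v\|_{j,q(p-1)}^{q(p-1)}$. 3. The matrices $d^1=\overline{W^1}(W^1)^T+\overline{W^2}(W^2)^T$ and $d^2=W^2(W^1)^T+W^1(W^2)^T$ satisfy $|d^1_{kl}-\delta_{kl}\mathcal T_k|\le C\sqrt\varepsilon$ and $|d^2_{kl}|\le C\sqrt\varepsilon$. 4. $|u_j-v_j|\le C\sqrt\varepsilon$ and $\big|\tfrac12|u_j|^2-\tfrac12|v_j|^2\big|\le C\sqrt\varepsilon$. -/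

import Mathlib

open MeasureTheory ProbabilityTheory Filter Topology
open scoped NNReal ENNReal

noncomputable section

namespace Rotators

/-! ### The lattice, the phase space and its symplectic calculus -/

/-- The `ℓ¹`-norm of a site of `ℤ^d`. -/
def siteNorm {d : ℕ} (j : Fin d → ℤ) : ℕ := ∑ i, (j i).natAbs

/-- The phase space `ℂ^N`, with coordinates indexed by the `N` sites of the finite set `Λ ⊂ ℤ^d`. -/
abbrev Phase {d : ℕ} (Λ : Finset (Fin d → ℤ)) : Type := Λ → ℂ

section Calculus

variable {d : ℕ} {Λ : Finset (Fin d → ℤ)}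

/-- The distance `|j - k|` between two sites of `Λ`. -/
def dist1 (j k : Λ) : ℕ := siteNorm (j.1 - k.1)

/-- `∇_j h = ∂h/∂x_j + i ∂h/∂y_j = 2 ∂h/∂ū_j`, for real-valued `h` and `u_j = x_j + i y_j`. -/
def grad (h : Phase Λ → ℝ) (u : Phase Λ) (j : Λ) : ℂ :=
  (fderiv ℝ h u (Pi.single j 1) : ℂ) + Complex.I * (fderiv ℝ h u (Pi.single j Complex.I) : ℂ)

/-- The Wirtinger derivative `∂φ/∂u_l = (∂φ/∂x_l - i ∂φ/∂y_l) / 2`. -/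
def dz (φ : Phase Λ → ℂ) (u : Phase Λ) (l : Λ) : ℂ :=
  (fderiv ℝ φ u (Pi.single l 1) - Complex.I * fderiv ℝ φ u (Pi.single l Complex.I)) / 2

/-- The Wirtinger derivative `∂φ/∂ū_l = (∂φ/∂x_l + i ∂φ/∂y_l) / 2`. -/
def dzbar (φ : Phase Λ → ℂ) (u : Phase Λ) (l : Λ) : ℂ :=
  (fderiv ℝ φ u (Pi.single l 1) + Complex.I * fderiv ℝ φ u (Pi.single l Complex.I)) / 2

/-- The symplectic form `∑ dx_j ∧ dy_j`. -/
def symp (a b : Phase Λ) : ℝ := ∑ j, ((a j).re * (b j).im - (a j).im * (b j).re)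

/-- A canonical `C²` change of variables: a `C²` diffeomorphism preserving the symplectic form. -/
structure IsCanonical (Γ : Phase Λ ≃ Phase Λ) : Prop where
  smooth : ContDiff ℝ 2 Γ
  smooth_symm : ContDiff ℝ 2 Γ.symm
  symplectic : ∀ v a b : Phase Λ, symp (fderiv ℝ Γ v a) (fderiv ℝ Γ v b) = symp a b

/-- `Γ` is the time-one map of the flow of the Hamiltonian equation `ẇ = i ∇h(w)`. -/
def IsTimeOneMap (h : Phase Λ → ℝ) (Γ : Phase Λ → Phase Λ) : Prop :=
  ∃ X : ℝ → Phase Λ → Phase Λ, (∀ v, X 0 v = v) ∧ (∀ v, X 1 v = Γ v) ∧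
    ∀ v s, HasDerivAt (fun τ : ℝ => X τ v) (fun j => Complex.I * grad h (X s v) j) s

/-- The weighted scalar product `(a · b)_j = ∑_k γ^{|k-j|} Re (a_k b̄_k)`. -/
def wInner (γ : ℝ) (j : Λ) (a b : Phase Λ) : ℝ :=
  ∑ k, γ ^ dist1 k j * (a k * (starRingEnd ℂ) (b k)).re

/-- The `q`-th power `‖a‖_{j,q}^q = ∑_k γ^{|k-j|} |a_k|^q` of the weighted `ℓ_q`-norm. -/
def wNormPow (γ : ℝ) (j : Λ) (q : ℝ) (a : Phase Λ) : ℝ :=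
  ∑ k, γ ^ dist1 k j * ‖a k‖ ^ q

/-- The averaging in angles `⟨P⟩`: the mean of `P` over the torus of all points with the same
moduli of the coordinates as `v`, with respect to the normalized Lebesgue measure on the angles. -/
def angleAvg (P : Phase Λ → ℝ) (v : Phase Λ) : ℝ :=
  ⨍ ψ in Set.Icc (0 : Λ → ℝ) (fun _ => 2 * Real.pi),
    P (fun k => (‖v k‖ : ℂ) * Complex.exp ((ψ k : ℂ) * Complex.I))

end Calculus

/-! ### The Hamiltonians -/

section Hamiltonians

variable {d : ℕ} (F : (Fin d → ℤ) → ℝ → ℝ) (G : ℝ → ℝ) (ε : ℝ) (Λ : Finset (Fin d → ℤ))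

/-- `H^ε(u) = ½ ∑_j F_j(|u_j|²) + (√ε / 4) ∑_{|j-k|=1} G(|u_j - u_k|²)`
(the second sum is over ordered pairs). -/
def hamiltonian (u : Phase Λ) : ℝ :=
  (1 / 2) * ∑ j : Λ, F j.1 (‖u j‖ ^ 2) +
    (√ε / 4) * ∑ j : Λ, ∑ k : Λ, if dist1 j k = 1 then G (‖u j - u k‖ ^ 2) else 0

/-- `H_0^ε(v) = ½ ∑_j F_j(|v_j|²) + (√ε / 4) ∑_{|j-k|=1} ⟨G(|v_j - v_k|²)⟩`. -/
def hamiltonian0 (v : Phase Λ) : ℝ :=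
  (1 / 2) * ∑ j : Λ, F j.1 (‖v j‖ ^ 2) +
    (√ε / 4) * ∑ j : Λ, ∑ k : Λ,
      if dist1 j k = 1 then angleAvg (fun w : Phase Λ => G (‖w j - w k‖ ^ 2)) v else 0

end Hamiltonians

/-! ### Assumptions on the coefficients -/

/-- The frequency `f` (the alternated frequencies being `f_j = (-1)^{|j|} f`). -/
structure AssumptionHF (p : ℕ) (ς : ℝ) (f : ℝ → ℝ) : Prop where
  pos : ∀ x, -ς < x → 0 < f x
  smooth : ContDiffOn ℝ 3 f (Set.Ioi (-ς))
  isolated_zeros : ∀ x, -ς < x → deriv f x = 0 → ∀ᶠ y in 𝓝[≠] x, deriv f y ≠ 0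
  lower : ∃ C : ℝ, 0 < C ∧ ∀ x : ℝ, 0 ≤ x → C * (1 + x ^ ((p : ℝ) / 2)) ≤ f x
  upper : ∃ C : ℝ, ∀ x : ℝ, 0 ≤ x →
    |deriv f x| * x ^ ((1 : ℝ) / 2) + |iteratedDeriv 2 f x| * x +
      |iteratedDeriv 3 f x| * x ^ ((3 : ℝ) / 2) ≤ C * f x

/-- The interaction potential `G`. -/
structure AssumptionHG (p : ℕ) (ς : ℝ) (G : ℝ → ℝ) : Prop where
  smooth : ContDiffOn ℝ 4 G (Set.Ioi (-ς))
  upper : ∃ C : ℝ, ∀ x : ℝ, 0 ≤ x →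
    |deriv G x| * x ^ ((1 : ℝ) / 2) + |iteratedDeriv 2 G x| * x +
      |iteratedDeriv 3 G x| * x ^ ((3 : ℝ) / 2) ≤ C * (1 + x ^ (((p : ℝ) - 1) / 2))

/-- The smoothness, locality and growth of the dissipations `g_l`, with the constant `Cg`. -/
structure AssumptionHg {d : ℕ} (p : ℕ) (Cg : ℝ) (Λ : Finset (Fin d → ℤ))
    (g : Phase Λ → Phase Λ) : Prop where
  smooth : ∀ l, ContDiff ℝ 2 (fun u => g u l)
  isLocal : ∀ l (u w : Phase Λ), (∀ k, dist1 k l ≤ 1 → u k = w k) → g u l = g w l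
  bound : ∀ l u, ‖g u l‖ ≤ Cg * (1 + ∑ k with dist1 k l ≤ 1, ‖u k‖ ^ (p - 1))
  bound_dz : ∀ l m u, ‖dz (fun u => g u l) u m‖ ≤
    Cg * (1 + ∑ k with dist1 k l ≤ 1, ‖u k‖ ^ (p - 1))
  bound_dzbar : ∀ l m u, ‖dzbar (fun u => g u l) u m‖ ≤
    Cg * (1 + ∑ k with dist1 k l ≤ 1, ‖u k‖ ^ (p - 1))
  bound_second : ∃ (K : ℝ) (m : ℕ), ∀ l u, ‖iteratedFDeriv ℝ 2 (fun u => g u l) u‖ ≤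
    K * (1 + ∑ k with dist1 k l ≤ 1, ‖u k‖) ^ m

/-! ### Stochastic integrals and stochastic equations -/

section Stochastic

variable {Ω : Type*} {mΩ : MeasurableSpace Ω}

/-- A simple integrand `∑_{i<n} ξ_i 1_{(t_i, t_{i+1}]}`, with `ξ_i` bounded and
`ℱ_{t_i}`-measurable. -/
structure SimpleIntegrand (ℱ : Filtration ℝ≥0 mΩ) where
  n : ℕ
  t : ℕ → ℝ≥0
  ξ : ℕ → Ω → ℂ
  mono : Monotone t
  adapted : ∀ i, StronglyMeasurable[ℱ (t i)] (ξ i)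
  bounded : ∃ K : ℝ, ∀ i ω, ‖ξ i ω‖ ≤ K

namespace SimpleIntegrand

variable {ℱ : Filtration ℝ≥0 mΩ}

/-- The value of a simple integrand at time `s`. -/
def val (S : SimpleIntegrand ℱ) (s : ℝ≥0) (ω : Ω) : ℂ :=
  ∑ i ∈ Finset.range S.n, (Set.Ioc (S.t i) (S.t (i + 1))).indicator (fun _ => S.ξ i ω) s

/-- The elementary stochastic integral `∑_{i<n} ξ_i (M_{t_{i+1} ∧ T} - M_{t_i ∧ T})`. -/
def integral (S : SimpleIntegrand ℱ) (M : ℝ≥0 → Ω → ℂ) (T : ℝ≥0) (ω : Ω) : ℂ :=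
  ∑ i ∈ Finset.range S.n, S.ξ i ω * (M (min (S.t (i + 1)) T) ω - M (min (S.t i) T) ω)

end SimpleIntegrand

/-- `X_T = ∑_l ∫_0^T H_l dM_l` for all `T ≥ 0`, as an Itô integral with respect to the
finitely many (Brownian) integrators `M_l`: there are simple integrands `S^n_l` with
`∫_0^T |S^n_l - H_l|² ds → 0` in probability for each `l`, whose elementary
integrals satisfy `∑_l ∫_0^T S^n_l dM_l → X_T` in probability. -/
def IsItoIntegral {κ : Type*} [Fintype κ] (ℱ : Filtration ℝ≥0 mΩ) (μ : Measure Ω)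
    (M H : κ → ℝ≥0 → Ω → ℂ) (X : ℝ≥0 → Ω → ℂ) : Prop :=
  ∃ S : ℕ → κ → SimpleIntegrand ℱ, ∀ T : ℝ≥0,
    (∀ l, ∀ δ : ℝ≥0∞, 0 < δ → Tendsto
      (fun n => μ {ω | δ ≤ ∫⁻ s in Set.Ioc (0 : ℝ) T,
        ‖(S n l).val s.toNNReal ω - H l s.toNNReal ω‖ₑ ^ 2}) atTop (𝓝 0)) ∧
    TendstoInMeasure μ (fun n ω => ∑ l, (S n l).integral (M l) T ω) atTop (X T)

variable {d : ℕ} {Λ : Finset (Fin d → ℤ)}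

/-- `β = (β_j)` is a standard complex Brownian motion relative to the filtration `ℱ`: the real and
imaginary parts of all `β_j` are independent standard real Brownian motions, `β` is adapted and
its increments after time `s` are independent of `ℱ_s`. -/
structure IsComplexBrownian (ℱ : Filtration ℝ≥0 mΩ) (μ : Measure Ω)
    (β : ℝ≥0 → Ω → Phase Λ) : Prop where
  adapted : StronglyAdapted ℱ β
  re : ∀ j, IsBrownianReal (fun t ω => (β t ω j).re) μ
  im : ∀ j, IsBrownianReal (fun t ω => (β t ω j).im) μ
  indep : iIndepFun (fun (i : Λ ⊕ Λ) (ω : Ω) (t : ℝ≥0) =>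
    Sum.elim (fun j => (β t ω j).re) (fun j => (β t ω j).im) i) μ
  indep_past : ∀ s t : ℝ≥0, s ≤ t →
    Indep (ℱ s) (MeasurableSpace.comap (fun ω => β t ω - β s ω) inferInstance) μ

/-- `u` is a continuous adapted solution, for all `t ≥ 0`, of
`du_j = b_j(u) dt + c_j dβ_j` with constant `c_j`. -/
structure SolvesAdditive (ℱ : Filtration ℝ≥0 mΩ) (μ : Measure Ω) (β : ℝ≥0 → Ω → Phase Λ)
    (b : Phase Λ → Phase Λ) (c : Λ → ℝ) (u : ℝ≥0 → Ω → Phase Λ) : Prop where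
  adapted : StronglyAdapted ℱ u
  cont : ∀ᵐ ω ∂μ, Continuous (fun t => u t ω)
  eqn : ∀ᵐ ω ∂μ, ∀ t : ℝ≥0, ∀ j,
    u t ω j = u 0 ω j + (∫ s in (0 : ℝ)..t, b (u s.toNNReal ω) j) + (c j : ℂ) * β t ω j

/-- `v` is a continuous adapted solution, for all `t ≥ 0`, of the Itô equation
`dv_k = b_k(v) dt + ∑_l σ¹_{kl}(v) dβ_l + ∑_l σ²_{kl}(v) dβ̄_l`, that is, the process
`v_k(t) - v_k(0) - ∫_0^t b_k(v) ds` is the Itô integral of the dispersion. -/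
structure SolvesIto (ℱ : Filtration ℝ≥0 mΩ) (μ : Measure Ω) (β : ℝ≥0 → Ω → Phase Λ)
    (b : Phase Λ → Phase Λ) (σ₁ σ₂ : Phase Λ → Matrix Λ Λ ℂ)
    (v : ℝ≥0 → Ω → Phase Λ) : Prop where
  adapted : StronglyAdapted ℱ v
  cont : ∀ᵐ ω ∂μ, Continuous (fun t => v t ω)
  eqn : ∀ k, IsItoIntegral ℱ μ
    (Sum.elim (fun l t ω => β t ω l) (fun l t ω => (starRingEnd ℂ) (β t ω l)))
    (Sum.elim (fun l t ω => σ₁ (v t ω) k l) (fun l t ω => σ₂ (v t ω) k l))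
    (fun t ω => v t ω k - v 0 ω k - ∫ s in (0 : ℝ)..t, b (v s.toNNReal ω) k)

end Stochastic

/-! ### The transformed dispersion -/

section Dispersion

variable {d : ℕ} {Λ : Finset (Fin d → ℤ)}

/-- `W¹_{kl} = √T_l ∂v_k/∂u_l`, as a function of `v`, where `u = Γ v`. -/
def W1 (T : Λ → ℝ) (Γ : Phase Λ ≃ Phase Λ) (v : Phase Λ) : Matrix Λ Λ ℂ :=
  Matrix.of fun k l => (√(T l) : ℂ) * dz (fun u => Γ.symm u k) (Γ v) l

/-- `W²_{kl} = √T_l ∂v_k/∂ū_l`, as a function of `v`, where `u = Γ v`. -/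
def W2 (T : Λ → ℝ) (Γ : Phase Λ ≃ Phase Λ) (v : Phase Λ) : Matrix Λ Λ ℂ :=
  Matrix.of fun k l => (√(T l) : ℂ) * dzbar (fun u => Γ.symm u k) (Γ v) l

/-- The diffusion coefficients `d¹`: the matrix `conj(W¹) (W¹)ᵀ + conj(W²) (W²)ᵀ`. -/
def diff1 (A B : Matrix Λ Λ ℂ) : Matrix Λ Λ ℂ :=
  A.map (starRingEnd ℂ) * A.transpose + B.map (starRingEnd ℂ) * B.transpose

/-- The diffusion coefficients `d²`: the matrix `W² (W¹)ᵀ + W¹ (W²)ᵀ`. -/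
def diff2 (A B : Matrix Λ Λ ℂ) : Matrix Λ Λ ℂ :=
  B * A.transpose + A * B.transpose

end Dispersion

end Rotators

end

open Rotators

namespace Rotators

/-! ### The lattice -/

section Lattice

variable {d : ℕ}

/-! The interaction of two neighbours depends on their angles only through the difference, whose
frequency in the uncoupled system is `f_j(|u_j|²) - f_k(|u_k|²)`. Since neighbouring spins
alternate, this equals `±(f(|u_j|²) + f(|u_k|²))`, of modulus at least `c (1 + |u_j|^p + |u_k|^p)`:
there are no small divisors anywhere in the phase space, and one step of averaging can be done
globally. For the pair potential `A = G(|a - b|²)` with angular mean `A₀` and for `S = f(|a|²) +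
f(|b|²)`, the function `B = S⁻¹ (2π)⁻¹ ∫ (s - π) A(e^{is} a, b) ds` satisfies `S ∂_θ B = A - A₀`
(`fderiv_pairAvg_sub_pi`). As `S` grows at least as fast as `A` and dominates its own derivatives,
`B` has bounded derivatives of orders one to three and a bounded angular derivative
(`exists_pairBounds`). For `Φ = ¼ ∑ (-1)^{|j|} B(u_j, u_k)` the field `i∇Φ` is bounded together with
two derivatives, couples only nearest neighbours, and differentiates the uncoupled Hamiltonian into
`-(A - A₀)` summed over pairs (`homological_equation`).

`Γ` is the time-one map of `√ε i∇Φ`. In the Taylor expansion of the Hamiltonian along this flow the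
first order replaces `A` by `A₀`, the second order leaves `H₂ = ½ d(A + A₀)(i∇Φ)`, and the rest has
size `ε√ε` (`abs_third_order_remainder_le`). The gradient of the rest is estimated by applying this
expansion to the difference of two trajectories, started at `v + a` and at `v`, which costs only one
derivative of the second Lie derivatives (`abs_ham3_sub_le`). Uniformity in the number of sites
comes from `weighted_gronwall`: the influence of site `l` on site `j` decays like `4^{-|j-l|}` for
the flow and for its first two derivatives, and such weights are summable over the lattice.

The factor `1 - γ` in the estimate of `(i∇H₂ · v)_j` comes from a symmetry: each local term of `H₂`
is invariant under a simultaneous rotation of all spins, so its angular derivatives sum to zero and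
only differences of the weights at nearby sites survive (`abs_wInner_ham2_le`). The actions move by
`O(√ε)` even at large amplitude because their speed is an angular derivative of `Φ`
(`abs_action_sub_le`).

For the stochastic equation, the flow is `C²` because the Picard operator on curves is a small
perturbation of the identity (`exists_contDiff_picard`), and canonical because a Hessian is
symmetric (`symp_fderiv_flow`). A canonical map carries Hamiltonian fields to Hamiltonian fields;
the change of `g` and the Itô correction involve `DΓ⁻¹ - 1`, `Γ - 1` and `D²Γ⁻¹`, all of size `√ε`,
so they belong to the remainder (`ito_drift_eq`, `norm_driftRem_le`). Itô's formula
(`isItoIntegral_comp`) is derived from the definition of the integral: a pathwise second order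
Taylor expansion on a grid, and `L²`-orthogonality of the fluctuations of the quadratic variation.
-/

lemma siteNorm_zero : siteNorm (0 : Fin d → ℤ) = 0 := by simp [siteNorm]

lemma siteNorm_neg (j : Fin d → ℤ) : siteNorm (-j) = siteNorm j := by simp [siteNorm]

lemma siteNorm_add_le (j k : Fin d → ℤ) : siteNorm (j + k) ≤ siteNorm j + siteNorm k := by
  unfold siteNorm
  rw [← Finset.sum_add_distrib]
  exact Finset.sum_le_sum fun i _ => Int.natAbs_add_le _ _

/-- The constant `((1 + x) / (1 - x))^d = ∑_{k ∈ ℤ^d} x^{|k|}`. -/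
noncomputable def latticeConst (d : ℕ) (x : ℝ) : ℝ := ((1 + x) / (1 - x)) ^ d

lemma sum_pow_natAbs_le {x : ℝ} (h0 : 0 ≤ x) (h1 : x < 1) (s : Finset ℤ) :
    ∑ m ∈ s, x ^ m.natAbs ≤ (1 + x) / (1 - x) := by
  have hg := hasSum_geometric_of_lt_one h0 h1
  have h2 : HasSum (fun n : ℕ => x ^ (-((n : ℤ) + 1)).natAbs) (x * (1 - x)⁻¹) := by
    have := hg.mul_left x
    refine this.congr_fun ?_
    intro n
    have : (-((n : ℤ) + 1)).natAbs = n + 1 := by omega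
    rw [this, pow_succ']
  have h3 : HasSum (fun n : ℕ => x ^ ((n : ℤ)).natAbs) (1 - x)⁻¹ := by simpa using hg
  have h4 : HasSum (fun m : ℤ => x ^ m.natAbs) ((1 - x)⁻¹ + x * (1 - x)⁻¹) :=
    HasSum.of_nat_of_neg_add_one h3 h2
  have h5 := sum_le_hasSum s (fun i _ => by positivity) h4
  refine h5.trans (le_of_eq ?_)
  field_simp

/-- For the `ℓ¹`-norm the weight is a product over the coordinates, so after enlarging `s` to a box
the sum factors into one-dimensional geometric series. This is the source of all bounds that do not
depend on `Λ`. -/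
lemma sum_pow_siteNorm_le {x : ℝ} (h0 : 0 ≤ x) (h1 : x < 1) (s : Finset (Fin d → ℤ)) :
    ∑ m ∈ s, x ^ siteNorm m ≤ latticeConst d x := by
  classical
  let t : Finset ℤ := Finset.univ.biUnion fun i : Fin d => s.image fun m => m i
  have hs : s ⊆ Fintype.piFinset fun _ => t := by
    intro m hm
    rw [Fintype.mem_piFinset]
    intro i
    exact Finset.mem_biUnion.2 ⟨i, Finset.mem_univ i, Finset.mem_image_of_mem _ hm⟩
  calc ∑ m ∈ s, x ^ siteNorm m ≤ ∑ m ∈ Fintype.piFinset fun _ => t, x ^ siteNorm m :=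
        Finset.sum_le_sum_of_subset_of_nonneg hs fun _ _ _ => by positivity
    _ = ∏ _i : Fin d, ∑ m ∈ t, x ^ m.natAbs := by
        rw [Finset.prod_univ_sum]
        refine Finset.sum_congr rfl fun m _ => ?_
        rw [siteNorm, Finset.prod_pow_eq_pow_sum]
    _ ≤ latticeConst d x := by
        rw [Finset.prod_const, latticeConst, Finset.card_univ, Fintype.card_fin]
        exact pow_le_pow_left₀ (Finset.sum_nonneg fun _ _ => by positivity)
          (sum_pow_natAbs_le h0 h1 t) d

lemma latticeConst_nonneg {x : ℝ} (h0 : 0 ≤ x) (h1 : x < 1) : 0 ≤ latticeConst d x := by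
  have : 0 < 1 - x := by linarith
  unfold latticeConst
  positivity

variable {Λ : Finset (Fin d → ℤ)}

@[simp] lemma dist1_self (j : Λ) : dist1 j j = 0 := by simp [dist1, siteNorm_zero]

lemma dist1_comm (j k : Λ) : dist1 j k = dist1 k j := by
  unfold dist1
  rw [← siteNorm_neg, neg_sub]

lemma dist1_triangle (j k l : Λ) : dist1 j l ≤ dist1 j k + dist1 k l := by
  unfold dist1
  convert siteNorm_add_le (j.1 - k.1) (k.1 - l.1) using 2
  abel

lemma ne_of_dist1_eq_one {j k : Λ} (h : dist1 j k = 1) : j ≠ k := by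
  rintro rfl
  simp at h

lemma sum_pow_dist1_le {x : ℝ} (h0 : 0 ≤ x) (h1 : x < 1) (j : Λ) :
    ∑ k : Λ, x ^ dist1 k j ≤ latticeConst d x := by
  classical
  have hinj : Function.Injective fun k : Λ => k.1 - j.1 := fun a b h =>
    Subtype.ext (sub_left_injective h)
  refine le_trans (le_of_eq ?_)
    (sum_pow_siteNorm_le h0 h1 (Finset.univ.image fun k : Λ => k.1 - j.1))
  rw [Finset.sum_image hinj.injOn]
  rfl

lemma sum_pow_dist1_le' {x : ℝ} (h0 : 0 ≤ x) (h1 : x < 1) (j : Λ) :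
    ∑ k : Λ, x ^ dist1 j k ≤ latticeConst d x := by
  simpa only [dist1_comm j] using sum_pow_dist1_le h0 h1 j

/-- A bound for the number of the sites at distance at most `ρ` from a given one. -/
noncomputable def nbhdConst (d ρ : ℕ) : ℝ := 2 ^ ρ * latticeConst d (1 / 2)

lemma nbhdConst_nonneg (d ρ : ℕ) : 0 ≤ nbhdConst d ρ := by
  have := latticeConst_nonneg (d := d) (x := 1 / 2) (by norm_num) (by norm_num)
  unfold nbhdConst
  positivity

/-- Each site of the ball contributes at least `2^{-ρ}` to the lattice sum of ratio `1/2`. The count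
is crude but independent of `Λ`. -/
lemma card_nbhd_le (ρ : ℕ) (j : Λ) :
    ((Finset.univ.filter fun k : Λ => dist1 k j ≤ ρ).card : ℝ) ≤ nbhdConst d ρ := by
  have h := sum_pow_dist1_le (x := 1 / 2) (by norm_num) (by norm_num) j
  have h2 : ((Finset.univ.filter fun k : Λ => dist1 k j ≤ ρ).card : ℝ) * (1 / 2) ^ ρ ≤
      ∑ k : Λ, (1 / 2 : ℝ) ^ dist1 k j := by
    rw [← nsmul_eq_mul]
    refine (Finset.card_nsmul_le_sum _ _ _ fun k hk => ?_).trans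
      (Finset.sum_le_sum_of_subset_of_nonneg (Finset.filter_subset _ _)
        fun _ _ _ => by positivity)
    exact pow_le_pow_of_le_one (by norm_num) (by norm_num) (Finset.mem_filter.1 hk).2
  have h3 := h2.trans h
  rw [one_div, inv_pow, ← div_eq_mul_inv, div_le_iff₀ (by positivity)] at h3
  unfold nbhdConst
  rw [one_div]
  linarith

lemma sum_nbhd_le {ρ : ℕ} (j : Λ) {a : Λ → ℝ} {K : ℝ} (hK : 0 ≤ K)
    (h : ∀ k, dist1 k j ≤ ρ → a k ≤ K) :
    ∑ k with dist1 k j ≤ ρ, a k ≤ nbhdConst d ρ * K := by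
  calc ∑ k with dist1 k j ≤ ρ, a k ≤ ∑ k : Λ with dist1 k j ≤ ρ, K :=
        Finset.sum_le_sum fun k hk => h k (Finset.mem_filter.1 hk).2
    _ = (Finset.univ.filter fun k : Λ => dist1 k j ≤ ρ).card * K := by
        rw [Finset.sum_const, nsmul_eq_mul]
    _ ≤ _ := mul_le_mul_of_nonneg_right (card_nbhd_le ρ j) hK

/-- The sign `(-1)^{|j|}` of a site. -/
noncomputable def siteSign (j : Fin d → ℤ) : ℝ := (-1) ^ siteNorm j

lemma siteSign_mul_self (j : Fin d → ℤ) : siteSign j * siteSign j = 1 := by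
  unfold siteSign
  rw [← mul_pow]; simp

lemma abs_siteSign (j : Fin d → ℤ) : |siteSign j| = 1 := by simp [siteSign]

/-- Taking absolute values does not change parity, so the sign is a character of `ℤ^d`. -/
lemma siteSign_sub (j k : Fin d → ℤ) : siteSign (j - k) = siteSign j * siteSign k := by
  unfold siteSign siteNorm
  rw [← Finset.prod_pow_eq_pow_sum, ← Finset.prod_pow_eq_pow_sum, ← Finset.prod_pow_eq_pow_sum,
    ← Finset.prod_mul_distrib]
  refine Finset.prod_congr rfl fun i _ => ?_
  rw [← pow_add]
  refine neg_one_pow_congr ?_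
  rw [Pi.sub_apply]
  simp only [Nat.even_add, Int.natAbs_even, Int.even_sub]

/-- The character takes the value `-1` on a unit step. This is the alternation of spins that turns a
difference of frequencies into a sum. -/
lemma siteSign_eq_neg {j k : Λ} (h : dist1 j k = 1) : siteSign k.1 = -siteSign j.1 := by
  have h1 : siteSign (j.1 - k.1) = -1 := by
    rw [siteSign, show siteNorm (j.1 - k.1) = 1 from h, pow_one]
  rw [siteSign_sub] at h1
  have := siteSign_mul_self j.1
  linear_combination siteSign j.1 * h1 - siteSign k.1 * this

end Lattice

end Rotators

namespace Rotators

/-! ### Bounds for derivatives up to a given order -/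

section Jets

variable {E E' F F' : Type*} [NormedAddCommGroup E] [NormedSpace ℝ E] [NormedAddCommGroup E']
  [NormedSpace ℝ E'] [NormedAddCommGroup F] [NormedSpace ℝ F] [NormedAddCommGroup F']
  [NormedSpace ℝ F']

/-- The derivatives of `h` at `x` of the orders `m, …, n` are bounded by `K`. -/
def JetLE (m n : ℕ) (h : E → F) (x : E) (K : ℝ) : Prop :=
  ∀ i, m ≤ i → i ≤ n → ‖iteratedFDeriv ℝ i h x‖ ≤ K

namespace JetLE

variable {m n : ℕ} {h h₁ h₂ : E → F} {x : E} {K K₁ K₂ : ℝ}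

lemma mono (H : JetLE m n h x K₁) (hK : K₁ ≤ K₂) : JetLE m n h x K₂ :=
  fun i hi hi' => (H i hi hi').trans hK

lemma weaken {m' n' : ℕ} (H : JetLE m n h x K) (hm : m ≤ m') (hn : n' ≤ n) : JetLE m' n' h x K :=
  fun i hi hi' => H i (hm.trans hi) (hi'.trans hn)

lemma nonneg (H : JetLE m n h x K) (hmn : m ≤ n) : 0 ≤ K :=
  (norm_nonneg _).trans (H m le_rfl hmn)

lemma norm_le (H : JetLE 0 n h x K) : ‖h x‖ ≤ K := by
  simpa using H 0 le_rfl (Nat.zero_le n)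

lemma norm_fderiv_le (H : JetLE m n h x K) (hm : m ≤ 1) (hn : 1 ≤ n) : ‖fderiv ℝ h x‖ ≤ K := by
  simpa [norm_iteratedFDeriv_one] using H 1 hm hn

lemma of_norm_le (H : JetLE 1 n h x K) (h0 : ‖h x‖ ≤ K) : JetLE 0 n h x K := by
  intro i _ hi'
  rcases Nat.eq_zero_or_pos i with rfl | hi
  · simpa using h0
  · exact H i hi hi'

lemma add (H₁ : JetLE m n h₁ x K₁) (H₂ : JetLE m n h₂ x K₂) (c₁ : ContDiff ℝ n h₁)
    (c₂ : ContDiff ℝ n h₂) : JetLE m n (fun y => h₁ y + h₂ y) x (K₁ + K₂) := by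
  intro i hi hi'
  have hc : ((i : ℕ) : WithTop ℕ∞) ≤ n := by exact_mod_cast hi'
  have : (fun y => h₁ y + h₂ y) = h₁ + h₂ := rfl
  rw [this, iteratedFDeriv_add (c₁.of_le hc) (c₂.of_le hc), Pi.add_apply]
  exact (norm_add_le _ _).trans (add_le_add (H₁ i hi hi') (H₂ i hi hi'))

lemma sum {ι : Type*} {s : Finset ι} {h : ι → E → F} {K : ι → ℝ}
    (H : ∀ i ∈ s, JetLE m n (h i) x (K i)) (c : ∀ i ∈ s, ContDiff ℝ n (h i)) :
    JetLE m n (fun y => ∑ i ∈ s, h i y) x (∑ i ∈ s, K i) := by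
  intro i hi hi'
  have hc : ((i : ℕ) : WithTop ℕ∞) ≤ n := by exact_mod_cast hi'
  rw [iteratedFDeriv_sum fun j hj => (c j hj).of_le hc, Finset.sum_apply]
  exact (norm_sum_le _ _).trans (Finset.sum_le_sum fun j hj => H j hj i hi hi')

lemma clm_comp (L : F →L[ℝ] F') (H : JetLE m n h x K) (c : ContDiff ℝ n h) :
    JetLE m n (fun y => L (h y)) x (‖L‖ * K) := by
  intro i hi hi'
  have hc : ((i : ℕ) : WithTop ℕ∞) ≤ n := by exact_mod_cast hi'
  exact (L.norm_iteratedFDeriv_comp_left c.contDiffAt hc).trans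
    (mul_le_mul_of_nonneg_left (H i hi hi') (norm_nonneg _))

lemma const_mul {h : E → ℝ} (a : ℝ) (H : JetLE m n h x K) (c : ContDiff ℝ n h) :
    JetLE m n (fun y => a * h y) x (|a| * K) := by
  intro i hi hi'
  have hc : ((i : ℕ) : WithTop ℕ∞) ≤ n := by exact_mod_cast hi'
  have : (fun y => a * h y) = a • h := rfl
  rw [this, iteratedFDeriv_const_smul_apply (c.of_le hc).contDiffAt, norm_smul, Real.norm_eq_abs]
  exact mul_le_mul_of_nonneg_left (H i hi hi') (abs_nonneg _)

lemma comp_clm_of_le (L : E' →L[ℝ] E) {R : ℝ} (hR : 1 ≤ R) (hL : ‖L‖ ≤ R) {y : E'}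
    (H : JetLE m n h (L y) K) (c : ContDiff ℝ n h) :
    JetLE m n (fun y => h (L y)) y (R ^ n * K) := by
  intro i hi hi'
  have hc : ((i : ℕ) : WithTop ℕ∞) ≤ n := by exact_mod_cast hi'
  have : (fun y => h (L y)) = h ∘ L := rfl
  rw [this, L.iteratedFDeriv_comp_right c y hc]
  refine (ContinuousMultilinearMap.norm_compContinuousLinearMap_le _ _).trans ?_
  rw [Finset.prod_const, Finset.card_univ, Fintype.card_fin, mul_comm]
  exact mul_le_mul ((pow_le_pow_left₀ (norm_nonneg _) hL i).trans (pow_le_pow_right₀ hR hi'))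
    (H i hi hi') (norm_nonneg _) (by positivity)

lemma comp_clm (L : E' →L[ℝ] E) (hL : ‖L‖ ≤ 1) {y : E'} (H : JetLE m n h (L y) K)
    (c : ContDiff ℝ n h) : JetLE m n (fun y => h (L y)) y K := by
  simpa using H.comp_clm_of_le L le_rfl hL c

lemma fderiv (H : JetLE (m + 1) (n + 1) h x K) : JetLE m n (fderiv ℝ h) x K := by
  intro i hi hi'
  rw [norm_iteratedFDeriv_fderiv]
  exact H (i + 1) (by omega) (by omega)

/-- The common end of the two Leibniz rules below: binomial coefficients of order `i` sum to `2 ^ i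
≤ 2 ^ n`. -/
lemma sum_choose_mul_le {i n : ℕ} (hin : i ≤ n) {a b : ℕ → ℝ} (ha : ∀ j ≤ n, a j ≤ K₁)
    (hb : ∀ j ≤ n, b j ≤ K₂) (ha0 : ∀ j, 0 ≤ a j) (hb0 : ∀ j, 0 ≤ b j) :
    ∑ j ∈ Finset.range (i + 1), (i.choose j : ℝ) * a j * b (i - j) ≤ 2 ^ n * (K₁ * K₂) := by
  have hK₁ : 0 ≤ K₁ := (ha0 0).trans (ha 0 (Nat.zero_le n))
  have hK₂ : 0 ≤ K₂ := (hb0 0).trans (hb 0 (Nat.zero_le n))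
  calc _ ≤ ∑ j ∈ Finset.range (i + 1), (i.choose j : ℝ) * (K₁ * K₂) := by
        refine Finset.sum_le_sum fun j hj => ?_
        have hj' : j ≤ i := Nat.lt_succ_iff.1 (Finset.mem_range.1 hj)
        rw [mul_assoc]
        exact mul_le_mul_of_nonneg_left (mul_le_mul (ha j (hj'.trans hin))
          (hb _ ((Nat.sub_le _ _).trans hin)) (hb0 _) hK₁) (Nat.cast_nonneg _)
    _ = 2 ^ i * (K₁ * K₂) := by
        rw [← Finset.sum_mul, ← Nat.cast_sum, Nat.sum_range_choose]
        norm_num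
    _ ≤ _ := mul_le_mul_of_nonneg_right (pow_le_pow_right₀ (by norm_num) hin) (by positivity)

lemma mul {h₁ h₂ : E → ℝ} (H₁ : JetLE 0 n h₁ x K₁) (H₂ : JetLE 0 n h₂ x K₂)
    (c₁ : ContDiff ℝ n h₁) (c₂ : ContDiff ℝ n h₂) :
    JetLE 0 n (fun y => h₁ y * h₂ y) x (2 ^ n * (K₁ * K₂)) := by
  intro i _ hi'
  have hc : ((i : ℕ) : WithTop ℕ∞) ≤ n := by exact_mod_cast hi'
  exact (norm_iteratedFDeriv_mul_le c₁ c₂ x hc).trans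
    (sum_choose_mul_le hi' (fun j hj => H₁ j (Nat.zero_le j) hj)
      (fun j hj => H₂ j (Nat.zero_le j) hj) (fun _ => norm_nonneg _) fun _ => norm_nonneg _)

lemma clm_apply {h₁ : E → F →L[ℝ] F'} {h₂ : E → F} (H₁ : JetLE 0 n h₁ x K₁)
    (H₂ : JetLE 0 n h₂ x K₂) (c₁ : ContDiff ℝ n h₁) (c₂ : ContDiff ℝ n h₂) :
    JetLE 0 n (fun y => h₁ y (h₂ y)) x (2 ^ n * (K₁ * K₂)) := by
  intro i _ hi'
  have hc : ((i : ℕ) : WithTop ℕ∞) ≤ n := by exact_mod_cast hi'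
  exact (norm_iteratedFDeriv_clm_apply c₁ c₂ x hc).trans
    (sum_choose_mul_le hi' (fun j hj => H₁ j (Nat.zero_le j) hj)
      (fun j hj => H₂ j (Nat.zero_le j) hj) (fun _ => norm_nonneg _) fun _ => norm_nonneg _)

end JetLE

lemma exists_jetLE_of_compact {n : ℕ} {h : E → F} (c : ContDiff ℝ n h) {s : Set E}
    (hs : IsCompact s) : ∃ K, 0 ≤ K ∧ ∀ x ∈ s, JetLE 0 n h x K := by
  have h1 : ∀ i : ℕ, ∃ C, i ≤ n → ∀ x ∈ s, ‖iteratedFDeriv ℝ i h x‖ ≤ C := by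
    intro i
    by_cases hi : i ≤ n
    · have hc : ((i : ℕ) : WithTop ℕ∞) ≤ n := by exact_mod_cast hi
      obtain ⟨C, hC⟩ := hs.exists_bound_of_continuousOn
        (c.continuous_iteratedFDeriv hc).continuousOn
      exact ⟨C, fun _ => hC⟩
    · exact ⟨0, fun h => absurd h hi⟩
  choose C hC using h1
  refine ⟨∑ i ∈ Finset.range (n + 1), |C i|, by positivity, fun x hx i _ hi => ?_⟩
  exact (hC i hi x hx).trans ((le_abs_self _).trans
    (Finset.single_le_sum (f := fun i => |C i|) (fun _ _ => abs_nonneg _)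
      (Finset.mem_range.2 (Nat.lt_succ_iff.2 hi))))

/-- Derivatives of the inverse of a positive function which dominates its derivatives. -/
lemma exists_jetLE_inv (n : ℕ) : ∃ K, 0 ≤ K ∧ ∀ (S : ℂ × ℂ → ℝ), ContDiff ℝ n S →
    (∀ x, 0 < S x) → ∀ (x : ℂ × ℂ) (C : ℝ), 1 ≤ C → JetLE 1 n S x (C * S x) →
    JetLE 0 n (fun y => (S y)⁻¹) x (K * C ^ n * (S x)⁻¹) := by
  have hK : ∀ i : ℕ, ∃ K : ℝ, ‖iteratedFDerivWithin ℝ i (fun y : ℝ => y⁻¹) (Set.Ioi 0) 1‖ ≤ K :=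
    fun i => ⟨_, le_rfl⟩
  choose K hK using hK
  have hK0 : ∀ i, 0 ≤ K i := fun i => (norm_nonneg _).trans (hK i)
  let K' := ∑ i ∈ Finset.range (n + 1), K i
  have hKK : ∀ i ≤ n, K i ≤ K' := fun i hi => Finset.single_le_sum (f := K) (fun j _ => hK0 j)
    (Finset.mem_range.2 (Nat.lt_succ_iff.2 hi))
  have hK'0 : 0 ≤ K' := Finset.sum_nonneg fun j _ => hK0 j
  refine ⟨n.factorial * K', by positivity, fun S c hS x C hC H => ?_⟩
  have hx := hS x
  -- Normalizing by `S x` makes the value at `x` equal to one, so only the derivatives of the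
  -- inversion at `1` enter and the constant does not depend on `S`.
  let S' : ℂ × ℂ → ℝ := fun y => (S x)⁻¹ * S y
  have c' : ContDiff ℝ n S' := contDiff_const.mul c
  have H' : JetLE 1 n S' x C := (H.const_mul (S x)⁻¹ c).mono (by
    rw [abs_of_pos (inv_pos.2 hx)]; field_simp; rfl)
  have hcomp : JetLE 0 n (fun y => (S' y)⁻¹) x (n.factorial * K' * C ^ n) := by
    intro i _ hi
    have hci : ((i : ℕ) : WithTop ℕ∞) ≤ n := by exact_mod_cast hi
    have hg : ContDiffOn ℝ n (fun y : ℝ => y⁻¹) (Set.Ioi 0) :=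
      contDiffOn_id.inv fun y hy => ne_of_gt hy
    have := norm_iteratedFDeriv_comp_le' (g := fun y : ℝ => y⁻¹) (f := S') (t := Set.Ioi 0) (n := i)
      (N := n) (by
        rintro _ ⟨y, rfl⟩
        exact mul_pos (inv_pos.2 hx) (hS y)) (uniqueDiffOn_Ioi 0) hg c' hci x (C := K') (D := C)
      (by
        intro j hj
        have h1 : S' x = 1 := inv_mul_cancel₀ hx.ne'
        rw [h1]
        exact (hK j).trans (hKK j (hj.trans hi)))
      (by
        intro j hj hj'
        -- The composition estimate asks for bounds `C ^ j`; the uniform bound `C` gives them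
        -- because `1 ≤ C`.
        exact (H' j hj (hj'.trans hi)).trans (le_self_pow₀ hC (by omega)))
    refine this.trans ?_
    gcongr
  have hS' : (fun y => (S y)⁻¹) = fun y => (S x)⁻¹ * (S' y)⁻¹ := by
    funext y
    simp only [S']
    have := hS y
    field_simp
  rw [hS']
  refine (hcomp.const_mul _ (c'.inv fun y => (mul_pos (inv_pos.2 hx) (hS y)).ne')).mono ?_
  rw [abs_of_pos (inv_pos.2 hx)]
  exact le_of_eq (by ring)

end Jets

/-! ### Smooth functions of the squared modulus -/

section NormSq

lemma contDiff_comp_normSq {E : Type*} [NormedAddCommGroup E] [InnerProductSpace ℝ E] {ς : ℝ}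
    (hς : 0 < ς) {n : WithTop ℕ∞} {h : ℝ → ℝ} (hh : ContDiffOn ℝ n h (Set.Ioi (-ς))) :
    ContDiff ℝ n fun z : E => h (‖z‖ ^ 2) := by
  have : ContDiffOn ℝ n (h ∘ fun z : E => ‖z‖ ^ 2) Set.univ :=
    hh.comp (contDiff_norm_sq ℝ).contDiffOn fun z _ => by
      simp only [Set.mem_Ioi]; nlinarith [sq_nonneg ‖z‖]
  exact contDiffOn_univ.1 this

/-- The gradient of this quadratic function at `z` has norm `2`, its constant Hessian has norm at
most `2 / ‖z‖ ≤ 2`, and the higher derivatives vanish. It is the inner map of the rescaled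
composition in the next lemma. -/
lemma jetLE_normSq_div {z : ℂ} (hz : 1 ≤ ‖z‖) (i : ℕ) (hi : 1 ≤ i) :
    ‖iteratedFDeriv ℝ i (fun w : ℂ => ‖z‖⁻¹ * ‖w‖ ^ 2) z‖ ≤ 2 ^ i := by
  let L : ℂ →L[ℝ] ℂ →L[ℝ] ℝ := (‖z‖⁻¹ * 2) • innerSL ℝ
  have hL : fderiv ℝ (fun w : ℂ => ‖z‖⁻¹ * ‖w‖ ^ 2) = L := by
    funext w
    have h1 := ((hasStrictFDerivAt_norm_sq w).hasFDerivAt.const_mul ‖z‖⁻¹).fderiv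
    rw [h1]
    ext v
    simp only [L, smul_apply, smul_eq_mul, nsmul_eq_mul, Nat.cast_ofNat]
    ring
  have hz0 : 0 < ‖z‖ := by linarith
  have hLn : ∀ w, ‖L w‖ ≤ 2 * (‖z‖⁻¹ * ‖w‖) := by
    intro w
    have h1 : ‖innerSL ℝ w‖ = ‖w‖ := innerSL_apply_norm ℝ w
    simp only [L, smul_apply, norm_smul, h1]
    rw [Real.norm_eq_abs, abs_of_pos (by positivity)]
    exact le_of_eq (by ring)
  obtain ⟨i, rfl⟩ : ∃ i', i = i' + 1 := ⟨i - 1, by omega⟩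
  rw [← norm_iteratedFDeriv_fderiv, hL]
  have hz1 : ‖z‖⁻¹ ≤ 1 := inv_le_one_of_one_le₀ hz
  rcases i with _ | _ | i
  · rw [norm_iteratedFDeriv_zero]
    refine (hLn z).trans ?_
    rw [inv_mul_cancel₀ hz0.ne']; norm_num
  · rw [norm_iteratedFDeriv_one, L.fderiv]
    refine (ContinuousLinearMap.opNorm_le_bound _ zero_le_two fun w => (hLn w).trans ?_).trans
      (by norm_num : (2 : ℝ) ≤ _)
    have := mul_le_mul_of_nonneg_right hz1 (norm_nonneg w)
    linarith
  · rw [← norm_iteratedFDeriv_fderiv]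
    have : fderiv ℝ L = fun _ => L := funext fun w => L.fderiv
    rw [this, iteratedFDeriv_const_of_ne (by omega)]
    simp

/-- Rescaling at `z`: the function is `(k ∘ L) ∘ q` with `L` the multiplication by `‖z‖` and `q w =
‖w‖² / ‖z‖`. The `i`-th derivative of `k ∘ L` at `q z` is exactly the weighted quantity bounded by
`M`, and `q` has derivatives at most `2 ^ i`. The constant is `48 = 3! · 2³`. -/
lemma jetLE_comp_normSq_of_one_le {ς : ℝ} (hς : 0 < ς) {h : ℝ → ℝ}
    (hh : ContDiffOn ℝ 3 h (Set.Ioi (-ς))) {z : ℂ} (hz : 1 ≤ ‖z‖) {M : ℝ}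
    (hM : ∀ i, 1 ≤ i → i ≤ 3 → |iteratedDeriv i h (‖z‖ ^ 2)| * ‖z‖ ^ i ≤ M) :
    JetLE 1 3 (fun w : ℂ => h (‖w‖ ^ 2)) z (48 * M) := by
  have hM0 : 0 ≤ M := le_trans (by positivity) (hM 1 le_rfl (by norm_num))
  have hz0 : 0 < ‖z‖ := by linarith
  -- Subtracting the value at the base point makes the zeroth order term vanish there, so that the
  -- composition estimate, which starts at order zero, needs no bound for `h` itself.
  let k : ℝ → ℝ := fun y => h y - h (‖z‖ ^ 2)
  have hk : ContDiffOn ℝ 3 k (Set.Ioi (-ς)) := hh.sub contDiffOn_const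
  let L : ℝ →L[ℝ] ℝ := ‖z‖ • ContinuousLinearMap.id ℝ ℝ
  have hL : ∀ y, L y = ‖z‖ * y := fun y => rfl
  have hLn : ‖L‖ ≤ ‖z‖ := by
    refine ContinuousLinearMap.opNorm_le_bound _ hz0.le fun y => ?_
    rw [hL, norm_mul, norm_norm]
  let t : Set ℝ := L ⁻¹' Set.Ioi (-ς)
  have ht : IsOpen t := isOpen_Ioi.preimage L.continuous
  let q : ℂ → ℝ := fun w => ‖z‖⁻¹ * ‖w‖ ^ 2
  have hLq : ∀ w, L (q w) = ‖w‖ ^ 2 := fun w => by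
    rw [hL]; simp only [q]; field_simp
  have hqz : L (q z) ∈ Set.Ioi (-ς) := by
    rw [hLq]; simp only [Set.mem_Ioi]; nlinarith [sq_nonneg ‖z‖]
  have hkL : ContDiffOn ℝ 3 (k ∘ L) t := hk.comp_continuousLinearMap L
  intro i hi hi3
  have hi3' : ((i : ℕ) : WithTop ℕ∞) ≤ 3 := by exact_mod_cast hi3
  have e1 : ∀ j, 1 ≤ j → iteratedFDeriv ℝ j (fun w : ℂ => h (‖w‖ ^ 2)) z =
      iteratedFDeriv ℝ j ((k ∘ L) ∘ q) z := by
    intro j hj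
    have h1 : ((k ∘ L) ∘ q) = fun w => h (‖w‖ ^ 2) - h (‖z‖ ^ 2) := by
      funext w
      simp only [Function.comp_apply, hLq, k]
    obtain ⟨j, rfl⟩ : ∃ j', j = j' + 1 := ⟨j - 1, by omega⟩
    have h2 : fderiv ℝ (fun w : ℂ => h (‖w‖ ^ 2)) =
        fderiv ℝ fun w : ℂ => h (‖w‖ ^ 2) - h (‖z‖ ^ 2) := funext fun w => by
      rw [fderiv_sub_const]
    rw [h1]
    ext v
    rw [iteratedFDeriv_succ_apply_right, iteratedFDeriv_succ_apply_right, h2]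
  rw [e1 i hi]
  have := norm_iteratedFDeriv_comp_le' (g := k ∘ L) (f := q) (t := t) (n := i) (N := 3)
    (by
      rintro _ ⟨w, rfl⟩
      change L (q w) ∈ Set.Ioi (-ς)
      rw [hLq]; simp only [Set.mem_Ioi]; nlinarith [sq_nonneg ‖w‖]) ht.uniqueDiffOn hkL
    (contDiff_const.mul (contDiff_norm_sq ℝ)) hi3' z (C := M) (D := 2)
    (by
      intro j hj
      have hj3' : ((j : ℕ) : WithTop ℕ∞) ≤ 3 := by exact_mod_cast hj.trans hi3
      rw [L.iteratedFDerivWithin_comp_right hk (uniqueDiffOn_Ioi _) ht.uniqueDiffOn hqz hj3']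
      refine (ContinuousMultilinearMap.norm_compContinuousLinearMap_le _ _).trans ?_
      rw [Finset.prod_const, Finset.card_univ, Fintype.card_fin, hLq,
        iteratedFDerivWithin_of_isOpen j isOpen_Ioi (by rw [← hLq]; exact hqz)]
      rcases Nat.eq_zero_or_pos j with rfl | hj0
      · simp [k, hM0]
      · rw [norm_iteratedFDeriv_eq_norm_iteratedDeriv, Real.norm_eq_abs]
        have e2 : iteratedDeriv j k (‖z‖ ^ 2) = iteratedDeriv j h (‖z‖ ^ 2) := by
          obtain ⟨j, rfl⟩ : ∃ j', j = j' + 1 := ⟨j - 1, by omega⟩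
          rw [iteratedDeriv_succ', iteratedDeriv_succ']
          congr 1
          funext y
          simp [k]
        rw [e2]
        refine le_trans ?_ (hM j hj0 (hj.trans hi3))
        gcongr)
    (fun j hj _ => jetLE_normSq_div hz j hj)
  refine this.trans ?_
  have h6 : (i.factorial : ℝ) ≤ 6 := by
    have : i.factorial ≤ (3).factorial := Nat.factorial_le hi3
    exact_mod_cast this
  have h8 : (2 : ℝ) ^ i ≤ 8 := by
    calc (2 : ℝ) ^ i ≤ 2 ^ 3 := pow_le_pow_right₀ (by norm_num) hi3
      _ = 8 := by norm_num
  calc (i.factorial : ℝ) * M * 2 ^ i ≤ 6 * M * 8 := by gcongr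
    _ = 48 * M := by ring

/-- The derivatives of `z ↦ h(|z|²)` are dominated by `M(|z|²)` if the derivatives of `h` are
dominated by `M` with the natural weights. -/
lemma exists_jetLE_comp_normSq {ς : ℝ} (hς : 0 < ς) {h M : ℝ → ℝ}
    (hh : ContDiffOn ℝ 3 h (Set.Ioi (-ς))) {C m : ℝ} (hm : 0 < m) (hMm : ∀ x, 0 ≤ x → m ≤ M x)
    (hM : ∀ x : ℝ, 0 ≤ x →
    |deriv h x| * x ^ ((1 : ℝ) / 2) + |iteratedDeriv 2 h x| * x +
      |iteratedDeriv 3 h x| * x ^ ((3 : ℝ) / 2) ≤ C * M x) :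
    ∃ K, 0 ≤ K ∧ ∀ z : ℂ, JetLE 1 3 (fun w : ℂ => h (‖w‖ ^ 2)) z (K * M (‖z‖ ^ 2)) := by
  obtain ⟨K, hK0, hK⟩ := exists_jetLE_of_compact (n := 3)
    (contDiff_comp_normSq (E := ℂ) hς (n := 3) hh) (isCompact_closedBall (0 : ℂ) 1)
  refine ⟨48 * |C| + K / m, by positivity, fun z => ?_⟩
  have hMz := hMm (‖z‖ ^ 2) (sq_nonneg _)
  have hMz0 : 0 < M (‖z‖ ^ 2) := hm.trans_le hMz
  -- Near the origin the weights in the hypothesis degenerate, so compactness is used and the lower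
  -- bound `m` of `M` absorbs the constant. Outside the unit disc the weights are powers of `‖z‖`.
  rcases le_total ‖z‖ 1 with hz | hz
  · refine ((hK z (by simpa using hz)).weaken (Nat.zero_le 1) le_rfl).mono ?_
    rw [add_mul]
    have : K ≤ K / m * M (‖z‖ ^ 2) := by
      rw [div_mul_eq_mul_div, le_div_iff₀ hm]
      exact mul_le_mul_of_nonneg_left hMz hK0
    have h2 : 0 ≤ 48 * |C| * M (‖z‖ ^ 2) := by positivity
    linarith
  · have h1 := hM (‖z‖ ^ 2) (sq_nonneg _)
    have r1 : (‖z‖ ^ 2) ^ ((1 : ℝ) / 2) = ‖z‖ ^ 1 := by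
      rw [← Real.rpow_natCast, ← Real.rpow_mul (norm_nonneg z)]; norm_num
    have r3 : (‖z‖ ^ 2) ^ ((3 : ℝ) / 2) = ‖z‖ ^ 3 := by
      rw [← Real.rpow_natCast, ← Real.rpow_mul (norm_nonneg z), ← Real.rpow_natCast]; norm_num
    rw [r1, r3] at h1
    have hCM : C * M (‖z‖ ^ 2) ≤ |C| * M (‖z‖ ^ 2) :=
      mul_le_mul_of_nonneg_right (le_abs_self C) hMz0.le
    have a1 : 0 ≤ |deriv h (‖z‖ ^ 2)| * ‖z‖ ^ 1 := by positivity
    have a2 : 0 ≤ |iteratedDeriv 2 h (‖z‖ ^ 2)| * ‖z‖ ^ 2 := by positivity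
    have a3 : 0 ≤ |iteratedDeriv 3 h (‖z‖ ^ 2)| * ‖z‖ ^ 3 := by positivity
    refine (jetLE_comp_normSq_of_one_le hς hh hz (M := |C| * M (‖z‖ ^ 2)) ?_).mono ?_
    · intro i hi hi3
      interval_cases i
      · rw [iteratedDeriv_one]; linarith
      · linarith
      · linarith
    · have : 0 ≤ K / m * M (‖z‖ ^ 2) := by positivity
      linarith

end NormSq

/-! ### Integrals depending on a parameter -/

section Parametric

universe u

variable {E F : Type u} [NormedAddCommGroup E] [NormedSpace ℝ E]
  [NormedAddCommGroup F] [NormedSpace ℝ F]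

/-- The derivative in the first variable. -/
noncomputable def fderivLeft (φ : E × ℝ → F) (p : E × ℝ) : E →L[ℝ] F :=
  (fderiv ℝ φ p).comp (ContinuousLinearMap.inl ℝ E ℝ)

lemma hasFDerivAt_left {φ : E × ℝ → F} (hφ : Differentiable ℝ φ) (z : E) (s : ℝ) :
    HasFDerivAt (fun z => φ (z, s)) (fderivLeft φ (z, s)) z :=
  (hφ (z, s)).hasFDerivAt.comp z (hasFDerivAt_prodMk_left z s)

variable [ProperSpace E]

/-- The domination is by a constant: a continuous derivative is bounded on the product of a closed
ball, compact because `E` is proper, with the interval of integration. -/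
lemma hasFDerivAt_parametric_integral {φ : E × ℝ → F} (hφ : ContDiff ℝ 1 φ) (a b : ℝ) (z : E) :
    HasFDerivAt (fun z => ∫ s in a..b, φ (z, s)) (∫ s in a..b, fderivLeft φ (z, s)) z := by
  have hc : Continuous (fderivLeft φ) :=
    (hφ.continuous_fderiv (by norm_num)).clm_comp continuous_const
  obtain ⟨C, hC⟩ := ((isCompact_closedBall z 1).prod (isCompact_uIcc (a := a) (b := b)))
    |>.exists_bound_of_continuousOn hc.continuousOn
  refine intervalIntegral.hasFDerivAt_integral_of_dominated_of_fderiv_le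
    (s := Metric.closedBall z 1) (bound := fun _ => C)
    (F := fun z s => φ (z, s)) (F' := fun z s => fderivLeft φ (z, s))
    (Metric.closedBall_mem_nhds z one_pos) ?_ ?_ ?_ ?_ ?_ ?_
  · refine Eventually.of_forall fun y => ?_
    exact (hφ.continuous.comp (Continuous.prodMk_right y)).aestronglyMeasurable
  · exact (hφ.continuous.comp (Continuous.prodMk_right z)).intervalIntegrable a b
  · exact (hc.comp (Continuous.prodMk_right z)).aestronglyMeasurable
  · exact Eventually.of_forall fun s hs y hy => hC (y, s) ⟨hy, Set.uIoc_subset_uIcc hs⟩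
  · exact intervalIntegrable_const
  · exact Eventually.of_forall fun s _ y _ => hasFDerivAt_left (hφ.differentiable one_ne_zero) y s

/-- The derivative is again a parametric integral, with values in `E →L[ℝ] F`; the induction
therefore runs over all target spaces, and `E` and `F` must share a universe. -/
lemma contDiff_parametric_integral (n : ℕ) : ∀ {F : Type u} [NormedAddCommGroup F]
    [NormedSpace ℝ F] {φ : E × ℝ → F}, ContDiff ℝ n φ → ∀ a b : ℝ,
    ContDiff ℝ n fun z => ∫ s in a..b, φ (z, s) := by
  induction n with
  | zero =>
    intro F _ _ φ hφ a b
    refine contDiff_zero.2 ?_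
    exact intervalIntegral.continuous_parametric_intervalIntegral_of_continuous'
      (f := fun z s => φ (z, s)) hφ.continuous a b
  | succ n ih =>
    intro F _ _ φ hφ a b
    have h1 : ContDiff ℝ 1 φ := hφ.of_le (by exact_mod_cast Nat.le_add_left 1 n)
    refine contDiff_succ_iff_hasFDerivAt.2 ⟨_, ?_, hasFDerivAt_parametric_integral h1 a b⟩
    refine ih ?_ a b
    exact (hφ.fderiv_right (m := n) (by norm_cast)).clm_comp contDiff_const

lemma jetLE_parametric_integral (n : ℕ) : ∀ {F : Type u} [NormedAddCommGroup F]
    [NormedSpace ℝ F] {φ : E × ℝ → F}, ContDiff ℝ n φ → ∀ {a b K : ℝ} {z : E}, a ≤ b →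
    (∀ s ∈ Set.Icc a b, ‖iteratedFDeriv ℝ n (fun z => φ (z, s)) z‖ ≤ K) →
    ‖iteratedFDeriv ℝ n (fun z => ∫ s in a..b, φ (z, s)) z‖ ≤ (b - a) * K := by
  induction n with
  | zero =>
    intro F _ _ φ hφ a b K z hab H
    rw [norm_iteratedFDeriv_zero]
    have := intervalIntegral.norm_integral_le_of_norm_le_const (a := a) (b := b)
      (f := fun s => φ (z, s)) (C := K) (fun s hs => by
        rw [Set.uIoc_of_le hab] at hs
        simpa using H s ⟨hs.1.le, hs.2⟩)
    rwa [abs_of_nonneg (sub_nonneg.2 hab), mul_comm] at this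
  | succ n ih =>
    intro F _ _ φ hφ a b K z hab H
    have h1 : ContDiff ℝ 1 φ := hφ.of_le (by exact_mod_cast Nat.le_add_left 1 n)
    have h2 : fderiv ℝ (fun z => ∫ s in a..b, φ (z, s)) =
        fun z => ∫ s in a..b, fderivLeft φ (z, s) :=
      funext fun z => (hasFDerivAt_parametric_integral h1 a b z).fderiv
    rw [← norm_iteratedFDeriv_fderiv, h2]
    refine ih ((hφ.fderiv_right (m := n) (by norm_cast)).clm_comp contDiff_const) hab
      fun s hs => ?_
    have h3 : (fun z => fderivLeft φ (z, s)) = fderiv ℝ fun z => φ (z, s) :=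
      funext fun z => (hasFDerivAt_left (h1.differentiable one_ne_zero) z s).fderiv.symm
    change ‖iteratedFDeriv ℝ n (fun z => fderivLeft φ (z, s)) z‖ ≤ K
    rw [h3, norm_iteratedFDeriv_fderiv]
    exact H s hs

end Parametric

end Rotators

namespace Rotators

/-! ### Functions of a pair of coordinates -/

section Pair

/-- The weight `1 + |a|^q + |b|^q`. -/
noncomputable def pairWeight (q : ℕ) (x : ℂ × ℂ) : ℝ := 1 + ‖x.1‖ ^ q + ‖x.2‖ ^ q

lemma one_le_pairWeight (q : ℕ) (x : ℂ × ℂ) : 1 ≤ pairWeight q x := by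
  unfold pairWeight
  have := pow_nonneg (norm_nonneg x.1) q
  have := pow_nonneg (norm_nonneg x.2) q
  linarith

lemma pairWeight_pos (q : ℕ) (x : ℂ × ℂ) : 0 < pairWeight q x :=
  one_pos.trans_le (one_le_pairWeight q x)

/-- The rotation of the first coordinate of a pair. -/
noncomputable def rotLeft (s : ℝ) : ℂ × ℂ →L[ℝ] ℂ × ℂ :=
  (((Complex.exp (s * Complex.I) • ContinuousLinearMap.id ℂ ℂ).restrictScalars ℝ).comp
    (ContinuousLinearMap.fst ℝ ℂ ℂ)).prod (ContinuousLinearMap.snd ℝ ℂ ℂ)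

lemma rotLeft_apply (s : ℝ) (x : ℂ × ℂ) :
    rotLeft s x = (Complex.exp (s * Complex.I) * x.1, x.2) := rfl

lemma rotLeft_norm_le (s : ℝ) : ‖rotLeft s‖ ≤ 1 := by
  refine ContinuousLinearMap.opNorm_le_bound _ zero_le_one fun x => ?_
  rw [rotLeft_apply, one_mul, Prod.norm_mk, norm_mul, Complex.norm_exp_ofReal_mul_I, one_mul]
  exact le_rfl

lemma pairWeight_rotLeft (q : ℕ) (s : ℝ) (x : ℂ × ℂ) :
    pairWeight q (rotLeft s x) = pairWeight q x := by
  simp [pairWeight, rotLeft_apply, Complex.norm_exp_ofReal_mul_I]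

/-- The weighted mean `(2π)⁻¹ ∫_0^{2π} κ(s) A(e^{is} a, b) ds` over the rotations of the first
coordinate. -/
noncomputable def pairAvg (κ : ℝ → ℝ) (A : ℂ × ℂ → ℝ) (x : ℂ × ℂ) : ℝ :=
  (2 * Real.pi)⁻¹ * ∫ s in (0 : ℝ)..2 * Real.pi, κ s * A (rotLeft s x)

variable {κ : ℝ → ℝ} {A : ℂ × ℂ → ℝ}

lemma contDiff_rotLeft {n : WithTop ℕ∞} :
    ContDiff ℝ n fun q : (ℂ × ℂ) × ℝ => rotLeft q.2 q.1 := by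
  have h1 : ContDiff ℝ n fun q : (ℂ × ℂ) × ℝ => Complex.exp (q.2 * Complex.I) :=
    ((Complex.ofRealCLM.contDiff.comp contDiff_snd).mul contDiff_const).cexp
  have h2 : ContDiff ℝ n fun q : (ℂ × ℂ) × ℝ => q.1.1 := contDiff_fst.fst
  have h3 : ContDiff ℝ n fun q : (ℂ × ℂ) × ℝ => q.1.2 := contDiff_fst.snd
  exact (h1.mul h2).prodMk h3

lemma contDiff_pairAvg_integrand {n : WithTop ℕ∞} (hκ : ContDiff ℝ n κ) (hA : ContDiff ℝ n A) :
    ContDiff ℝ n fun q : (ℂ × ℂ) × ℝ => κ q.2 * A (rotLeft q.2 q.1) :=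
  (hκ.comp contDiff_snd).mul (hA.comp contDiff_rotLeft)

lemma contDiff_pairAvg {n : ℕ} (hκ : ContDiff ℝ n κ) (hA : ContDiff ℝ n A) :
    ContDiff ℝ n (pairAvg κ A) :=
  contDiff_const.mul (contDiff_parametric_integral n (contDiff_pairAvg_integrand hκ hA) _ _)

/-- Rotations do not increase norms and do not change the weight `w`, so each integrand obeys the
bound of `A` up to `|κ s| ≤ π`. The normalization cancels the length `2π`. The bound `π` serves both
weights in use, `1` and `s - π`. -/
lemma jetLE_pairAvg {m n : ℕ} (hκ : ContDiff ℝ n κ) (hA : ContDiff ℝ n A)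
    (hκπ : ∀ s ∈ Set.Icc 0 (2 * Real.pi), |κ s| ≤ Real.pi) {w : ℂ × ℂ → ℝ} {K : ℝ}
    (hw : ∀ s x, w (rotLeft s x) = w x) (H : ∀ x, JetLE m n A x (K * w x)) (x : ℂ × ℂ) :
    JetLE m n (pairAvg κ A) x (Real.pi * K * w x) := by
  have hc := contDiff_pairAvg_integrand hκ hA
  have h2π : 0 ≤ 2 * Real.pi := by positivity
  have h1 : JetLE m n (fun x => ∫ s in (0 : ℝ)..2 * Real.pi, κ s * A (rotLeft s x)) x
      ((2 * Real.pi) * (Real.pi * (K * w x))) := by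
    intro i hi hi'
    have hci : ((i : ℕ) : WithTop ℕ∞) ≤ n := by exact_mod_cast hi'
    have := jetLE_parametric_integral i (hc.of_le hci) (a := 0) (b := 2 * Real.pi) (z := x)
      (K := Real.pi * (K * w x)) h2π (fun s hs => by
        have h2 : JetLE m n A (rotLeft s x) (K * w x) := by rw [← hw s x]; exact H _
        have h3 := (h2.comp_clm (rotLeft s) (rotLeft_norm_le s) hA).const_mul (κ s)
          (hA.comp (rotLeft s).contDiff)
        exact (h3 i hi hi').trans
          (mul_le_mul_of_nonneg_right (hκπ s hs) (h2.nonneg (hi.trans hi'))))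
    simpa using this
  refine (h1.const_mul _ (contDiff_parametric_integral n hc _ _)).mono (le_of_eq ?_)
  rw [abs_of_pos (by positivity)]
  have := Real.pi_pos
  field_simp

lemma pairAvg_rot {c : ℂ} (hinv : ∀ x, A (c • x) = A x) (x : ℂ × ℂ) :
    pairAvg κ A (c • x) = pairAvg κ A x := by
  unfold pairAvg
  congr 2
  funext s
  have : rotLeft s (c • x) = c • rotLeft s x := by
    simp only [rotLeft_apply, Prod.smul_mk, Prod.smul_fst, Prod.smul_snd, smul_eq_mul]
    congr 1
    ring
  rw [this, hinv]

lemma hasDerivAt_rotLeft (s : ℝ) (x : ℂ × ℂ) :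
    HasDerivAt (fun t => rotLeft t x) (rotLeft s (Complex.I * x.1, 0)) s := by
  have h1 : HasDerivAt (fun t : ℝ => Complex.exp (t * Complex.I))
      (Complex.exp (s * Complex.I) * Complex.I) s := by
    have := ((Complex.ofRealCLM.hasDerivAt (x := s)).mul_const Complex.I).cexp
    simpa using this
  have h2 := (h1.mul_const x.1).prodMk (hasDerivAt_const s x.2)
  refine h2.congr_deriv ?_
  rw [rotLeft_apply, mul_assoc]

lemma rotLeft_zero (x : ℂ × ℂ) : rotLeft 0 x = x := by simp [rotLeft_apply]

lemma rotLeft_two_pi (x : ℂ × ℂ) : rotLeft (2 * Real.pi) x = x := by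
  rw [rotLeft_apply]
  push_cast
  rw [Complex.exp_two_pi_mul_I, one_mul]

lemma hasDerivAt_comp_rotLeft (hA : Differentiable ℝ A) (s : ℝ) (x : ℂ × ℂ) :
    HasDerivAt (fun t => A (rotLeft t x)) (fderiv ℝ A (rotLeft s x) (rotLeft s (Complex.I * x.1, 0)))
      s :=
  (hA _).hasFDerivAt.comp_hasDerivAt s (hasDerivAt_rotLeft s x)

lemma fderiv_pairAvg_apply (hκ : ContDiff ℝ 1 κ) (hA : ContDiff ℝ 1 A) (x v : ℂ × ℂ) :
    fderiv ℝ (pairAvg κ A) x v = (2 * Real.pi)⁻¹ *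
      ∫ s in (0 : ℝ)..2 * Real.pi, κ s * fderiv ℝ A (rotLeft s x) (rotLeft s v) := by
  have hc := contDiff_pairAvg_integrand hκ hA
  have h1 : HasFDerivAt (pairAvg κ A) _ x :=
    (hasFDerivAt_parametric_integral hc 0 (2 * Real.pi) x).const_mul (2 * Real.pi)⁻¹
  have hcl : Continuous fun s : ℝ => fderivLeft
      (fun q : (ℂ × ℂ) × ℝ => κ q.2 * A (rotLeft q.2 q.1)) (x, s) := by
    have : Continuous (fderivLeft (fun q : (ℂ × ℂ) × ℝ => κ q.2 * A (rotLeft q.2 q.1))) :=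
      (hc.continuous_fderiv (by norm_num)).clm_comp continuous_const
    exact this.comp (Continuous.prodMk_right x)
  rw [h1.fderiv, smul_apply, smul_eq_mul,
    ContinuousLinearMap.intervalIntegral_apply (hcl.intervalIntegrable _ _)]
  congr 2
  funext s
  have e1 := hasFDerivAt_left (hc.differentiable one_ne_zero) x s
  have e2 : HasFDerivAt (fun z => κ s * A (rotLeft s z))
      (κ s • (fderiv ℝ A (rotLeft s x)).comp (rotLeft s)) x :=
    ((hA.differentiable one_ne_zero _).hasFDerivAt.comp x (rotLeft s).hasFDerivAt).const_mul _
  rw [e1.unique e2]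
  rfl

/-- The angular derivative of the mean with the weight `s - π` is the deviation from the mean. -/
lemma fderiv_pairAvg_sub_pi (hA : ContDiff ℝ 1 A) (x : ℂ × ℂ) :
    fderiv ℝ (pairAvg (fun s => s - Real.pi) A) x (Complex.I * x.1, 0) =
      A x - pairAvg (fun _ => 1) A x := by
  have hκ : ContDiff ℝ 1 fun s : ℝ => s - Real.pi := contDiff_id.sub contDiff_const
  rw [fderiv_pairAvg_apply hκ hA]
  have hrc : ∀ y : ℂ × ℂ, Continuous fun s : ℝ => rotLeft s y := fun y => by
    simp only [rotLeft_apply]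
    fun_prop
  have ha'c : Continuous fun s => fderiv ℝ A (rotLeft s x) (rotLeft s (Complex.I * x.1, 0)) :=
    ((hA.continuous_fderiv (by norm_num)).comp (hrc x)).clm_apply (hrc _)
  -- Integration by parts. The rotations by `0` and `2π` are the identity, so the boundary terms add
  -- up to `2π A x`, and the remaining integral is the mean. Any weight `s - const` would do here;
  -- centring at `π` gives the smallest bound.
  rw [intervalIntegral.integral_mul_deriv_eq_deriv_mul (u := fun s => s - Real.pi)
    (u' := fun _ => 1) (v := fun s => A (rotLeft s x))
    (fun s _ => (hasDerivAt_id s).sub_const _)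
    (fun s _ => hasDerivAt_comp_rotLeft (hA.differentiable one_ne_zero) s x)
    intervalIntegrable_const (ha'c.intervalIntegrable _ _)]
  simp only [rotLeft_zero, rotLeft_two_pi, pairAvg]
  have := Real.pi_pos
  field_simp
  ring

end Pair

/-- The estimates for the pair interaction `A`, its angular mean `A₀`, and the solution `B` of the
homological equation with the frequencies `S`. -/
structure PairBounds (p : ℕ) (S A A₀ B : ℂ × ℂ → ℝ) (K : ℝ) : Prop where
  contDiff : ContDiff ℝ 4 A
  contDiff_avg : ContDiff ℝ 4 A₀
  contDiff_hom : ContDiff ℝ 3 B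
  jet : ∀ x, JetLE 1 3 A x (K * pairWeight (p - 1) x)
  jet_avg : ∀ x, JetLE 1 3 A₀ x (K * pairWeight (p - 1) x)
  jet_hom : ∀ x, JetLE 1 3 B x K
  rot : ∀ c : ℂ, ‖c‖ = 1 → ∀ x, A (c • x) = A x
  rot_avg : ∀ c : ℂ, ‖c‖ = 1 → ∀ x, A₀ (c • x) = A₀ x
  rot_hom : ∀ c : ℂ, ‖c‖ = 1 → ∀ x, B (c • x) = B x
  hom : ∀ x, S x * fderiv ℝ B x (Complex.I * x.1, 0) = A x - A₀ x
  bound : ∀ x, |fderiv ℝ B x (Complex.I * x.1, 0)| ≤ K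

/-! ### Existence and bounds of the solution of the homological equation for a pair -/

section PairExist

/-- The sum `f(|a|²) + f(|b|²)` of the frequencies. -/
noncomputable def pairFreq (f : ℝ → ℝ) (x : ℂ × ℂ) : ℝ := f (‖x.1‖ ^ 2) + f (‖x.2‖ ^ 2)

/-- The pair potential `G(|a - b|²)`. -/
noncomputable def pairPot (G : ℝ → ℝ) (x : ℂ × ℂ) : ℝ := G (‖x.1 - x.2‖ ^ 2)

/-- The solution of the homological equation for a pair. -/
noncomputable def pairHom (f G : ℝ → ℝ) (x : ℂ × ℂ) : ℝ :=
  pairAvg (fun s => s - Real.pi) (pairPot G) x * (pairFreq f x)⁻¹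

lemma norm_fst_clm_le : ‖ContinuousLinearMap.fst ℝ ℂ ℂ‖ ≤ 1 := ContinuousLinearMap.norm_fst_le ..

lemma norm_snd_clm_le : ‖ContinuousLinearMap.snd ℝ ℂ ℂ‖ ≤ 1 := ContinuousLinearMap.norm_snd_le ..

variable {p : ℕ} {ς : ℝ} {f G : ℝ → ℝ}

lemma sq_rpow_half {q : ℕ} (z : ℂ) {r : ℝ} (hr : r = (q : ℝ) / 2) :
    (‖z‖ ^ 2) ^ r = ‖z‖ ^ q := by
  rw [← Real.rpow_natCast, ← Real.rpow_mul (norm_nonneg z), hr, ← Real.rpow_natCast]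
  congr 1
  push_cast
  ring

/-- The function `G(|z|²)` is composed with `(a, b) ↦ a - b`, a map of norm at most two; this gives
the factor `2 ^ 3`, and the power of `|a - b|` splits by convexity. -/
lemma exists_jetLE_pairPot (hp : 2 ≤ p) (hς : 0 < ς) (hG : AssumptionHG p ς G) :
    ∃ K, 0 ≤ K ∧ ∀ x, JetLE 1 3 (pairPot G) x (K * pairWeight (p - 1) x) := by
  obtain ⟨C, hC⟩ := hG.upper
  have h3 : ContDiffOn ℝ 3 G (Set.Ioi (-ς)) := hG.smooth.of_le (by norm_num)
  obtain ⟨K, hK0, hK⟩ := exists_jetLE_comp_normSq hς h3 one_pos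
    (M := fun x => 1 + x ^ (((p : ℝ) - 1) / 2))
    (fun x hx => by have := Real.rpow_nonneg hx (((p : ℝ) - 1) / 2); linarith) hC
  refine ⟨2 ^ 3 * (K * 2 ^ (p - 1 - 1)), by positivity, fun x => ?_⟩
  let L : ℂ × ℂ →L[ℝ] ℂ := ContinuousLinearMap.fst ℝ ℂ ℂ - ContinuousLinearMap.snd ℝ ℂ ℂ
  have hL : ‖L‖ ≤ 2 := (norm_sub_le _ _).trans
    ((add_le_add norm_fst_clm_le norm_snd_clm_le).trans (by norm_num))
  refine ((hK (L x)).comp_clm_of_le L one_le_two hL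
    (contDiff_comp_normSq hς (n := 3) h3)).mono ?_
  rw [mul_assoc, mul_assoc]
  refine mul_le_mul_of_nonneg_left (mul_le_mul_of_nonneg_left ?_ hK0) (by norm_num)
  rw [sq_rpow_half (q := p - 1) _ (by rw [Nat.cast_sub (by omega)]; simp)]
  have h1 : ‖L x‖ ≤ ‖x.1‖ + ‖x.2‖ := norm_sub_le _ _
  have h2 := (pow_le_pow_left₀ (norm_nonneg _) h1 (p - 1)).trans
    (add_pow_le (norm_nonneg x.1) (norm_nonneg x.2) (p - 1))
  have h3 : (1 : ℝ) ≤ 2 ^ (p - 1 - 1) := one_le_pow₀ one_le_two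
  unfold pairWeight
  linarith

lemma pairPot_rot {c : ℂ} (hc : ‖c‖ = 1) (x : ℂ × ℂ) : pairPot G (c • x) = pairPot G x := by
  simp only [pairPot, Prod.smul_fst, Prod.smul_snd, smul_eq_mul, ← mul_sub, norm_mul, hc, one_mul]

lemma pairFreq_rot {c : ℂ} (hc : ‖c‖ = 1) (x : ℂ × ℂ) : pairFreq f (c • x) = pairFreq f x := by
  simp only [pairFreq, Prod.smul_fst, Prod.smul_snd, smul_eq_mul, norm_mul, hc, one_mul]

lemma pairFreq_rotLeft (s : ℝ) (x : ℂ × ℂ) : pairFreq f (rotLeft s x) = pairFreq f x := by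
  simp [pairFreq, rotLeft_apply, Complex.norm_exp_ofReal_mul_I]

lemma contDiff_pairPot {n : WithTop ℕ∞} (hς : 0 < ς) (hG : ContDiffOn ℝ n G (Set.Ioi (-ς))) :
    ContDiff ℝ n (pairPot G) :=
  (contDiff_comp_normSq hς hG).comp (contDiff_fst.sub contDiff_snd)

lemma contDiff_pairFreq {n : WithTop ℕ∞} (hς : 0 < ς) (hf : ContDiffOn ℝ n f (Set.Ioi (-ς))) :
    ContDiff ℝ n (pairFreq f) :=
  ((contDiff_comp_normSq hς hf).comp contDiff_fst).add
    ((contDiff_comp_normSq hς hf).comp contDiff_snd)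

/-- A crude form of Young's inequality: in `t ^ q * r` the larger of the two numbers dominates. It
converts growth of order `p - 1` of a gradient into growth of order `p` of the function. -/
lemma pairWeight_mul_norm_le (hp : 2 ≤ p) (x : ℂ × ℂ) :
    pairWeight (p - 1) x * ‖x‖ ≤ 3 * pairWeight p x := by
  obtain ⟨q, rfl⟩ : ∃ q, p = q + 1 := ⟨p - 1, by omega⟩
  rw [Nat.add_sub_cancel]
  have key : ∀ r t : ℝ, 0 ≤ r → 0 ≤ t → t ^ q * r ≤ t ^ (q + 1) + r ^ (q + 1) := by
    intro r t hr ht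
    rcases le_total r t with h | h
    · have := mul_le_mul_of_nonneg_left h (pow_nonneg ht q)
      have := pow_nonneg hr (q + 1)
      rw [pow_succ t]; linarith
    · have := mul_le_mul_of_nonneg_right (pow_le_pow_left₀ ht h q) hr
      have := pow_nonneg ht (q + 1)
      rw [pow_succ r]; linarith
  have k1 : ∀ r : ℝ, 0 ≤ r → r ≤ 1 + r ^ (q + 1) := by
    intro r hr
    have := key r 1 hr zero_le_one
    simpa using this
  unfold pairWeight
  have h1 := pow_nonneg (norm_nonneg x.1) (q + 1)
  have h2 := pow_nonneg (norm_nonneg x.2) (q + 1)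
  rcases max_cases ‖x.1‖ ‖x.2‖ with ⟨h, _⟩ | ⟨h, _⟩
  · rw [Prod.norm_def, h]
    have a1 := k1 _ (norm_nonneg x.1)
    have a2 := key _ _ (norm_nonneg x.1) (norm_nonneg x.2)
    have a3 := key _ _ (norm_nonneg x.1) (norm_nonneg x.1)
    nlinarith [pow_succ ‖x.1‖ q]
  · rw [Prod.norm_def, h]
    have a1 := k1 _ (norm_nonneg x.2)
    have a2 := key _ _ (norm_nonneg x.2) (norm_nonneg x.1)
    have a3 := key _ _ (norm_nonneg x.2) (norm_nonneg x.2)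
    nlinarith [pow_succ ‖x.2‖ q]

lemma pairWeight_le (p : ℕ) (x : ℂ × ℂ) : pairWeight (p - 1) x ≤ 3 * pairWeight p x := by
  have key : ∀ t : ℝ, 0 ≤ t → t ^ (p - 1) ≤ 1 + t ^ p := by
    intro t ht
    rcases le_total t 1 with h | h
    · have := pow_le_one₀ ht h (n := p - 1)
      have := pow_nonneg ht p
      linarith
    · have := pow_le_pow_right₀ h (Nat.sub_le p 1)
      linarith
  unfold pairWeight
  have := key _ (norm_nonneg x.1)
  have := key _ (norm_nonneg x.2)
  have h1 := pow_nonneg (norm_nonneg x.1) p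
  have h2 := pow_nonneg (norm_nonneg x.2) p
  linarith

/-- A bound for a function of a pair from a bound for its derivative. -/
lemma abs_le_of_jetLE (hp : 2 ≤ p) {A : ℂ × ℂ → ℝ} (hA : Differentiable ℝ A) {K : ℝ} (hK : 0 ≤ K)
    (H : ∀ x, JetLE 1 3 A x (K * pairWeight (p - 1) x)) (x : ℂ × ℂ) :
    |A x| ≤ (|A 0| + 3 * K) * pairWeight p x := by
  have h1 : ‖A x - A 0‖ ≤ K * pairWeight (p - 1) x * ‖x - 0‖ := by
    -- The mean value inequality is used on the polydisc with the radii of `x`, where the weight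
    -- does not exceed its value at `x`.
    refine Convex.norm_image_sub_le_of_norm_fderiv_le (𝕜 := ℝ)
      (s := {y | ‖y.1‖ ≤ ‖x.1‖ ∧ ‖y.2‖ ≤ ‖x.2‖}) (fun y _ => hA y) ?_ ?_ ?_ ?_
    · rintro y ⟨hy1, hy2⟩
      refine ((H y).norm_fderiv_le le_rfl (by norm_num)).trans (mul_le_mul_of_nonneg_left ?_ hK)
      unfold pairWeight
      have := pow_le_pow_left₀ (norm_nonneg _) hy1 (p - 1)
      have := pow_le_pow_left₀ (norm_nonneg _) hy2 (p - 1)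
      linarith
    · have hset : {y : ℂ × ℂ | ‖y.1‖ ≤ ‖x.1‖ ∧ ‖y.2‖ ≤ ‖x.2‖} =
          Metric.closedBall (0 : ℂ) ‖x.1‖ ×ˢ Metric.closedBall (0 : ℂ) ‖x.2‖ := by
        ext y
        simp
      rw [hset]
      exact (convex_closedBall (0 : ℂ) ‖x.1‖).prod (convex_closedBall (0 : ℂ) ‖x.2‖)
    · simp
    · simp
  rw [sub_zero, mul_assoc] at h1
  have h2 := mul_le_mul_of_nonneg_left (pairWeight_mul_norm_le hp x) hK
  have h3 : |A x| ≤ |A 0| + ‖A x - A 0‖ := by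
    have := abs_add_le (A 0) (A x - A 0)
    simpa using this
  have h4 := mul_le_mul_of_nonneg_left (one_le_pairWeight p x) (abs_nonneg (A 0))
  linarith

/-- The lower bound for the frequencies has the order `p` which the potential reaches after
integration of its gradient bound, and the frequencies dominate their own derivatives. Hence the
quotient defining `pairHom` has all derivatives up to order three bounded on the whole plane, with
no loss at infinity. -/
lemma exists_pairBounds (hp : 2 ≤ p) (hς : 0 < ς) (hf : AssumptionHF p ς f)
    (hG : AssumptionHG p ς G) :
    ∃ K, 0 ≤ K ∧ PairBounds p (pairFreq f) (pairPot G) (pairAvg (fun _ => 1) (pairPot G))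
      (pairHom f G) K := by
  obtain ⟨K₁, hK₁, hA⟩ := exists_jetLE_pairPot hp hς hG
  have cA : ContDiff ℝ 4 (pairPot G) := contDiff_pairPot hς hG.smooth
  have cA3 : ContDiff ℝ 3 (pairPot G) := cA.of_le (by norm_num)
  have cS : ContDiff ℝ 3 (pairFreq f) := contDiff_pairFreq hς hf.smooth
  obtain ⟨c, hc, hlow⟩ := hf.lower
  obtain ⟨C, hC⟩ := hf.upper
  have hone : ContDiff ℝ 4 fun _ : ℝ => (1 : ℝ) := contDiff_const
  have hsub : ContDiff ℝ 3 fun s : ℝ => s - Real.pi := contDiff_id.sub contDiff_const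
  have hpi3 := Real.pi_gt_three
  have hone' : ∀ s ∈ Set.Icc 0 (2 * Real.pi), |(1 : ℝ)| ≤ Real.pi := fun s _ => by
    rw [abs_one]; linarith
  have hsub' : ∀ s ∈ Set.Icc 0 (2 * Real.pi), |s - Real.pi| ≤ Real.pi := fun s hs => by
    rw [abs_le]; constructor <;> linarith [hs.1, hs.2]
  have hlow' : ∀ z : ℂ, c * (1 + ‖z‖ ^ p) ≤ f (‖z‖ ^ 2) := fun z => by
    have := hlow (‖z‖ ^ 2) (sq_nonneg _)
    rwa [sq_rpow_half (q := p) z rfl] at this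
  have hSlow : ∀ x, c * pairWeight p x ≤ pairFreq f x := fun x => by
    have h1 := hlow' x.1
    have h2 := hlow' x.2
    unfold pairWeight pairFreq
    linarith
  have hSpos : ∀ x, 0 < pairFreq f x := fun x =>
    (mul_pos hc (pairWeight_pos p x)).trans_le (hSlow x)
  have hflow : ∀ x : ℝ, 0 ≤ x → c ≤ f x := fun x hx => by
    have := hlow x hx
    have h2 := mul_nonneg hc.le (Real.rpow_nonneg hx ((p : ℝ) / 2))
    linarith
  obtain ⟨K₂, hK₂, hfj⟩ := exists_jetLE_comp_normSq hς hf.smooth hc hflow hC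
  have cf : ContDiff ℝ 3 fun w : ℂ => f (‖w‖ ^ 2) := contDiff_comp_normSq hς hf.smooth
  have hS : ∀ x, JetLE 1 3 (pairFreq f) x ((K₂ + 1) * pairFreq f x) := fun x => by
    have h1 := (hfj x.1).comp_clm (ContinuousLinearMap.fst ℝ ℂ ℂ) norm_fst_clm_le cf (y := x)
    have h2 := (hfj x.2).comp_clm (ContinuousLinearMap.snd ℝ ℂ ℂ) norm_snd_clm_le cf (y := x)
    refine (h1.add h2 (cf.comp contDiff_fst) (cf.comp contDiff_snd)).mono ?_
    have := hSpos x
    unfold pairFreq at *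
    linarith
  obtain ⟨K₃, hK₃, hinv⟩ := exists_jetLE_inv 3
  have hSinv : ∀ x, JetLE 0 3 (fun y => (pairFreq f y)⁻¹) x
      (K₃ * (K₂ + 1) ^ 3 * (pairFreq f x)⁻¹) := fun x =>
    hinv (pairFreq f) cS hSpos x (K₂ + 1) (by linarith) (hS x)
  let K₀ : ℝ := |pairPot G 0| + 3 * K₁
  have hK₀ : 0 ≤ K₀ := by positivity
  have hAabs : ∀ x, |pairPot G x| ≤ K₀ * pairWeight p x :=
    abs_le_of_jetLE hp (cA.differentiable (by norm_num)) hK₁ hA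
  have hA0 : ∀ x, JetLE 0 3 (pairPot G) x ((K₀ + 3 * K₁) * pairWeight p x) := fun x => by
    have hw := pairWeight_pos p x
    refine JetLE.of_norm_le ((hA x).mono ?_) ((hAabs x).trans ?_)
    · have := mul_le_mul_of_nonneg_left (pairWeight_le p x) hK₁
      have := mul_nonneg hK₀ hw.le
      linarith
    · have := mul_nonneg hK₁ hw.le
      linarith
  have hN : ∀ x, JetLE 0 3 (pairAvg (fun s => s - Real.pi) (pairPot G)) x
      (Real.pi * (K₀ + 3 * K₁) * pairWeight p x) :=
    jetLE_pairAvg hsub cA3 hsub' (pairWeight_rotLeft p) hA0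
  have hAvg : ∀ x, JetLE 0 3 (pairAvg (fun _ => 1) (pairPot G)) x
      (Real.pi * (K₀ + 3 * K₁) * pairWeight p x) :=
    jetLE_pairAvg (hone.of_le (by norm_num)) cA3 hone' (pairWeight_rotLeft p) hA0
  have cN : ContDiff ℝ 3 (pairAvg (fun s => s - Real.pi) (pairPot G)) :=
    contDiff_pairAvg hsub cA3
  have cB : ContDiff ℝ 3 (pairHom f G) := cN.mul (cS.inv fun x => (hSpos x).ne')
  -- Dividing by `c` trades the weight of order `p` for the frequency itself, which the factor `S⁻¹`
  -- then cancels.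
  let K₄ : ℝ := Real.pi * (K₀ + 3 * K₁) / c
  have hK₄ : 0 ≤ K₄ := by positivity
  have hdom : ∀ x, Real.pi * (K₀ + 3 * K₁) * pairWeight p x ≤ K₄ * pairFreq f x := fun x => by
    have h1 : Real.pi * (K₀ + 3 * K₁) * pairWeight p x = K₄ * (c * pairWeight p x) := by
      simp only [K₄]; field_simp
    rw [h1]
    exact mul_le_mul_of_nonneg_left (hSlow x) hK₄
  let K₅ : ℝ := 2 ^ 3 * (K₄ * (K₃ * (K₂ + 1) ^ 3))
  have hB : ∀ x, JetLE 0 3 (pairHom f G) x K₅ := fun x => by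
    refine (((hN x).mono (hdom x)).mul (hSinv x) cN (cS.inv fun x => (hSpos x).ne')).mono ?_
    have := hSpos x
    simp only [K₅]
    field_simp
    rfl
  have hhom : ∀ x, pairFreq f x * fderiv ℝ (pairHom f G) x (Complex.I * x.1, 0) =
      pairPot G x - pairAvg (fun _ => 1) (pairPot G) x := fun x => by
    rw [← fderiv_pairAvg_sub_pi (cA.of_le (by norm_num))]
    -- The frequencies are constant along the rotation, so in the angular derivative of the quotient
    -- only the numerator is differentiated.
    have d1 := hasDerivAt_comp_rotLeft (cB.differentiable (by norm_num)) 0 x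
    have d2 := (hasDerivAt_comp_rotLeft (cN.differentiable (by norm_num)) 0 x).mul_const
      (pairFreq f x)⁻¹
    have e : (fun t => pairHom f G (rotLeft t x)) = fun t =>
        pairAvg (fun s => s - Real.pi) (pairPot G) (rotLeft t x) * (pairFreq f x)⁻¹ := by
      funext t
      rw [pairHom, pairFreq_rotLeft]
    rw [e] at d1
    have h1 := d1.unique d2
    simp only [rotLeft_zero] at h1
    rw [h1]
    have := (hSpos x).ne'
    field_simp
  have hbound : ∀ x, |fderiv ℝ (pairHom f G) x (Complex.I * x.1, 0)| ≤ 2 * K₄ := fun x => by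
    have h1 := (hA0 x).norm_le
    have h2 := ((hAvg x).norm_le).trans (hdom x)
    have h3 : (K₀ + 3 * K₁) * pairWeight p x ≤ Real.pi * (K₀ + 3 * K₁) * pairWeight p x := by
      have := pairWeight_pos p x
      have h4 : 0 ≤ (K₀ + 3 * K₁) * pairWeight p x := by positivity
      nlinarith
    have h4 := (h1.trans h3).trans (hdom x)
    rw [Real.norm_eq_abs] at h2 h4
    -- The homological equation gives `|∂_θ B| = |A - A₀| / S`. The bound for the gradient of `B`
    -- alone would leave an additional factor `|a|`.
    have h5 : pairFreq f x * |fderiv ℝ (pairHom f G) x (Complex.I * x.1, 0)| ≤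
        pairFreq f x * (2 * K₄) := by
      rw [← abs_of_pos (hSpos x), ← abs_mul, abs_of_pos (hSpos x), hhom]
      refine (abs_sub _ _).trans ?_
      linarith
    exact le_of_mul_le_mul_left h5 (hSpos x)
  let K : ℝ := Real.pi * K₁ + K₅ + 2 * K₄
  have hK₅ : 0 ≤ K₅ := by positivity
  have hπK₁ : K₁ ≤ Real.pi * K₁ := by nlinarith
  have hK1 : Real.pi * K₁ ≤ K := by simp only [K]; linarith
  refine ⟨K, by positivity, cA, contDiff_pairAvg (n := 4) hone cA, cB, ?_, ?_, ?_, ?_, ?_, ?_,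
    hhom, ?_⟩
  · exact fun x => (hA x).mono (mul_le_mul_of_nonneg_right (hπK₁.trans hK1) (pairWeight_pos _ x).le)
  · exact fun x => (jetLE_pairAvg (hone.of_le (by norm_num)) cA3 hone' (pairWeight_rotLeft _) hA x).mono
      (mul_le_mul_of_nonneg_right hK1 (pairWeight_pos _ x).le)
  · refine fun x => ((hB x).weaken (Nat.zero_le 1) le_rfl).mono ?_
    simp only [K]
    have : 0 ≤ Real.pi * K₁ := by positivity
    linarith
  · exact fun c hc x => pairPot_rot hc x
  · exact fun c hc x => pairAvg_rot (fun y => pairPot_rot hc y) x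
  · intro c hc x
    rw [pairHom, pairHom, pairAvg_rot (fun y => pairPot_rot hc y), pairFreq_rot hc]
  · refine fun x => (hbound x).trans ?_
    simp only [K]
    have : 0 ≤ Real.pi * K₁ := by positivity
    linarith

end PairExist

end Rotators

namespace Rotators

section PairSums

variable {d : ℕ} {Λ : Finset (Fin d → ℤ)}

/-! ### Gradients and local functions -/

/-- The coordinates at a pair of sites. -/
noncomputable def pairProj (j k : Λ) : Phase Λ →L[ℝ] ℂ × ℂ :=
  (ContinuousLinearMap.proj j).prod (ContinuousLinearMap.proj k)

lemma pairProj_apply (j k : Λ) (u : Phase Λ) : pairProj j k u = (u j, u k) := rfl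

lemma pairProj_norm_le (j k : Λ) : ‖pairProj j k‖ ≤ 1 := by
  refine ContinuousLinearMap.opNorm_le_bound _ zero_le_one fun u => ?_
  rw [pairProj_apply, one_mul]
  exact max_le (norm_le_pi_norm u j) (norm_le_pi_norm u k)

/-- The embedding of the plane of the site `j` into the phase space. -/
noncomputable def siteSingle (j : Λ) : ℂ →L[ℝ] Phase Λ :=
  ContinuousLinearMap.single ℝ (fun _ : Λ => ℂ) j

lemma siteSingle_apply (j : Λ) (z : ℂ) : siteSingle j z = Pi.single j z := rfl

lemma norm_single_site (j : Λ) (z : ℂ) : ‖(Pi.single j z : Phase Λ)‖ = ‖z‖ := 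
  Pi.norm_single (ι := Λ) (G := fun _ => ℂ) (i := j) z

lemma siteSingle_norm_le (j : Λ) : ‖siteSingle j‖ ≤ 1 := by
  refine ContinuousLinearMap.opNorm_le_bound _ zero_le_one fun z => ?_
  rw [siteSingle_apply, norm_single_site, one_mul]

/-- The map which sends the differential of a function to its gradient at the site `j`. -/
noncomputable def gradL (j : Λ) : (Phase Λ →L[ℝ] ℝ) →L[ℝ] ℂ :=
  Complex.ofRealCLM.comp (ContinuousLinearMap.apply ℝ ℝ (Pi.single j 1 : Phase Λ)) +
    Complex.I • Complex.ofRealCLM.comp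
      (ContinuousLinearMap.apply ℝ ℝ (Pi.single j Complex.I : Phase Λ))

lemma gradL_apply (j : Λ) (l : Phase Λ →L[ℝ] ℝ) :
    gradL j l = (l (Pi.single j 1) : ℂ) + Complex.I * (l (Pi.single j Complex.I) : ℂ) := rfl

lemma grad_eq_gradL (h : Phase Λ → ℝ) (u : Phase Λ) (j : Λ) :
    grad h u j = gradL j (fderiv ℝ h u) := rfl

lemma gradL_norm_apply_le (j : Λ) (l : Phase Λ →L[ℝ] ℝ) : ‖gradL j l‖ ≤ 2 * ‖l‖ := by
  rw [gradL_apply]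
  have h1 := l.le_opNorm (Pi.single j 1)
  have h2 := l.le_opNorm (Pi.single j Complex.I)
  rw [norm_single_site, norm_one, mul_one] at h1
  rw [norm_single_site, Complex.norm_I, mul_one] at h2
  refine (norm_add_le _ _).trans ?_
  rw [norm_mul, Complex.norm_I, one_mul, Complex.norm_real, Complex.norm_real]
  linarith

lemma gradL_re (j : Λ) (l : Phase Λ →L[ℝ] ℝ) : (gradL j l).re = l (Pi.single j 1) := by
  simp [gradL_apply]

lemma gradL_im (j : Λ) (l : Phase Λ →L[ℝ] ℝ) : (gradL j l).im = l (Pi.single j Complex.I) := by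
  simp [gradL_apply]

lemma map_single_eq (j : Λ) (l : Phase Λ →L[ℝ] ℝ) (z : ℂ) :
    l (Pi.single j z) = (gradL j l).re * z.re + (gradL j l).im * z.im := by
  have hz : (Pi.single j z : Phase Λ) =
      z.re • (Pi.single j 1 : Phase Λ) + z.im • (Pi.single j Complex.I : Phase Λ) := by
    rw [← Pi.single_smul, ← Pi.single_smul, ← Pi.single_add]
    congr 1
    simp [Complex.re_add_im]
  rw [hz, map_add, map_smul, map_smul, gradL_re, gradL_im, smul_eq_mul, smul_eq_mul]
  ring

lemma sum_single_eq (v : Phase Λ) : ∑ j, (Pi.single j (v j) : Phase Λ) = v :=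
  Finset.univ_sum_single v

lemma map_eq_sum_single {F : Type*} [NormedAddCommGroup F] [NormedSpace ℝ F]
    (l : Phase Λ →L[ℝ] F) (v : Phase Λ) : l v = ∑ j, l (Pi.single j (v j)) := by
  conv_lhs => rw [← sum_single_eq v, map_sum]

lemma map_eq_sum_grad (l : Phase Λ →L[ℝ] ℝ) (v : Phase Λ) :
    l v = ∑ j, ((gradL j l).re * (v j).re + (gradL j l).im * (v j).im) := by
  rw [map_eq_sum_single]
  exact Finset.sum_congr rfl fun j _ => map_single_eq j l (v j)

lemma re_I_mul_grad (j : Λ) (l : Phase Λ →L[ℝ] ℝ) (z : ℂ) :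
    (Complex.I * gradL j l * (starRingEnd ℂ) z).re = -l (Pi.single j (Complex.I * z)) := by
  rw [map_single_eq]
  simp [Complex.mul_re, Complex.mul_im]

/-- The sites at distance at most `ρ` from `j`. -/
def siteBall (j : Λ) (ρ : ℕ) : Set Λ := {k | dist1 k j ≤ ρ}

open Classical in
/-- The projection which forgets the coordinates outside of `s`. -/
noncomputable def siteRestrict (s : Set Λ) : Phase Λ →L[ℝ] Phase Λ :=
  ContinuousLinearMap.pi fun j => if j ∈ s then ContinuousLinearMap.proj j else 0

open Classical in
lemma siteRestrict_apply (s : Set Λ) (u : Phase Λ) (j : Λ) :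
    siteRestrict s u j = if j ∈ s then u j else 0 := by
  simp only [siteRestrict, ContinuousLinearMap.pi_apply]
  split_ifs <;> rfl

lemma siteRestrict_eq {s : Set Λ} {u w : Phase Λ} (h : ∀ j ∈ s, u j = w j) :
    siteRestrict s u = siteRestrict s w := by
  classical
  funext j
  rw [siteRestrict_apply, siteRestrict_apply]
  split_ifs with hj
  · exact h j hj
  · rfl

lemma siteRestrict_of_mem {s : Set Λ} {j : Λ} (hj : j ∈ s) (u : Phase Λ) :
    siteRestrict s u j = u j := by
  classical
  rw [siteRestrict_apply, if_pos hj]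

lemma norm_siteRestrict_le {s : Set Λ} {u : Phase Λ} {K : ℝ} (hK : 0 ≤ K)
    (h : ∀ j ∈ s, ‖u j‖ ≤ K) : ‖siteRestrict s u‖ ≤ K := by
  classical
  refine (pi_norm_le_iff_of_nonneg hK).2 fun j => ?_
  rw [siteRestrict_apply]
  split_ifs with hj
  · exact h j hj
  · simpa using hK

lemma comp_siteRestrict {F : Type*} {h : Phase Λ → F} {s : Set Λ} (hs : DependsOn h s) :
    (fun u => h (siteRestrict s u)) = h :=
  funext fun _ => hs fun _ hj => siteRestrict_of_mem hj _

section Local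

variable {F : Type*} [NormedAddCommGroup F] [NormedSpace ℝ F] {h : Phase Λ → F} {s : Set Λ}

/-- A function of the coordinates in `s` equals its composition with the restriction to `s`, so its
derivative factors through that restriction. All locality statements for derivatives follow from
this. -/
lemma fderiv_eq_of_dependsOn (hs : DependsOn h s) (hd : Differentiable ℝ h) (u : Phase Λ) :
    fderiv ℝ h u = (fderiv ℝ h (siteRestrict s u)).comp (siteRestrict s) := by
  have h1 : HasFDerivAt (fun u => h (siteRestrict s u))
      ((fderiv ℝ h (siteRestrict s u)).comp (siteRestrict s)) u :=
    (hd _).hasFDerivAt.comp u (siteRestrict s).hasFDerivAt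
  rw [comp_siteRestrict hs] at h1
  exact h1.fderiv

lemma dependsOn_fderiv (hs : DependsOn h s) (hd : Differentiable ℝ h) :
    DependsOn (fderiv ℝ h) s := fun u w huw => by
  rw [fderiv_eq_of_dependsOn hs hd u, fderiv_eq_of_dependsOn hs hd w, siteRestrict_eq huw]

lemma fderiv_apply_congr (hs : DependsOn h s) (hd : Differentiable ℝ h) (u : Phase Λ)
    {v w : Phase Λ} (hvw : ∀ j ∈ s, v j = w j) : fderiv ℝ h u v = fderiv ℝ h u w := by
  rw [fderiv_eq_of_dependsOn hs hd u]
  simp only [ContinuousLinearMap.comp_apply]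
  rw [siteRestrict_eq hvw]

lemma fderiv_single_eq_zero (hs : DependsOn h s) (hd : Differentiable ℝ h) (u : Phase Λ) {k : Λ}
    (hk : k ∉ s) (z : ℂ) : fderiv ℝ h u (Pi.single k z) = 0 := by
  have h1 : fderiv ℝ h u (Pi.single k z) = fderiv ℝ h u 0 := by
    refine fderiv_apply_congr hs hd u fun j hj => ?_
    have : j ≠ k := fun e => hk (e ▸ hj)
    simp [this]
  rw [h1, map_zero]

/-- A local Lipschitz estimate: only the coordinates on which the function depends matter. -/
lemma norm_sub_le_of_dependsOn (hs : DependsOn h s) (hd : Differentiable ℝ h) {u w : Phase Λ}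
    {K M : ℝ} (hM : 0 ≤ M)
    (hK : ∀ t ∈ Set.Icc (0 : ℝ) 1, ‖fderiv ℝ h (AffineMap.lineMap u w t)‖ ≤ K)
    (huw : ∀ j ∈ s, ‖w j - u j‖ ≤ M) : ‖h w - h u‖ ≤ K * M := by
  have h1 : ∀ t ∈ Set.Icc (0 : ℝ) 1, HasDerivWithinAt
      (fun t => h (AffineMap.lineMap u w t)) (fderiv ℝ h (AffineMap.lineMap u w t) (w - u))
      (Set.Icc 0 1) t := fun t _ =>
    ((hd _).hasFDerivAt.comp_hasDerivAt t AffineMap.hasDerivAt_lineMap).hasDerivWithinAt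
  have h2 := norm_image_sub_le_of_norm_deriv_le_segment_01' (C := K * M) h1 (fun t ht => by
    have e : fderiv ℝ h (AffineMap.lineMap u w t) (w - u) =
        fderiv ℝ h (AffineMap.lineMap u w t) (siteRestrict s (w - u)) :=
      fderiv_apply_congr hs hd _ fun j hj => (siteRestrict_of_mem hj _).symm
    rw [e]
    have hk := hK t ⟨ht.1, ht.2.le⟩
    refine (ContinuousLinearMap.le_opNorm _ _).trans (mul_le_mul hk
      (norm_siteRestrict_le hM huw) (norm_nonneg _) ((norm_nonneg _).trans hk)))
  simpa using h2

end Local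

/-- The phase space carries the sup norm, so componentwise bounds pass to the vector field without
any factor depending on the number of sites. -/
lemma jetLE_pi {m n : ℕ} {V : Phase Λ → Phase Λ} (c : ContDiff ℝ n V) {u : Phase Λ} {K : ℝ}
    (hK : 0 ≤ K) (H : ∀ j, JetLE m n (fun u => V u j) u K) : JetLE m n V u K := by
  intro i hi hi'
  have hc : ((i : ℕ) : WithTop ℕ∞) ≤ n := by exact_mod_cast hi'
  refine ContinuousMultilinearMap.opNorm_le_bound hK fun v => ?_
  refine (pi_norm_le_iff_of_nonneg (by positivity)).2 fun j => ?_
  have h1 := (ContinuousLinearMap.proj (R := ℝ) (φ := fun _ : Λ => ℂ) j).iteratedFDeriv_comp_left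
    (c.contDiffAt (x := u)) hc
  have h2 : iteratedFDeriv ℝ i V u v j = iteratedFDeriv ℝ i (fun u => V u j) u v := by
    have := congrArg (fun T => T v) h1
    exact this.symm
  rw [h2]
  exact (ContinuousMultilinearMap.le_opNorm _ v).trans
    (mul_le_mul_of_nonneg_right (H j i hi hi') (by positivity))

/-! ### Sums over the pairs of neighbours -/

/-- The sum `¼ ∑_{|j-k|=1} c_j A(u_j, u_k)`. -/
noncomputable def pairSum (c : Λ → ℝ) (A : ℂ × ℂ → ℝ) (u : Phase Λ) : ℝ :=
  (1 / 4) * ∑ j, ∑ k, if dist1 j k = 1 then c j * A (u j, u k) else 0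

/-- The terms of `pairSum c A` which depend on `u_m`. -/
noncomputable def pairStar (c : Λ → ℝ) (A : ℂ × ℂ → ℝ) (m : Λ) (u : Phase Λ) : ℝ :=
  (1 / 4) * ∑ k with dist1 k m = 1, (c m * A (u m, u k) + c k * A (u k, u m))

variable {c : Λ → ℝ} {A : ℂ × ℂ → ℝ}

lemma hasFDerivAt_pair (hA : Differentiable ℝ A) (j k : Λ) (u : Phase Λ) :
    HasFDerivAt (fun u : Phase Λ => A (u j, u k))
      ((fderiv ℝ A (u j, u k)).comp (pairProj j k)) u := by
  have h1 : HasFDerivAt A (fderiv ℝ A (u j, u k)) (pairProj j k u) := (hA (u j, u k)).hasFDerivAt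
  exact h1.comp u (pairProj j k).hasFDerivAt

lemma contDiff_pair {n : WithTop ℕ∞} (hA : ContDiff ℝ n A) (j k : Λ) :
    ContDiff ℝ n fun u : Phase Λ => A (u j, u k) := hA.comp (pairProj j k).contDiff

lemma contDiff_pairSum {n : WithTop ℕ∞} (hA : ContDiff ℝ n A) : ContDiff ℝ n (pairSum c A) := by
  refine contDiff_const.mul (ContDiff.sum fun j _ => ContDiff.sum fun k _ => ?_)
  split_ifs
  · exact contDiff_const.mul (contDiff_pair hA j k)
  · exact contDiff_const

lemma contDiff_pairStar {n : WithTop ℕ∞} (hA : ContDiff ℝ n A) (m : Λ) :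
    ContDiff ℝ n (pairStar c A m) :=
  contDiff_const.mul (ContDiff.sum fun k _ => (contDiff_const.mul (contDiff_pair hA m k)).add
    (contDiff_const.mul (contDiff_pair hA k m)))

lemma fderiv_pairSum (hA : Differentiable ℝ A) (u v : Phase Λ) :
    fderiv ℝ (pairSum c A) u v = (1 / 4) * ∑ j, ∑ k, if dist1 j k = 1 then
      c j * fderiv ℝ A (u j, u k) (v j, v k) else 0 := by
  have h1 : HasFDerivAt (pairSum c A) ((1 / 4 : ℝ) • ∑ j, ∑ k, if dist1 j k = 1 then
      c j • (fderiv ℝ A (u j, u k)).comp (pairProj j k) else 0) u := by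
    refine HasFDerivAt.const_mul (HasFDerivAt.fun_sum fun j _ => HasFDerivAt.fun_sum fun k _ => ?_) _
    split_ifs
    · exact (hasFDerivAt_pair hA j k u).const_mul _
    · exact hasFDerivAt_const _ _
  rw [h1.fderiv, smul_apply, smul_eq_mul, sum_apply]
  congr 1
  refine Finset.sum_congr rfl fun j _ => ?_
  rw [sum_apply]
  refine Finset.sum_congr rfl fun k _ => ?_
  split_ifs <;> rfl

lemma fderiv_pairStar (hA : Differentiable ℝ A) (m : Λ) (u v : Phase Λ) :
    fderiv ℝ (pairStar c A m) u v = (1 / 4) * ∑ k with dist1 k m = 1,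
      (c m * fderiv ℝ A (u m, u k) (v m, v k) + c k * fderiv ℝ A (u k, u m) (v k, v m)) := by
  have h1 : HasFDerivAt (pairStar c A m) ((1 / 4 : ℝ) • ∑ k with dist1 k m = 1,
      (c m • (fderiv ℝ A (u m, u k)).comp (pairProj m k) +
        c k • (fderiv ℝ A (u k, u m)).comp (pairProj k m))) u :=
    HasFDerivAt.const_mul (HasFDerivAt.fun_sum fun k _ =>
      ((hasFDerivAt_pair hA m k u).const_mul _).add ((hasFDerivAt_pair hA k m u).const_mul _)) _
  rw [h1.fderiv, smul_apply, smul_eq_mul, sum_apply]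
  rfl

lemma fderiv_pairSum_single (hA : Differentiable ℝ A) (m : Λ) (u : Phase Λ) (z : ℂ) :
    fderiv ℝ (pairSum c A) u (Pi.single m z) = (1 / 4) * ∑ k with dist1 k m = 1,
      (c m * fderiv ℝ A (u m, u k) (z, 0) + c k * fderiv ℝ A (u k, u m) (0, z)) := by
  classical
  rw [fderiv_pairSum hA]
  congr 1
  -- A pair contributes only if one of its members is `m`; sites at distance one are distinct, so
  -- the two contributions never overlap.
  have h1 : ∀ j k : Λ, (if dist1 j k = 1 then c j * fderiv ℝ A (u j, u k)
      ((Pi.single m z : Phase Λ) j, (Pi.single m z : Phase Λ) k) else 0) =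
      (if j = m then (if dist1 k m = 1 then c m * fderiv ℝ A (u m, u k) (z, 0) else 0) else 0) +
      (if k = m then (if dist1 j m = 1 then c j * fderiv ℝ A (u j, u m) (0, z) else 0) else 0) := by
    intro j k
    by_cases hj : j = m
    · subst hj
      by_cases hk : k = j
      · subst hk
        simp
      · simp only [if_true, hk, if_false, add_zero, Pi.single_eq_same, dist1_comm j k]
        rw [Pi.single_eq_of_ne hk]
    · by_cases hk : k = m
      · subst hk
        simp only [hj, if_false, if_true, zero_add, Pi.single_eq_same]
        rw [Pi.single_eq_of_ne hj]
      · simp only [hj, hk, if_false, add_zero]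
        rw [Pi.single_eq_of_ne hj, Pi.single_eq_of_ne hk]
        have : ((0 : ℂ), (0 : ℂ)) = 0 := rfl
        simp [this]
  simp_rw [h1, Finset.sum_add_distrib]
  rw [Finset.sum_comm]
  simp only [Finset.sum_ite_eq', Finset.mem_univ, if_true, Finset.sum_filter]

/-- The full sum has a number of terms proportional to that of the sites, and only the star of `m`
admits bounds uniform in `Λ`. The two have the same derivative in the directions of site `m`, which
is all the gradient at `m` sees. -/
lemma fderiv_pairStar_single (hA : Differentiable ℝ A) (m : Λ) (u : Phase Λ) (z : ℂ) :
    fderiv ℝ (pairStar c A m) u (Pi.single m z) =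
      fderiv ℝ (pairSum c A) u (Pi.single m z) := by
  rw [fderiv_pairSum_single hA, fderiv_pairStar hA]
  congr 1
  refine Finset.sum_congr rfl fun k hk => ?_
  have hkm : k ≠ m := ne_of_dist1_eq_one (Finset.mem_filter.1 hk).2
  rw [Pi.single_eq_same, Pi.single_eq_of_ne hkm]

lemma grad_pairSum_eq (hA : Differentiable ℝ A) (m : Λ) (u : Phase Λ) :
    grad (pairSum c A) u m = gradL m (fderiv ℝ (pairStar c A m) u) := by
  rw [grad_eq_gradL, gradL_apply, gradL_apply, fderiv_pairStar_single hA, fderiv_pairStar_single hA]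

lemma dependsOn_pairStar (m : Λ) : DependsOn (pairStar c A m) (siteBall m 1) := by
  intro u w h
  unfold pairStar
  congr 1
  refine Finset.sum_congr rfl fun k hk => ?_
  rw [h m (by simp [siteBall]), h k (by simp [siteBall, (Finset.mem_filter.1 hk).2])]

/-- The weight `1 + ∑_{|n-j|≤1} |u_n|^q` of a site. -/
noncomputable def siteWeight (q : ℕ) (j : Λ) (u : Phase Λ) : ℝ :=
  1 + ∑ n with dist1 n j ≤ 1, ‖u n‖ ^ q

lemma one_le_siteWeight (q : ℕ) (j : Λ) (u : Phase Λ) : 1 ≤ siteWeight q j u := by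
  unfold siteWeight
  have : 0 ≤ ∑ n with dist1 n j ≤ 1, ‖u n‖ ^ q := Finset.sum_nonneg fun _ _ => by positivity
  linarith

lemma siteWeight_pos (q : ℕ) (j : Λ) (u : Phase Λ) : 0 < siteWeight q j u :=
  one_pos.trans_le (one_le_siteWeight q j u)

lemma pairWeight_le_siteWeight (q : ℕ) {m k : Λ} (h : dist1 k m = 1) (u : Phase Λ) :
    pairWeight q (u m, u k) ≤ siteWeight q m u ∧ pairWeight q (u k, u m) ≤ siteWeight q m u := by
  classical
  have hkm : k ≠ m := ne_of_dist1_eq_one h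
  have h1 : ‖u m‖ ^ q + ‖u k‖ ^ q ≤ ∑ n with dist1 n m ≤ 1, ‖u n‖ ^ q := by
    rw [← Finset.sum_pair (f := fun n => ‖u n‖ ^ q) hkm.symm]
    refine Finset.sum_le_sum_of_subset_of_nonneg ?_ fun _ _ _ => by positivity
    intro n hn
    rcases Finset.mem_insert.1 hn with rfl | hn
    · simp
    · rw [Finset.mem_singleton.1 hn]
      simp [h]
  unfold pairWeight siteWeight
  constructor <;> simp only <;> linarith

/-- There are at most `nbhdConst d 1` neighbours with two terms each, and the prefactor `1 / 4` more
than compensates for the two. -/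
lemma jetLE_pairStar {K : ℝ} (hK : 0 ≤ K) (hA : ContDiff ℝ 3 A) (hc : ∀ j, |c j| ≤ 1) {w : ℝ}
    (hw : 0 ≤ w) (m : Λ) (u : Phase Λ)
    (H : ∀ k, dist1 k m = 1 → JetLE 1 3 A (u m, u k) (K * w) ∧ JetLE 1 3 A (u k, u m) (K * w)) :
    JetLE 1 3 (pairStar c A m) u (nbhdConst d 1 * K * w) := by
  have h1 : JetLE 1 3 (fun u => ∑ k with dist1 k m = 1,
      (c m * A (u m, u k) + c k * A (u k, u m))) u
      (∑ k : Λ with dist1 k m = 1, (|c m| * (K * w) + |c k| * (K * w))) := by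
    refine JetLE.sum (fun k hk => ?_) fun k _ => ?_
    · obtain ⟨a1, a2⟩ := H k (Finset.mem_filter.1 hk).2
      have b1 := a1.comp_clm (pairProj m k) (pairProj_norm_le m k) (y := u) hA
      have b2 := a2.comp_clm (pairProj k m) (pairProj_norm_le k m) (y := u) hA
      exact (b1.const_mul (c m) (contDiff_pair hA m k)).add
        (b2.const_mul (c k) (contDiff_pair hA k m)) (contDiff_const.mul (contDiff_pair hA m k))
        (contDiff_const.mul (contDiff_pair hA k m))
    · exact (contDiff_const.mul (contDiff_pair hA m k)).add
        (contDiff_const.mul (contDiff_pair hA k m))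
  have hcd : ContDiff ℝ 3 fun u : Phase Λ => ∑ k with dist1 k m = 1,
      (c m * A (u m, u k) + c k * A (u k, u m)) := ContDiff.sum fun k _ =>
    (contDiff_const.mul (contDiff_pair hA m k)).add (contDiff_const.mul (contDiff_pair hA k m))
  refine (h1.const_mul (1 / 4) hcd).mono ?_
  have hKw : 0 ≤ K * w := by positivity
  have h2 : ∑ k : Λ with dist1 k m = 1, (|c m| * (K * w) + |c k| * (K * w)) ≤
      ∑ k : Λ with dist1 k m ≤ 1, (2 * (K * w)) := by
    refine (Finset.sum_le_sum fun k _ => ?_).trans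
      (Finset.sum_le_sum_of_subset_of_nonneg (t := Finset.univ.filter fun k : Λ => dist1 k m ≤ 1)
        (fun k hk => ?_) fun _ _ _ => by positivity)
    · have := mul_le_mul_of_nonneg_right (hc m) hKw
      have := mul_le_mul_of_nonneg_right (hc k) hKw
      linarith
    · simp only [Finset.mem_filter, Finset.mem_univ, true_and] at hk ⊢
      omega
  have h3 := sum_nbhd_le (ρ := 1) m (a := fun _ => 2 * (K * w)) (K := 2 * (K * w))
    (by positivity) fun _ _ => le_rfl
  rw [abs_of_pos (by norm_num : (0 : ℝ) < 1 / 4)]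
  have h4 : 0 ≤ nbhdConst d 1 * (K * w) := mul_nonneg (nbhdConst_nonneg d 1) hKw
  linarith

lemma pairStar_rot {a : ℂ} (hinv : ∀ x, A (a • x) = A x) (m : Λ) (u : Phase Λ) :
    pairStar c A m (a • u) = pairStar c A m u := by
  unfold pairStar
  congr 1
  refine Finset.sum_congr rfl fun k _ => ?_
  have h1 := hinv (u m, u k)
  have h2 := hinv (u k, u m)
  simp only [Prod.smul_mk, smul_eq_mul] at h1 h2
  simp only [Pi.smul_apply, smul_eq_mul, h1, h2]

/-- The scalar multiplication by a complex number, as a real-linear map. -/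
noncomputable def smulL (a : ℂ) : Phase Λ →L[ℝ] Phase Λ :=
  (a • ContinuousLinearMap.id ℂ (Phase Λ)).restrictScalars ℝ

lemma fderiv_rot {h : Phase Λ → ℝ} (hd : Differentiable ℝ h) {a : ℂ}
    (hinv : ∀ u, h (a • u) = h u) (u v : Phase Λ) :
    fderiv ℝ h (a • u) (a • v) = fderiv ℝ h u v := by
  have h1 : HasFDerivAt (fun u => h (smulL a u)) ((fderiv ℝ h (a • u)).comp (smulL a)) u :=
    HasFDerivAt.comp u (hd (a • u)).hasFDerivAt (smulL a).hasFDerivAt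
  have h2 : (fun u => h (smulL a u)) = h := funext fun u => hinv u
  rw [h2] at h1
  rw [h1.fderiv]
  rfl

lemma gradL_rot {l l' : Phase Λ →L[ℝ] ℝ} {a : ℂ} (ha : ‖a‖ = 1)
    (h : ∀ v, l' (a • v) = l v) (m : Λ) : gradL m l' = a * gradL m l := by
  have key : ∀ z : ℂ, l (Pi.single m z) = l' (Pi.single m (a * z)) := fun z => by
    rw [← h, ← Pi.single_smul, smul_eq_mul]
  have hn : a.re * a.re + a.im * a.im = 1 := by
    have := Complex.normSq_apply a
    rw [Complex.normSq_eq_norm_sq, ha] at this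
    linarith
  have e1 := key 1
  have e2 := key Complex.I
  rw [← gradL_re, map_single_eq] at e1
  rw [← gradL_im, map_single_eq] at e2
  apply Complex.ext
  · rw [Complex.mul_re, e1, e2]
    simp only [Complex.mul_re, Complex.mul_im, Complex.I_re, Complex.I_im, mul_one, mul_zero]
    linear_combination -(gradL m l').re * hn
  · rw [Complex.mul_im, e1, e2]
    simp only [Complex.mul_re, Complex.mul_im, Complex.I_re, Complex.I_im, mul_one, mul_zero]
    linear_combination -(gradL m l').im * hn

/-- Differentiation of the invariance along `e^{it} u` at `t = 0`: the angular derivatives over all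
sites sum to zero. -/
lemma fderiv_rot_eq_zero {h : Phase Λ → ℝ} (hd : Differentiable ℝ h)
    (hinv : ∀ a : ℂ, ‖a‖ = 1 → ∀ u, h (a • u) = h u) (u : Phase Λ) :
    fderiv ℝ h u (Complex.I • u) = 0 := by
  have h1 : HasDerivAt (fun t : ℝ => Complex.exp (t * Complex.I) • u) (Complex.I • u) 0 := by
    have h2 : HasDerivAt (fun t : ℝ => Complex.exp (t * Complex.I)) Complex.I 0 := by
      have := ((Complex.ofRealCLM.hasDerivAt (x := 0)).mul_const Complex.I).cexp
      simpa using this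
    exact h2.smul_const u
  have h3 : HasDerivAt (fun t : ℝ => h (Complex.exp (t * Complex.I) • u))
      (fderiv ℝ h (Complex.exp ((0 : ℝ) * Complex.I) • u) (Complex.I • u)) 0 :=
    (hd _).hasFDerivAt.comp_hasDerivAt (0 : ℝ) h1
  have h4 : (fun t : ℝ => h (Complex.exp (t * Complex.I) • u)) = fun _ => h u :=
    funext fun t => hinv _ (Complex.norm_exp_ofReal_mul_I t) u
  rw [h4] at h3
  have := h3.unique (hasDerivAt_const (0 : ℝ) (h u))
  simpa using this

end PairSums

end Rotators

namespace Rotators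

/-- Regularity, growth and rotation invariance of a pair interaction. -/
structure PairReg (p : ℕ) (A : ℂ × ℂ → ℝ) (K : ℝ) : Prop where
  contDiff : ContDiff ℝ 4 A
  jet : ∀ x, JetLE 1 3 A x (K * pairWeight (p - 1) x)
  rot : ∀ c : ℂ, ‖c‖ = 1 → ∀ x, A (c • x) = A x

namespace PairBounds

variable {p : ℕ} {S A A₀ B : ℂ × ℂ → ℝ} {K : ℝ}

lemma reg (h : PairBounds p S A A₀ B K) : PairReg p A K := ⟨h.contDiff, h.jet, h.rot⟩

lemma reg_avg (h : PairBounds p S A A₀ B K) : PairReg p A₀ K :=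
  ⟨h.contDiff_avg, h.jet_avg, h.rot_avg⟩

lemma nonneg (h : PairBounds p S A A₀ B K) : 0 ≤ K := (h.jet_hom 0).nonneg (by norm_num)

end PairBounds

section HamField

variable {d : ℕ} {Λ : Finset (Fin d → ℤ)} {p : ℕ} {S A A₀ B : ℂ × ℂ → ℝ} {K : ℝ}

/-! ### The Hamiltonian which generates the change of variables -/

/-- The signs of the sites of `Λ`. -/
noncomputable def signs (Λ : Finset (Fin d → ℤ)) (j : Λ) : ℝ := siteSign j.1

/-- The Hamiltonian vector field `i ∇Φ` of `Φ = ¼ ∑_{|j-k|=1} (-1)^{|j|} B(u_j, u_k)`. -/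
noncomputable def hamField (Λ : Finset (Fin d → ℤ)) (B : ℂ × ℂ → ℝ) (u : Phase Λ) : Phase Λ :=
  fun j => Complex.I * grad (pairSum (signs Λ) B) u j

lemma hamField_apply (hB : Differentiable ℝ B) (u : Phase Λ) (j : Λ) :
    hamField Λ B u j = Complex.I * gradL j (fderiv ℝ (pairStar (signs Λ) B j) u) := by
  rw [hamField, grad_pairSum_eq hB]

lemma abs_signs_le (j : Λ) : |signs Λ j| ≤ 1 := (abs_siteSign j.1).le

/-- A bound for the vector field and its two derivatives. -/
noncomputable def fieldConst (d : ℕ) (K : ℝ) : ℝ := 2 * (nbhdConst d 1 * K)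

lemma fieldConst_nonneg (hK : 0 ≤ K) : 0 ≤ fieldConst d K :=
  mul_nonneg zero_le_two (mul_nonneg (nbhdConst_nonneg d 1) hK)

/-- The map `l ↦ i ∇_j`, as a real-linear map of the differential. -/
noncomputable def fieldL (j : Λ) : (Phase Λ →L[ℝ] ℝ) →L[ℝ] ℂ := Complex.I • gradL j

lemma fieldL_norm_le (j : Λ) : ‖fieldL j‖ ≤ 2 := by
  refine ContinuousLinearMap.opNorm_le_bound _ zero_le_two fun l => ?_
  rw [fieldL, smul_apply, norm_smul, Complex.norm_I, one_mul]
  exact gradL_norm_apply_le j l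

lemma hamField_eq_fieldL (hB : Differentiable ℝ B) (j : Λ) :
    (fun u => hamField Λ B u j) = fun u => fieldL j (fderiv ℝ (pairStar (signs Λ) B j) u) :=
  funext fun u => hamField_apply hB u j

lemma contDiff_hamField_apply (hB : ContDiff ℝ 3 B) (j : Λ) :
    ContDiff ℝ 2 fun u => hamField Λ B u j := by
  rw [hamField_eq_fieldL (hB.differentiable (by norm_num))]
  exact (fieldL j).contDiff.comp ((contDiff_pairStar hB j).fderiv_right (m := 2) (by norm_num))

lemma contDiff_hamField (hB : ContDiff ℝ 3 B) : ContDiff ℝ 2 (hamField Λ B) :=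
  contDiff_pi.2 fun j => contDiff_hamField_apply hB j

lemma dependsOn_hamField (hB : ContDiff ℝ 3 B) (j : Λ) :
    DependsOn (fun u => hamField Λ B u j) (siteBall j 1) := by
  rw [hamField_eq_fieldL (hB.differentiable (by norm_num))]
  intro u w h
  have := dependsOn_fderiv (dependsOn_pairStar (c := signs Λ) (A := B) j)
    ((contDiff_pairStar hB j).differentiable (by norm_num)) h
  simp only [this]

lemma jetLE_hamField_apply (hB : ContDiff ℝ 3 B) (hj : ∀ x, JetLE 1 3 B x K) (hK : 0 ≤ K) (j : Λ)
    (u : Phase Λ) : JetLE 0 2 (fun u => hamField Λ B u j) u (fieldConst d K) := by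
  rw [hamField_eq_fieldL (hB.differentiable (by norm_num))]
  have h1 := jetLE_pairStar hK hB abs_signs_le zero_le_one j u
    fun k _ => ⟨by simpa using hj _, by simpa using hj _⟩
  rw [mul_one] at h1
  exact ((h1.fderiv).clm_comp (fieldL j)
    ((contDiff_pairStar hB j).fderiv_right (m := 2) (by norm_num))).mono
    (mul_le_mul_of_nonneg_right (fieldL_norm_le j) (mul_nonneg (nbhdConst_nonneg d 1) hK))

lemma jetLE_hamField (hB : ContDiff ℝ 3 B) (hj : ∀ x, JetLE 1 3 B x K) (hK : 0 ≤ K)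
    (u : Phase Λ) : JetLE 0 2 (hamField Λ B) u (fieldConst d K) :=
  jetLE_pi (contDiff_hamField hB) (fieldConst_nonneg hK) fun j => jetLE_hamField_apply hB hj hK j u

lemma hamField_rot (hB : ContDiff ℝ 3 B) (hrot : ∀ c : ℂ, ‖c‖ = 1 → ∀ x, B (c • x) = B x) {a : ℂ}
    (ha : ‖a‖ = 1) (u : Phase Λ) : hamField Λ B (a • u) = a • hamField Λ B u := by
  funext j
  have hd : Differentiable ℝ (pairStar (signs Λ) B j) :=
    (contDiff_pairStar hB j).differentiable (by norm_num)
  rw [Pi.smul_apply, hamField_apply (hB.differentiable (by norm_num)),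
    hamField_apply (hB.differentiable (by norm_num)),
    gradL_rot ha (fderiv_rot hd (pairStar_rot (hrot a ha) j) u) j, smul_eq_mul]
  ring

/-! ### Lie derivatives of the interaction -/

/-- The differential of the interaction `¼ ∑ A(u_j, u_k)` on the component of the vector field at
the site `j`. -/
noncomputable def lieTerm (A B : ℂ × ℂ → ℝ) (j : Λ) (u : Phase Λ) : ℝ :=
  fderiv ℝ (pairStar (fun _ => 1) A j) u (Pi.single j (hamField Λ B u j))

/-- The second Lie derivative, term by term. -/
noncomputable def lieTerm2 (A B : ℂ × ℂ → ℝ) (j : Λ) (u : Phase Λ) : ℝ :=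
  fderiv ℝ (lieTerm A B j) u (hamField Λ B u)

/-- The differential is split over the directions of the sites, and in the direction of site `j` the
interaction may be replaced by its star. Thus a Lie derivative of the total interaction becomes a
sum of local terms. -/
lemma sum_lieTerm (hA : Differentiable ℝ A) (u : Phase Λ) :
    ∑ j, lieTerm A B j u = fderiv ℝ (pairSum (fun _ => 1) A) u (hamField Λ B u) := by
  rw [map_eq_sum_single]
  exact Finset.sum_congr rfl fun j _ => fderiv_pairStar_single hA j u _

lemma contDiff_lieTerm (hA : ContDiff ℝ 3 A) (hB : ContDiff ℝ 3 B) (j : Λ) :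
    ContDiff ℝ 2 (lieTerm A B j : Phase Λ → ℝ) :=
  ((contDiff_pairStar hA j).fderiv_right (m := 2) (by norm_num)).clm_apply
    ((siteSingle j).contDiff.comp (contDiff_hamField_apply hB j))

lemma contDiff_lieTerm2 (hA : ContDiff ℝ 3 A) (hB : ContDiff ℝ 3 B) (j : Λ) :
    ContDiff ℝ 1 (lieTerm2 A B j : Phase Λ → ℝ) :=
  ((contDiff_lieTerm hA hB j).fderiv_right (m := 1) (by norm_num)).clm_apply
    ((contDiff_hamField hB).of_le (by norm_num))

lemma dependsOn_lieTerm (hA : ContDiff ℝ 3 A) (hB : ContDiff ℝ 3 B) (j : Λ) :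
    DependsOn (lieTerm A B j : Phase Λ → ℝ) (siteBall j 1) := by
  intro u w h
  unfold lieTerm
  have h1 := dependsOn_hamField hB j h
  simp only at h1
  rw [h1, dependsOn_fderiv (dependsOn_pairStar j)
    ((contDiff_pairStar hA j).differentiable (by norm_num)) h]

/-- The first Lie term sees neighbours, and the components of the field at those sites see their own
neighbours. -/
lemma dependsOn_lieTerm2 (hA : ContDiff ℝ 3 A) (hB : ContDiff ℝ 3 B) (j : Λ) :
    DependsOn (lieTerm2 A B j : Phase Λ → ℝ) (siteBall j 2) := by
  intro u w h
  have hd := (contDiff_lieTerm hA hB j).differentiable (by norm_num)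
  have hs := dependsOn_lieTerm hA hB j
  unfold lieTerm2
  rw [dependsOn_fderiv hs hd fun k hk => h k (le_trans (show dist1 k j ≤ 1 from hk) one_le_two)]
  refine fderiv_apply_congr hs hd w fun k hk => ?_
  refine dependsOn_hamField hB k fun n hn => h n ?_
  have := dist1_triangle n k j
  simp only [siteBall, Set.mem_ofPred_eq] at *
  omega

/-- The constant in the bounds for the Lie derivatives. -/
noncomputable def lieConst (d : ℕ) (K : ℝ) : ℝ := 2 ^ 2 * (nbhdConst d 1 * K * fieldConst d K)

lemma lieConst_nonneg (hK : 0 ≤ K) : 0 ≤ lieConst d K :=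
  mul_nonneg (by norm_num) (mul_nonneg (mul_nonneg (nbhdConst_nonneg d 1) hK) (fieldConst_nonneg hK))

/-- The constant in the bounds for the second Lie derivatives. -/
noncomputable def lieConst2 (d : ℕ) (K : ℝ) : ℝ := 2 ^ 1 * (lieConst d K * fieldConst d K)

lemma lieConst2_nonneg (hK : 0 ≤ K) : 0 ≤ lieConst2 d K :=
  mul_nonneg (by norm_num) (mul_nonneg (lieConst_nonneg hK) (fieldConst_nonneg hK))

lemma jetLE_pairStar_of_reg (hA : PairReg p A K) (hK : 0 ≤ K) (j : Λ) (u : Phase Λ) :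
    JetLE 1 3 (pairStar (fun _ => 1) A j) u (nbhdConst d 1 * K * siteWeight (p - 1) j u) := by
  refine jetLE_pairStar hK (hA.contDiff.of_le (by norm_num)) (fun _ => by simp)
    (siteWeight_pos _ j u).le j u fun k hk => ?_
  have := pairWeight_le_siteWeight (p - 1) hk u
  exact ⟨(hA.jet _).mono (mul_le_mul_of_nonneg_left this.1 hK),
    (hA.jet _).mono (mul_le_mul_of_nonneg_left this.2 hK)⟩

lemma jetLE_lieTerm (hA : PairReg p A K) (hB : ContDiff ℝ 3 B) (hj : ∀ x, JetLE 1 3 B x K)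
    (hK : 0 ≤ K) (j : Λ) (u : Phase Λ) :
    JetLE 0 2 (lieTerm A B j) u (lieConst d K * siteWeight (p - 1) j u) := by
  have hA3 : ContDiff ℝ 3 A := hA.contDiff.of_le (by norm_num)
  have h1 := (jetLE_pairStar_of_reg hA hK j u).fderiv
  have h2 := ((jetLE_hamField_apply hB hj hK j u).clm_comp (siteSingle j)
    (contDiff_hamField_apply hB j)).mono
    (mul_le_of_le_one_left (fieldConst_nonneg hK) (siteSingle_norm_le j))
  refine (h1.clm_apply h2 ((contDiff_pairStar hA3 j).fderiv_right (m := 2) (by norm_num))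
    ((siteSingle j).contDiff.comp (contDiff_hamField_apply hB j))).mono (le_of_eq ?_)
  unfold lieConst
  ring

lemma jetLE_lieTerm2 (hA : PairReg p A K) (hB : ContDiff ℝ 3 B) (hj : ∀ x, JetLE 1 3 B x K)
    (hK : 0 ≤ K) (j : Λ) (u : Phase Λ) :
    JetLE 0 1 (lieTerm2 A B j) u (lieConst2 d K * siteWeight (p - 1) j u) := by
  have hA3 : ContDiff ℝ 3 A := hA.contDiff.of_le (by norm_num)
  have h1 := ((jetLE_lieTerm hA hB hj hK j u).weaken (m' := 1) (n' := 2) (by norm_num) le_rfl).fderiv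
  have h2 := (jetLE_hamField hB hj hK u).weaken (m' := 0) (n' := 1) le_rfl (by norm_num)
  refine (h1.clm_apply h2 ((contDiff_lieTerm hA3 hB j).fderiv_right (m := 1) (by norm_num))
    ((contDiff_hamField hB).of_le (by norm_num))).mono (le_of_eq ?_)
  unfold lieConst2
  ring

lemma lieTerm_rot (hA : PairReg p A K) (hB : ContDiff ℝ 3 B)
    (hrot : ∀ c : ℂ, ‖c‖ = 1 → ∀ x, B (c • x) = B x) {a : ℂ} (ha : ‖a‖ = 1) (j : Λ)
    (u : Phase Λ) : lieTerm A B j (a • u) = lieTerm A B j u := by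
  have hd : Differentiable ℝ (pairStar (Λ := Λ) (fun _ => 1) A j) :=
    (contDiff_pairStar hA.contDiff j).differentiable (by norm_num)
  unfold lieTerm
  rw [hamField_rot hB hrot ha, Pi.smul_apply, Pi.single_smul,
    fderiv_rot hd (pairStar_rot (hA.rot a ha) j)]

/-! ### The homological equation -/

/-- The Hamiltonian `½ ∑_j F_j(|u_j|²)` of the uncoupled system. -/
noncomputable def freeHam (F : (Fin d → ℤ) → ℝ → ℝ) (u : Phase Λ) : ℝ :=
  (1 / 2) * ∑ j : Λ, F j.1 (‖u j‖ ^ 2)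

variable {F : (Fin d → ℤ) → ℝ → ℝ} {f : ℝ → ℝ} {ς : ℝ}

/-- The primitive `H` is differentiable only one-sidedly at `0`; since `‖z‖²` maps into the
half-line, the chain rule within `Set.Ici 0` still gives a full derivative. -/
lemma hasFDerivAt_comp_normSq {H h : ℝ → ℝ} {σ : ℝ}
    (hH : ∀ x : ℝ, 0 ≤ x → HasDerivWithinAt H (σ * h x) (Set.Ici 0) x) (z : ℂ) :
    HasFDerivAt (fun z : ℂ => H (‖z‖ ^ 2)) ((σ * h (‖z‖ ^ 2)) • (2 • innerSL ℝ z)) z := by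
  rw [← hasFDerivWithinAt_univ]
  exact (hH (‖z‖ ^ 2) (sq_nonneg _)).comp_hasFDerivWithinAt z
    (hasStrictFDerivAt_norm_sq z).hasFDerivAt.hasFDerivWithinAt fun w _ => sq_nonneg ‖w‖

lemma contDiff_four_comp_normSq (hς : 0 < ς) {H h : ℝ → ℝ} {σ : ℝ}
    (hh : ContDiffOn ℝ 3 h (Set.Ioi (-ς)))
    (hH : ∀ x : ℝ, 0 ≤ x → HasDerivWithinAt H (σ * h x) (Set.Ici 0) x) :
    ContDiff ℝ 4 fun z : ℂ => H (‖z‖ ^ 2) := by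
  have h1 : ContDiff ℝ ((3 : ℕ) + 1) fun z : ℂ => H (‖z‖ ^ 2) :=
    contDiff_succ_iff_hasFDerivAt.2 ⟨_, (contDiff_const.mul (contDiff_comp_normSq hς hh)).smul
      ((innerSL ℝ).contDiff.const_smul 2), hasFDerivAt_comp_normSq hH⟩
  exact h1.of_le (by norm_num)

lemma contDiff_freeHam (hς : 0 < ς) (hf : ContDiffOn ℝ 3 f (Set.Ioi (-ς)))
    (hF : ∀ j, ∀ x : ℝ, 0 ≤ x →
      HasDerivWithinAt (F j) ((-1) ^ siteNorm j * f x) (Set.Ici 0) x) :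
    ContDiff ℝ 4 (freeHam F : Phase Λ → ℝ) :=
  contDiff_const.mul (ContDiff.sum fun j _ =>
    (contDiff_four_comp_normSq hς hf (hF j.1)).comp (contDiff_apply ℝ ℂ j))

lemma fderiv_freeHam (hF : ∀ j, ∀ x : ℝ, 0 ≤ x →
      HasDerivWithinAt (F j) ((-1) ^ siteNorm j * f x) (Set.Ici 0) x) (u v : Phase Λ) :
    fderiv ℝ (freeHam F) u v =
      ∑ j : Λ, signs Λ j * f (‖u j‖ ^ 2) * ((u j).re * (v j).re + (u j).im * (v j).im) := by
  have h1 : HasFDerivAt (freeHam F : Phase Λ → ℝ) ((1 / 2 : ℝ) • ∑ j : Λ,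
      (((-1) ^ siteNorm j.1 * f (‖u j‖ ^ 2)) • (2 • innerSL ℝ (u j))).comp
        (ContinuousLinearMap.proj (R := ℝ) (φ := fun _ : Λ => ℂ) j)) u :=
    HasFDerivAt.const_mul (HasFDerivAt.fun_sum fun j _ => HasFDerivAt.comp u
      (hasFDerivAt_comp_normSq (hF j.1) (u j))
      (ContinuousLinearMap.proj (R := ℝ) (φ := fun _ : Λ => ℂ) j).hasFDerivAt) _
  rw [h1.fderiv, smul_apply, smul_eq_mul, sum_apply, Finset.mul_sum]
  refine Finset.sum_congr rfl fun j _ => ?_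
  rw [ContinuousLinearMap.comp_apply, smul_apply, smul_apply, ContinuousLinearMap.proj_apply,
    innerSL_apply_apply, Complex.inner]
  simp only [Complex.mul_re, Complex.conj_re, Complex.conj_im, smul_eq_mul, nsmul_eq_mul,
    Nat.cast_ofNat, signs, siteSign]
  ring

/-- The radial speed of site `j` under a Hamiltonian flow is minus the angular derivative of the
Hamiltonian. For `z = u_j` this is the equation of the action. -/
lemma re_mul_add_im_mul_hamField (u : Phase Λ) (z : ℂ) (j : Λ) :
    z.re * (hamField Λ B u j).re + z.im * (hamField Λ B u j).im =
      -fderiv ℝ (pairSum (signs Λ) B) u (Pi.single j (Complex.I * z)) := by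
  rw [← re_I_mul_grad, ← grad_eq_gradL, Complex.mul_re, Complex.conj_re, Complex.conj_im]
  unfold hamField
  ring

/-- Invariance of `B` under the common rotation of both arguments: it depends on the angles only
through their difference. -/
lemma fderiv_pair_snd (hP : PairBounds p S A A₀ B K) (a b : ℂ) :
    fderiv ℝ B (a, b) (0, Complex.I * b) = -fderiv ℝ B (a, b) (Complex.I * a, 0) := by
  have hd := hP.contDiff_hom.differentiable (by norm_num)
  have h1 : HasDerivAt (fun t : ℝ => Complex.exp (t * Complex.I) • ((a, b) : ℂ × ℂ))
      (Complex.I • ((a, b) : ℂ × ℂ)) 0 := by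
    have h2 : HasDerivAt (fun t : ℝ => Complex.exp (t * Complex.I)) Complex.I 0 := by
      have := ((Complex.ofRealCLM.hasDerivAt (x := 0)).mul_const Complex.I).cexp
      simpa using this
    exact h2.smul_const _
  have h3 : HasDerivAt (fun t : ℝ => B (Complex.exp (t * Complex.I) • ((a, b) : ℂ × ℂ)))
      (fderiv ℝ B (Complex.exp ((0 : ℝ) * Complex.I) • ((a, b) : ℂ × ℂ))
        (Complex.I • ((a, b) : ℂ × ℂ))) 0 :=
    (hd _).hasFDerivAt.comp_hasDerivAt (0 : ℝ) h1
  have h4 : (fun t : ℝ => B (Complex.exp (t * Complex.I) • ((a, b) : ℂ × ℂ))) = fun _ => B (a, b) :=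
    funext fun t => hP.rot_hom _ (Complex.norm_exp_ofReal_mul_I t) _
  rw [h4] at h3
  have h5 := h3.unique (hasDerivAt_const (0 : ℝ) (B (a, b)))
  rw [Complex.ofReal_zero, zero_mul, Complex.exp_zero, one_smul] at h5
  have h6 : Complex.I • ((a, b) : ℂ × ℂ) = (Complex.I * a, 0) + (0, Complex.I * b) := by
    simp [Prod.smul_mk]
  rw [h6, map_add] at h5
  linarith

/-- The bracket with the uncoupled Hamiltonian is, up to sign, the derivative of `Φ` along the
independent rotations of all sites; pair by pair these act on `B` through the sum of the two
frequencies. -/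
lemma homological_equation (hP : PairBounds p (pairFreq f) A A₀ B K)
    (hF : ∀ j, ∀ x : ℝ, 0 ≤ x →
      HasDerivWithinAt (F j) ((-1) ^ siteNorm j * f x) (Set.Ici 0) x) (u : Phase Λ) :
    fderiv ℝ (freeHam F) u (hamField Λ B u) =
      -(pairSum (fun _ => 1) A u - pairSum (fun _ => 1) A₀ u) := by
  have hd := hP.contDiff_hom.differentiable (by norm_num)
  let ω : Λ → ℝ := fun j => signs Λ j * f (‖u j‖ ^ 2)
  -- Antisymmetry of the Poisson bracket: the field `i∇Φ` acting on the uncoupled energy is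
  -- exchanged for the uncoupled flow, with frequency `ω j` at site `j`, acting on `Φ`.
  have h1 : fderiv ℝ (freeHam F) u (hamField Λ B u) =
      -fderiv ℝ (pairSum (signs Λ) B) u fun j => (ω j : ℂ) * (Complex.I * u j) := by
    rw [fderiv_freeHam hF, map_eq_sum_single, ← Finset.sum_neg_distrib]
    refine Finset.sum_congr rfl fun j _ => ?_
    have h2 : (Pi.single j ((ω j : ℂ) * (Complex.I * u j)) : Phase Λ) =
        ω j • (Pi.single j (Complex.I * u j) : Phase Λ) := by
      rw [← Pi.single_smul]
      rfl
    rw [re_mul_add_im_mul_hamField, h2, map_smul, smul_eq_mul]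
    ring
  rw [h1, fderiv_pairSum hd, pairSum, pairSum, ← mul_sub, ← Finset.sum_sub_distrib]
  congr 2
  refine Finset.sum_congr rfl fun j _ => ?_
  rw [← Finset.sum_sub_distrib]
  refine Finset.sum_congr rfl fun k _ => ?_
  split_ifs with hjk
  · have e1 : (((ω j : ℂ) * (Complex.I * u j), (ω k : ℂ) * (Complex.I * u k)) : ℂ × ℂ) =
        ω j • (Complex.I * u j, 0) + ω k • (0, Complex.I * u k) := by
      simp
    -- Here alternation enters. The two angular derivatives of `B` are opposite and so are the signs
    -- of `ω j` and `ω k`; the products add, and the sign in `Φ` squares to one.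
    have hs : signs Λ k = -signs Λ j := siteSign_eq_neg hjk
    have hs2 : signs Λ j * signs Λ j = 1 := siteSign_mul_self j.1
    have e2 := hP.hom (u j, u k)
    rw [e1, map_add, map_smul, map_smul, fderiv_pair_snd hP, smul_eq_mul, smul_eq_mul]
    simp only [pairFreq] at e2
    rw [one_mul, one_mul, ← e2]
    simp only [ω, hs]
    linear_combination ((f (‖u j‖ ^ 2) + f (‖u k‖ ^ 2)) *
      fderiv ℝ B (u j, u k) (Complex.I * u j, 0)) * hs2
  · rw [sub_zero]

/-- Uses the bound for `∂_θ B` rather than for the gradient, so no factor `|u_j|` appears. This is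
what controls the actions at large amplitude. -/
lemma abs_angular_deriv_le (hP : PairBounds p S A A₀ B K) (u : Phase Λ) (j : Λ) :
    |fderiv ℝ (pairSum (signs Λ) B) u (Pi.single j (Complex.I * u j))| ≤ nbhdConst d 1 * K := by
  have hK := hP.nonneg
  have hN := nbhdConst_nonneg d 1
  rw [fderiv_pairSum_single (hP.contDiff_hom.differentiable (by norm_num)), abs_mul]
  have h1 : |∑ k with dist1 k j = 1, (signs Λ j * fderiv ℝ B (u j, u k) (Complex.I * u j, 0) +
      signs Λ k * fderiv ℝ B (u k, u j) (0, Complex.I * u j))| ≤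
      ∑ k : Λ with dist1 k j ≤ 1, 2 * K := by
    refine (Finset.abs_sum_le_sum_abs _ _).trans ?_
    refine (Finset.sum_le_sum fun k _ => ?_).trans
      (Finset.sum_le_sum_of_subset_of_nonneg (t := Finset.univ.filter fun k : Λ => dist1 k j ≤ 1)
        (fun k hk => ?_) fun _ _ _ => by positivity)
    · refine (abs_add_le _ _).trans ?_
      rw [abs_mul, abs_mul, fderiv_pair_snd hP, abs_neg]
      have a1 := hP.bound (u j, u k)
      have a2 := hP.bound (u k, u j)
      have b1 := mul_le_mul (abs_signs_le j) a1 (abs_nonneg _) zero_le_one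
      have b2 := mul_le_mul (abs_signs_le k) a2 (abs_nonneg _) zero_le_one
      simp only at b1 b2
      linarith
    · simp only [Finset.mem_filter, Finset.mem_univ, true_and] at hk ⊢
      omega
  have h2 := sum_nbhd_le (ρ := 1) j (a := fun _ => 2 * K) (K := 2 * K) (by positivity)
    fun _ _ => le_rfl
  rw [abs_of_pos (by norm_num : (0 : ℝ) < 1 / 4)]
  have h3 : 0 ≤ nbhdConst d 1 * K := by positivity
  linarith

end HamField

end Rotators

namespace Rotators

section SecondHam

variable {d : ℕ} {Λ : Finset (Fin d → ℤ)} {p : ℕ} {S A A₀ B : ℂ × ℂ → ℝ} {K : ℝ}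

/-! ### The second order Hamiltonian -/

/-- The local term at the site `j` of `H₂`. -/
noncomputable def ham2Term (A A₀ B : ℂ × ℂ → ℝ) (j : Λ) (u : Phase Λ) : ℝ :=
  (1 / 2) * (lieTerm A B j u + lieTerm A₀ B j u)

/-- The Hamiltonian `H₂`. -/
noncomputable def ham2 (Λ : Finset (Fin d → ℤ)) (A A₀ B : ℂ × ℂ → ℝ) (u : Phase Λ) : ℝ :=
  ∑ j : Λ, ham2Term A A₀ B j u

lemma contDiff_ham2Term (hP : PairBounds p S A A₀ B K) (j : Λ) :
    ContDiff ℝ 2 (ham2Term A A₀ B j : Phase Λ → ℝ) :=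
  contDiff_const.mul ((contDiff_lieTerm (hP.contDiff.of_le (by norm_num)) hP.contDiff_hom j).add
    (contDiff_lieTerm (hP.contDiff_avg.of_le (by norm_num)) hP.contDiff_hom j))

lemma contDiff_ham2 (hP : PairBounds p S A A₀ B K) : ContDiff ℝ 2 (ham2 Λ A A₀ B) :=
  ContDiff.sum fun j _ => contDiff_ham2Term hP j

lemma dependsOn_ham2Term (hP : PairBounds p S A A₀ B K) (j : Λ) :
    DependsOn (ham2Term A A₀ B j : Phase Λ → ℝ) (siteBall j 1) := fun u w h => by
  unfold ham2Term
  rw [dependsOn_lieTerm (hP.contDiff.of_le (by norm_num)) hP.contDiff_hom j h,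
    dependsOn_lieTerm (hP.contDiff_avg.of_le (by norm_num)) hP.contDiff_hom j h]

lemma norm_fderiv_ham2Term_le (hP : PairBounds p S A A₀ B K) (j : Λ) (u : Phase Λ) :
    ‖fderiv ℝ (ham2Term A A₀ B j) u‖ ≤ lieConst d K * siteWeight (p - 1) j u := by
  have c1 : ContDiff ℝ 2 (lieTerm A B j : Phase Λ → ℝ) :=
    contDiff_lieTerm (hP.contDiff.of_le (by norm_num)) hP.contDiff_hom j
  have c2 : ContDiff ℝ 2 (lieTerm A₀ B j : Phase Λ → ℝ) :=
    contDiff_lieTerm (hP.contDiff_avg.of_le (by norm_num)) hP.contDiff_hom j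
  have h1 := jetLE_lieTerm hP.reg hP.contDiff_hom hP.jet_hom hP.nonneg j u
  have h2 := jetLE_lieTerm hP.reg_avg hP.contDiff_hom hP.jet_hom hP.nonneg j u
  have h3 := ((h1.add h2 c1 c2).const_mul (1 / 2) (c1.add c2)).norm_fderiv_le
    (by norm_num) (by norm_num)
  refine h3.trans (le_of_eq ?_)
  rw [abs_of_pos (by norm_num : (0 : ℝ) < 1 / 2)]
  ring

lemma fderiv_ham2 (hP : PairBounds p S A A₀ B K) (u v : Phase Λ) :
    fderiv ℝ (ham2 Λ A A₀ B) u v = ∑ j : Λ, fderiv ℝ (ham2Term A A₀ B j) u v := by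
  have h1 : HasFDerivAt (ham2 Λ A A₀ B) (∑ j : Λ, fderiv ℝ (ham2Term A A₀ B j) u) u :=
    HasFDerivAt.fun_sum fun j _ =>
      ((contDiff_ham2Term hP j).differentiable (by norm_num) u).hasFDerivAt
  rw [h1.fderiv, sum_apply]

/-- Terms centred farther than one from `j` do not see `u_j`, which leaves a sum of bounded length.
-/
lemma fderiv_ham2_single (hP : PairBounds p S A A₀ B K) (u : Phase Λ) (j : Λ) (z : ℂ) :
    fderiv ℝ (ham2 Λ A A₀ B) u (Pi.single j z) =
      ∑ m : Λ with dist1 m j ≤ 1, fderiv ℝ (ham2Term A A₀ B m) u (Pi.single j z) := by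
  rw [fderiv_ham2 hP]
  refine (Finset.sum_subset (Finset.filter_subset _ _) fun m _ hm => ?_).symm
  refine fderiv_single_eq_zero (dependsOn_ham2Term hP m)
    ((contDiff_ham2Term hP m).differentiable (by norm_num)) u (fun hj => hm ?_) z
  simp only [Finset.mem_filter, Finset.mem_univ, true_and]
  rw [dist1_comm]
  exact hj

lemma grad_ham2 (hP : PairBounds p S A A₀ B K) (u : Phase Λ) (j : Λ) :
    grad (ham2 Λ A A₀ B) u j =
      ∑ m : Λ with dist1 m j ≤ 1, gradL j (fderiv ℝ (ham2Term A A₀ B m) u) := by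
  rw [grad_eq_gradL, gradL_apply, fderiv_ham2_single hP, fderiv_ham2_single hP]
  simp only [gradL_apply, Finset.sum_add_distrib, ← Finset.mul_sum]
  push_cast
  rfl

lemma grad_ham2_congr (hP : PairBounds p S A A₀ B K) {v w : Phase Λ} {j : Λ}
    (h : ∀ n, dist1 n j ≤ 2 → v n = w n) :
    grad (ham2 Λ A A₀ B) v j = grad (ham2 Λ A A₀ B) w j := by
  rw [grad_ham2 hP, grad_ham2 hP]
  refine Finset.sum_congr rfl fun m hm => ?_
  have hm' := (Finset.mem_filter.1 hm).2
  rw [dependsOn_fderiv (dependsOn_ham2Term hP m)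
    ((contDiff_ham2Term hP m).differentiable (by norm_num)) fun n hn => h n ?_]
  have := dist1_triangle n m j
  have hn' : dist1 n m ≤ 1 := hn
  omega

lemma norm_grad_ham2_le (hP : PairBounds p S A A₀ B K) (v : Phase Λ) (j : Λ) :
    ‖grad (ham2 Λ A A₀ B) v j‖ ≤ (nbhdConst d 1 * (2 * lieConst d K)) *
      (∑ n with dist1 n j ≤ 2, ‖v n‖ ^ (p - 1)) + nbhdConst d 1 * (2 * lieConst d K) := by
  rw [grad_ham2 hP]
  have hL := lieConst_nonneg (d := d) hP.nonneg
  have h_sum : 0 ≤ ∑ n with dist1 n j ≤ 2, ‖v n‖ ^ (p - 1) :=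
    Finset.sum_nonneg fun _ _ => by positivity
  have hw : ∀ m : Λ, dist1 m j ≤ 1 →
      siteWeight (p - 1) m v ≤ 1 + ∑ n with dist1 n j ≤ 2, ‖v n‖ ^ (p - 1) := by
    intro m hm
    unfold siteWeight
    refine add_le_add le_rfl (Finset.sum_le_sum_of_subset_of_nonneg ?_ fun _ _ _ => by positivity)
    intro n hn
    have h1 := (Finset.mem_filter.1 hn).2
    have := dist1_triangle n m j
    simp only [Finset.mem_filter, Finset.mem_univ, true_and]
    omega
  refine (norm_sum_le _ _).trans ?_
  have h1 := sum_nbhd_le (ρ := 1) j (a := fun m => ‖gradL j (fderiv ℝ (ham2Term A A₀ B m) v)‖)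
    (K := 2 * lieConst d K * (1 + ∑ n with dist1 n j ≤ 2, ‖v n‖ ^ (p - 1))) (by positivity)
    (fun m hm => by
      refine (gradL_norm_apply_le j _).trans ?_
      have h2 := norm_fderiv_ham2Term_le hP m v
      have h3 := mul_le_mul_of_nonneg_left (hw m hm) hL
      linarith)
  refine h1.trans (le_of_eq ?_)
  ring

lemma ham2Term_rot (hP : PairBounds p S A A₀ B K) {a : ℂ} (ha : ‖a‖ = 1) (j : Λ)
    (u : Phase Λ) : ham2Term A A₀ B j (a • u) = ham2Term A A₀ B j u := by
  unfold ham2Term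
  rw [lieTerm_rot hP.reg hP.contDiff_hom hP.rot_hom ha,
    lieTerm_rot hP.reg_avg hP.contDiff_hom hP.rot_hom ha]

/-! ### Weighted sums -/

/-- Young's inequality again, now over the ball around `m`. It turns the product of a gradient of
order `p - 1` with `|v_k|` into a weight of order `p`. -/
lemma siteWeight_mul_norm_le (hp : 1 ≤ p) (v : Phase Λ) {m k : Λ} (hk : dist1 k m ≤ 1) :
    siteWeight (p - 1) m v * ‖v k‖ ≤ (2 + nbhdConst d 1) * siteWeight p m v := by
  obtain ⟨q, rfl⟩ : ∃ q, p = q + 1 := ⟨p - 1, by omega⟩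
  rw [Nat.add_sub_cancel]
  have key : ∀ r t : ℝ, 0 ≤ r → 0 ≤ t → t ^ q * r ≤ t ^ (q + 1) + r ^ (q + 1) := by
    intro r t hr ht
    rcases le_total r t with h | h
    · have := mul_le_mul_of_nonneg_left h (pow_nonneg ht q)
      have := pow_nonneg hr (q + 1)
      rw [pow_succ t]; linarith
    · have := mul_le_mul_of_nonneg_right (pow_le_pow_left₀ ht h q) hr
      have := pow_nonneg ht (q + 1)
      rw [pow_succ r]; linarith
  have hk1 : ‖v k‖ ^ (q + 1) ≤ siteWeight (q + 1) m v - 1 := by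
    unfold siteWeight
    have := Finset.single_le_sum (f := fun n : Λ => ‖v n‖ ^ (q + 1))
      (s := Finset.univ.filter fun n : Λ => dist1 n m ≤ 1) (fun _ _ => by positivity)
      (by simp [hk] : k ∈ Finset.univ.filter fun n : Λ => dist1 n m ≤ 1)

    linarith
  have hW := one_le_siteWeight (q + 1) m v
  have h1 : ‖v k‖ ≤ siteWeight (q + 1) m v := by
    have := key ‖v k‖ 1 (norm_nonneg _) zero_le_one
    rw [one_pow, one_pow, one_mul] at this
    linarith
  have h2 : (∑ n with dist1 n m ≤ 1, ‖v n‖ ^ q) * ‖v k‖ ≤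
      siteWeight (q + 1) m v + nbhdConst d 1 * siteWeight (q + 1) m v := by
    rw [Finset.sum_mul]
    calc ∑ n with dist1 n m ≤ 1, ‖v n‖ ^ q * ‖v k‖
        ≤ ∑ n with dist1 n m ≤ 1, (‖v n‖ ^ (q + 1) + ‖v k‖ ^ (q + 1)) :=
          Finset.sum_le_sum fun n _ => key _ _ (norm_nonneg _) (norm_nonneg _)
      _ ≤ _ := by
          rw [Finset.sum_add_distrib]
          refine add_le_add ?_ (sum_nbhd_le (ρ := 1) m (a := fun _ => ‖v k‖ ^ (q + 1)) (by linarith)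
            fun _ _ => by linarith)
          unfold siteWeight
          linarith
  unfold siteWeight at h2 ⊢
  rw [add_mul, one_mul]
  unfold siteWeight at h1
  linarith

lemma pow_dist1_le {γ : ℝ} (h1 : 1 / 2 < γ) (h2 : γ < 1) {m k : Λ} (hk : dist1 k m ≤ 1) (j : Λ) :
    γ ^ dist1 m j ≤ 2 * γ ^ dist1 k j := by
  have h0 : 0 < γ := by linarith
  have h3 : dist1 k j ≤ dist1 m j + 1 := by
    have := dist1_triangle k m j
    omega
  have h4 : γ ^ (dist1 m j + 1) ≤ γ ^ dist1 k j := pow_le_pow_of_le_one h0.le h2.le h3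
  rw [pow_succ] at h4
  have h5 : 0 < γ ^ dist1 m j := pow_pos h0 _
  nlinarith

/-- Distances to `j` from nearby sites differ by at most one. The factor two is needed when `m` is
the farther site, where `γ⁻¹ - 1 ≤ 2 (1 - γ)` because `γ > 1 / 2`. -/
lemma abs_pow_dist1_sub_le {γ : ℝ} (h1 : 1 / 2 < γ) (h2 : γ < 1) {m k : Λ} (hk : dist1 k m ≤ 1)
    (j : Λ) : |γ ^ dist1 k j - γ ^ dist1 m j| ≤ 2 * (1 - γ) * γ ^ dist1 m j := by
  have h0 : 0 < γ := by linarith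
  have h3 : dist1 k j ≤ dist1 m j + 1 := by
    have := dist1_triangle k m j
    omega
  have h4 : dist1 m j ≤ dist1 k j + 1 := by
    have := dist1_triangle m k j
    rw [dist1_comm m k] at this
    omega
  have hpos : 0 < γ ^ dist1 m j := pow_pos h0 _
  have hcase : dist1 k j = dist1 m j ∨ dist1 k j = dist1 m j + 1 ∨ dist1 m j = dist1 k j + 1 := by
    omega
  rcases hcase with h | h | h
  · rw [h, sub_self, abs_zero]
    have : 0 < 1 - γ := by linarith
    positivity
  · rw [h, pow_succ, abs_sub_comm, abs_of_nonneg (by nlinarith)]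
    nlinarith
  · rw [h, pow_succ] at *
    have h5 : 0 < γ ^ dist1 k j := pow_pos h0 _
    rw [abs_of_nonneg (by nlinarith)]
    nlinarith [mul_pos h5 (by linarith : (0 : ℝ) < 1 - γ)]

/-- The sums are interchanged: each `v_n` appears in the weights of boundedly many sites `m`, whose
`γ`-weights are at most twice that of `n`. -/
lemma sum_pow_mul_siteWeight_le {γ : ℝ} (h1 : 1 / 2 < γ) (h2 : γ < 1) (q : ℕ) (j : Λ)
    (v : Phase Λ) : ∑ m : Λ, γ ^ dist1 m j * siteWeight q m v ≤
      latticeConst d γ + 2 * nbhdConst d 1 * ∑ n : Λ, γ ^ dist1 n j * ‖v n‖ ^ q := by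
  classical
  have h0 : 0 < γ := by linarith
  unfold siteWeight
  simp_rw [mul_add, mul_one, Finset.sum_add_distrib, Finset.mul_sum, Finset.sum_filter]
  refine add_le_add (sum_pow_dist1_le h0.le h2 j) ?_
  rw [Finset.sum_comm]
  refine Finset.sum_le_sum fun n _ => ?_
  rw [← Finset.sum_filter]
  have h3 := sum_nbhd_le (ρ := 1) n (a := fun m => γ ^ dist1 m j * ‖v n‖ ^ q)
    (K := 2 * γ ^ dist1 n j * ‖v n‖ ^ q) (by positivity) (fun m hm =>
      mul_le_mul_of_nonneg_right (pow_dist1_le h1 h2 (by rwa [dist1_comm]) j) (by positivity))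
  simp_rw [dist1_comm n] at h3 ⊢
  refine h3.trans (le_of_eq ?_)
  ring

/-- The constant in the estimate for `(i∇H₂ · v)_j`. -/
noncomputable def innerConst (d : ℕ) (K : ℝ) : ℝ :=
  nbhdConst d 1 * (2 * (lieConst d K * (2 + nbhdConst d 1)))

lemma innerConst_nonneg (hK : 0 ≤ K) : 0 ≤ innerConst d K := by
  have := lieConst_nonneg (d := d) hK
  have := nbhdConst_nonneg d 1
  unfold innerConst
  positivity

/-- Write `a m k` for the derivative of the term of `H₂` centred at `m` in the angle of site `k`. By
rotation invariance `∑_k a m k = 0`, so `γ^{|k-j|}` may be replaced by its difference with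
`γ^{|m-j|}`. The terms have range one, so this difference is `O(1 - γ) γ^{|m-j|}`. -/
lemma abs_wInner_ham2_le (hp : 1 ≤ p) (hP : PairBounds p S A A₀ B K) (j : Λ) {γ : ℝ}
    (h1 : 1 / 2 < γ) (h2 : γ < 1) (v : Phase Λ) :
    |wInner γ j (fun k => Complex.I * grad (ham2 Λ A A₀ B) v k) v| ≤
      (1 - γ) * (innerConst d K * (2 * nbhdConst d 1)) * wNormPow γ j p v +
        innerConst d K * latticeConst d γ := by
  have h0 : 0 < γ := by linarith
  have hγ : 0 < 1 - γ := by linarith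
  have hL := lieConst_nonneg (d := d) hP.nonneg
  have hN := nbhdConst_nonneg d 1
  have hC := innerConst_nonneg (d := d) hP.nonneg
  let a : Λ → Λ → ℝ := fun m k =>
    fderiv ℝ (ham2Term A A₀ B m) v (Pi.single k (Complex.I * v k))
  have hd : ∀ m : Λ, Differentiable ℝ (ham2Term A A₀ B m : Phase Λ → ℝ) := fun m =>
    (contDiff_ham2Term hP m).differentiable (by norm_num)
  have ha0 : ∀ m k, ¬ dist1 k m ≤ 1 → a m k = 0 := fun m k hk =>
    fderiv_single_eq_zero (dependsOn_ham2Term hP m) (hd m) v hk _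
  have hasum : ∀ m, ∑ k, a m k = 0 := fun m => by
    have h3 := fderiv_rot_eq_zero (hd m) (fun b hb u => ham2Term_rot hP hb m u) v
    rw [map_eq_sum_single] at h3
    exact h3
  have habs : ∀ m k, dist1 k m ≤ 1 →
      |a m k| ≤ lieConst d K * (2 + nbhdConst d 1) * siteWeight p m v := fun m k hk => by
    have h3 := (fderiv ℝ (ham2Term A A₀ B m) v).le_opNorm (Pi.single k (Complex.I * v k))
    rw [norm_single_site, norm_mul, Complex.norm_I, one_mul] at h3
    refine h3.trans ?_
    have h4 := mul_le_mul_of_nonneg_right (norm_fderiv_ham2Term_le hP m v) (norm_nonneg (v k))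
    have h5 := mul_le_mul_of_nonneg_left (siteWeight_mul_norm_le hp v hk) hL
    linarith
  -- The weight at the centre `m` is subtracted at no cost, because it multiplies a vanishing sum.
  have e1 : wInner γ j (fun k => Complex.I * grad (ham2 Λ A A₀ B) v k) v =
      -∑ m, ∑ k, (γ ^ dist1 k j - γ ^ dist1 m j) * a m k := by
    unfold wInner
    simp_rw [grad_eq_gradL, re_I_mul_grad, fderiv_ham2 hP, sub_mul, Finset.sum_sub_distrib,
      ← Finset.mul_sum, hasum, mul_zero, Finset.sum_const_zero, sub_zero]
    rw [Finset.sum_comm, ← Finset.sum_neg_distrib]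
    refine Finset.sum_congr rfl fun k _ => ?_
    rw [← Finset.mul_sum]
    ring
  have e2 : ∀ m, |∑ k, (γ ^ dist1 k j - γ ^ dist1 m j) * a m k| ≤
      (1 - γ) * innerConst d K * (γ ^ dist1 m j * siteWeight p m v) := fun m => by
    have h3 : ∑ k, (γ ^ dist1 k j - γ ^ dist1 m j) * a m k =
        ∑ k with dist1 k m ≤ 1, (γ ^ dist1 k j - γ ^ dist1 m j) * a m k := by
      refine (Finset.sum_subset (Finset.filter_subset _ _) fun k _ hk => ?_).symm
      rw [ha0 m k (by simpa using hk), mul_zero]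
    rw [h3]
    refine (Finset.abs_sum_le_sum_abs _ _).trans ?_
    have hw := siteWeight_pos p m v
    have h4 := sum_nbhd_le (ρ := 1) m
      (a := fun k => |(γ ^ dist1 k j - γ ^ dist1 m j) * a m k|)
      (K := 2 * (1 - γ) * γ ^ dist1 m j *
        (lieConst d K * (2 + nbhdConst d 1) * siteWeight p m v)) (by positivity)
      (fun k hk => by
        rw [abs_mul]
        exact mul_le_mul (abs_pow_dist1_sub_le h1 h2 hk j) (habs m k hk) (abs_nonneg _)
          (by positivity))
    refine h4.trans (le_of_eq ?_)
    unfold innerConst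
    ring
  rw [e1, abs_neg]
  have h5 : wNormPow γ j p v = ∑ n : Λ, γ ^ dist1 n j * ‖v n‖ ^ p := by
    unfold wNormPow
    simp_rw [Real.rpow_natCast]
  calc |∑ m, ∑ k, (γ ^ dist1 k j - γ ^ dist1 m j) * a m k|
      ≤ ∑ m, (1 - γ) * innerConst d K * (γ ^ dist1 m j * siteWeight p m v) :=
        (Finset.abs_sum_le_sum_abs _ _).trans (Finset.sum_le_sum fun m _ => e2 m)
    _ ≤ (1 - γ) * innerConst d K *
          (latticeConst d γ + 2 * nbhdConst d 1 * wNormPow γ j p v) := by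
        rw [← Finset.mul_sum, h5]
        exact mul_le_mul_of_nonneg_left (sum_pow_mul_siteWeight_le h1 h2 p j v) (by positivity)
    _ ≤ _ := by
        -- In the constant term the factor `1 - γ` is not needed and is dropped.
        have h6 : (1 - γ) * (innerConst d K * latticeConst d γ) ≤
            1 * (innerConst d K * latticeConst d γ) :=
          mul_le_mul_of_nonneg_right (by linarith)
            (mul_nonneg hC (latticeConst_nonneg h0.le h2))
        linarith

end SecondHam

end Rotators

namespace Rotators

universe u

/-! ### Smoothness of superposition operators on spaces of continuous functions -/

section Superposition

variable {X E F : Type*} [TopologicalSpace X] [CompactSpace X] [NormedAddCommGroup E]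
  [NormedSpace ℝ E] [NormedAddCommGroup F] [NormedSpace ℝ F]

/-- The pointwise application of a continuous family of operators to a continuous function. -/
noncomputable def pointwiseApply : C(X, E →L[ℝ] F) →L[ℝ] C(X, E) →L[ℝ] C(X, F) :=
  LinearMap.mkContinuous₂
    (LinearMap.mk₂ ℝ
      (fun (A : C(X, E →L[ℝ] F)) (h : C(X, E)) => (⟨fun x => A x (h x), (map_continuous A).clm_apply (map_continuous h)⟩ : C(X, F)))
      (fun _ _ _ => by ext; simp) (fun _ _ _ => by ext; simp)
      (fun _ _ _ => by ext; simp) (fun _ _ _ => by ext; simp))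
    1 fun A h => by
      rw [one_mul]
      refine (ContinuousMap.norm_le _ (by positivity)).2 fun x => ?_
      exact (A x).le_of_opNorm_le_of_le (A.norm_coe_le_norm x) (h.norm_coe_le_norm x)

@[simp] theorem pointwiseApply_apply (A : C(X, E →L[ℝ] F)) (h : C(X, E)) (x : X) :
    pointwiseApply A h x = A x (h x) := rfl

/-- Postcomposition with the continuous derivative `V'` is continuous in the sup metric, so `V'` is
uniformly close to its value along the whole segment between two nearby curves. The mean value
inequality at each `x` is then uniform in `x`. -/
theorem hasFDerivAt_superposition (V : C(E, F)) (V' : C(E, E →L[ℝ] F))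
    (hV : ∀ e, HasFDerivAt V (V' e) e) (w : C(X, E)) :
    HasFDerivAt (fun w : C(X, E) => V.comp w) (pointwiseApply (V'.comp w)) w := by
  rw [hasFDerivAt_iff_isLittleO, Asymptotics.isLittleO_iff]
  intro c hc
  have hcont : Continuous fun w : C(X, E) => V'.comp w := ContinuousMap.continuous_postcomp V'
  obtain ⟨δ, hδ, hball⟩ := (Metric.continuous_iff (α := C(X, E)) (β := C(X, E →L[ℝ] F))).1 hcont w c hc
  filter_upwards [Metric.ball_mem_nhds w hδ] with w' hw'
  refine (ContinuousMap.norm_le _ (by positivity)).2 fun x => ?_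
  have key : ∀ z ∈ segment ℝ (w x) (w' x), ‖V' z - V' (w x)‖ ≤ c := by
    intro z hz
    rw [segment_eq_image'] at hz
    obtain ⟨t, ht, rfl⟩ := hz
    have h1 : dist (w + t • (w' - w)) w < δ := by
      rw [dist_eq_norm, add_sub_cancel_left, norm_smul, Real.norm_of_nonneg ht.1]
      rw [Metric.mem_ball, dist_eq_norm] at hw'
      exact (mul_le_of_le_one_left (norm_nonneg _) ht.2).trans_lt hw'
    have h2 := (hball _ h1).le
    have h4 := (ContinuousMap.dist_apply_le_dist x).trans h2
    rw [dist_eq_norm] at h4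
    exact h4
  have h3 := (convex_segment (w x) (w' x)).norm_image_sub_le_of_norm_hasFDerivWithin_le'
    (fun z _ => (hV z).hasFDerivWithinAt) key (left_mem_segment ℝ _ _) (right_mem_segment ℝ _ _)
  refine (le_of_eq ?_).trans (h3.trans ?_)
  · simp
  · exact mul_le_mul_of_nonneg_left ((w' - w).norm_coe_le_norm x) hc.le

/-- The derivative is the superposition operator of `V'` followed by a bounded linear map, so one
order of smoothness is gained at each step of the induction over the target space. -/
theorem contDiff_superposition {X : Type*} {E : Type u} [TopologicalSpace X] [CompactSpace X]
    [NormedAddCommGroup E] [NormedSpace ℝ E] {n : ℕ} :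
    ∀ {F : Type u} [NormedAddCommGroup F] [NormedSpace ℝ F]
    (V : C(E, F)), ContDiff ℝ n V → ContDiff ℝ n fun w : C(X, E) => V.comp w := by
  induction n with
  | zero =>
    intro F _ _ V hV
    exact contDiff_zero.2 (ContinuousMap.continuous_postcomp V)
  | succ n ih =>
    intro F _ _ V hV
    have hV' := hV
    rw [Nat.cast_succ, contDiff_succ_iff_hasFDerivAt] at hV' ⊢
    obtain ⟨V', hV'1, hV'2⟩ := hV'
    have h1 := ih (⟨V', hV'1.continuous⟩ : C(E, E →L[ℝ] F)) hV'1
    have h2 : ContDiff ℝ n fun w : C(X, E) =>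
        pointwiseApply ((⟨V', hV'1.continuous⟩ : C(E, E →L[ℝ] F)).comp w) :=
      h1.continuousLinearMap_comp (pointwiseApply (X := X) (E := E) (F := F))
    exact ⟨fun w => pointwiseApply ((⟨V', hV'1.continuous⟩ : C(E, E →L[ℝ] F)).comp w), h2,
      hasFDerivAt_superposition V ⟨V', hV'1.continuous⟩ hV'2⟩

end Superposition

/-! ### Global flows: existence, smoothness in the initial condition, variational equation -/

section Flow

variable {E : Type*} [NormedAddCommGroup E] [NormedSpace ℝ E]

/-- `X` is the global flow of the vector field `W`. -/
structure IsFlow (W : E → E) (X : ℝ → E → E) : Prop where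
  zero : ∀ v, X 0 v = v
  hasDerivAt : ∀ v s, HasDerivAt (fun τ => X τ v) (W (X s v)) s

namespace IsFlow

variable {W : E → E} {X : ℝ → E → E} {K : ℝ≥0}

theorem unique (hX : IsFlow W X) (hW : LipschitzWith K W) {y : ℝ → E}
    (hy : ∀ s, HasDerivAt y (W (y s)) s) (s : ℝ) : y s = X s (y 0) :=
  congrFun (ODE_solution_unique_univ (t₀ := 0) (fun _ => hW.lipschitzOnWith) 
    (fun t => ⟨hy t, Set.mem_univ _⟩) (fun t => ⟨hX.hasDerivAt (y 0) t, Set.mem_univ _⟩)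
    (hX.zero _).symm) s

theorem add (hX : IsFlow W X) (hW : LipschitzWith K W) (s t : ℝ) (v : E) :
    X (s + t) v = X s (X t v) := by
  have := hX.unique hW (y := fun τ => X (τ + t) v)
    (fun τ => by simpa using (hX.hasDerivAt v (τ + t)).comp_add_const τ t) s
  simpa using this

theorem continuous_time (hX : IsFlow W X) (v : E) : Continuous fun s => X s v :=
  continuous_iff_continuousAt.2 fun s => (hX.hasDerivAt v s).continuousAt

theorem fderiv_zero (hX : IsFlow W X) (v : E) : fderiv ℝ (X 0) v = ContinuousLinearMap.id ℝ E := by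
  have : X 0 = id := funext hX.zero
  rw [this, fderiv_id]

theorem neg_cancel (hX : IsFlow W X) (hW : LipschitzWith K W) (s : ℝ) (v : E) :
    X (-s) (X s v) = v := by
  rw [← hX.add hW, neg_add_cancel, hX.zero]

/-- The bijection given by a flow at a fixed time. -/
def equiv (hX : IsFlow W X) (hW : LipschitzWith K W) (s : ℝ) : E ≃ E where
  toFun := X s
  invFun := X (-s)
  left_inv := hX.neg_cancel hW s
  right_inv v := by simpa using hX.neg_cancel hW (-s) v

end IsFlow

/-- The field is globally bounded and Lipschitz, so Picard–Lindelöf applies on intervals of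
arbitrary length; the solutions on growing intervals are glued by uniqueness. -/
theorem exists_isFlow [CompleteSpace E] {W : E → E} {K L : ℝ≥0} (hW : LipschitzWith K W)
    (hL : ∀ v, ‖W v‖ ≤ L) : ∃ X, IsFlow W X := by
  have h1 : ∀ (n : ℕ) (v : E), ∃ α : ℝ → E, α 0 = v ∧
      ∀ t ∈ Set.Ioo (-(n + 1 : ℝ)) (n + 1), HasDerivAt α (W (α t)) t := by
    intro n v
    have h0 : (0 : ℝ) ∈ Set.Icc (-(n + 1 : ℝ)) (n + 1) := by constructor <;> linarith [n.cast_nonneg (α := ℝ)]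
    have hPL : IsPicardLindelof (fun _ => W) (⟨0, h0⟩ : Set.Icc (-(n + 1 : ℝ)) (n + 1)) v
        (L * (n + 1)) 0 L K :=
      { lipschitzOnWith := fun _ _ => hW.lipschitzOnWith
        continuousOn := fun _ _ => continuousOn_const
        norm_le := fun _ _ x _ => hL x
        mul_max_le := by simp }
    obtain ⟨α, hα0, hα⟩ := hPL.exists_eq_forall_mem_Icc_hasDerivWithinAt₀
    exact ⟨α, hα0, fun t ht => (hα t (Set.Ioo_subset_Icc_self ht)).hasDerivAt
      (Icc_mem_nhds ht.1 ht.2)⟩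
  choose α hα0 hα using h1
  have hcomp : ∀ (n m : ℕ) (v : E) (t : ℝ), n ≤ m → t ∈ Set.Ioo (-(n + 1 : ℝ)) (n + 1) →
      α n v t = α m v t := by
    intro n m v t hnm ht
    have hnm' : (n : ℝ) ≤ m := by exact_mod_cast hnm
    exact ODE_solution_unique_of_mem_Ioo (v := fun _ => W) (s := fun _ => Set.univ) (K := K)
      (fun _ _ => hW.lipschitzOnWith) 
      (t₀ := 0) ⟨by linarith [n.cast_nonneg (α := ℝ)], by linarith [n.cast_nonneg (α := ℝ)]⟩
      (fun s hs => ⟨hα n v s hs, Set.mem_univ _⟩)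
      (fun s hs => ⟨hα m v s ⟨by linarith [hs.1], by linarith [hs.2]⟩, Set.mem_univ _⟩)
      ((hα0 n v).trans (hα0 m v).symm) ht
  -- The index is tied to time; the interval of index `n` has half-length `n + 1`, so `t` is always
  -- interior.
  refine ⟨fun t v => α ⌈|t|⌉₊ v t, fun v => hα0 _ v, fun v s => ?_⟩
  have hmem : ∀ t : ℝ, t ∈ Set.Ioo (-((⌈|t|⌉₊ : ℕ) + 1 : ℝ)) ((⌈|t|⌉₊ : ℕ) + 1) := fun t => by
    have := abs_le.1 (Nat.le_ceil |t|)
    constructor <;> linarith [this.1, this.2]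
  -- One unit more than at `s` itself, so that a single solution covers all indices occurring in a
  -- neighbourhood of `s`.
  set m := ⌈|s|⌉₊ + 1 with hm
  have hs : s ∈ Set.Ioo (-(m : ℝ)) m := by
    rw [hm]; push_cast; exact hmem s
  have hev : (fun τ => α ⌈|τ|⌉₊ v τ) =ᶠ[𝓝 s] α m v := by
    filter_upwards [Ioo_mem_nhds hs.1 hs.2] with t ht
    refine hcomp _ _ v t (Nat.ceil_le.2 (abs_lt.2 ht).le) (hmem t)
  have h2 := (hα m v s ⟨by linarith [hs.1], by linarith [hs.2]⟩).congr_of_eventuallyEq hev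
  rwa [← hev.eq_of_nhds] at h2

/-- The integral from `0` of continuous functions on `[-2, 2]`. -/
noncomputable def timeIntegral (E : Type*) [NormedAddCommGroup E] [NormedSpace ℝ E] :
    C(Set.Icc (-2 : ℝ) 2, E) →L[ℝ] C(Set.Icc (-2 : ℝ) 2, E) :=
  LinearMap.mkContinuous
    { toFun := fun h => ⟨fun t => ∫ s in (0 : ℝ)..t, h (Set.projIcc (-2) 2 (by norm_num) s), by
        have hc : Continuous fun s : ℝ => h (Set.projIcc (-2) 2 (by norm_num) s) :=
          h.continuous.comp continuous_projIcc
        exact (intervalIntegral.continuous_primitive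
          (fun a b => hc.intervalIntegrable a b) 0).comp continuous_subtype_val⟩
      map_add' := fun h k => by
        ext t
        exact intervalIntegral.integral_add
          ((h.continuous.comp continuous_projIcc).intervalIntegrable _ _)
          ((k.continuous.comp continuous_projIcc).intervalIntegrable _ _)
      map_smul' := fun c h => by
        ext t
        exact intervalIntegral.integral_smul _ _ } 2 fun h => by
    refine (ContinuousMap.norm_le _ (by positivity)).2 fun t => ?_
    refine (intervalIntegral.norm_integral_le_of_norm_le_const (C := ‖h‖)
      fun s _ => h.norm_coe_le_norm _).trans ?_
    rw [sub_zero, mul_comm]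
    exact mul_le_mul_of_nonneg_right (abs_le.2 t.2) (norm_nonneg _)

theorem norm_timeIntegral_le (h : C(Set.Icc (-2 : ℝ) 2, E)) : ‖timeIntegral E h‖ ≤ 2 * ‖h‖ :=
  (timeIntegral E).le_of_opNorm_le (LinearMap.mkContinuous_norm_le _ (by norm_num) _) h

/-- The constant functions on `[-2, 2]`. -/
noncomputable def constCurve (E : Type*) [NormedAddCommGroup E] [NormedSpace ℝ E] :
    E →L[ℝ] C(Set.Icc (-2 : ℝ) 2, E) :=
  LinearMap.mkContinuous
    { toFun := fun v => ContinuousMap.const _ v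
      map_add' := fun _ _ => rfl
      map_smul' := fun _ _ => rfl } 1 fun v => by
    rw [one_mul]
    exact (ContinuousMap.norm_le _ (norm_nonneg _)).2 fun _ => le_rfl

/-- The evaluation of functions on `[-2, 2]`. -/
noncomputable def evalCurve (τ : Set.Icc (-2 : ℝ) 2) : C(Set.Icc (-2 : ℝ) 2, E) →L[ℝ] E :=
  LinearMap.mkContinuous
    { toFun := fun w => w τ
      map_add' := fun _ _ => rfl
      map_smul' := fun _ _ => rfl } 1 fun w => by
    rw [one_mul]
    exact w.norm_coe_le_norm τ

/-- On curves over `[-2, 2]` the integral has norm at most two, so for `K ≤ 1 / 4` the map `w ↦ w -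
∫ W(w)` differs from the identity by a `1/2`-contraction. It is a homeomorphism with invertible
derivative, hence its inverse is as smooth as `W`. Solutions with initial value `v` are the
preimages of constant curves. -/
theorem exists_contDiff_picard {E : Type u} [NormedAddCommGroup E] [NormedSpace ℝ E]
    [CompleteSpace E] {W : E → E} {K : ℝ≥0} (hK : K ≤ 1 / 4) (hW : LipschitzWith K W) {n : ℕ}
    (hn : n ≠ 0) (hC : ContDiff ℝ n W) :
    ∃ Ψ : C(Set.Icc (-2 : ℝ) 2, E) ≃ₜ C(Set.Icc (-2 : ℝ) 2, E), ContDiff ℝ n Ψ.symm ∧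
      ∀ w, Ψ w = w - timeIntegral E ((⟨W, hW.continuous⟩ : C(E, E)).comp w) := by
  set W₀ : C(E, E) := ⟨W, hW.continuous⟩
  set Ψ : C(Set.Icc (-2 : ℝ) 2, E) → C(Set.Icc (-2 : ℝ) 2, E) :=
    fun w => w - timeIntegral E (W₀.comp w) with hΨ
  have hK' : (K : ℝ) ≤ 1 / 4 := by exact_mod_cast hK
  have happ : ApproximatesLinearOn Ψ
      ((ContinuousLinearEquiv.refl ℝ C(Set.Icc (-2 : ℝ) 2, E) : _ ≃L[ℝ] _) :
        C(Set.Icc (-2 : ℝ) 2, E) →L[ℝ] C(Set.Icc (-2 : ℝ) 2, E)) Set.univ (1 / 2) := by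
    intro w _ w' _
    have h1 : Ψ w - Ψ w' - (w - w') = - timeIntegral E (W₀.comp w - W₀.comp w') := by
      simp only [map_sub, hΨ]; abel
    have h2 : ‖W₀.comp w - W₀.comp w'‖ ≤ 1 / 4 * ‖w - w'‖ := by
      refine (ContinuousMap.norm_le _ (by positivity)).2 fun x => ?_
      refine (hW.norm_sub_le _ _).trans ?_
      exact mul_le_mul hK' ((w - w').norm_coe_le_norm x) (norm_nonneg _) (by norm_num)
    have h3 : ‖Ψ w - Ψ w' - (w - w')‖ ≤ 1 / 2 * ‖w - w'‖ := by
      rw [h1, norm_neg]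
      refine (norm_timeIntegral_le _).trans ?_
      linarith
    simpa using h3
  have hsub : Subsingleton C(Set.Icc (-2 : ℝ) 2, E) ∨ (1 / 2 : ℝ≥0) <
      ‖((ContinuousLinearEquiv.refl ℝ C(Set.Icc (-2 : ℝ) 2, E)).symm :
        C(Set.Icc (-2 : ℝ) 2, E) →L[ℝ] C(Set.Icc (-2 : ℝ) 2, E))‖₊⁻¹ := by
    rcases subsingleton_or_nontrivial C(Set.Icc (-2 : ℝ) 2, E) with h | h
    · exact Or.inl h
    · right
      have : ‖((ContinuousLinearEquiv.refl ℝ C(Set.Icc (-2 : ℝ) 2, E)).symm :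
        C(Set.Icc (-2 : ℝ) 2, E) →L[ℝ] C(Set.Icc (-2 : ℝ) 2, E))‖₊ = 1 :=
        NNReal.eq ContinuousLinearMap.norm_id
      rw [this, inv_one]
      exact NNReal.half_lt_self one_ne_zero
  have hC' := hC
  obtain ⟨m, rfl⟩ := Nat.exists_eq_succ_of_ne_zero hn
  rw [Nat.succ_eq_add_one, Nat.cast_succ, contDiff_succ_iff_hasFDerivAt] at hC'
  obtain ⟨W', hW'1, hW'2⟩ := hC'
  set W₀' : C(E, E →L[ℝ] E) := ⟨W', hW'1.continuous⟩
  have hder : ∀ w, HasFDerivAt Ψ (1 - (timeIntegral E).comp (pointwiseApply (W₀'.comp w))) w :=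
    fun w => (hasFDerivAt_id w).sub
      ((timeIntegral E).hasFDerivAt.comp w (hasFDerivAt_superposition W₀ W₀' hW'2 w))
  -- The derivative is the identity minus an operator of norm at most `1/2`, invertible by the
  -- Neumann series.
  have hsmall : ∀ w : C(Set.Icc (-2 : ℝ) 2, E),
      ‖(timeIntegral E).comp (pointwiseApply (W₀'.comp w))‖ < 1 := by
    intro w
    refine lt_of_le_of_lt (ContinuousLinearMap.opNorm_le_bound _ (M := 1 / 2) (by norm_num)
      fun h => ?_) (by norm_num)
    have h0 : ‖((timeIntegral E).comp (pointwiseApply (W₀'.comp w))) h‖ ≤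
      2 * ‖pointwiseApply (W₀'.comp w) h‖ := norm_timeIntegral_le _
    have : ‖pointwiseApply (W₀'.comp w) h‖ ≤ 1 / 4 * ‖h‖ := by
      refine (ContinuousMap.norm_le _ (by positivity)).2 fun x => ?_
      refine ContinuousLinearMap.le_of_opNorm_le_of_le _ ?_ (h.norm_coe_le_norm x)
      exact ((hW'2 (w x)).le_of_lipschitz hW).trans hK'
    linarith
  refine ⟨happ.toHomeomorph Ψ hsub, ?_, fun w => rfl⟩
  refine Homeomorph.contDiff_symm (f₀' := fun w =>
    ContinuousLinearEquiv.unitsEquiv ℝ _ (Units.oneSub _ (hsmall w))) _ (fun w => ?_) ?_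
  · exact hder w
  · exact contDiff_id.sub ((timeIntegral E).contDiff.comp (contDiff_superposition W₀ hC))

/-- The trajectory solves the integral equation, so as a curve it is the smooth inverse of the
Picard map evaluated at a constant curve. The whole trajectory, and not only its value at one time,
is smooth in `v`. -/
theorem IsFlow.contDiff {E : Type u} [NormedAddCommGroup E] [NormedSpace ℝ E]
    [CompleteSpace E] {W : E → E} {X : ℝ → E → E} {K : ℝ≥0} (hX : IsFlow W X) (hK : K ≤ 1 / 4)
    (hW : LipschitzWith K W) {n : ℕ} (hn : n ≠ 0) (hC : ContDiff ℝ n W) :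
    ∃ Y : E → C(Set.Icc (-2 : ℝ) 2, E), ContDiff ℝ n Y ∧
      ∀ v (s : Set.Icc (-2 : ℝ) 2), X s v = Y v s := by
  obtain ⟨Ψ, h1, h2⟩ := exists_contDiff_picard hK hW hn hC
  refine ⟨fun v => Ψ.symm (constCurve E v), ?_, fun v s => ?_⟩
  · refine h1.comp ?_
    exact (constCurve E).contDiff
  · set y : C(Set.Icc (-2 : ℝ) 2, E) := ⟨fun s => X s v,
      (hX.continuous_time v).comp continuous_subtype_val⟩
    have : Ψ y = constCurve E v := by
      rw [h2]
      ext s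
      have hint : (∫ τ in (0 : ℝ)..s, W (X τ v)) = X s v - X 0 v :=
        intervalIntegral.integral_eq_sub_of_hasDerivAt (fun τ _ => hX.hasDerivAt v τ)
          ((hW.continuous.comp (hX.continuous_time v)).intervalIntegrable _ _)
      have hint2 : (∫ τ in (0 : ℝ)..s, W (X (Set.projIcc (-2 : ℝ) 2 (by norm_num) τ) v)) =
          ∫ τ in (0 : ℝ)..s, W (X τ v) := by
        refine intervalIntegral.integral_congr fun τ hτ => ?_
        have hτ' : τ ∈ Set.Icc (-2 : ℝ) 2 :=
          Set.uIcc_subset_Icc (by norm_num) s.2 hτ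
        simp only [Set.projIcc_of_mem _ hτ']
      have : timeIntegral E ((⟨W, hW.continuous⟩ : C(E, E)).comp y) s = X s v - X 0 v := by
        rw [← hint, ← hint2]; rfl
      simp only [ContinuousMap.sub_apply, this, hX.zero]
      change X s v - (X s v - v) = v
      abel
    change X s v = Ψ.symm (constCurve E v) s
    rw [← this, Homeomorph.symm_apply_apply]
    rfl

namespace IsFlow

variable {E : Type u} [NormedAddCommGroup E] [NormedSpace ℝ E] [CompleteSpace E] {W : E → E}
  {X : ℝ → E → E} {K : ℝ≥0}

theorem contDiff_map (hX : IsFlow W X) (hK : K ≤ 1 / 4) (hW : LipschitzWith K W) {n : ℕ}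
    (hn : n ≠ 0) (hC : ContDiff ℝ n W) {s : ℝ} (hs : s ∈ Set.Icc (-2 : ℝ) 2) :
    ContDiff ℝ n (X s) := by
  obtain ⟨Y, hY, hXY⟩ := hX.contDiff hK hW hn hC
  have : X s = fun v => evalCurve ⟨s, hs⟩ (Y v) :=
    funext fun v => hXY v ⟨s, hs⟩
  rw [this]
  exact hY.continuousLinearMap_comp _

/-- Differentiating the integral equation in `v` gives a linear integral equation for the variation,
and the fundamental theorem of calculus gives its time derivative. The interval `[-2, 2]` is larger
than `[0, 1]` so that two-sided derivatives exist at the end points used later. -/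
theorem hasDerivAt_fderiv (hX : IsFlow W X) (hK : K ≤ 1 / 4) (hW : LipschitzWith K W)
    (hC : ContDiff ℝ 1 W) (v a : E) {s : ℝ} (hs : s ∈ Set.Ioo (-2 : ℝ) 2) :
    HasDerivAt (fun τ => fderiv ℝ (X τ) v a) (fderiv ℝ W (X s v) (fderiv ℝ (X s) v a)) s := by
  obtain ⟨Y, hY, hXY⟩ := hX.contDiff (n := 1) hK hW one_ne_zero (by exact_mod_cast hC)
  have hYd : DifferentiableAt ℝ Y v := (hY.differentiable (by simp)) v
  set Z : C(Set.Icc (-2 : ℝ) 2, E) := fderiv ℝ Y v a with hZ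
  have hXd : ∀ τ : Set.Icc (-2 : ℝ) 2, fderiv ℝ (X τ) v a = Z τ := by
    intro τ
    have : X τ = fun v => evalCurve τ (Y v) := funext fun v => hXY v τ
    have h1 : HasFDerivAt (fun v => evalCurve τ (Y v))
      ((evalCurve τ).comp (fderiv ℝ Y v)) v :=
      (evalCurve (E := E) τ).hasFDerivAt.comp v hYd.hasFDerivAt
    rw [this, h1.fderiv]
    rfl
  set W₀ : C(E, E) := ⟨W, hW.continuous⟩
  set W₀' : C(E, E →L[ℝ] E) := ⟨fderiv ℝ W, hC.continuous_fderiv (by simp)⟩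
  have hYeq : Y = fun v => constCurve E v + timeIntegral E (W₀.comp (Y v)) := by
    funext v
    ext τ
    have hint : (∫ r in (0 : ℝ)..τ, W (X r v)) = X τ v - X 0 v :=
      intervalIntegral.integral_eq_sub_of_hasDerivAt (fun r _ => hX.hasDerivAt v r)
        ((hW.continuous.comp (hX.continuous_time v)).intervalIntegrable _ _)
    have hint2 : (∫ r in (0 : ℝ)..τ, W (Y v (Set.projIcc (-2 : ℝ) 2 (by norm_num) r))) =
        ∫ r in (0 : ℝ)..τ, W (X r v) := by
      refine intervalIntegral.integral_congr fun r hr => ?_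
      have hr' : r ∈ Set.Icc (-2 : ℝ) 2 := Set.uIcc_subset_Icc (by norm_num) τ.2 hr
      simp only [Set.projIcc_of_mem _ hr', ← hXY]
    have : timeIntegral E (W₀.comp (Y v)) τ = X τ v - X 0 v := by
      rw [← hint, ← hint2]; rfl
    rw [ContinuousMap.add_apply, this, hX.zero, ← hXY]
    change X τ v = v + (X τ v - v)
    abel
  have hZeq : Z = constCurve E a + timeIntegral E (pointwiseApply (W₀'.comp (Y v)) Z) := by
    have h1 : HasFDerivAt Y (constCurve E + (timeIntegral E).comp
        ((pointwiseApply (W₀'.comp (Y v))).comp (fderiv ℝ Y v))) v := by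
      have h2 := (hasFDerivAt_superposition W₀ W₀'
        (fun e => ((hC.differentiable (by simp)) e).hasFDerivAt) (Y v)).comp v hYd.hasFDerivAt
      have h3 := (constCurve E).hasFDerivAt.add ((timeIntegral E).hasFDerivAt.comp v h2)
      exact h3.congr_of_eventuallyEq (Eventually.of_forall fun v => congrFun hYeq v)
    conv_lhs => rw [hZ, h1.fderiv]
    rfl
  set c : ℝ → E := fun r => pointwiseApply (W₀'.comp (Y v)) Z
    (Set.projIcc (-2 : ℝ) 2 (by norm_num) r) with hc
  have hcc : Continuous c := (map_continuous _).comp continuous_projIcc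
  have hder : HasDerivAt (fun τ => a + ∫ r in (0 : ℝ)..τ, c r) (c s) s :=
    (intervalIntegral.integral_hasDerivAt_right (hcc.intervalIntegrable _ _)
      hcc.aestronglyMeasurable.stronglyMeasurableAtFilter hcc.continuousAt).const_add a
  have hsI := Set.Ioo_subset_Icc_self hs
  have hcs : c s = fderiv ℝ W (X s v) (fderiv ℝ (X s) v a) := by
    rw [hc]
    simp only [Set.projIcc_of_mem _ hsI, pointwiseApply_apply]
    rw [hXY v ⟨s, hsI⟩, hXd ⟨s, hsI⟩]
    rfl
  rw [← hcs]
  refine hder.congr_of_eventuallyEq ?_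
  filter_upwards [Ioo_mem_nhds hs.1 hs.2] with τ hτ
  rw [hXd ⟨τ, Set.Ioo_subset_Icc_self hτ⟩, hZeq]
  rfl

end IsFlow

end Flow

end Rotators

namespace Rotators

lemma hasDerivAt_fderiv_line {E F : Type*} [NormedAddCommGroup E] [NormedSpace ℝ E]
    [NormedAddCommGroup F] [NormedSpace ℝ F] {f : E → F} (hd : Differentiable ℝ (fderiv ℝ f))
    (v a : E) :
    HasDerivAt (fun t : ℝ => fderiv ℝ f (v + t • a) a) (fderiv ℝ (fderiv ℝ f) v a a) 0 := by
  have hline : HasDerivAt (fun t : ℝ => v + t • a) a 0 := by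
    simpa using ((hasDerivAt_id (0 : ℝ)).smul_const a).const_add v
  have h2 : HasFDerivAt (fderiv ℝ f) (fderiv ℝ (fderiv ℝ f) v) (v + (0 : ℝ) • a) := by
    simpa using (hd v).hasFDerivAt
  have h3 : HasDerivAt (fun t : ℝ => fderiv ℝ f (v + t • a)) (fderiv ℝ (fderiv ℝ f) v a) 0 :=
    h2.comp_hasDerivAt (0 : ℝ) hline
  exact (ContinuousLinearMap.apply ℝ F a).hasFDerivAt.comp_hasDerivAt (0 : ℝ) h3

/-! ### Flows of local vector fields: exponential decay of the influence between sites -/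

section LocalFlow

variable {d : ℕ} {Λ : Finset (Fin d → ℤ)}

/-- The decay factor of the influence of a perturbation with the distance. -/
noncomputable def decay (j l : Λ) : ℝ := (1 / 4) ^ dist1 j l

lemma decay_pos (j l : Λ) : 0 < decay j l := by unfold decay; positivity

lemma decay_nonneg (j l : Λ) : 0 ≤ decay j l := (decay_pos j l).le

lemma decay_le_one (j l : Λ) : decay j l ≤ 1 := pow_le_one₀ (by norm_num) (by norm_num)

lemma decay_self (j : Λ) : decay j j = 1 := by simp [decay]

lemma decay_comm (j l : Λ) : decay j l = decay l j := by rw [decay, dist1_comm, decay]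

/-- Passing to a site at distance `ρ` costs a factor `4 ^ ρ`. For neighbours this is `4`, matched by
the smallness condition `κ ≤ 1 / 4`. -/
lemma decay_le_of_dist1_le {j k l : Λ} {ρ : ℕ} (h : dist1 k j ≤ ρ) :
    decay k l ≤ 4 ^ ρ * decay j l := by
  have h1 : dist1 j l ≤ ρ + dist1 k l :=
    (dist1_triangle j k l).trans (by rw [dist1_comm j k]; omega)
  have h2 : (1 / 4 : ℝ) ^ (ρ + dist1 k l) ≤ (1 / 4) ^ dist1 j l :=
    pow_le_pow_of_le_one (by norm_num) (by norm_num) h1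
  calc decay k l = 4 ^ ρ * (1 / 4 : ℝ) ^ (ρ + dist1 k l) := by
        rw [pow_add, ← mul_assoc, ← mul_pow]; norm_num [decay]
    _ ≤ _ := mul_le_mul_of_nonneg_left h2 (by positivity)

lemma sum_decay_le (j : Λ) : ∑ k, decay k j ≤ latticeConst d (1 / 4) :=
  sum_pow_dist1_le (by norm_num) (by norm_num) j

lemma sum_decay_le' (j : Λ) : ∑ k, decay j k ≤ latticeConst d (1 / 4) :=
  sum_pow_dist1_le' (by norm_num) (by norm_num) j

/-- Dividing each component by its decay factor reduces the claim to Grönwall in the sup norm: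
neighbours of `j` have decay factors at most four times that of `j`, so the rescaled system has rate
`4κ ≤ 1` independently of the number of sites. -/
theorem weighted_gronwall {κ ρ D : ℝ} (hκ0 : 0 ≤ κ) (hκ : κ ≤ 1 / 4) (hρ : 0 ≤ ρ) (hD : 0 ≤ D)
    (l : Λ) {δ δ' : ℝ → Phase Λ} (hδ : ∀ s ∈ Set.Icc (0 : ℝ) 1, HasDerivAt δ (δ' s) s)
    (h0 : ∀ j, ‖δ 0 j‖ ≤ D * decay j l)
    (hb : ∀ s ∈ Set.Icc (0 : ℝ) 1, ∀ j M, 0 ≤ M → (∀ k, dist1 k j ≤ 1 → ‖δ s k‖ ≤ M) →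
      ‖δ' s j‖ ≤ κ * M + ρ * decay j l) {s : ℝ} (hs : s ∈ Set.Icc (0 : ℝ) 1) (j : Λ) :
    ‖δ s j‖ ≤ (3 * D + 2 * ρ) * decay j l ∧
      ‖δ s j - δ 0 j‖ ≤ (4 * κ * (3 * D + 2 * ρ) + ρ) * decay j l := by
  have hdec : ∀ j, (decay j l)⁻¹ * decay j l = 1 := fun j => inv_mul_cancel₀ (decay_pos j l).ne'
  set y : ℝ → Phase Λ := fun s j => (decay j l)⁻¹ • δ s j with hy
  have hyd : ∀ s ∈ Set.Icc (0 : ℝ) 1, HasDerivAt y (fun j => (decay j l)⁻¹ • δ' s j) s := by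
    intro s hs
    rw [hasDerivAt_pi]
    exact fun j => (hasDerivAt_pi.1 (hδ s hs) j).fun_const_smul _
  have hδy : ∀ s j, ‖δ s j‖ ≤ ‖y s‖ * decay j l := by
    intro s j
    have h1 := norm_le_pi_norm (y s) j
    rw [hy] at h1
    simp only [norm_smul, norm_inv, Real.norm_of_nonneg (decay_nonneg j l)] at h1
    rwa [inv_mul_le_iff₀ (decay_pos j l), mul_comm] at h1
  have hstep : ∀ s ∈ Set.Icc (0 : ℝ) 1, ∀ j,
      ‖δ' s j‖ ≤ (4 * κ * ‖y s‖ + ρ) * decay j l := by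
    intro s hs j
    refine (hb s hs j (‖y s‖ * (4 * decay j l))
      (by have := decay_nonneg j l; positivity) fun k hk => ?_).trans (le_of_eq (by ring))
    refine (hδy s k).trans (mul_le_mul_of_nonneg_left ?_ (norm_nonneg _))
    simpa using decay_le_of_dist1_le (l := l) hk
  have hgron : ∀ s ∈ Set.Icc (0 : ℝ) 1, ‖y s‖ ≤ gronwallBound D 1 ρ (s - 0) := by
    refine norm_le_gronwallBound_of_norm_deriv_right_le
      (f' := fun s j => (decay j l)⁻¹ • δ' s j)
      (fun s hs => (hyd s hs).continuousAt.continuousWithinAt)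
      (fun s hs => (hyd s (Set.Ico_subset_Icc_self hs)).hasDerivWithinAt) ?_ fun s hs => ?_
    · refine (pi_norm_le_iff_of_nonneg hD).2 fun j => ?_
      rw [hy]
      simp only [norm_smul, norm_inv, Real.norm_of_nonneg (decay_nonneg j l)]
      rw [inv_mul_le_iff₀ (decay_pos j l), mul_comm]
      exact h0 j
    · refine (pi_norm_le_iff_of_nonneg (by positivity)).2 fun j => ?_
      simp only [norm_smul, norm_inv, Real.norm_of_nonneg (decay_nonneg j l)]
      rw [inv_mul_le_iff₀ (decay_pos j l), mul_comm (decay j l)]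
      refine (hstep s (Set.Ico_subset_Icc_self hs) j).trans
        (mul_le_mul_of_nonneg_right ?_ (decay_nonneg j l))
      have := mul_le_mul_of_nonneg_right (show 4 * κ ≤ 1 by linarith) (norm_nonneg (y s))
      linarith
  have hbd : ∀ s ∈ Set.Icc (0 : ℝ) 1, ‖y s‖ ≤ 3 * D + 2 * ρ := by
    intro s hs
    refine (hgron s hs).trans ?_
    rw [gronwallBound_of_K_ne_0 one_ne_zero, sub_zero]
    simp only [one_mul, div_one]
    -- Grönwall gives `D e^s + ρ (e^s - 1)`; with `e ≤ 3` this is at most `3 D + 2 ρ`.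
    have h3 : Real.exp s ≤ 3 :=
      (Real.exp_le_exp.2 hs.2).trans (Real.exp_one_lt_d9.le.trans (by norm_num))
    nlinarith
  refine ⟨(hδy s j).trans (mul_le_mul_of_nonneg_right (hbd s hs) (decay_nonneg j l)), ?_⟩
  -- The bound just obtained is fed back into the derivative. The deviation from the initial value
  -- acquires the small factor `κ`.
  have hmv := (convex_Icc (0 : ℝ) 1).norm_image_sub_le_of_norm_hasDerivWithin_le
    (f := fun s => δ s j) (f' := fun s => δ' s j)
    (C := (4 * κ * (3 * D + 2 * ρ) + ρ) * decay j l)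
    (fun s hs => (hasDerivAt_pi.1 (hδ s hs) j).hasDerivWithinAt)
    (fun s hs => (hstep s hs j).trans (mul_le_mul_of_nonneg_right (by
      have := mul_le_mul_of_nonneg_left (hbd s hs) (show 0 ≤ 4 * κ by linarith)
      linarith) (decay_nonneg j l)))
    (Set.left_mem_Icc.2 zero_le_one) hs
  refine hmv.trans (mul_le_of_le_one_right ?_ ?_)
  · have := decay_nonneg j l
    positivity
  · rw [sub_zero, Real.norm_of_nonneg hs.1]; exact hs.2

/-- A vector field with bounded derivatives, each component of which depends only on the
coordinates at neighbouring sites. -/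
structure LocalField (W : Phase Λ → Phase Λ) (κ : ℝ) : Prop where
  nonneg : 0 ≤ κ
  contDiff : ContDiff ℝ 2 W
  jet : ∀ j u, JetLE 0 2 (fun u => W u j) u κ
  dependsOn : ∀ j, DependsOn (fun u => W u j) (siteBall j 1)

namespace LocalField

variable {W : Phase Λ → Phase Λ} {κ : ℝ}

lemma contDiff_apply (hW : LocalField W κ) (j : Λ) : ContDiff ℝ 2 fun u => W u j :=
  contDiff_pi.1 hW.contDiff j

lemma differentiable_apply (hW : LocalField W κ) (j : Λ) : Differentiable ℝ fun u => W u j :=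
  (hW.contDiff_apply j).differentiable (by norm_num)

lemma jetLE (hW : LocalField W κ) (u : Phase Λ) : JetLE 0 2 W u κ :=
  jetLE_pi hW.contDiff hW.nonneg fun j => hW.jet j u

lemma norm_le (hW : LocalField W κ) (u : Phase Λ) : ‖W u‖ ≤ κ := (hW.jetLE u).norm_le

lemma lipschitz (hW : LocalField W κ) : LipschitzWith κ.toNNReal W :=
  lipschitzWith_of_nnnorm_fderiv_le (hW.contDiff.differentiable (by norm_num)) fun u => by
    rw [← NNReal.coe_le_coe, coe_nnnorm, Real.coe_toNNReal _ hW.nonneg]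
    exact (hW.jetLE u).norm_fderiv_le zero_le_one one_le_two

lemma toNNReal_le (hW : LocalField W κ) (hκ : κ ≤ 1 / 4) : κ.toNNReal ≤ 1 / 4 := by
  rw [← NNReal.coe_le_coe, Real.coe_toNNReal _ hW.nonneg]
  simpa using hκ

lemma neg (hW : LocalField W κ) : LocalField (fun u => -W u) κ where
  nonneg := hW.nonneg
  contDiff := hW.contDiff.neg
  jet j u i h0 h2 := by
    have h : (fun u => (-W u) j) = -fun u => W u j := rfl
    rw [h, iteratedFDeriv_neg, Pi.neg_apply, norm_neg]
    exact hW.jet j u i h0 h2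
  dependsOn j _ _ h := congrArg Neg.neg (hW.dependsOn j h)

lemma exists_isFlow (hW : LocalField W κ) : ∃ X, IsFlow W X :=
  Rotators.exists_isFlow hW.lipschitz (L := κ.toNNReal) fun u => by
    rw [Real.coe_toNNReal _ hW.nonneg]; exact hW.norm_le u

lemma norm_sub_apply_le (hW : LocalField W κ) (j : Λ) {u w : Phase Λ} {M : ℝ} (hM : 0 ≤ M)
    (h : ∀ k, dist1 k j ≤ 1 → ‖w k - u k‖ ≤ M) : ‖W w j - W u j‖ ≤ κ * M :=
  norm_sub_le_of_dependsOn (hW.dependsOn j) (hW.differentiable_apply j) hM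
    (fun _ _ => (hW.jet j _).norm_fderiv_le zero_le_one one_le_two) fun k hk => h k hk

lemma fderiv_apply (hW : LocalField W κ) (u a : Phase Λ) (j : Λ) :
    fderiv ℝ W u a j = fderiv ℝ (fun u => W u j) u a := by
  rw [(hasFDerivAt_pi'.1 (hW.contDiff.differentiable (by norm_num) u).hasFDerivAt j).fderiv]
  rfl

lemma norm_fderiv_apply_le (hW : LocalField W κ) (j : Λ) (u a : Phase Λ) {M : ℝ} (hM : 0 ≤ M)
    (h : ∀ k, dist1 k j ≤ 1 → ‖a k‖ ≤ M) : ‖fderiv ℝ W u a j‖ ≤ κ * M := by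
  rw [hW.fderiv_apply, fderiv_apply_congr (hW.dependsOn j) (hW.differentiable_apply j) u
    (w := siteRestrict (siteBall j 1) a) fun k hk => (siteRestrict_of_mem hk a).symm]
  exact ContinuousLinearMap.le_of_opNorm_le_of_le _
    ((hW.jet j u).norm_fderiv_le zero_le_one one_le_two) (norm_siteRestrict_le hM h)

/-- With the direction `a` restricted to the neighbours of `j` and frozen, `u ↦ DW_j(u) a` is a
local function of `u` whose derivative is a second derivative of `W`, so the local mean value
estimate applies. -/
lemma norm_fderiv_sub_apply_le (hW : LocalField W κ) (j : Λ) (u w a : Phase Λ) {M N : ℝ}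
    (hM : 0 ≤ M) (hN : 0 ≤ N) (h : ∀ k, dist1 k j ≤ 1 → ‖a k‖ ≤ M)
    (huw : ∀ k, dist1 k j ≤ 1 → ‖w k - u k‖ ≤ N) :
    ‖fderiv ℝ W w a j - fderiv ℝ W u a j‖ ≤ κ * M * N := by
  have hd := hW.differentiable_apply j
  have hd2 : Differentiable ℝ (fderiv ℝ fun u => W u j) :=
    ((hW.contDiff_apply j).fderiv_right (m := 1) (by norm_num)).differentiable (by norm_num)
  set b := siteRestrict (siteBall j 1) a with hb
  have h1 : ∀ u, fderiv ℝ W u a j = fderiv ℝ (fun u => W u j) u b := fun u => by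
    rw [hW.fderiv_apply]
    exact fderiv_apply_congr (hW.dependsOn j) hd u fun k hk => (siteRestrict_of_mem hk a).symm
  rw [h1, h1]
  refine norm_sub_le_of_dependsOn (h := fun u => fderiv ℝ (fun u => W u j) u b)
    (s := siteBall j 1) (fun x y hxy => ?_) (fun x => (hd2 x).clm_apply (differentiableAt_const b))
    hN (fun t _ => ?_) huw
  · exact congrArg (fun L : Phase Λ →L[ℝ] ℂ => L b) (dependsOn_fderiv (hW.dependsOn j) hd hxy)
  · refine ContinuousLinearMap.opNorm_le_bound _ (mul_nonneg hW.nonneg hM) fun c => ?_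
    rw [(((hd2 _).hasFDerivAt).clm_apply (hasFDerivAt_const b _)).fderiv]
    simp only [ContinuousLinearMap.comp_zero, zero_add, ContinuousLinearMap.flip_apply]
    refine ((fderiv ℝ (fderiv ℝ fun u => W u j) _ c).le_opNorm b).trans ?_
    have h2 : ‖fderiv ℝ (fderiv ℝ fun u => W u j) (AffineMap.lineMap u w t)‖ ≤ κ :=
      (((hW.jet j _).weaken (m' := 1) (n' := 2) (by norm_num) le_rfl).fderiv).norm_fderiv_le 
        zero_le_one le_rfl
    have h3 := ContinuousLinearMap.le_of_opNorm_le _ h2 c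
    have h4 := norm_siteRestrict_le hM (fun k hk => h k hk) (s := siteBall j 1) (u := a)
    calc _ ≤ κ * ‖c‖ * M := mul_le_mul h3 h4 (norm_nonneg _)
          (mul_nonneg hW.nonneg (norm_nonneg _))
      _ = _ := by ring

end LocalField

namespace LocalField

variable {W : Phase Λ → Phase Λ} {κ : ℝ} {X : ℝ → Phase Λ → Phase Λ} {s : ℝ}

lemma norm_flow_sub_le (hW : LocalField W κ) (hX : IsFlow W X) (hs : s ∈ Set.Icc (0 : ℝ) 1)
    (v : Phase Λ) : ‖X s v - v‖ ≤ κ := by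
  have h := (convex_Icc (0 : ℝ) 1).norm_image_sub_le_of_norm_hasDerivWithin_le
    (f := fun s => X s v) (f' := fun s => W (X s v)) (C := κ)
    (fun s _ => (hX.hasDerivAt v s).hasDerivWithinAt) (fun s _ => hW.norm_le _)
    (Set.left_mem_Icc.2 zero_le_one) hs
  rw [hX.zero] at h
  refine h.trans (mul_le_of_le_one_right hW.nonneg ?_)
  rw [sub_zero, Real.norm_of_nonneg hs.1]; exact hs.2

lemma norm_single_apply_le (l j : Λ) (z : ℂ) :
    ‖(Pi.single l z : Phase Λ) j‖ ≤ ‖z‖ * decay j l := by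
  rcases eq_or_ne j l with rfl | hj
  · simp [decay_self]
  · rw [Pi.single_eq_of_ne hj, norm_zero]
    exact mul_nonneg (norm_nonneg _) (decay_nonneg _ _)

lemma flow_sub_apply_le (hW : LocalField W κ) (hκ : κ ≤ 1 / 4) (hX : IsFlow W X)
    (hs : s ∈ Set.Icc (0 : ℝ) 1) (v : Phase Λ) {l : Λ} {a : Phase Λ} {A : ℝ} (hA : 0 ≤ A)
    (ha : ∀ j, ‖a j‖ ≤ A * decay j l) (j : Λ) :
    ‖X s (v + a) j - X s v j‖ ≤ 3 * A * decay j l := by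
  have h := (weighted_gronwall hW.nonneg hκ le_rfl hA l
    (δ := fun s => X s (v + a) - X s v) (δ' := fun s => W (X s (v + a)) - W (X s v))
    (fun s _ => (hX.hasDerivAt _ s).fun_sub (hX.hasDerivAt _ s)) (fun j => ?_)
    (fun s _ j M hM h => ?_) hs j).1
  · simpa using h
  · simp only [hX.zero, add_sub_cancel_left]
    exact ha j
  · rw [zero_mul, add_zero]
    exact hW.norm_sub_apply_le j hM h

lemma hasDerivAt_fderiv_flow (hW : LocalField W κ) (hκ : κ ≤ 1 / 4) (hX : IsFlow W X)
    (hs : s ∈ Set.Icc (0 : ℝ) 1) (v a : Phase Λ) :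
    HasDerivAt (fun s => fderiv ℝ (X s) v a) (fderiv ℝ W (X s v) (fderiv ℝ (X s) v a)) s :=
  hX.hasDerivAt_fderiv (hW.toNNReal_le hκ) hW.lipschitz
      (hW.contDiff.of_le (by norm_num)) v _ ⟨by linarith [hs.1], by linarith [hs.2]⟩

lemma fderiv_flow_apply_le (hW : LocalField W κ) (hκ : κ ≤ 1 / 4) (hX : IsFlow W X)
    (hs : s ∈ Set.Icc (0 : ℝ) 1) (v : Phase Λ) {l : Λ} {a : Phase Λ} {A : ℝ} (hA : 0 ≤ A)
    (ha : ∀ j, ‖a j‖ ≤ A * decay j l) (j : Λ) :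
    ‖fderiv ℝ (X s) v a j‖ ≤ 3 * A * decay j l ∧
    ‖fderiv ℝ (X s) v a j - a j‖ ≤ 12 * κ * A * decay j l := by
  have h := weighted_gronwall hW.nonneg hκ le_rfl hA l
    (δ := fun s => fderiv ℝ (X s) v a)
    (δ' := fun s => fderiv ℝ W (X s v) (fderiv ℝ (X s) v a))
    (fun s hs => hW.hasDerivAt_fderiv_flow hκ hX hs v a)
    (fun j => ?_) (fun s _ j M hM h => ?_) hs j
  · simp only [hX.fderiv_zero, ContinuousLinearMap.id_apply] at h
    exact ⟨h.1.trans (le_of_eq (by ring)), h.2.trans (le_of_eq (by ring))⟩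
  · simp only [hX.fderiv_zero, ContinuousLinearMap.id_apply]
    exact ha j
  · rw [zero_mul, add_zero]
    exact hW.norm_fderiv_apply_le j _ _ hM h

/-- The difference of two variations solves the variational equation with a source, caused by the
difference of the base points and zero initially. The source is at most `κ (3A · 4)(3B · 4)`, that
is `144 κ A B`, and `weighted_gronwall` doubles it. -/
lemma fderiv_flow_sub_apply_le (hW : LocalField W κ) (hκ : κ ≤ 1 / 4) (hX : IsFlow W X)
    (hs : s ∈ Set.Icc (0 : ℝ) 1) (v : Phase Λ) {l : Λ} {a b : Phase Λ} {A B : ℝ} (hA : 0 ≤ A)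
    (hB : 0 ≤ B) (ha : ∀ j, ‖a j‖ ≤ A * decay j l) (hb : ∀ j, ‖b j‖ ≤ B * decay j l) (j : Λ) :
    ‖fderiv ℝ (X s) (v + b) a j - fderiv ℝ (X s) v a j‖ ≤ 288 * κ * B * A * decay j l := by
  have hρ : 0 ≤ 144 * κ * B * A := by have := hW.nonneg; positivity
  have h := (weighted_gronwall hW.nonneg hκ hρ le_rfl l
    (δ := fun s => fderiv ℝ (X s) (v + b) a - fderiv ℝ (X s) v a)
    (δ' := fun s => fderiv ℝ W (X s (v + b)) (fderiv ℝ (X s) (v + b) a) -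
      fderiv ℝ W (X s v) (fderiv ℝ (X s) v a))
    (fun s hs => (hW.hasDerivAt_fderiv_flow hκ hX hs _ a).fun_sub
      (hW.hasDerivAt_fderiv_flow hκ hX hs _ a)) (fun j => ?_) (fun s hs j M hM h => ?_) hs j).1
  · exact h.trans (le_of_eq (by ring))
  · simp [hX.fderiv_zero]
  · set z₁ := fderiv ℝ (X s) (v + b) a
    set z₀ := fderiv ℝ (X s) v a
    have e : (fderiv ℝ W (X s (v + b)) z₁ - fderiv ℝ W (X s v) z₀) j =
        fderiv ℝ W (X s (v + b)) (z₁ - z₀) j +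
          (fderiv ℝ W (X s (v + b)) z₀ j - fderiv ℝ W (X s v) z₀ j) := by
      rw [map_sub, Pi.sub_apply, Pi.sub_apply]; ring
    rw [e]
    refine (norm_add_le _ _).trans (add_le_add (hW.norm_fderiv_apply_le j _ _ hM h) ?_)
    have hdec := decay_nonneg j l
    have hnb : ∀ k, dist1 k j ≤ 1 → decay k l ≤ 4 * decay j l := fun k hk => by
      simpa using decay_le_of_dist1_le (l := l) hk
    refine (hW.norm_fderiv_sub_apply_le j (X s v) (X s (v + b)) z₀
      (M := 3 * A * (4 * decay j l)) (N := 3 * B * (4 * decay j l))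
      (by positivity) (by positivity) (fun k hk => ?_) fun k hk => ?_).trans ?_
    · exact (hW.fderiv_flow_apply_le hκ hX hs v hA ha k).1.trans
        (mul_le_mul_of_nonneg_left (hnb k hk) (by positivity))
    · exact (hW.flow_sub_apply_le hκ hX hs v hB hb k).trans
        (mul_le_mul_of_nonneg_left (hnb k hk) (by positivity))
    -- Both factors of the source decay from `l`; one decay factor is enough and the other is
    -- bounded by one.
    · have := mul_le_mul_of_nonneg_left (decay_le_one j l) (mul_nonneg hρ hdec)
      calc _ = 144 * κ * B * A * decay j l * decay j l := by ring
        _ ≤ _ := by linarith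

lemma contDiff_flow (hW : LocalField W κ) (hκ : κ ≤ 1 / 4) (hX : IsFlow W X)
    (hs : s ∈ Set.Icc (0 : ℝ) 1) : ContDiff ℝ 2 (X s) := by
  have := hX.contDiff_map (n := 2) (hW.toNNReal_le hκ) hW.lipschitz two_ne_zero
    (by exact_mod_cast hW.contDiff) (s := s) ⟨by linarith [hs.1], by linarith [hs.2]⟩
  exact_mod_cast this

/-- The second variational equation is avoided: the second derivative is the derivative along a line
of the first one, which has just been shown to be Lipschitz with the required constant. -/
lemma fderiv_fderiv_flow_apply_le (hW : LocalField W κ) (hκ : κ ≤ 1 / 4) (hX : IsFlow W X)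
    (hs : s ∈ Set.Icc (0 : ℝ) 1) (v : Phase Λ) {l : Λ} {a : Phase Λ} {A : ℝ} (hA : 0 ≤ A)
    (ha : ∀ j, ‖a j‖ ≤ A * decay j l) (j : Λ) :
    ‖fderiv ℝ (fderiv ℝ (X s)) v a a j‖ ≤ 288 * κ * A * A * decay j l := by
  have hd : Differentiable ℝ (fderiv ℝ (X s)) :=
    ((hW.contDiff_flow hκ hX hs).fderiv_right (m := 1) (by norm_num)).differentiable (by norm_num)
  have h1 := hasDerivAt_pi.1 (hasDerivAt_fderiv_line hd v a) j
  have := hW.nonneg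
  have := decay_nonneg j l
  refine h1.le_of_lip' (by positivity) (Eventually.of_forall fun t => ?_)
  have h4 := hW.fderiv_flow_sub_apply_le hκ hX hs v (b := t • a) (B := ‖t‖ * A) hA (by positivity)
    ha (fun j => by
      rw [Pi.smul_apply, norm_smul, mul_assoc]
      exact mul_le_mul_of_nonneg_left (ha j) (norm_nonneg _)) j
  rw [zero_smul, add_zero, sub_zero]
  exact h4.trans (le_of_eq (by ring))

end LocalField

end LocalFlow

end Rotators

namespace Rotators

/-! ### Symplectic form, canonicity of Hamiltonian flows, transformation of Hamiltonian fields -/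

section Symplectic

variable {d : ℕ} {Λ : Finset (Fin d → ℤ)}

/-- The intrinsic description of a Hamiltonian field. It allows the symplectic arguments below to
avoid coordinates. -/
lemma symp_I_mul_gradL (l : Phase Λ →L[ℝ] ℝ) (b : Phase Λ) :
    symp (fun j => Complex.I * gradL j l) b = -l b := by
  rw [map_eq_sum_grad l b, symp, ← Finset.sum_neg_distrib]
  refine Finset.sum_congr rfl fun j _ => ?_
  simp only [Complex.mul_re, Complex.mul_im, Complex.I_re, Complex.I_im]
  ring

lemma symp_comm (a b : Phase Λ) : symp a b = -symp b a := by
  rw [symp, symp, ← Finset.sum_neg_distrib]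
  exact Finset.sum_congr rfl fun j _ => by ring

lemma symp_single (a : Phase Λ) (j : Λ) (z : ℂ) :
    symp a (Pi.single j z) = (a j).re * z.im - (a j).im * z.re := by
  rw [symp, Finset.sum_eq_single j]
  · simp
  · intro k _ hk
    rw [Pi.single_eq_of_ne hk]; simp
  · simp

lemma eq_of_symp_eq {a a' : Phase Λ} (h : ∀ b, symp a b = symp a' b) : a = a' := by
  funext j
  have h1 := h (Pi.single j 1)
  have h2 := h (Pi.single j Complex.I)
  simp only [symp_single, Complex.one_im, Complex.one_re, Complex.I_im, Complex.I_re] at h1 h2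
  exact Complex.ext (by linarith) (by linarith)

lemma hasDerivAt_symp {a b : ℝ → Phase Λ} {a' b' : Phase Λ} {s : ℝ} (ha : HasDerivAt a a' s)
    (hb : HasDerivAt b b' s) :
    HasDerivAt (fun s => symp (a s) (b s)) (symp a' (b s) + symp (a s) b') s := by
  have hre : ∀ {c : ℝ → Phase Λ} {c' : Phase Λ}, HasDerivAt c c' s → ∀ j,
      HasDerivAt (fun s => (c s j).re) (c' j).re s := fun hc j =>
    Complex.reCLM.hasFDerivAt.comp_hasDerivAt s (hasDerivAt_pi.1 hc j)
  have him : ∀ {c : ℝ → Phase Λ} {c' : Phase Λ}, HasDerivAt c c' s → ∀ j,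
      HasDerivAt (fun s => (c s j).im) (c' j).im s := fun hc j =>
    Complex.imCLM.hasFDerivAt.comp_hasDerivAt s (hasDerivAt_pi.1 hc j)
  have h := HasDerivAt.fun_sum (u := Finset.univ) fun j _ =>
    ((hre ha j).mul (him hb j)).sub ((him ha j).mul (hre hb j))
  refine h.congr_deriv ?_
  rw [symp, symp, ← Finset.sum_add_distrib]
  exact Finset.sum_congr rfl fun j _ => by ring

lemma grad_const_mul {h : Phase Λ → ℝ} (hd : Differentiable ℝ h) (c : ℝ) (u : Phase Λ) (j : Λ) :
    grad (fun v => c * h v) u j = c * grad h u j := by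
  rw [grad, grad, fderiv_const_mul (hd u)]
  simp only [smul_apply, smul_eq_mul, Complex.ofReal_mul]
  ring

lemma grad_add {h₁ h₂ : Phase Λ → ℝ} (hd₁ : Differentiable ℝ h₁) (hd₂ : Differentiable ℝ h₂)
    (u : Phase Λ) (j : Λ) : grad (fun v => h₁ v + h₂ v) u j = grad h₁ u j + grad h₂ u j := by
  rw [grad_eq_gradL, grad_eq_gradL, grad_eq_gradL, fderiv_fun_add (hd₁ u) (hd₂ u), map_add]

variable {Φ : Phase Λ → ℝ} {W : Phase Λ → Phase Λ}

lemma fderiv_hamiltonianField (hΦ : ContDiff ℝ 2 Φ) (hW : ∀ u j, W u j = Complex.I * grad Φ u j)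
    (u a : Phase Λ) :
    fderiv ℝ W u a = fun j => Complex.I * gradL j (fderiv ℝ (fderiv ℝ Φ) u a) := by
  have hd : Differentiable ℝ (fderiv ℝ Φ) :=
    (hΦ.fderiv_right (m := 1) (by norm_num)).differentiable (by norm_num)
  have h : HasFDerivAt W (ContinuousLinearMap.pi fun j =>
      (Complex.I • (gradL j)).comp (fderiv ℝ (fderiv ℝ Φ) u)) u := by
    rw [hasFDerivAt_pi]
    intro j
    have h1 : (fun u => W u j) = fun u => (Complex.I • gradL j) (fderiv ℝ Φ u) := by
      funext u; rw [hW, grad_eq_gradL]; rfl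
    rw [h1]
    exact (Complex.I • gradL j).hasFDerivAt.comp u (hd u).hasFDerivAt
  rw [h.fderiv]
  rfl

/-- The linearization of a Hamiltonian field is infinitesimally symplectic because the Hessian of
the Hamiltonian is symmetric. -/
lemma symp_fderiv_add (hΦ : ContDiff ℝ 2 Φ) (hW : ∀ u j, W u j = Complex.I * grad Φ u j)
    (u a b : Phase Λ) : symp (fderiv ℝ W u a) b + symp a (fderiv ℝ W u b) = 0 := by
  rw [symp_comm a, fderiv_hamiltonianField hΦ hW, fderiv_hamiltonianField hΦ hW,
    symp_I_mul_gradL, symp_I_mul_gradL,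
    (hΦ.contDiffAt.isSymmSndFDerivAt (by simp)).eq a b]
  ring

/-- The form evaluated on two solutions of the variational equation has zero derivative in time. -/
lemma symp_fderiv_flow {κ : ℝ} {X : ℝ → Phase Λ → Phase Λ} (hL : LocalField W κ)
    (hκ : κ ≤ 1 / 4) (hX : IsFlow W X) (hΦ : ContDiff ℝ 2 Φ)
    (hW : ∀ u j, W u j = Complex.I * grad Φ u j) (v a b : Phase Λ) :
    symp (fderiv ℝ (X 1) v a) (fderiv ℝ (X 1) v b) = symp a b := by
  have hder : ∀ s ∈ Set.Icc (0 : ℝ) 1, HasDerivAt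
      (fun s => symp (fderiv ℝ (X s) v a) (fderiv ℝ (X s) v b)) 0 s := fun s hs =>
    (hasDerivAt_symp (hL.hasDerivAt_fderiv_flow hκ hX hs v a)
      (hL.hasDerivAt_fderiv_flow hκ hX hs v b)).congr_deriv (symp_fderiv_add hΦ hW _ _ _)
  have h := constant_of_has_deriv_right_zero
    (fun s hs => (hder s hs).continuousAt.continuousWithinAt)
    (fun s hs => (hder s (Set.Ico_subset_Icc_self hs)).hasDerivWithinAt) 1
    (Set.right_mem_Icc.2 zero_le_one)
  simpa [hX.fderiv_zero] using h

/-- Time reversal gives the flow of `-W`, so every estimate for the time-one map also holds for its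
inverse. -/
lemma IsFlow.neg {E : Type*} [NormedAddCommGroup E] [NormedSpace ℝ E] {W : E → E}
    {X : ℝ → E → E} (hX : IsFlow W X) : IsFlow (fun u => -W u) fun s => X (-s) where
  zero v := by simpa using hX.zero v
  hasDerivAt v s := by
    have h := (hX.hasDerivAt v (-s)).scomp s (hasDerivAt_neg s)
    rw [neg_one_smul] at h
    exact h

lemma isCanonical_flow {κ : ℝ} {X : ℝ → Phase Λ → Phase Λ} (hL : LocalField W κ)
    (hκ : κ ≤ 1 / 4) (hX : IsFlow W X) (hΦ : ContDiff ℝ 2 Φ)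
    (hW : ∀ u j, W u j = Complex.I * grad Φ u j) : IsCanonical (hX.equiv hL.lipschitz 1) where
  smooth := hL.contDiff_flow hκ hX (Set.right_mem_Icc.2 zero_le_one)
  smooth_symm := by
    have h := hL.neg.contDiff_flow hκ (X := fun s => X (-s)) hX.neg
      (Set.right_mem_Icc.2 zero_le_one)
    exact h
  symplectic := symp_fderiv_flow hL hκ hX hΦ hW

namespace IsCanonical

variable {Γ : Phase Λ ≃ Phase Λ}

lemma hasFDerivAt (hΓ : IsCanonical Γ) (v : Phase Λ) : HasFDerivAt Γ (fderiv ℝ Γ v) v :=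
  (hΓ.smooth.differentiable (by norm_num) v).hasFDerivAt

lemma hasFDerivAt_symm (hΓ : IsCanonical Γ) (u : Phase Λ) :
    HasFDerivAt Γ.symm (fderiv ℝ Γ.symm u) u :=
  (hΓ.smooth_symm.differentiable (by norm_num) u).hasFDerivAt

lemma fderiv_symm_apply_fderiv (hΓ : IsCanonical Γ) (v a : Phase Λ) :
    fderiv ℝ Γ.symm (Γ v) (fderiv ℝ Γ v a) = a := by
  have h := (hΓ.hasFDerivAt_symm (Γ v)).comp v (hΓ.hasFDerivAt v)
  rw [Γ.symm_comp_self] at h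
  exact congrArg (fun L : Phase Λ →L[ℝ] Phase Λ => L a) (h.unique (hasFDerivAt_id v))

lemma fderiv_apply_fderiv_symm (hΓ : IsCanonical Γ) (v a : Phase Λ) :
    fderiv ℝ Γ v (fderiv ℝ Γ.symm (Γ v) a) = a := by
  have h1 := hΓ.hasFDerivAt (Γ.symm (Γ v))
  have h := h1.comp (Γ v) (hΓ.hasFDerivAt_symm (Γ v))
  rw [Γ.self_comp_symm] at h
  have h2 := congrArg (fun L : Phase Λ →L[ℝ] Phase Λ => L a) (h.unique (hasFDerivAt_id (Γ v)))
  rw [Γ.symm_apply_apply] at h2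
  exact h2

/-- By nondegeneracy it suffices to pair with vectors of the form `DΓ b`; there invariance of the
form reduces the claim to the chain rule for `H ∘ Γ`. -/
lemma fderiv_symm_hamiltonianField (hΓ : IsCanonical Γ) {H : Phase Λ → ℝ}
    (hH : Differentiable ℝ H) (v : Phase Λ) :
    fderiv ℝ Γ.symm (Γ v) (fun j => Complex.I * grad H (Γ v) j) =
      fun j => Complex.I * grad (fun v => H (Γ v)) v j := by
  have key : fderiv ℝ Γ v (fun j => Complex.I * grad (fun v => H (Γ v)) v j) =
      fun j => Complex.I * grad H (Γ v) j := by
    refine eq_of_symp_eq fun b => ?_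
    rw [← hΓ.fderiv_apply_fderiv_symm v b, hΓ.symplectic]
    simp only [grad_eq_gradL, symp_I_mul_gradL]
    have h : HasFDerivAt (fun v => H (Γ v)) ((fderiv ℝ H (Γ v)).comp (fderiv ℝ Γ v)) v :=
      (hH (Γ v)).hasFDerivAt.comp v (hΓ.hasFDerivAt v)
    rw [h.fderiv]
    rfl
  rw [← key, hΓ.fderiv_symm_apply_fderiv]

end IsCanonical

end Symplectic

/-! ### The field of `√ε Φ` and the change of the actions -/

section Transformation

variable {d : ℕ} {Λ : Finset (Fin d → ℤ)} {p : ℕ} {S A A₀ B : ℂ × ℂ → ℝ} {K ε : ℝ}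

/-- The vector field of the Hamiltonian `√ε Φ`. -/
noncomputable def smallField (ε : ℝ) (Λ : Finset (Fin d → ℤ)) (B : ℂ × ℂ → ℝ) (u : Phase Λ) :
    Phase Λ := √ε • hamField Λ B u

lemma smallField_eq (hB : ContDiff ℝ 3 B) (u : Phase Λ) (j : Λ) :
    smallField ε Λ B u j = Complex.I * grad (fun v => √ε * pairSum (signs Λ) B v) u j := by
  rw [grad_const_mul ((contDiff_pairSum hB).differentiable (by norm_num)), smallField, Pi.smul_apply,
    hamField, Complex.real_smul]
  ring

lemma localField_smallField (hB : ContDiff ℝ 3 B) (hj : ∀ x, JetLE 1 3 B x K) (hK : 0 ≤ K) :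
    LocalField (smallField ε Λ B) (√ε * fieldConst d K) where
  nonneg := mul_nonneg (Real.sqrt_nonneg _) (fieldConst_nonneg hK)
  contDiff := (contDiff_hamField hB).const_smul _
  jet j u i h0 h2 := by
    have h : (fun u => smallField ε Λ B u j) = fun u => √ε • hamField Λ B u j := rfl
    rw [h, iteratedFDeriv_const_smul_apply' 
      (((contDiff_hamField_apply hB j).of_le (by exact_mod_cast h2)).contDiffAt), norm_smul,
      Real.norm_of_nonneg (Real.sqrt_nonneg _)]
    exact mul_le_mul_of_nonneg_left (jetLE_hamField_apply hB hj hK j u i h0 h2)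
      (Real.sqrt_nonneg _)
  dependsOn j _ _ h := congrArg (√ε • ·) (dependsOn_hamField hB j h)

/-- The time derivative of the action is `-√ε` times the angular derivative of `Φ`, which is bounded
uniformly. A bound through `|u_j - v_j|` would grow with `|v_j|`. -/
lemma abs_action_sub_le (hP : PairBounds p S A A₀ B K) {X : ℝ → Phase Λ → Phase Λ}
    (hX : IsFlow (smallField ε Λ B) X) (v : Phase Λ) (j : Λ) :
    |‖X 1 v j‖ ^ 2 / 2 - ‖v j‖ ^ 2 / 2| ≤ nbhdConst d 1 * K * √ε := by
  have hder : ∀ s, HasDerivAt (fun s => ((X s v j).re ^ 2 + (X s v j).im ^ 2) / 2)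
      (-(√ε * fderiv ℝ (pairSum (signs Λ) B) (X s v)
        (Pi.single j (Complex.I * X s v j)))) s := by
    intro s
    have h := hasDerivAt_pi.1 (hX.hasDerivAt v s) j
    have hre : HasDerivAt (fun s => (X s v j).re) (smallField ε Λ B (X s v) j).re s :=
      Complex.reCLM.hasFDerivAt.comp_hasDerivAt s h
    have him : HasDerivAt (fun s => (X s v j).im) (smallField ε Λ B (X s v) j).im s :=
      Complex.imCLM.hasFDerivAt.comp_hasDerivAt s h
    refine (((hre.fun_pow 2).fun_add (him.fun_pow 2)).div_const 2).congr_deriv ?_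
    have := re_mul_add_im_mul_hamField (B := B) (X s v) (X s v j) j
    simp only [smallField, Pi.smul_apply, Complex.smul_re, Complex.smul_im, smul_eq_mul]
    push_cast
    linear_combination √ε * this
  have h := (convex_Icc (0 : ℝ) 1).norm_image_sub_le_of_norm_hasDerivWithin_le
    (C := nbhdConst d 1 * K * √ε) (fun s _ => (hder s).hasDerivWithinAt) (fun s _ => by
      rw [norm_neg, norm_mul, Real.norm_of_nonneg (Real.sqrt_nonneg _), mul_comm]
      exact mul_le_mul_of_nonneg_right (abs_angular_deriv_le hP _ j) (Real.sqrt_nonneg _))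
    (Set.left_mem_Icc.2 zero_le_one) (Set.right_mem_Icc.2 zero_le_one)
  simp only [hX.zero, sub_zero, norm_one, mul_one, Real.norm_eq_abs] at h
  have e : ∀ z : ℂ, ‖z‖ ^ 2 / 2 = (z.re ^ 2 + z.im ^ 2) / 2 := fun z => by
    rw [← Complex.normSq_eq_norm_sq, Complex.normSq_apply]; ring
  rw [e, e]
  exact h

end Transformation

end Rotators

namespace Rotators

/-! ### Averaging over the torus reduces to a mean over one rotation -/

section AngleAverage

variable {d : ℕ} {Λ : Finset (Fin d → ℤ)}

/-- The uniform distribution of an angle. -/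
noncomputable def angleMeasure : Measure ℝ := ProbabilityTheory.cond volume (Set.Icc 0 (2 * Real.pi))

lemma volume_angle : volume (Set.Icc 0 (2 * Real.pi)) = ENNReal.ofReal (2 * Real.pi) := by
  rw [Real.volume_Icc, sub_zero]

instance : IsProbabilityMeasure angleMeasure :=
  ProbabilityTheory.cond_isProbabilityMeasure_of_finite
    (by rw [volume_angle]; simp [Real.pi_pos]) (by rw [volume_angle]; exact ENNReal.ofReal_ne_top)

lemma integral_angleMeasure (h : ℝ → ℝ) :
    ∫ s, h s ∂angleMeasure = (2 * Real.pi)⁻¹ * ∫ s in (0 : ℝ)..2 * Real.pi, h s := by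
  rw [angleMeasure, ProbabilityTheory.cond, integral_smul_measure, volume_angle,
    intervalIntegral.integral_of_le (by positivity), integral_Icc_eq_integral_Ioc,
    ENNReal.toReal_inv, ENNReal.toReal_ofReal (by positivity), smul_eq_mul]

/-- Normalized Lebesgue measure on the box is the product of the uniform laws of the angles; it is
enough to compare the two measures on rectangles. -/
lemma angleAvg_eq_integral (P : Phase Λ → ℝ) (v : Phase Λ) :
    angleAvg P v = ∫ ψ : Λ → ℝ, P (fun k => (‖v k‖ : ℂ) * Complex.exp ((ψ k : ℂ) * Complex.I))
      ∂Measure.pi fun _ => angleMeasure := by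
  rw [angleAvg, setAverage_eq']
  congr 1
  symm
  refine Measure.pi_eq fun s hs => ?_
  rw [← Set.pi_univ_Icc, volume_pi, Measure.restrict_pi_pi, Measure.smul_apply, Measure.pi_pi,
    Measure.pi_pi, smul_eq_mul]
  simp only [Pi.zero_apply, angleMeasure, ProbabilityTheory.cond, Measure.smul_apply, smul_eq_mul]
  rw [Finset.prod_mul_distrib, ENNReal.prod_inv_distrib]
  intro i _ j _ _
  left
  rw [volume_angle]
  simp [Real.pi_pos]

/-- Two different angles are independent, so their joint law is a product and Fubini applies.
Integrability holds because almost surely the angles lie in a compact square. -/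
lemma integral_pi_angle_pair {j k : Λ} (hjk : j ≠ k) {φ : ℝ × ℝ → ℝ} (hφ : Continuous φ) :
    ∫ ψ : Λ → ℝ, φ (ψ j, ψ k) ∂(Measure.pi fun _ => angleMeasure) =
      ∫ b, ∫ a, φ (a, b) ∂angleMeasure ∂angleMeasure := by
  have hind := (iIndepFun_pi (μ := fun _ : Λ => angleMeasure) (X := fun _ : Λ => (id : ℝ → ℝ))
    (fun _ => aemeasurable_id)).indepFun hjk
  have hmap := (indepFun_iff_map_prod_eq_prod_map_map (measurable_pi_apply j).aemeasurable
    (measurable_pi_apply k).aemeasurable).1 hind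
  rw [(measurePreserving_eval (fun _ : Λ => angleMeasure) j).map_eq,
    (measurePreserving_eval (fun _ : Λ => angleMeasure) k).map_eq] at hmap
  have h1 : ∫ ψ : Λ → ℝ, φ (ψ j, ψ k) ∂(Measure.pi fun _ => angleMeasure) =
      ∫ q, φ q ∂(angleMeasure.prod angleMeasure) := by
    rw [← hmap, integral_map (by fun_prop) hφ.aestronglyMeasurable]
  rw [h1, integral_prod_symm]
  obtain ⟨C, hC⟩ := (isCompact_Icc (a := ((0 : ℝ), (0 : ℝ)))
    (b := (2 * Real.pi, 2 * Real.pi))).exists_bound_of_continuousOn hφ.continuousOn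
  refine Integrable.of_bound hφ.aestronglyMeasurable C ?_
  have h2 : ∀ᵐ x ∂angleMeasure, x ∈ Set.Icc 0 (2 * Real.pi) :=
    ProbabilityTheory.ae_cond_mem measurableSet_Icc
  filter_upwards [Measure.quasiMeasurePreserving_fst.ae h2,
    Measure.quasiMeasurePreserving_snd.ae h2] with x h1 h2
  exact hC x ⟨⟨h1.1, h2.1⟩, ⟨h1.2, h2.2⟩⟩

/-- A common phase does not change the potential, so for each fixed second angle the mean over the
first one is the same mean over relative rotations, by periodicity. The outer integral is then of a
constant. -/
lemma angleAvg_pair {G : ℝ → ℝ} (hG : Continuous (pairPot G)) {j k : Λ} (hjk : j ≠ k)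
    (v : Phase Λ) : angleAvg (fun w : Phase Λ => G (‖w j - w k‖ ^ 2)) v =
      pairAvg (fun _ => 1) (pairPot G) (v j, v k) := by
  set φ : ℝ × ℝ → ℝ := fun q => pairPot G ((‖v j‖ : ℂ) * Complex.exp ((q.1 : ℂ) * Complex.I),
    (‖v k‖ : ℂ) * Complex.exp ((q.2 : ℂ) * Complex.I)) with hφ
  have hφc : Continuous φ := hG.comp (by fun_prop)
  have hper : ∀ b, Function.Periodic (fun a => φ (a, b)) (2 * Real.pi) := by
    intro b a
    simp only [hφ]
    push_cast
    rw [add_mul, Complex.exp_add, Complex.exp_two_pi_mul_I, mul_one]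
  have hinner : ∀ b, ∫ a, φ (a, b) ∂angleMeasure = pairAvg (fun _ => 1) (pairPot G) (v j, v k) := by
    intro b
    rw [integral_angleMeasure, pairAvg]
    congr 1
    -- The shift of the first angle that remains after a common rotation has brought the argument of
    -- the second coordinate to `b`.
    set c := (v j).arg - (v k).arg + b
    have h1 : ∀ s : ℝ, 1 * pairPot G (rotLeft s (v j, v k)) = φ (s + c, b) := by
      intro s
      have hn : ‖Complex.exp (((b - (v k).arg : ℝ) : ℂ) * Complex.I)‖ = 1 :=
        Complex.norm_exp_ofReal_mul_I _
      rw [one_mul, ← pairPot_rot hn, rotLeft_apply]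
      simp only [hφ]
      congr 1
      ext1
      · calc Complex.exp (((b - (v k).arg : ℝ) : ℂ) * Complex.I) *
              (Complex.exp ((s : ℂ) * Complex.I) * v j)
            = Complex.exp (((b - (v k).arg : ℝ) : ℂ) * Complex.I) * (Complex.exp
              ((s : ℂ) * Complex.I) * (‖v j‖ * Complex.exp ((v j).arg * Complex.I))) := by
                rw [Complex.norm_mul_exp_arg_mul_I]
          _ = ‖v j‖ * (Complex.exp (((b - (v k).arg : ℝ) : ℂ) * Complex.I) * Complex.exp
              ((s : ℂ) * Complex.I) * Complex.exp ((v j).arg * Complex.I)) := by ring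
          _ = _ := by
            rw [← Complex.exp_add, ← Complex.exp_add, ← add_mul, ← add_mul]
            congr 3
            simp only [c]
            push_cast
            ring
      · calc Complex.exp (((b - (v k).arg : ℝ) : ℂ) * Complex.I) * v k
            = Complex.exp (((b - (v k).arg : ℝ) : ℂ) * Complex.I) *
              (‖v k‖ * Complex.exp ((v k).arg * Complex.I)) := by
                rw [Complex.norm_mul_exp_arg_mul_I]
          _ = ‖v k‖ * (Complex.exp (((b - (v k).arg : ℝ) : ℂ) * Complex.I) *
              Complex.exp ((v k).arg * Complex.I)) := by ring
          _ = _ := by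
            rw [← Complex.exp_add, ← add_mul]
            congr 3
            push_cast
            ring
    simp only [h1]
    rw [intervalIntegral.integral_comp_add_right (fun s => φ (s, b)), zero_add, add_comm]
    have h2 := (hper b).intervalIntegral_add_eq 0 c
    rw [zero_add] at h2
    exact h2
  rw [angleAvg_eq_integral]
  have h3 := integral_pi_angle_pair hjk hφc
  simp only [hinner, integral_const, probReal_univ, one_smul] at h3
  exact h3

variable {F : (Fin d → ℤ) → ℝ → ℝ} {G : ℝ → ℝ} {ε : ℝ}

lemma hamiltonian_eq (u : Phase Λ) :
    hamiltonian F G ε Λ u = freeHam F u + √ε * pairSum (fun _ => 1) (pairPot G) u := by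
  rw [hamiltonian, freeHam, pairSum, ← mul_assoc, mul_one_div]
  simp only [one_mul, pairPot]

lemma hamiltonian0_eq (hG : Continuous (pairPot G)) (v : Phase Λ) :
    hamiltonian0 F G ε Λ v =
      freeHam F v + √ε * pairSum (fun _ => 1) (pairAvg (fun _ => 1) (pairPot G)) v := by
  rw [hamiltonian0, freeHam, pairSum, ← mul_assoc, mul_one_div]
  congr 2
  refine Finset.sum_congr rfl fun j _ => Finset.sum_congr rfl fun k _ => ?_
  split_ifs with h
  · rw [angleAvg_pair hG (ne_of_dist1_eq_one h), one_mul]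
  · rfl

lemma hamiltonian0_congr {v w : Phase Λ} (h : ∀ k, ‖v k‖ = ‖w k‖) :
    hamiltonian0 F G ε Λ v = hamiltonian0 F G ε Λ w := by
  simp only [hamiltonian0, angleAvg, h]

end AngleAverage

end Rotators

namespace Rotators

/-! ### The remainder `H_>` and its gradient -/

section Remainder

/-- The third order Taylor estimate for a Hamiltonian along the flow of the transformation. -/
theorem abs_third_order_remainder_le {δ M N : ℝ} (hδ : 0 ≤ δ) {h D P D₁ P₁ D₂ : ℝ → ℝ}
    (hh : ∀ s, HasDerivAt h (δ * (-D s + δ * P s)) s)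
    (hD : ∀ s, HasDerivAt D (δ * D₁ s) s) (hP : ∀ s, HasDerivAt P (δ * P₁ s) s)
    (hD₁ : ∀ s, HasDerivAt D₁ (δ * D₂ s) s)
    (hM : ∀ s ∈ Set.Icc (0 : ℝ) 1, |D₂ s| ≤ M) (hN : ∀ s ∈ Set.Icc (0 : ℝ) 1, |P₁ s| ≤ N) :
    |h 1 - h 0 + δ * D 0 - δ ^ 2 * P 0 + δ ^ 2 / 2 * D₁ 0| ≤ δ ^ 3 * (M + N) := by
  have hM0 : 0 ≤ M := (abs_nonneg _).trans (hM 0 (Set.left_mem_Icc.2 zero_le_one))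
  have hN0 : 0 ≤ N := (abs_nonneg _).trans (hN 0 (Set.left_mem_Icc.2 zero_le_one))
  have mv : ∀ {k k' : ℝ → ℝ} {C : ℝ}, 0 ≤ C → (∀ s, HasDerivAt k (k' s) s) →
      (∀ s ∈ Set.Icc (0 : ℝ) 1, |k' s| ≤ C) → ∀ s ∈ Set.Icc (0 : ℝ) 1, |k s - k 0| ≤ C := by
    intro k k' C hC hk hk' s hs
    refine ((convex_Icc (0 : ℝ) 1).norm_image_sub_le_of_norm_hasDerivWithin_le
      (fun s _ => (hk s).hasDerivWithinAt) hk' (Set.left_mem_Icc.2 zero_le_one) hs).trans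
      (mul_le_of_le_one_right hC ?_)
    rw [sub_zero, Real.norm_of_nonneg hs.1]
    exact hs.2
  have h1 : ∀ s ∈ Set.Icc (0 : ℝ) 1, |D₁ s - D₁ 0| ≤ δ * M :=
    mv (by positivity) hD₁ fun s hs => by
      rw [abs_mul, abs_of_nonneg hδ]; exact mul_le_mul_of_nonneg_left (hM s hs) hδ
  have h2 : ∀ s ∈ Set.Icc (0 : ℝ) 1, |P s - P 0| ≤ δ * N :=
    mv (by positivity) hP fun s hs => by
      rw [abs_mul, abs_of_nonneg hδ]; exact mul_le_mul_of_nonneg_left (hN s hs) hδ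
  have hid := fun s : ℝ => hasDerivAt_id' s
  have h3 : ∀ s ∈ Set.Icc (0 : ℝ) 1, |D s - s * (δ * D₁ 0) - D 0| ≤ δ * (δ * M) := fun s hs => by
    have := mv (k := fun s => D s - s * (δ * D₁ 0)) (k' := fun s => δ * D₁ s - 1 * (δ * D₁ 0))
      (C := δ * (δ * M)) (by positivity) (fun s => (hD s).sub ((hid s).mul_const _))
      (fun s hs => by
        rw [one_mul, ← mul_sub, abs_mul, abs_of_nonneg hδ]
        exact mul_le_mul_of_nonneg_left (h1 s hs) hδ) s hs
    simpa using this
  -- The second order Taylor polynomial is subtracted; its derivative cancels that of `h` up to the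
  -- first order error of `D` and the zeroth order error of `P`, each already one factor of `δ`
  -- smaller.
  have h4 := mv (k := fun s => h s + s * (δ * D 0) - s * (δ ^ 2 * P 0) + s ^ 2 * (δ ^ 2 / 2 * D₁ 0))
    (k' := fun s => δ * (-D s + δ * P s) + 1 * (δ * D 0) - 1 * (δ ^ 2 * P 0) +
      (2 * s) * (δ ^ 2 / 2 * D₁ 0)) (C := δ * (δ * (δ * M)) + δ ^ 2 * (δ * N)) (by positivity)
    (fun s => (((hh s).add ((hid s).mul_const _)).sub ((hid s).mul_const _)).add
      (HasDerivAt.mul_const (by simpa using hasDerivAt_pow 2 s) _))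
    (fun s hs => by
      have e : δ * (-D s + δ * P s) + 1 * (δ * D 0) - 1 * (δ ^ 2 * P 0) +
          (2 * s) * (δ ^ 2 / 2 * D₁ 0) =
          -(δ * (D s - s * (δ * D₁ 0) - D 0)) + δ ^ 2 * (P s - P 0) := by ring
      rw [e]
      refine (abs_add_le _ _).trans (add_le_add ?_ ?_)
      · rw [abs_neg, abs_mul, abs_of_nonneg hδ]
        exact mul_le_mul_of_nonneg_left (h3 s hs) hδ
      · rw [abs_mul, abs_of_nonneg (sq_nonneg δ)]
        exact mul_le_mul_of_nonneg_left (h2 s hs) (sq_nonneg δ)) 1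
    (Set.right_mem_Icc.2 zero_le_one)
  refine le_trans (le_of_eq ?_) (h4.trans (le_of_eq (by ring)))
  congr 1
  ring

variable {d : ℕ} {Λ : Finset (Fin d → ℤ)} {p : ℕ} {S A A₀ B : ℂ × ℂ → ℝ} {K ε : ℝ}

/-- The constant comparing the weights of configurations at distance at most `4`. -/
noncomputable def nearConst (d q : ℕ) : ℝ := 1 + 2 ^ q + 8 ^ q * nbhdConst d 1

lemma nearConst_nonneg (d q : ℕ) : 0 ≤ nearConst d q := by
  have := nbhdConst_nonneg d 1
  unfold nearConst; positivity

/-- The radius `4` covers the two displacements that occur together: at most `3` for a perturbation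
of size one carried by the flow, and at most `1` for the flow itself. -/
lemma siteWeight_le_of_near (q : ℕ) (j : Λ) {u v : Phase Λ} (h : ∀ n, ‖u n - v n‖ ≤ 4) :
    siteWeight q j u ≤ nearConst d q * siteWeight q j v := by
  have h1 : ∀ n, ‖u n‖ ^ q ≤ 2 ^ q * ‖v n‖ ^ q + 8 ^ q := by
    intro n
    have h2 : ‖u n‖ ≤ ‖v n‖ + 4 := by
      have := norm_add_le (v n) (u n - v n)
      rw [add_sub_cancel] at this
      linarith [h n]
    calc ‖u n‖ ^ q ≤ (‖v n‖ + 4) ^ q := pow_le_pow_left₀ (norm_nonneg _) h2 q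
      _ ≤ 2 ^ (q - 1) * (‖v n‖ ^ q + 4 ^ q) := add_pow_le (norm_nonneg _) (by norm_num) q
      _ ≤ 2 ^ q * (‖v n‖ ^ q + 4 ^ q) := mul_le_mul_of_nonneg_right
          (pow_le_pow_right₀ (by norm_num) (Nat.sub_le q 1)) (by positivity)
      _ = _ := by
        rw [mul_add, ← mul_pow 2 4]
        norm_num
  have h3 : ∑ n : Λ with dist1 n j ≤ 1, ‖u n‖ ^ q ≤
      2 ^ q * ∑ n : Λ with dist1 n j ≤ 1, ‖v n‖ ^ q + nbhdConst d 1 * 8 ^ q := by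
    calc _ ≤ ∑ n : Λ with dist1 n j ≤ 1, (2 ^ q * ‖v n‖ ^ q + 8 ^ q) :=
          Finset.sum_le_sum fun n _ => h1 n
      _ ≤ _ := by
          rw [Finset.sum_add_distrib, ← Finset.mul_sum]
          exact add_le_add le_rfl (sum_nbhd_le j (by positivity) fun _ _ => le_rfl)
  have h4 : 0 ≤ ∑ n : Λ with dist1 n j ≤ 1, ‖v n‖ ^ q := by positivity
  have h5 := nbhdConst_nonneg d 1
  have h6 : (0 : ℝ) ≤ 8 ^ q * nbhdConst d 1 := by positivity
  have h7 : (0 : ℝ) ≤ 2 ^ q := by positivity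
  unfold siteWeight nearConst
  nlinarith [mul_nonneg h6 h4]

/-- The size of the changes of the second Lie derivatives. -/
noncomputable def remConst (d p : ℕ) (K : ℝ) : ℝ := 48 * lieConst2 d K * nearConst d (p - 1)

lemma remConst_nonneg (hK : 0 ≤ K) : 0 ≤ remConst d p K := by
  have := lieConst2_nonneg (d := d) hK
  have := nearConst_nonneg d (p - 1)
  unfold remConst; positivity

variable {W : Phase Λ → Phase Λ} {κ : ℝ} {X : ℝ → Phase Λ → Phase Λ}

/-- A perturbation of size `α` at `k` is felt within the range two of the term at `j` with size `3α
· 4² · decay j k`, and the term has a derivative bounded by its weight. Summing over `j` keeps the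
decay, so the bound does not see the size of `Λ`. -/
lemma abs_sum_lieTerm2_sub_le (hA : PairReg p A K) (hB : ContDiff ℝ 3 B)
    (hj : ∀ x, JetLE 1 3 B x K) (hK : 0 ≤ K) (hW : LocalField W κ) (hκ : κ ≤ 1 / 4)
    (hX : IsFlow W X) {s : ℝ} (hs : s ∈ Set.Icc (0 : ℝ) 1) (v : Phase Λ) {k : Λ} {a : Phase Λ}
    {α : ℝ} (hα0 : 0 ≤ α) (hα : α ≤ 1) (ha : ∀ j, ‖a j‖ ≤ α * decay j k) :
    |∑ j, lieTerm2 A B j (X s (v + a)) - ∑ j, lieTerm2 A B j (X s v)| ≤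
      remConst d p K * (∑ j, decay j k * siteWeight (p - 1) j v) * α := by
  rw [← Finset.sum_sub_distrib, Finset.mul_sum, Finset.sum_mul]
  refine (Finset.abs_sum_le_sum_abs _ _).trans (Finset.sum_le_sum fun j _ => ?_)
  have hflow := hW.flow_sub_apply_le hκ hX hs v hα0 ha
  have hdec := decay_nonneg j k
  have hl := lieConst2_nonneg (d := d) hK
  have h := norm_sub_le_of_dependsOn (h := (lieTerm2 A B j : Phase Λ → ℝ))
    (dependsOn_lieTerm2 (hA.contDiff.of_le (by norm_num)) hB j)
    ((contDiff_lieTerm2 (hA.contDiff.of_le (by norm_num)) hB j).differentiable (by norm_num))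
    (u := X s v) (w := X s (v + a)) (M := 3 * α * (16 * decay j k))
    (K := lieConst2 d K * (nearConst d (p - 1) * siteWeight (p - 1) j v)) (by positivity)
    (fun t ht => ?_) fun n hn => ?_
  · rw [Real.norm_eq_abs] at h
    refine h.trans (le_of_eq ?_)
    unfold remConst
    ring
  · refine ((jetLE_lieTerm2 hA hB hj hK j _).norm_fderiv_le zero_le_one le_rfl).trans
      (mul_le_mul_of_nonneg_left (siteWeight_le_of_near _ j fun n => ?_) hl)
    have e : AffineMap.lineMap (X s v) (X s (v + a)) t n - v n =
        t • (X s (v + a) n - X s v n) + (X s v - v) n := by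
      rw [AffineMap.lineMap_apply_module']
      simp only [Pi.add_apply, Pi.smul_apply, Pi.sub_apply]
      ring
    rw [e]
    have h1 : ‖t • (X s (v + a) n - X s v n)‖ ≤ 3 := by
      rw [norm_smul, Real.norm_of_nonneg ht.1]
      have h2 := hflow n
      have h3 := decay_le_one n k
      have h4 := decay_nonneg n k
      have h5 : 3 * α * decay n k ≤ 3 * 1 := by nlinarith
      calc _ ≤ 1 * 3 := mul_le_mul ht.2 (h2.trans (by linarith)) (norm_nonneg _) zero_le_one
        _ = 3 := one_mul _
    have h2 : ‖(X s v - v) n‖ ≤ 1 := (norm_le_pi_norm _ n).trans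
      ((hW.norm_flow_sub_le hX hs v).trans (by linarith))
    linarith [norm_add_le (t • (X s (v + a) n - X s v n)) ((X s v - v) n)]
  · refine (hflow n).trans (mul_le_mul_of_nonneg_left ?_ (by positivity))
    have := decay_le_of_dist1_le (l := k) (show dist1 n j ≤ 2 from hn)
    linarith

lemma hasDerivAt_comp_flow {h : Phase Λ → ℝ} (hd : Differentiable ℝ h)
    (hX : IsFlow (smallField ε Λ B) X) (v : Phase Λ) (s : ℝ) :
    HasDerivAt (fun s => h (X s v)) (√ε * fderiv ℝ h (X s v) (hamField Λ B (X s v))) s := by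
  have h1 := (hd (X s v)).hasFDerivAt.comp_hasDerivAt s (hX.hasDerivAt v s)
  rw [smallField, map_smul, smul_eq_mul] at h1
  exact h1

variable {F : (Fin d → ℤ) → ℝ → ℝ} {f : ℝ → ℝ} {ς : ℝ}

/-- The remainder `H_>` of the Hamiltonian in the new variables. -/
noncomputable def ham3 (F : (Fin d → ℤ) → ℝ → ℝ) (ε : ℝ) (A A₀ B : ℂ × ℂ → ℝ)
    (Γ : Phase Λ → Phase Λ) (v : Phase Λ) : ℝ :=
  (ε * √ε)⁻¹ * (freeHam F (Γ v) + √ε * pairSum (fun _ => 1) A (Γ v) -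
    (freeHam F v + √ε * pairSum (fun _ => 1) A₀ v) - ε * ham2 Λ A A₀ B v)

lemma contDiff_ham3 (hP : PairBounds p S A A₀ B K) (hF : ContDiff ℝ 2 (freeHam F : Phase Λ → ℝ))
    {Γ : Phase Λ → Phase Λ} (hΓ : ContDiff ℝ 2 Γ) : ContDiff ℝ 2 (ham3 F ε A A₀ B Γ) := by
  have hA : ContDiff ℝ 2 (pairSum (fun _ => 1) A : Phase Λ → ℝ) :=
    contDiff_pairSum (hP.contDiff.of_le (by norm_num))
  have hA₀ : ContDiff ℝ 2 (pairSum (fun _ => 1) A₀ : Phase Λ → ℝ) :=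
    contDiff_pairSum (hP.contDiff_avg.of_le (by norm_num))
  exact contDiff_const.mul ((((hF.comp hΓ).add (contDiff_const.mul (hA.comp hΓ))).sub
    (hF.add (contDiff_const.mul hA₀))).sub (contDiff_const.mul (contDiff_ham2 hP)))

/-- The third order estimate is applied with `δ = √ε` to the difference of the Hamiltonian along the
trajectories from `v + a` and `v`. Estimating the two remainders separately would give sums over all
sites; in the difference only the decaying influence of `a` is left. -/
lemma abs_ham3_sub_le (hε : 0 < ε) (hP : PairBounds p (pairFreq f) A A₀ B K)
    (hFd : Differentiable ℝ (freeHam F : Phase Λ → ℝ))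
    (hF : ∀ j, ∀ x : ℝ, 0 ≤ x →
      HasDerivWithinAt (F j) ((-1) ^ siteNorm j * f x) (Set.Ici 0) x)
    (hκ : √ε * fieldConst d K ≤ 1 / 4) (hX : IsFlow (smallField ε Λ B) X) (v : Phase Λ)
    {k : Λ} {a : Phase Λ} {α : ℝ} (hα0 : 0 ≤ α) (hα : α ≤ 1) (ha : ∀ j, ‖a j‖ ≤ α * decay j k) :
    |ham3 F ε A A₀ B (X 1) (v + a) - ham3 F ε A A₀ B (X 1) v| ≤
      3 * remConst d p K * (∑ j, decay j k * siteWeight (p - 1) j v) * α := by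
  have hA3 := hP.contDiff.of_le (m := 3) (by norm_num)
  have hA3' := hP.contDiff_avg.of_le (m := 3) (by norm_num)
  have hAd := hP.contDiff.of_le (m := 1) (by norm_num)
  have hAd' := hP.contDiff_avg.of_le (m := 1) (by norm_num)
  have hW := localField_smallField (Λ := Λ) (ε := ε) hP.contDiff_hom hP.jet_hom hP.nonneg
  have hsum : ∀ {A : ℂ × ℂ → ℝ}, ContDiff ℝ 3 A → ∀ v s,
      HasDerivAt (fun s => ∑ j : Λ, lieTerm A B j (X s v))
        (√ε * ∑ j, lieTerm2 A B j (X s v)) s := by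
    intro A hA v s
    rw [Finset.mul_sum]
    exact HasDerivAt.fun_sum fun j _ => hasDerivAt_comp_flow
      ((contDiff_lieTerm hA hP.contDiff_hom j).differentiable (by norm_num)) hX v s
  have hpair : ∀ {A : ℂ × ℂ → ℝ}, ContDiff ℝ 1 A → ∀ v s,
      HasDerivAt (fun s => pairSum (fun _ => 1) A (X s v))
        (√ε * ∑ j : Λ, lieTerm A B j (X s v)) s := by
    intro A hA v s
    rw [sum_lieTerm (hA.differentiable one_ne_zero)]
    exact hasDerivAt_comp_flow ((contDiff_pairSum hA).differentiable one_ne_zero) hX v s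
  set M := remConst d p K * (∑ j, decay j k * siteWeight (p - 1) j v) * α with hMdef
  have hbA : ∀ s ∈ Set.Icc (0 : ℝ) 1,
      |∑ j, lieTerm2 A B j (X s (v + a)) - ∑ j, lieTerm2 A B j (X s v)| ≤ M := fun s hs =>
    abs_sum_lieTerm2_sub_le hP.reg hP.contDiff_hom hP.jet_hom hP.nonneg hW hκ hX hs v hα0 hα ha
  have hbA' : ∀ s ∈ Set.Icc (0 : ℝ) 1,
      |∑ j, lieTerm2 A₀ B j (X s (v + a)) - ∑ j, lieTerm2 A₀ B j (X s v)| ≤ M := fun s hs =>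
    abs_sum_lieTerm2_sub_le hP.reg_avg hP.contDiff_hom hP.jet_hom hP.nonneg hW hκ hX hs v hα0 hα ha
  have hfree : ∀ v s, HasDerivAt (fun s => freeHam F (X s v)) (√ε * -(pairSum (fun _ => 1) A (X s v) -
      pairSum (fun _ => 1) A₀ (X s v))) s := by
    intro v s
    have := hasDerivAt_comp_flow hFd hX v s
    rwa [homological_equation hP hF] at this
  -- By the homological equation the first derivative of the energy is `δ(-D + δP)`, where `D` and
  -- `P` come from `A - A₀` and from the Lie derivative of `A`. The bound for `D₂` is `M + M`, one
  -- for `A` and one for `A₀`, and with `P₁` this makes the factor `3`.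
  have key := abs_third_order_remainder_le (δ := √ε) (Real.sqrt_nonneg ε) (M := M + M) (N := M)
    (h := fun s => (freeHam F (X s (v + a)) + √ε * pairSum (fun _ => 1) A (X s (v + a))) -
      (freeHam F (X s v) + √ε * pairSum (fun _ => 1) A (X s v)))
    (D := fun s => (pairSum (fun _ => 1) A (X s (v + a)) - pairSum (fun _ => 1) A₀ (X s (v + a))) -
      (pairSum (fun _ => 1) A (X s v) - pairSum (fun _ => 1) A₀ (X s v)))
    (P := fun s => ∑ j, lieTerm A B j (X s (v + a)) - ∑ j, lieTerm A B j (X s v))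
    (D₁ := fun s => (∑ j, lieTerm A B j (X s (v + a)) - ∑ j, lieTerm A₀ B j (X s (v + a))) -
      (∑ j, lieTerm A B j (X s v) - ∑ j, lieTerm A₀ B j (X s v)))
    (P₁ := fun s => ∑ j, lieTerm2 A B j (X s (v + a)) - ∑ j, lieTerm2 A B j (X s v))
    (D₂ := fun s => (∑ j, lieTerm2 A B j (X s (v + a)) - ∑ j, lieTerm2 A₀ B j (X s (v + a))) -
      (∑ j, lieTerm2 A B j (X s v) - ∑ j, lieTerm2 A₀ B j (X s v)))
    (fun s => (((hfree _ s).add ((hpair hAd _ s).const_mul _)).sub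
      ((hfree _ s).add ((hpair hAd _ s).const_mul _))).congr_deriv (by ring))
    (fun s => (((hpair hAd _ s).sub (hpair hAd' _ s)).sub
      ((hpair hAd _ s).sub (hpair hAd' _ s))).congr_deriv (by ring))
    (fun s => ((hsum hA3 _ s).sub (hsum hA3 _ s)).congr_deriv (by ring))
    (fun s => (((hsum hA3 _ s).sub (hsum hA3' _ s)).sub
      ((hsum hA3 _ s).sub (hsum hA3' _ s))).congr_deriv (by ring))
    (fun s hs => by
      rw [sub_sub_sub_comm]
      exact (abs_sub _ _).trans (add_le_add (hbA s hs) (hbA' s hs)))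
    hbA
  have hsq : √ε ^ 2 = ε := Real.sq_sqrt hε.le
  have hsq3 : √ε ^ 3 = ε * √ε := by rw [pow_succ, hsq]
  have hpos : 0 < ε * √ε := mul_pos hε (Real.sqrt_pos.2 hε)
  -- The Taylor polynomial at order two is `½ (L A + L A₀)`, since `P - ½ D₁ = L A - ½ (L A - L
  -- A₀)`. This is why `H₂` contains both potentials.
  have e : ham3 F ε A A₀ B (X 1) (v + a) - ham3 F ε A A₀ B (X 1) v = (ε * √ε)⁻¹ *
      (((freeHam F (X 1 (v + a)) + √ε * pairSum (fun _ => 1) A (X 1 (v + a))) -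
      (freeHam F (X 1 v) + √ε * pairSum (fun _ => 1) A (X 1 v))) -
      ((freeHam F (X 0 (v + a)) + √ε * pairSum (fun _ => 1) A (X 0 (v + a))) -
      (freeHam F (X 0 v) + √ε * pairSum (fun _ => 1) A (X 0 v))) +
      √ε * ((pairSum (fun _ => 1) A (X 0 (v + a)) - pairSum (fun _ => 1) A₀ (X 0 (v + a))) -
      (pairSum (fun _ => 1) A (X 0 v) - pairSum (fun _ => 1) A₀ (X 0 v))) -
      √ε ^ 2 * (∑ j, lieTerm A B j (X 0 (v + a)) - ∑ j, lieTerm A B j (X 0 v)) +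
      √ε ^ 2 / 2 * ((∑ j, lieTerm A B j (X 0 (v + a)) - ∑ j, lieTerm A₀ B j (X 0 (v + a))) -
      (∑ j, lieTerm A B j (X 0 v) - ∑ j, lieTerm A₀ B j (X 0 v)))) := by
    simp only [ham3, hX.zero, hsq, ham2, ham2Term, ← Finset.mul_sum, Finset.sum_add_distrib]
    ring
  rw [e, abs_mul, abs_of_pos (inv_pos.2 hpos), inv_mul_le_iff₀ hpos]
  refine key.trans (le_of_eq ?_)
  rw [hsq3, hMdef]
  ring

/-- The Lipschitz estimate for perturbations at the single site `k` bounds the two real partial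
derivatives, each by half of the constant. -/
lemma norm_grad_ham3_le (hε : 0 < ε) (hP : PairBounds p (pairFreq f) A A₀ B K)
    (hFd : ContDiff ℝ 2 (freeHam F : Phase Λ → ℝ))
    (hF : ∀ j, ∀ x : ℝ, 0 ≤ x →
      HasDerivWithinAt (F j) ((-1) ^ siteNorm j * f x) (Set.Ici 0) x)
    (hκ : √ε * fieldConst d K ≤ 1 / 4) (hX : IsFlow (smallField ε Λ B) X) (v : Phase Λ) (k : Λ) :
    ‖grad (ham3 F ε A A₀ B (X 1)) v k‖ ≤
      6 * remConst d p K * ∑ j, decay j k * siteWeight (p - 1) j v := by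
  have hW := localField_smallField (Λ := Λ) (ε := ε) hP.contDiff_hom hP.jet_hom hP.nonneg
  have hd : Differentiable ℝ (ham3 F ε A A₀ B (X 1)) := (contDiff_ham3 hP hFd
    (hW.contDiff_flow hκ hX (Set.right_mem_Icc.2 zero_le_one))).differentiable (by norm_num)
  have hsum : 0 ≤ ∑ j, decay j k * siteWeight (p - 1) j v :=
    Finset.sum_nonneg fun j _ => mul_nonneg (decay_nonneg _ _) (siteWeight_pos _ _ _).le
  have hrem := remConst_nonneg (d := d) (p := p) hP.nonneg
  have key : ∀ z : ℂ, ‖z‖ = 1 → ‖fderiv ℝ (ham3 F ε A A₀ B (X 1)) v (Pi.single k z)‖ ≤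
      3 * remConst d p K * ∑ j, decay j k * siteWeight (p - 1) j v := by
    intro z hz
    set a : Phase Λ := Pi.single k z with ha
    have h3 : HasDerivAt (fun t : ℝ => ham3 F ε A A₀ B (X 1) (v + t • a))
        (fderiv ℝ (ham3 F ε A A₀ B (X 1)) v a) 0 := (hd v).hasFDerivAt.hasLineDerivAt a
    refine h3.le_of_lip' (by positivity) ?_
    filter_upwards [Metric.ball_mem_nhds (0 : ℝ) one_pos] with t ht
    rw [mem_ball_zero_iff] at ht
    rw [zero_smul, add_zero, sub_zero]
    refine abs_ham3_sub_le hε hP (hFd.differentiable (by norm_num)) hF hκ hX v (norm_nonneg t)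
      ht.le fun j => ?_
    rw [Pi.smul_apply, norm_smul]
    refine mul_le_mul_of_nonneg_left ?_ (norm_nonneg t)
    have := LocalField.norm_single_apply_le k j z
    rwa [hz, one_mul] at this
  rw [grad]
  refine (norm_add_le _ _).trans ?_
  rw [norm_mul, Complex.norm_I, one_mul, Complex.norm_real, Complex.norm_real]
  have h1 := key 1 norm_one
  have h2 := key Complex.I Complex.norm_I
  linarith

end Remainder

end Rotators

namespace Rotators

/-! ### Weighted norms of functions with exponentially decaying kernels -/

section WeightedNorms

variable {d : ℕ} {Λ : Finset (Fin d → ℤ)}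

/-- Jensen's inequality after normalization of the weights. Total weight at least one allows the
normalizing division to be dropped on the right. -/
lemma rpow_sum_mul_le {ι : Type*} (s : Finset ι) {c w : ι → ℝ} (hc : ∀ i ∈ s, 0 ≤ c i)
    (hw : ∀ i ∈ s, 0 ≤ w i) (hZ : 1 ≤ ∑ i ∈ s, c i) {q Z : ℝ} (hq : 1 ≤ q)
    (hZ' : ∑ i ∈ s, c i ≤ Z) :
    (∑ i ∈ s, c i * w i) ^ q ≤ Z ^ q * ∑ i ∈ s, c i * w i ^ q := by
  set Y := ∑ i ∈ s, c i with hY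
  have hY0 : 0 < Y := zero_lt_one.trans_le hZ
  have hj := Real.rpow_arith_mean_le_arith_mean_rpow s (fun i => c i / Y) w
    (fun i hi => div_nonneg (hc i hi) hY0.le)
    (by rw [← Finset.sum_div]; exact div_self hY0.ne') hw hq
  have hnn : 0 ≤ ∑ i ∈ s, c i / Y * w i :=
    Finset.sum_nonneg fun i hi => mul_nonneg (div_nonneg (hc i hi) hY0.le) (hw i hi)
  have e : ∑ i ∈ s, c i * w i = Y * ∑ i ∈ s, c i / Y * w i := by
    rw [Finset.mul_sum]
    exact Finset.sum_congr rfl fun i _ => by field_simp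
  rw [e, Real.mul_rpow hY0.le hnn]
  refine mul_le_mul (Real.rpow_le_rpow hY0.le hZ' (by linarith)) (hj.trans ?_)
    (Real.rpow_nonneg hnn _) (Real.rpow_nonneg (hY0.le.trans hZ') _)
  exact Finset.sum_le_sum fun i hi => mul_le_mul_of_nonneg_right
    (div_le_self (hc i hi) hZ) (Real.rpow_nonneg (hw i hi) _)

lemma one_add_rpow_le {x q : ℝ} (hx : 0 ≤ x) (hq : 0 ≤ q) :
    (1 + x) ^ q ≤ 2 ^ q * (1 + x ^ q) := by
  have h1 : (1 + x) ≤ 2 * max 1 x := by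
    linarith [le_max_left 1 x, le_max_right 1 x]
  have h2 : (max 1 x) ^ q ≤ 1 + x ^ q := by
    rcases le_total 1 x with h | h
    · rw [max_eq_right h]; linarith
    · rw [max_eq_left h, Real.one_rpow]; linarith [Real.rpow_nonneg hx q]
  calc (1 + x) ^ q ≤ (2 * max 1 x) ^ q := Real.rpow_le_rpow (by linarith) h1 hq
    _ = 2 ^ q * (max 1 x) ^ q := Real.mul_rpow zero_le_two (le_max_of_le_left zero_le_one)
    _ ≤ _ := mul_le_mul_of_nonneg_left h2 (Real.rpow_nonneg zero_le_two _)

/-- The summand `1` of the weight is distributed over the ball, which is not empty, so that Jensen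
applies to the terms `1 + |v_m|^{p-1}`. -/
lemma siteWeight_rpow_le {p : ℕ} (hp : 1 ≤ p) (n : Λ) (v : Phase Λ) {q : ℝ} (hq : 1 ≤ q) :
    siteWeight (p - 1) n v ^ q ≤ nbhdConst d 1 ^ q * (2 ^ q *
      ∑ m with dist1 m n ≤ 1, (1 + ‖v m‖ ^ (q * ((p : ℝ) - 1)))) := by
  have hn : n ∈ Finset.univ.filter fun m : Λ => dist1 m n ≤ 1 := by simp
  have hcard : (1 : ℝ) ≤ ((Finset.univ.filter fun m : Λ => dist1 m n ≤ 1).card : ℝ) := by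
    exact_mod_cast Finset.card_pos.2 ⟨n, hn⟩
  have h1 : siteWeight (p - 1) n v ≤ ∑ m with dist1 m n ≤ 1, 1 * (1 + ‖v m‖ ^ (p - 1)) := by
    simp only [one_mul, Finset.sum_add_distrib, Finset.sum_const, nsmul_eq_mul, mul_one]
    exact add_le_add hcard le_rfl
  refine (Real.rpow_le_rpow (siteWeight_pos _ _ _).le h1 (by linarith)).trans ?_
  refine (rpow_sum_mul_le _ (fun _ _ => zero_le_one) (fun m _ => by positivity) ?_ hq
    (Z := nbhdConst d 1) ?_).trans (mul_le_mul_of_nonneg_left ?_ 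
      (Real.rpow_nonneg (nbhdConst_nonneg _ _) _))
  · simpa using hcard
  · simpa using card_nbhd_le 1 n
  · rw [Finset.mul_sum]
    refine Finset.sum_le_sum fun m _ => ?_
    rw [one_mul]
    refine (one_add_rpow_le (by positivity) (by linarith)).trans (le_of_eq ?_)
    rw [← Real.rpow_natCast_mul (norm_nonneg _), Nat.cast_sub hp, Nat.cast_one, mul_comm q]

/-- Since `1/4 ≤ γ/2`, the decay splits into `(1/2)^{|n-k|}`, which pays for the summation, and
`γ^{|n-k|}`, which transports the weight from `k` to `n` by the triangle inequality. -/
lemma sum_pow_mul_decay_le {γ : ℝ} (h1 : 1 / 2 < γ) (h2 : γ < 1) (j n : Λ) :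
    ∑ k, γ ^ dist1 k j * decay n k ≤ latticeConst d (1 / 2) * γ ^ dist1 n j := by
  have hγ : 0 < γ := by linarith
  calc _ ≤ ∑ k, (1 / 2 : ℝ) ^ dist1 n k * γ ^ dist1 n j := by
        refine Finset.sum_le_sum fun k _ => ?_
        have h3 : γ ^ (dist1 n k + dist1 k j) ≤ γ ^ dist1 n j :=
          pow_le_pow_of_le_one hγ.le h2.le (dist1_triangle n k j)
        have h4 : (1 / 4 : ℝ) ^ dist1 n k ≤ (1 / 2) ^ dist1 n k * γ ^ dist1 n k := by
          rw [← mul_pow]; exact pow_le_pow_left₀ (by norm_num) (by linarith) _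
        calc _ ≤ γ ^ dist1 k j * ((1 / 2) ^ dist1 n k * γ ^ dist1 n k) :=
              mul_le_mul_of_nonneg_left h4 (by positivity)
          _ = (1 / 2) ^ dist1 n k * γ ^ (dist1 n k + dist1 k j) := by rw [pow_add]; ring
          _ ≤ _ := mul_le_mul_of_nonneg_left h3 (by positivity)
    _ ≤ _ := by
        rw [← Finset.sum_mul]
        exact mul_le_mul_of_nonneg_right (sum_pow_dist1_le' (by norm_num) (by norm_num) n)
          (by positivity)

/-- The constant in the estimate of the remainder in the weighted norms. -/
noncomputable def normConst (d : ℕ) (c q : ℝ) : ℝ :=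
  c ^ q * latticeConst d (1 / 4) ^ q * latticeConst d (1 / 2) *
    (nbhdConst d 1 ^ q * 2 ^ q) * (2 * nbhdConst d 1)

/-- Jensen removes the power from the convolution with the decay kernel and from the neighbourhood
sum, and interchanging the sums moves the `γ`-weights onto the sites of `v`. The multiplier of the
norm of `v` does not involve `γ`: only the sum of the constants over the lattice does. -/
lemma wNormPow_le {p : ℕ} (hp : 1 ≤ p) {c : ℝ} (hc : 0 ≤ c) {r v : Phase Λ}
    (hr : ∀ k, ‖r k‖ ≤ c * ∑ n, decay n k * siteWeight (p - 1) n v) (j : Λ) {γ : ℝ}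
    (h1 : 1 / 2 < γ) (h2 : γ < 1) {q : ℝ} (hq : 1 ≤ q) :
    wNormPow γ j q r ≤ normConst d c q * latticeConst d γ +
      normConst d c q * wNormPow γ j (q * ((p : ℝ) - 1)) v := by
  have hγ : 0 < γ := by linarith
  have hL4 := latticeConst_nonneg (d := d) (x := 1 / 4) (by norm_num) (by norm_num)
  have hL2 := latticeConst_nonneg (d := d) (x := 1 / 2) (by norm_num) (by norm_num)
  have hN := nbhdConst_nonneg d 1
  set e := q * ((p : ℝ) - 1)
  set x : Λ → ℝ := fun m => 1 + ‖v m‖ ^ e with hx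
  have hx0 : ∀ m, 0 ≤ x m := fun m => by
    have := Real.rpow_nonneg (norm_nonneg (v m)) e
    simp only [hx]; linarith
  have hw0 : ∀ n, 0 ≤ siteWeight (p - 1) n v := fun n => (siteWeight_pos _ _ _).le
  have step1 : ∀ k, ‖r k‖ ^ q ≤ c ^ q * latticeConst d (1 / 4) ^ q *
      ∑ n, decay n k * siteWeight (p - 1) n v ^ q := by
    intro k
    have hs : 0 ≤ ∑ n, decay n k * siteWeight (p - 1) n v :=
      Finset.sum_nonneg fun n _ => mul_nonneg (decay_nonneg _ _) (hw0 n)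
    refine (Real.rpow_le_rpow (norm_nonneg _) (hr k) (by linarith)).trans ?_
    rw [Real.mul_rpow hc hs, mul_assoc]
    refine mul_le_mul_of_nonneg_left (rpow_sum_mul_le _ (fun n _ => decay_nonneg n k)
      (fun n _ => hw0 n) ?_ hq (sum_decay_le k)) (Real.rpow_nonneg hc _)
    rw [← decay_self k]
    exact Finset.single_le_sum (fun n _ => decay_nonneg n k) (Finset.mem_univ k)
  have step2 : ∑ k, γ ^ dist1 k j * ∑ n, decay n k * siteWeight (p - 1) n v ^ q ≤
      latticeConst d (1 / 2) * ∑ n, γ ^ dist1 n j * siteWeight (p - 1) n v ^ q := by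
    calc _ = ∑ n, (∑ k, γ ^ dist1 k j * decay n k) * siteWeight (p - 1) n v ^ q := by
          simp only [Finset.mul_sum, Finset.sum_mul]
          rw [Finset.sum_comm]
          exact Finset.sum_congr rfl fun _ _ => Finset.sum_congr rfl fun _ _ => by ring
      _ ≤ ∑ n, latticeConst d (1 / 2) * γ ^ dist1 n j * siteWeight (p - 1) n v ^ q :=
          Finset.sum_le_sum fun n _ => mul_le_mul_of_nonneg_right (sum_pow_mul_decay_le h1 h2 j n)
            (Real.rpow_nonneg (hw0 n) _)
      _ = _ := by rw [Finset.mul_sum]; exact Finset.sum_congr rfl fun _ _ => by ring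
  have step3 : ∑ n, γ ^ dist1 n j * siteWeight (p - 1) n v ^ q ≤
      (nbhdConst d 1 ^ q * 2 ^ q) * ∑ n, γ ^ dist1 n j * ∑ m with dist1 m n ≤ 1, x m := by
    rw [Finset.mul_sum]
    refine Finset.sum_le_sum fun n _ => ?_
    refine (mul_le_mul_of_nonneg_left (siteWeight_rpow_le hp n v hq) (by positivity)).trans
      (le_of_eq (by ring))
  have step4 : ∑ n, γ ^ dist1 n j * ∑ m with dist1 m n ≤ 1, x m ≤
      (2 * nbhdConst d 1) * ∑ m, γ ^ dist1 m j * x m := by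
    calc _ = ∑ m, (∑ n with dist1 n m ≤ 1, γ ^ dist1 n j) * x m := by
          simp only [Finset.mul_sum, Finset.sum_mul, Finset.sum_filter]
          rw [Finset.sum_comm]
          refine Finset.sum_congr rfl fun m _ => Finset.sum_congr rfl fun n _ => ?_
          rw [dist1_comm m n]
          split_ifs <;> ring
      _ ≤ ∑ m, (nbhdConst d 1 * (2 * γ ^ dist1 m j)) * x m :=
          Finset.sum_le_sum fun m _ => mul_le_mul_of_nonneg_right
            (sum_nbhd_le m (by positivity) fun n hn =>
              pow_dist1_le h1 h2 (by rwa [dist1_comm]) j) (hx0 m)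
      _ = _ := by rw [Finset.mul_sum]; exact Finset.sum_congr rfl fun _ _ => by ring
  have step5 : ∑ m, γ ^ dist1 m j * x m ≤ latticeConst d γ + wNormPow γ j e v := by
    simp only [hx, mul_add, mul_one, Finset.sum_add_distrib]
    exact add_le_add (sum_pow_dist1_le hγ.le h2 j) le_rfl
  have hc1 : 0 ≤ c ^ q * latticeConst d (1 / 4) ^ q :=
    mul_nonneg (Real.rpow_nonneg hc _) (Real.rpow_nonneg hL4 _)
  have hc2 : 0 ≤ nbhdConst d 1 ^ q * 2 ^ q := by positivity
  calc wNormPow γ j q r ≤ ∑ k, γ ^ dist1 k j * (c ^ q * latticeConst d (1 / 4) ^ q *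
        ∑ n, decay n k * siteWeight (p - 1) n v ^ q) :=
        Finset.sum_le_sum fun k _ => mul_le_mul_of_nonneg_left (step1 k) (by positivity)
    _ = c ^ q * latticeConst d (1 / 4) ^ q *
        ∑ k, γ ^ dist1 k j * ∑ n, decay n k * siteWeight (p - 1) n v ^ q := by
        rw [Finset.mul_sum]; exact Finset.sum_congr rfl fun _ _ => by ring
    _ ≤ c ^ q * latticeConst d (1 / 4) ^ q * (latticeConst d (1 / 2) *
        ((nbhdConst d 1 ^ q * 2 ^ q) * ((2 * nbhdConst d 1) *
          (latticeConst d γ + wNormPow γ j e v)))) := by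
        refine mul_le_mul_of_nonneg_left (step2.trans (mul_le_mul_of_nonneg_left
          (step3.trans (mul_le_mul_of_nonneg_left (step4.trans
            (mul_le_mul_of_nonneg_left step5 (by positivity))) hc2)) hL2)) hc1
    _ = _ := by unfold normConst; ring

end WeightedNorms

/-! ### Diffusion coefficients of a near-identity change of variables -/

section Diffusion

variable {d : ℕ} {Λ : Finset (Fin d → ℤ)}

/-- Both Wirtinger derivatives are averages of the deviations from the identity in the directions
`1` and `i`, so the constant is not lost. -/
lemma norm_dz_sub_le {Ψ : Phase Λ → Phase Λ} (hΨ : Differentiable ℝ Ψ) (u : Phase Λ) {η : ℝ}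
    (k m : Λ) (h : ∀ z : ℂ, ‖fderiv ℝ Ψ u (Pi.single m z) k - (Pi.single m z : Phase Λ) k‖ ≤
      η * ‖z‖ * decay k m) :
    ‖dz (fun u => Ψ u k) u m - (if k = m then 1 else 0)‖ ≤ η * decay k m ∧
      ‖dzbar (fun u => Ψ u k) u m‖ ≤ η * decay k m := by
  have hd : ∀ a, fderiv ℝ (fun u => Ψ u k) u a = fderiv ℝ Ψ u a k := fun a => by
    rw [(hasFDerivAt_pi'.1 (hΨ u).hasFDerivAt k).fderiv]; rfl
  have h1 := h 1
  have h2 := h Complex.I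
  rw [norm_one, mul_one] at h1
  rw [Complex.norm_I, mul_one] at h2
  set x := fderiv ℝ Ψ u (Pi.single m 1) k with hx
  set y := fderiv ℝ Ψ u (Pi.single m Complex.I) k with hy
  have e1 : (Pi.single m (1 : ℂ) : Phase Λ) k = if k = m then 1 else 0 := Pi.single_apply ..
  have e2 : (Pi.single m Complex.I : Phase Λ) k = Complex.I * if k = m then 1 else 0 := by
    rw [Pi.single_apply, mul_ite, mul_one, mul_zero]
  rw [e1] at h1
  rw [e2] at h2
  set δ : ℂ := if k = m then 1 else 0
  have hI2 : Complex.I * Complex.I = -1 := Complex.I_mul_I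
  constructor
  · have e : dz (fun u => Ψ u k) u m - δ = ((x - δ) - Complex.I * (y - Complex.I * δ)) / 2 := by
      rw [dz, hd, hd]
      linear_combination -δ / 2 * hI2
    rw [e, norm_div, Complex.norm_ofNat, div_le_iff₀ two_pos]
    refine (norm_sub_le _ _).trans ?_
    rw [norm_mul, Complex.norm_I, one_mul]
    linarith
  · have e : dzbar (fun u => Ψ u k) u m = ((x - δ) + Complex.I * (y - Complex.I * δ)) / 2 := by
      rw [dzbar, hd, hd]
      linear_combination δ / 2 * hI2
    rw [e, norm_div, Complex.norm_ofNat, div_le_iff₀ two_pos]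
    refine (norm_add_le _ _).trans ?_
    rw [norm_mul, Complex.norm_I, one_mul]
    linarith

/-- The constant in the estimate of the diffusion coefficients. -/
noncomputable def diffConst (d : ℕ) (Tm : ℝ) : ℝ := Tm * (2 + 6 * latticeConst d (1 / 4))

lemma sum_norm_delta_mul_le (k : Λ) {c : Λ → ℝ} {η : ℝ} (hc : ∀ m, c m ≤ η) :
    ∑ m, ‖(if k = m then (1 : ℂ) else 0)‖ * c m ≤ η := by
  rw [Finset.sum_eq_single k]
  · simpa using hc k
  · intro m _ hm
    rw [if_neg (Ne.symm hm)]; simp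
  · simp

lemma norm_sum_mul_le {T : Λ → ℝ} {Tm : ℝ} (hT : ∀ m, 0 ≤ T m ∧ T m ≤ Tm) (k l : Λ) {η : ℝ}
    (hη : 0 ≤ η) (hη3 : η ≤ 3) {z : Λ → ℂ}
    (hz : ∀ m, ‖z m‖ ≤ ‖(if k = m then (1 : ℂ) else 0)‖ * η + ‖(if l = m then (1 : ℂ) else 0)‖ * η +
      2 * (η * (η * decay k m))) :
    ‖∑ m, (T m : ℂ) * z m‖ ≤ diffConst d Tm * η := by
  have hTm : 0 ≤ Tm := (hT k).1.trans (hT k).2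
  calc ‖∑ m, (T m : ℂ) * z m‖ ≤ ∑ m, Tm * ‖z m‖ := by
        refine (norm_sum_le _ _).trans (Finset.sum_le_sum fun m _ => ?_)
        rw [norm_mul, Complex.norm_real, Real.norm_of_nonneg (hT m).1]
        exact mul_le_mul_of_nonneg_right (hT m).2 (norm_nonneg _)
    _ = Tm * ∑ m, ‖z m‖ := by rw [Finset.mul_sum]
    _ ≤ Tm * (η + η + 6 * η * latticeConst d (1 / 4)) := by
        refine mul_le_mul_of_nonneg_left ((Finset.sum_le_sum fun m _ => hz m).trans ?_) hTm
        rw [Finset.sum_add_distrib, Finset.sum_add_distrib]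
        refine add_le_add (add_le_add (sum_norm_delta_mul_le k fun _ => le_rfl)
          (sum_norm_delta_mul_le l fun _ => le_rfl)) ?_
        calc ∑ m, 2 * (η * (η * decay k m)) ≤ ∑ m, 6 * η * decay k m := by
              refine Finset.sum_le_sum fun m _ => ?_
              have := mul_le_mul_of_nonneg_right hη3 (mul_nonneg hη (decay_nonneg k m))
              linarith
          _ ≤ _ := by
              rw [← Finset.mul_sum]
              exact mul_le_mul_of_nonneg_left (sum_decay_le' k) (by positivity)
    _ = _ := by unfold diffConst; ring

/-- The products are expanded around the identity. In the linear terms a Kronecker symbol leaves one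
summand; in the quadratic terms the decay makes the sum over the sites converge. Hence the error is
`O(η)` uniformly in `Λ`. -/
lemma norm_diff_sub_le {T : Λ → ℝ} {Tm : ℝ} (hT : ∀ m, 0 ≤ T m ∧ T m ≤ Tm) {η : ℝ}
    (hη : 0 ≤ η) (hη3 : η ≤ 3) {A B : Matrix Λ Λ ℂ} {x y : Λ → Λ → ℂ}
    (hA : ∀ k m, A k m = (√(T m) : ℂ) * x k m) (hB : ∀ k m, B k m = (√(T m) : ℂ) * y k m)
    (hx : ∀ k m, ‖x k m - (if k = m then 1 else 0)‖ ≤ η * decay k m)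
    (hy : ∀ k m, ‖y k m‖ ≤ η * decay k m) (k l : Λ) :
    ‖diff1 A B k l - (if k = l then (T k : ℂ) else 0)‖ ≤ diffConst d Tm * η ∧
      ‖diff2 A B k l‖ ≤ diffConst d Tm * η := by
  have hTT : ∀ m, (√(T m) : ℂ) * (√(T m) : ℂ) = T m := fun m => by
    rw [← Complex.ofReal_mul, Real.mul_self_sqrt (hT m).1]
  have hle : ∀ k m : Λ, η * decay k m ≤ η := fun k m => mul_le_of_le_one_right hη (decay_le_one k m)
  have hx' : ∀ k m, ‖x k m - (if k = m then 1 else 0)‖ ≤ η := fun k m => (hx k m).trans (hle k m)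
  have hy' : ∀ k m, ‖y k m‖ ≤ η := fun k m => (hy k m).trans (hle k m)
  have hconj : ∀ k m : Λ, (starRingEnd ℂ) (if k = m then (1 : ℂ) else 0) = if k = m then 1 else 0 :=
    fun k m => by split_ifs <;> simp
  have hsumδ : ∑ m, (T m : ℂ) * ((if k = m then 1 else 0) * (if l = m then 1 else 0)) =
      if k = l then (T k : ℂ) else 0 := by
    rw [Finset.sum_eq_single k]
    · simp only [if_true, eq_comm (a := l), mul_ite, mul_one, mul_zero]
    · intro m _ hm
      rw [if_neg (Ne.symm hm)]; simp
    · simp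
  constructor
  · have e : diff1 A B k l - (if k = l then (T k : ℂ) else 0) = ∑ m, (T m : ℂ) *
        ((if k = m then 1 else 0) * (x l m - (if l = m then 1 else 0)) +
          (if l = m then 1 else 0) * (starRingEnd ℂ) (x k m - (if k = m then 1 else 0)) +
          ((x l m - (if l = m then 1 else 0)) *
            (starRingEnd ℂ) (x k m - (if k = m then 1 else 0)) +
            y l m * (starRingEnd ℂ) (y k m))) := by
      rw [← hsumδ, diff1, Matrix.add_apply, Matrix.mul_apply, Matrix.mul_apply,
        ← Finset.sum_add_distrib, ← Finset.sum_sub_distrib]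
      refine Finset.sum_congr rfl fun m _ => ?_
      simp only [Matrix.map_apply, Matrix.transpose_apply, hA, hB, map_mul, Complex.conj_ofReal,
        map_sub, hconj]
      rw [← hTT]
      ring
    rw [e]
    refine norm_sum_mul_le hT k l hη hη3 fun m => ?_
    refine (norm_add₃_le).trans (add_le_add (add_le_add ?_ ?_) ((norm_add_le _ _).trans ?_))
    · rw [norm_mul]
      exact mul_le_mul_of_nonneg_left (hx' l m) (norm_nonneg _)
    · rw [norm_mul, RCLike.norm_conj]
      exact mul_le_mul_of_nonneg_left (hx' k m) (norm_nonneg _)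
    · rw [norm_mul, norm_mul, RCLike.norm_conj, RCLike.norm_conj, two_mul]
      exact add_le_add (mul_le_mul (hx' l m) (hx k m) (norm_nonneg _) hη)
        (mul_le_mul (hy' l m) (hy k m) (norm_nonneg _) hη)
  · have e : diff2 A B k l = ∑ m, (T m : ℂ) *
        ((if k = m then 1 else 0) * y l m + (if l = m then 1 else 0) * y k m +
          ((x l m - (if l = m then 1 else 0)) * y k m +
            y l m * (x k m - (if k = m then 1 else 0)))) := by
      rw [diff2, Matrix.add_apply, Matrix.mul_apply, Matrix.mul_apply, ← Finset.sum_add_distrib]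
      refine Finset.sum_congr rfl fun m _ => ?_
      simp only [Matrix.transpose_apply, hA, hB]
      rw [← hTT]
      ring
    rw [e]
    refine norm_sum_mul_le hT k l hη hη3 fun m => ?_
    refine (norm_add₃_le).trans (add_le_add (add_le_add ?_ ?_) ((norm_add_le _ _).trans ?_))
    · rw [norm_mul]
      exact mul_le_mul_of_nonneg_left (hy' l m) (norm_nonneg _)
    · rw [norm_mul]
      exact mul_le_mul_of_nonneg_left (hy' k m) (norm_nonneg _)
    · rw [norm_mul, norm_mul, two_mul]
      exact add_le_add (mul_le_mul (hx' l m) (hy k m) (norm_nonneg _) hη)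
        (mul_le_mul (hy' l m) (hx k m) (norm_nonneg _) hη)

end Diffusion

end Rotators

namespace Rotators

/-! ### The drift in the new variables -/

section Drift

variable {d : ℕ} {Λ : Finset (Fin d → ℤ)}

/-- The second derivative `∂²φ/∂x_l² + ∂²φ/∂y_l²`. -/
noncomputable def siteLaplacian (Ψ : Phase Λ → Phase Λ) (l : Λ) (u : Phase Λ) : Phase Λ :=
  fderiv ℝ (fderiv ℝ Ψ) u (Pi.single l 1) (Pi.single l 1) +
    fderiv ℝ (fderiv ℝ Ψ) u (Pi.single l Complex.I) (Pi.single l Complex.I)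

/-- The remainder in the drift of the transformed equation. -/
noncomputable def driftRem (H₃ : Phase Λ → ℝ) (ε : ℝ) (T : Λ → ℝ) (g : Phase Λ → Phase Λ)
    (Γ : Phase Λ ≃ Phase Λ) (v : Phase Λ) (k : Λ) : ℂ :=
  Complex.I * grad H₃ v k +
    ((√ε)⁻¹ : ℂ) * (fderiv ℝ Γ.symm (Γ v) (g (Γ v)) k - g v k) +
    ((√ε)⁻¹ / 2 : ℂ) * ∑ l, (T l : ℂ) * siteLaplacian Γ.symm l (Γ v) k

variable {Γ : Phase Λ ≃ Phase Λ} {H H₀ H₂ H₃ : Phase Λ → ℝ} {ε : ℝ} {T : Λ → ℝ}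
  {g : Phase Λ → Phase Λ}

lemma continuous_siteLaplacian {Ψ : Phase Λ → Phase Λ} (hΨ : ContDiff ℝ 2 Ψ) (l : Λ) :
    Continuous (siteLaplacian Ψ l) := by
  have h := (hΨ.fderiv_right (m := 1) (by norm_num)).continuous_fderiv (by norm_num)
  exact ((h.clm_apply continuous_const).clm_apply continuous_const).add
    ((h.clm_apply continuous_const).clm_apply continuous_const)

lemma continuous_grad {h : Phase Λ → ℝ} (hh : ContDiff ℝ 1 h) (k : Λ) :
    Continuous fun v => grad h v k := by
  simp only [grad_eq_gradL]
  exact (gradL k).continuous.comp (hh.continuous_fderiv (by norm_num))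

lemma continuous_driftRem (hΓ : IsCanonical Γ) (hH₃ : ContDiff ℝ 2 H₃) (hg : Continuous g) :
    Continuous (driftRem H₃ ε T g Γ) := by
  refine continuous_pi fun k => ?_
  have hc := hΓ.smooth.continuous
  have h1 : Continuous fun v => fderiv ℝ Γ.symm (Γ v) (g (Γ v)) k :=
    (continuous_apply k).comp (((hΓ.smooth_symm.continuous_fderiv (by norm_num)).comp hc).clm_apply
      (hg.comp hc))
  have h2 : ∀ l, Continuous fun v => siteLaplacian Γ.symm l (Γ v) k := fun l =>
    (continuous_apply k).comp ((continuous_siteLaplacian hΓ.smooth_symm l).comp hc)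
  exact ((continuous_const.mul (continuous_grad (hH₃.of_le (by norm_num)) k)).add
    (continuous_const.mul (h1.sub ((continuous_apply k).comp hg)))).add
    (continuous_const.mul (continuous_finsetSum _ fun l _ => continuous_const.mul (h2 l)))

/-- The Hamiltonian part transforms exactly because `Γ` is canonical. The displacement of `g` and
the Itô correction carry a factor `ε`, and `driftRem` is what remains of them after division by
`ε√ε`. -/
lemma ito_drift_eq (hΓ : IsCanonical Γ) (hε : 0 < ε) (hT : ∀ l, 0 < T l) (hH : Differentiable ℝ H)
    (hH₀ : Differentiable ℝ H₀) (hH₂ : Differentiable ℝ H₂) (hH₃ : Differentiable ℝ H₃)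
    (heq : ∀ v, H (Γ v) = H₀ v + ε * H₂ v + ε * √ε * H₃ v) (v : Phase Λ) (k : Λ) :
    fderiv ℝ Γ.symm (Γ v) (fun j => Complex.I * grad H (Γ v) j + ε * g (Γ v) j) k +
      ∑ l, ((√(ε * T l) ^ 2 / 2 : ℝ) : ℂ) * siteLaplacian Γ.symm l (Γ v) k =
    Complex.I * grad H₀ v k + ε * (Complex.I * grad H₂ v k) + ε * g v k +
      ε * √ε * driftRem H₃ ε T g Γ v k := by
  have hsplit : (fun j => Complex.I * grad H (Γ v) j + ε * g (Γ v) j) =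
      (fun j => Complex.I * grad H (Γ v) j) + ε • g (Γ v) := by
    funext j
    rw [Pi.add_apply, Pi.smul_apply, Complex.real_smul]
  have hgrad : grad (fun v => H (Γ v)) v k =
      grad H₀ v k + ε * grad H₂ v k + (ε * √ε : ℝ) * grad H₃ v k := by
    have h : (fun v => H (Γ v)) = fun v => H₀ v + ε * H₂ v + ε * √ε * H₃ v := funext heq
    have hd : Differentiable ℝ fun v => ε * H₂ v := hH₂.const_mul _
    have hd' : Differentiable ℝ fun v => H₀ v + ε * H₂ v := hH₀.add hd
    rw [h, grad_add hd' (hH₃.const_mul _), grad_add hH₀ hd, grad_const_mul hH₂,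
      grad_const_mul hH₃]
  rw [hsplit, map_add, Pi.add_apply, hΓ.fderiv_symm_hamiltonianField hH, map_smul,
    Pi.smul_apply, Complex.real_smul, driftRem]
  simp only [hgrad]
  have hs : (√ε : ℂ) ≠ 0 := by
    exact_mod_cast (Real.sqrt_pos.2 hε).ne'
  have hlap : ∑ l, ((√(ε * T l) ^ 2 / 2 : ℝ) : ℂ) * siteLaplacian Γ.symm l (Γ v) k =
      ε / 2 * ∑ l, (T l : ℂ) * siteLaplacian Γ.symm l (Γ v) k := by
    rw [Finset.mul_sum]
    refine Finset.sum_congr rfl fun l _ => ?_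
    rw [Real.sq_sqrt (mul_nonneg hε.le (hT l).le)]
    push_cast
    ring
  rw [hlap]
  push_cast
  field_simp
  ring

end Drift

/-! ### Pointwise bound for the remainder of the drift -/

section RemainderBound

variable {d : ℕ} {Λ : Finset (Fin d → ℤ)} {p : ℕ} {S A A₀ B : ℂ × ℂ → ℝ} {K ε Cg : ℝ}
  {g : Phase Λ → Phase Λ}

lemma AssumptionHg.norm_apply_le (hg : AssumptionHg p Cg Λ g) (l : Λ) (u : Phase Λ) :
    ‖g u l‖ ≤ |Cg| * siteWeight (p - 1) l u :=
  (hg.bound l u).trans (mul_le_mul_of_nonneg_right (le_abs_self _) (siteWeight_pos _ _ _).le)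

/-- The operator norm is recovered from the Wirtinger derivatives at the boundedly many sites on
which `g_l` depends. -/
lemma AssumptionHg.norm_fderiv_le (hg : AssumptionHg p Cg Λ g) (l : Λ) (u : Phase Λ) :
    ‖fderiv ℝ (fun u => g u l) u‖ ≤ nbhdConst d 1 * (2 * |Cg| * siteWeight (p - 1) l u) := by
  have hd : Differentiable ℝ fun u => g u l := (hg.smooth l).differentiable (by norm_num)
  have hdep : DependsOn (fun u => g u l) (siteBall l 1) := fun u w h =>
    hg.isLocal l u w fun k hk => h k hk
  have hw := siteWeight_pos (p - 1) l u
  refine ContinuousLinearMap.opNorm_le_bound _ (mul_nonneg (nbhdConst_nonneg _ _)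
    (by positivity)) fun a => ?_
  rw [map_eq_sum_single]
  have hterm : ∀ m, ‖fderiv ℝ (fun u => g u l) u (Pi.single m (a m))‖ ≤
      2 * |Cg| * siteWeight (p - 1) l u * ‖a‖ := by
    intro m
    have e : fderiv ℝ (fun u => g u l) u (Pi.single m (a m)) =
        dz (fun u => g u l) u m * a m + dzbar (fun u => g u l) u m * (starRingEnd ℂ) (a m) := by
      have h1 : (Pi.single m (a m) : Phase Λ) =
          (a m).re • (Pi.single m (1 : ℂ) : Phase Λ) +
            (a m).im • (Pi.single m Complex.I : Phase Λ) := by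
        rw [← Pi.single_smul, ← Pi.single_smul, ← Pi.single_add]
        congr 1
        conv_lhs => rw [← Complex.re_add_im (a m)]
        simp
      rw [h1, map_add, map_smul, map_smul, Complex.real_smul, Complex.real_smul, dz, dzbar]
      conv_rhs => rw [← Complex.re_add_im (a m)]
      simp only [map_add, map_mul, Complex.conj_ofReal, Complex.conj_I]
      linear_combination (a m).im * fderiv ℝ (fun u => g u l) u (Pi.single m Complex.I) *
        Complex.I_mul_I
    have hC : Cg * (1 + ∑ k with dist1 k l ≤ 1, ‖u k‖ ^ (p - 1)) ≤
        |Cg| * siteWeight (p - 1) l u := mul_le_mul_of_nonneg_right (le_abs_self _) hw.le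
    rw [e]
    refine (norm_add_le _ _).trans ?_
    rw [norm_mul, norm_mul, RCLike.norm_conj]
    have h1 := mul_le_mul ((hg.bound_dz l m u).trans hC) (norm_le_pi_norm a m) (norm_nonneg _)
      (by positivity)
    have h2 := mul_le_mul ((hg.bound_dzbar l m u).trans hC) (norm_le_pi_norm a m) (norm_nonneg _)
      (by positivity)
    linarith
  calc ‖∑ m, fderiv ℝ (fun u => g u l) u (Pi.single m (a m))‖
      = ‖∑ m with dist1 m l ≤ 1, fderiv ℝ (fun u => g u l) u (Pi.single m (a m))‖ := by
        rw [Finset.sum_filter]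
        congr 1
        refine Finset.sum_congr rfl fun m _ => ?_
        split_ifs with h
        · rfl
        · exact fderiv_single_eq_zero hdep hd u (k := m) h _
    _ ≤ ∑ m with dist1 m l ≤ 1, ‖fderiv ℝ (fun u => g u l) u (Pi.single m (a m))‖ :=
        norm_sum_le _ _
    _ ≤ nbhdConst d 1 * (2 * |Cg| * siteWeight (p - 1) l u * ‖a‖) :=
        sum_nbhd_le l (by positivity) fun m _ => hterm m
    _ = _ := by ring

/-- The constant in the pointwise estimate of the remainder. -/
noncomputable def driftConst (d p : ℕ) (K Cg Tm : ℝ) : ℝ :=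
  6 * remConst d p K + (12 * fieldConst d K * (|Cg| * nearConst d (p - 1)) +
    nbhdConst d 1 * (2 * |Cg| * nearConst d (p - 1)) * fieldConst d K) +
    288 * |Tm| * fieldConst d K

lemma driftConst_nonneg (hK : 0 ≤ K) (Cg Tm : ℝ) : 0 ≤ driftConst d p K Cg Tm := by
  have := remConst_nonneg (d := d) (p := p) hK
  have := fieldConst_nonneg (d := d) hK
  have := nearConst_nonneg d (p - 1)
  have := nbhdConst_nonneg d 1
  unfold driftConst
  positivity

/-- The vector is split into single-site vectors, for which the weighted estimate holds with decay
from that site. -/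
lemma norm_fderiv_flow_sub_le {W : Phase Λ → Phase Λ} {κ : ℝ} {X : ℝ → Phase Λ → Phase Λ}
    (hW : LocalField W κ) (hκ : κ ≤ 1 / 4) (hX : IsFlow W X) {s : ℝ}
    (hs : s ∈ Set.Icc (0 : ℝ) 1) (v a : Phase Λ) (k : Λ) :
    ‖fderiv ℝ (X s) v a k - a k‖ ≤ 12 * κ * ∑ l, decay l k * ‖a l‖ := by
  have e : fderiv ℝ (X s) v a k - a k =
      ∑ l, (fderiv ℝ (X s) v (Pi.single l (a l)) k - (Pi.single l (a l) : Phase Λ) k) := by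
    rw [Finset.sum_sub_distrib, map_eq_sum_single (fderiv ℝ (X s) v) a, Finset.sum_apply,
      ← Finset.sum_apply, ← Finset.sum_apply, sum_single_eq]
  rw [e, Finset.mul_sum]
  refine (norm_sum_le _ _).trans (Finset.sum_le_sum fun l _ => ?_)
  refine (hW.fderiv_flow_apply_le hκ hX hs v (norm_nonneg (a l))
    (fun j => LocalField.norm_single_apply_le l j (a l)) k).2.trans (le_of_eq ?_)
  rw [decay_comm]
  ring

/-- Each contribution divided by `√ε` contains a quantity of size `√ε`: `DΓ⁻¹ - 1` for the field, `Γ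
- 1` for its argument, `D²Γ⁻¹` for the Itô correction. Only decaying sums of weights occur. -/
theorem norm_driftRem_le {F : (Fin d → ℤ) → ℝ → ℝ} {f : ℝ → ℝ} {Tm : ℝ} {T : Λ → ℝ}
    {X : ℝ → Phase Λ → Phase Λ} (hε : 0 < ε) (hP : PairBounds p (pairFreq f) A A₀ B K)
    (hFd : ContDiff ℝ 2 (freeHam F : Phase Λ → ℝ))
    (hF : ∀ j, ∀ x : ℝ, 0 ≤ x →
      HasDerivWithinAt (F j) ((-1) ^ siteNorm j * f x) (Set.Ici 0) x)
    (hκ : √ε * fieldConst d K ≤ 1 / 4) (hX : IsFlow (smallField ε Λ B) X)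
    (hL : LipschitzWith (√ε * fieldConst d K).toNNReal (smallField ε Λ B))
    (hg : AssumptionHg p Cg Λ g) (hT : ∀ l, 0 < T l ∧ T l ≤ Tm) (v : Phase Λ) (k : Λ) :
    ‖driftRem (ham3 F ε A A₀ B (X 1)) ε T g (hX.equiv hL 1) v k‖ ≤
      driftConst d p K Cg Tm * ∑ n, decay n k * siteWeight (p - 1) n v := by
  have hK := hP.nonneg
  have hsε : 0 < √ε := Real.sqrt_pos.2 hε
  have hW := localField_smallField (Λ := Λ) (ε := ε) hP.contDiff_hom hP.jet_hom hK
  have h01 : (1 : ℝ) ∈ Set.Icc (0 : ℝ) 1 := Set.right_mem_Icc.2 zero_le_one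
  set Γ := hX.equiv hL 1
  set R := ∑ n, decay n k * siteWeight (p - 1) n v with hR
  have hfc := fieldConst_nonneg (d := d) hK
  have hnc := nearConst_nonneg d (p - 1)
  have hnb := nbhdConst_nonneg d 1
  -- `Γ⁻¹` is the time-one map of the reversed flow, so its derivatives obey the same bounds.
  have hY : IsFlow (fun u => -smallField ε Λ B u) fun s => X (-s) := hX.neg
  have hnear : ∀ n, ‖Γ v n - v n‖ ≤ √ε * fieldConst d K := fun n =>
    (norm_le_pi_norm (Γ v - v) n).trans (hW.norm_flow_sub_le hX h01 v)
  have hw : ∀ l, siteWeight (p - 1) l (Γ v) ≤ nearConst d (p - 1) * siteWeight (p - 1) l v :=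
    fun l => siteWeight_le_of_near _ l fun n => (hnear n).trans (by linarith)
  have hR1 : siteWeight (p - 1) k v ≤ R := by
    have := Finset.single_le_sum (f := fun n => decay n k * siteWeight (p - 1) n v)
      (fun n _ => mul_nonneg (decay_nonneg _ _) (siteWeight_pos _ _ _).le) (Finset.mem_univ k)
    simp only [decay_self, one_mul] at this
    exact this
  have hR0 : 0 ≤ R := (siteWeight_pos _ _ _).le.trans hR1
  have hdecR : ∑ n, decay n k ≤ R := Finset.sum_le_sum fun n _ =>
    le_mul_of_one_le_right (decay_nonneg _ _) (one_le_siteWeight _ _ _)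
  have b1 : ‖Complex.I * grad (ham3 F ε A A₀ B (X 1)) v k‖ ≤ 6 * remConst d p K * R := by
    rw [norm_mul, Complex.norm_I, one_mul]
    exact norm_grad_ham3_le hε hP hFd hF hκ hX v k
  have b2 : ‖fderiv ℝ Γ.symm (Γ v) (g (Γ v)) k - g (Γ v) k‖ ≤
      √ε * (12 * fieldConst d K * (|Cg| * nearConst d (p - 1))) * R := by
    refine (norm_fderiv_flow_sub_le hW.neg hκ hY h01 (Γ v) (g (Γ v)) k).trans ?_
    have : ∑ l, decay l k * ‖g (Γ v) l‖ ≤ |Cg| * nearConst d (p - 1) * R := by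
      rw [hR, Finset.mul_sum]
      refine Finset.sum_le_sum fun l _ => ?_
      calc decay l k * ‖g (Γ v) l‖
          ≤ decay l k * (|Cg| * (nearConst d (p - 1) * siteWeight (p - 1) l v)) :=
            mul_le_mul_of_nonneg_left ((hg.norm_apply_le l _).trans
              (mul_le_mul_of_nonneg_left (hw l) (abs_nonneg _))) (decay_nonneg _ _)
        _ = _ := by ring
    calc _ ≤ 12 * (√ε * fieldConst d K) * (|Cg| * nearConst d (p - 1) * R) :=
          mul_le_mul_of_nonneg_left this (by positivity)
      _ = _ := by ring
  have b3 : ‖g (Γ v) k - g v k‖ ≤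
      √ε * (nbhdConst d 1 * (2 * |Cg| * nearConst d (p - 1)) * fieldConst d K) * R := by
    have h := norm_sub_le_of_dependsOn (h := fun u => g u k) (s := siteBall k 1) (u := v)
      (w := Γ v) (M := √ε * fieldConst d K)
      (K := nbhdConst d 1 * (2 * |Cg| * (nearConst d (p - 1) * siteWeight (p - 1) k v)))
      (fun u w h => hg.isLocal k u w fun n hn => h n hn)
      ((hg.smooth k).differentiable (by norm_num)) (by positivity) (fun t ht => ?_)
      fun n _ => hnear n
    · refine h.trans ?_
      calc _ = √ε * (nbhdConst d 1 * (2 * |Cg| * nearConst d (p - 1)) * fieldConst d K) *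
            siteWeight (p - 1) k v := by ring
        _ ≤ _ := mul_le_mul_of_nonneg_left hR1 (by positivity)
    · refine (hg.norm_fderiv_le k _).trans (mul_le_mul_of_nonneg_left
        (mul_le_mul_of_nonneg_left (siteWeight_le_of_near _ k fun n => ?_) (by positivity)) hnb)
      have e : AffineMap.lineMap v (Γ v) t n - v n = t • (Γ v n - v n) := by
        rw [AffineMap.lineMap_apply_module']
        simp only [Pi.add_apply, Pi.smul_apply, Pi.sub_apply]
        ring
      rw [e, norm_smul, Real.norm_of_nonneg ht.1]
      calc _ ≤ 1 * (1 / 4 : ℝ) := mul_le_mul ht.2 ((hnear n).trans hκ) (norm_nonneg _) zero_le_one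
        _ ≤ 4 := by norm_num
  have b4 : ‖∑ l, (T l : ℂ) * siteLaplacian Γ.symm l (Γ v) k‖ ≤
      √ε * (576 * |Tm| * fieldConst d K) * R := by
    have hz : ∀ l (z : ℂ), ‖z‖ = 1 →
        ‖fderiv ℝ (fderiv ℝ Γ.symm) (Γ v) (Pi.single l z) (Pi.single l z) k‖ ≤
          288 * (√ε * fieldConst d K) * decay l k := by
      intro l z hz
      refine (hW.neg.fderiv_fderiv_flow_apply_le hκ hY h01 (Γ v) zero_le_one (fun j => ?_)
        k).trans (le_of_eq (by rw [decay_comm]; ring))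
      have := LocalField.norm_single_apply_le l j z
      rwa [hz] at this
    calc _ ≤ ∑ l, √ε * (576 * |Tm| * fieldConst d K) * decay l k := by
          refine (norm_sum_le _ _).trans (Finset.sum_le_sum fun l _ => ?_)
          rw [norm_mul, Complex.norm_real, Real.norm_of_nonneg (hT l).1.le]
          have h1 : ‖siteLaplacian Γ.symm l (Γ v) k‖ ≤
              576 * (√ε * fieldConst d K) * decay l k := by
            rw [siteLaplacian, Pi.add_apply]
            have h2 := hz l 1 norm_one
            have h3 := hz l Complex.I Complex.norm_I
            linarith [norm_add_le
              (fderiv ℝ (fderiv ℝ Γ.symm) (Γ v) (Pi.single l 1) (Pi.single l 1) k)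
              (fderiv ℝ (fderiv ℝ Γ.symm) (Γ v) (Pi.single l Complex.I)
                (Pi.single l Complex.I) k)]
          calc _ ≤ |Tm| * (576 * (√ε * fieldConst d K) * decay l k) :=
                mul_le_mul ((hT l).2.trans (le_abs_self _)) h1 (norm_nonneg _) (abs_nonneg _)
            _ = _ := by ring
      _ ≤ _ := by
          rw [← Finset.mul_sum]
          exact mul_le_mul_of_nonneg_left hdecR (by positivity)
  have hns : ‖((√ε)⁻¹ : ℂ)‖ = (√ε)⁻¹ := by
    rw [norm_inv, Complex.norm_real, Real.norm_of_nonneg hsε.le]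
  have b23 : ‖((√ε)⁻¹ : ℂ) * (fderiv ℝ Γ.symm (Γ v) (g (Γ v)) k - g v k)‖ ≤
      (12 * fieldConst d K * (|Cg| * nearConst d (p - 1)) +
        nbhdConst d 1 * (2 * |Cg| * nearConst d (p - 1)) * fieldConst d K) * R := by
    rw [norm_mul, hns, inv_mul_le_iff₀ hsε]
    have e : fderiv ℝ Γ.symm (Γ v) (g (Γ v)) k - g v k =
        (fderiv ℝ Γ.symm (Γ v) (g (Γ v)) k - g (Γ v) k) + (g (Γ v) k - g v k) := by ring
    rw [e]
    refine (norm_add_le _ _).trans ((add_le_add b2 b3).trans (le_of_eq (by ring)))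
  have b44 : ‖((√ε)⁻¹ / 2 : ℂ) * ∑ l, (T l : ℂ) * siteLaplacian Γ.symm l (Γ v) k‖ ≤
      288 * |Tm| * fieldConst d K * R := by
    rw [norm_mul, norm_div, Complex.norm_real, Real.norm_of_nonneg (inv_nonneg.2 hsε.le),
      Complex.norm_ofNat, div_mul_eq_mul_div, div_le_iff₀ two_pos,
      inv_mul_le_iff₀ hsε]
    exact b4.trans (le_of_eq (by ring))
  rw [driftRem]
  refine (norm_add₃_le).trans ((add_le_add (add_le_add b1 b23) b44).trans (le_of_eq ?_))
  unfold driftConst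
  ring

end RemainderBound

end Rotators

namespace Rotators

/-! ### Moments and independence of the increments of the Brownian motion -/

section Increments

variable {d : ℕ} {Λ : Finset (Fin d → ℤ)} {Ω : Type*} {mΩ : MeasurableSpace Ω}
  {ℱ : Filtration ℝ≥0 mΩ} {μ : Measure Ω} {β : ℝ≥0 → Ω → Phase Λ}

/-- The real coordinates of a point of the phase space. -/
def coord (I : Λ ⊕ Λ) (a : Phase Λ) : ℝ := Sum.elim (fun j => (a j).re) (fun j => (a j).im) I

/-- The real basis of the phase space dual to `coord`. -/
noncomputable def coordVec (I : Λ ⊕ Λ) : Phase Λ :=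
  Sum.elim (fun j => Pi.single j 1) (fun j => Pi.single j Complex.I) I

lemma continuous_coord (I : Λ ⊕ Λ) : Continuous (coord I) := by
  rcases I with j | j
  · exact Complex.continuous_re.comp (continuous_apply j)
  · exact Complex.continuous_im.comp (continuous_apply j)

lemma sum_coord_smul_coordVec (a : Phase Λ) : ∑ I, coord I a • coordVec I = a := by
  funext k
  simp only [Fintype.sum_sum_type, coord, coordVec, Sum.elim_inl, Sum.elim_inr,
    Finset.sum_apply, Pi.smul_apply]
  rw [Finset.sum_eq_single k (fun j _ hj => by rw [Pi.single_eq_of_ne hj.symm, smul_zero])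
    (fun h => absurd (Finset.mem_univ _) h),
    Finset.sum_eq_single k (fun j _ hj => by rw [Pi.single_eq_of_ne hj.symm, smul_zero])
    (fun h => absurd (Finset.mem_univ _) h), Pi.single_eq_same, Pi.single_eq_same,
    Complex.real_smul, Complex.real_smul, mul_one, Complex.re_add_im]

/-- The fourth moment of the standard Gaussian law. -/
noncomputable def gaussMoment : ℝ := ∫ x, x ^ 4 ∂(gaussianReal 0 1)

/-- By scaling, all fourth moments are multiples of that of the standard law; its numerical value is
never needed. -/
lemma integral_pow_four_gaussianReal (v : ℝ≥0) :
    ∫ x, x ^ 4 ∂(gaussianReal 0 v) = gaussMoment * (v : ℝ) ^ 2 := by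
  have h := gaussianReal_map_const_mul (μ := 0) (v := 1) (√(v : ℝ))
  have h2 : NNReal.mk (√(v : ℝ) ^ 2) (sq_nonneg _) * 1 = v := by
    rw [mul_one]
    exact NNReal.eq (Real.sq_sqrt v.coe_nonneg)
  rw [mul_zero, h2] at h
  rw [← h, integral_map (by fun_prop) (by fun_prop), gaussMoment, ← integral_mul_const]
  congr 1
  funext x
  rw [mul_pow, show √(v : ℝ) ^ 4 = (√(v : ℝ) ^ 2) ^ 2 by ring, Real.sq_sqrt v.coe_nonneg]
  ring

lemma integral_sq_gaussianReal (v : ℝ≥0) : ∫ x, x ^ 2 ∂(gaussianReal 0 v) = v := by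
  have h := variance_id_gaussianReal (μ := 0) (v := v)
  rw [variance_eq_integral (by fun_prop)] at h
  simpa using h

lemma IsComplexBrownian.hasLaw_coord (hβ : IsComplexBrownian ℱ μ β) (I : Λ ⊕ Λ) (s t : ℝ≥0) :
    HasLaw (fun ω => coord I (β t ω - β s ω)) (gaussianReal 0 (nndist t.1 s.1)) μ := by
  rcases I with j | j
  · exact (hβ.re j).hasLaw_sub t s
  · exact (hβ.im j).hasLaw_sub t s

lemma nndist_val {s t : ℝ≥0} (hst : s ≤ t) : ((nndist t.1 s.1 : ℝ≥0) : ℝ) = t - s := by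
  rw [coe_nndist, Real.dist_eq]
  exact abs_of_nonneg (sub_nonneg.2 hst)

lemma IsComplexBrownian.memLp_coord (hβ : IsComplexBrownian ℱ μ β) (I : Λ ⊕ Λ) (s t : ℝ≥0) :
    MemLp (fun ω => coord I (β t ω - β s ω)) 4 μ := by
  have h := hβ.hasLaw_coord I s t
  have := (memLp_id_gaussianReal' (μ := 0) (v := nndist t.1 s.1) 4 (by simp))
  rw [← h.map_eq] at this
  exact this.comp_of_map h.aemeasurable

lemma IsComplexBrownian.integral_coord (hβ : IsComplexBrownian ℱ μ β) (I : Λ ⊕ Λ) (s t : ℝ≥0) :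
    ∫ ω, coord I (β t ω - β s ω) ∂μ = 0 := by
  rw [(hβ.hasLaw_coord I s t).integral_eq, integral_id_gaussianReal]

lemma IsComplexBrownian.integral_coord_sq (hβ : IsComplexBrownian ℱ μ β) (I : Λ ⊕ Λ) {s t : ℝ≥0}
    (hst : s ≤ t) : ∫ ω, coord I (β t ω - β s ω) ^ 2 ∂μ = t - s := by
  have h := (hβ.hasLaw_coord I s t).integral_comp (f := fun x => x ^ 2) (by fun_prop)
  rw [integral_sq_gaussianReal, nndist_val hst] at h
  exact h

lemma IsComplexBrownian.integral_coord_pow_four (hβ : IsComplexBrownian ℱ μ β) (I : Λ ⊕ Λ)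
    {s t : ℝ≥0} (hst : s ≤ t) :
    ∫ ω, coord I (β t ω - β s ω) ^ 4 ∂μ = gaussMoment * ((t : ℝ) - s) ^ 2 := by
  have h := (hβ.hasLaw_coord I s t).integral_comp (f := fun x => x ^ 4) (by fun_prop)
  rw [integral_pow_four_gaussianReal, nndist_val hst] at h
  exact h

lemma IsComplexBrownian.integral_coord_mul (hβ : IsComplexBrownian ℱ μ β) {I J : Λ ⊕ Λ}
    (hIJ : I ≠ J) (s t : ℝ≥0) :
    ∫ ω, coord I (β t ω - β s ω) * coord J (β t ω - β s ω) ∂μ = 0 := by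
  have h := (hβ.indep.indepFun hIJ).comp (φ := fun x : ℝ≥0 → ℝ => x t - x s)
    (ψ := fun x : ℝ≥0 → ℝ => x t - x s) (by fun_prop) (by fun_prop)
  have e : ∀ I : Λ ⊕ Λ, ((fun x : ℝ≥0 → ℝ => x t - x s) ∘ fun (ω : Ω) (t : ℝ≥0) =>
      Sum.elim (fun j => (β t ω j).re) (fun j => (β t ω j).im) I) =
      fun ω => coord I (β t ω - β s ω) := by
    rintro (j | j) <;> rfl
  rw [e, e] at h
  rw [h.integral_fun_mul_eq_mul_integral (hβ.memLp_coord I s t).1 (hβ.memLp_coord J s t).1,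
    hβ.integral_coord, zero_mul]

/-- The centred product of two coordinates of an increment. -/
noncomputable def incProd (β : ℝ≥0 → Ω → Phase Λ) (I J : Λ ⊕ Λ) (s t : ℝ≥0) (ω : Ω) : ℝ :=
  coord I (β t ω - β s ω) * coord J (β t ω - β s ω) - if I = J then (t : ℝ) - s else 0

lemma IsComplexBrownian.indepFun_past (hβ : IsComplexBrownian ℱ μ β) {s t : ℝ≥0} (hst : s ≤ t)
    {f : Ω → ℝ} (hf : Measurable[ℱ s] f) {h : Phase Λ → ℝ} (hh : Measurable h) :
    IndepFun f (fun ω => h (β t ω - β s ω)) μ := by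
  rw [IndepFun_iff_Indep]
  refine indep_of_indep_of_le_left (indep_of_indep_of_le_right (hβ.indep_past s t hst) ?_)
    hf.comap_le
  have : (fun ω => h (β t ω - β s ω)) = h ∘ fun ω => β t ω - β s ω := rfl
  rw [this, ← MeasurableSpace.comap_comp]
  exact MeasurableSpace.comap_mono hh.comap_le

variable [IsProbabilityMeasure μ]

lemma IsComplexBrownian.memLp_incProd (hβ : IsComplexBrownian ℱ μ β) (I J : Λ ⊕ Λ) (s t : ℝ≥0) :
    MemLp (incProd β I J s t) 2 μ := by
  have : ENNReal.HolderTriple 4 4 2 := ⟨by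
    rw [← two_mul, show (4 : ℝ≥0∞) = 2 * 2 by norm_num,
      ENNReal.mul_inv (by simp) (by simp), ← mul_assoc, ENNReal.mul_inv_cancel (by simp) (by simp),
      one_mul]⟩
  exact ((hβ.memLp_coord J s t).mul (hβ.memLp_coord I s t)).sub (memLp_const _)

lemma IsComplexBrownian.integral_incProd (hβ : IsComplexBrownian ℱ μ β) (I J : Λ ⊕ Λ) {s t : ℝ≥0}
    (hst : s ≤ t) : ∫ ω, incProd β I J s t ω ∂μ = 0 := by
  have hi : Integrable (fun ω => coord I (β t ω - β s ω) * coord J (β t ω - β s ω)) μ :=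
    ((hβ.memLp_coord I s t).mono_exponent (p := 2) (by norm_num)).integrable_mul
      ((hβ.memLp_coord J s t).mono_exponent (p := 2) (by norm_num))
  unfold incProd
  rw [integral_sub hi (integrable_const _), integral_const, probReal_univ, one_smul]
  by_cases h : I = J
  · subst h
    rw [if_pos rfl]
    have := hβ.integral_coord_sq I hst
    simp only [sq] at this
    rw [this, sub_self]
  · rw [if_neg h, hβ.integral_coord_mul h, sub_zero]

/-- From `(xy - τ)² ≤ x⁴ + y⁴ + 2τ²`. The square of the length of the interval is essential: summed
over a partition it vanishes with the mesh. -/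
lemma IsComplexBrownian.integral_incProd_sq_le (hβ : IsComplexBrownian ℱ μ β) (I J : Λ ⊕ Λ)
    {s t : ℝ≥0} (hst : s ≤ t) :
    ∫ ω, incProd β I J s t ω ^ 2 ∂μ ≤ (2 * gaussMoment + 2) * ((t : ℝ) - s) ^ 2 := by
  have h4 : ∀ I, Integrable (fun ω => coord I (β t ω - β s ω) ^ 4) μ := fun I => by
    have := (hβ.memLp_coord I s t).integrable_norm_pow (p := 4) (by norm_num)
    simpa [Even.pow_abs (show Even 4 by decide)] using this
  have hb : Integrable (fun ω => coord I (β t ω - β s ω) ^ 4 + coord J (β t ω - β s ω) ^ 4 +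
      2 * ((t : ℝ) - s) ^ 2) μ := ((h4 I).add (h4 J)).add (integrable_const _)
  refine (integral_mono (hβ.memLp_incProd I J s t).integrable_sq hb fun ω => ?_).trans
    (le_of_eq ?_)
  · simp only [incProd]
    set x := coord I (β t ω - β s ω)
    set y := coord J (β t ω - β s ω)
    set τ := (t : ℝ) - s
    split_ifs
    · nlinarith [sq_nonneg (x * y + τ), sq_nonneg (x ^ 2 - y ^ 2)]
    · nlinarith [sq_nonneg (x ^ 2 - y ^ 2), sq_nonneg τ, sq_nonneg (x ^ 2 + y ^ 2)]
  · have e := integral_add (f := fun ω => coord I (β t ω - β s ω) ^ 4 +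
      coord J (β t ω - β s ω) ^ 4) ((h4 I).add (h4 J))
      (integrable_const (2 * ((t : ℝ) - s) ^ 2))
    rw [e, integral_add (h4 I) (h4 J),
      hβ.integral_coord_pow_four I hst, hβ.integral_coord_pow_four J hst, integral_const,
      probReal_univ, one_smul]
    ring

end Increments

end Rotators

namespace Rotators

/-! ### Orthogonality of the fluctuations of the quadratic variation -/

section Orthogonality

variable {d : ℕ} {Λ : Finset (Fin d → ℤ)} {Ω : Type*} {mΩ : MeasurableSpace Ω}
  {ℱ : Filtration ℝ≥0 mΩ} {μ : Measure Ω} {β : ℝ≥0 → Ω → Phase Λ}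

/-- The sums `∑_{i<N} ξ_i η_i` of centred products of increments with weights. -/
noncomputable def incSum (β : ℝ≥0 → Ω → Phase Λ) (I J : Λ ⊕ Λ) (s : ℕ → ℝ≥0) (ξ : ℕ → Ω → ℂ)
    (N : ℕ) (ω : Ω) : ℂ :=
  ∑ i ∈ Finset.range N, ξ i ω * (incProd β I J (s i) (s (i + 1)) ω : ℂ)

lemma IsComplexBrownian.measurable_coord (hβ : IsComplexBrownian ℱ μ β) (I : Λ ⊕ Λ) {s t r : ℝ≥0}
    (hs : s ≤ r) (ht : t ≤ r) : StronglyMeasurable[ℱ r] fun ω => coord I (β t ω - β s ω) :=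
  (continuous_coord I).comp_stronglyMeasurable
    (((hβ.adapted t).mono (ℱ.mono ht)).sub ((hβ.adapted s).mono (ℱ.mono hs)))

lemma IsComplexBrownian.measurable_incProd (hβ : IsComplexBrownian ℱ μ β) (I J : Λ ⊕ Λ)
    {s t : ℝ≥0} (hst : s ≤ t) : StronglyMeasurable[ℱ t] (incProd β I J s t) :=
  ((hβ.measurable_coord I hst le_rfl).mul (hβ.measurable_coord J hst le_rfl)).sub
    stronglyMeasurable_const

variable {s : ℕ → ℝ≥0} {ξ : ℕ → Ω → ℂ} {K : ℝ}

lemma IsComplexBrownian.measurable_incSum (hβ : IsComplexBrownian ℱ μ β) (I J : Λ ⊕ Λ)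
    (hs : Monotone s) (hξ : ∀ i, StronglyMeasurable[ℱ (s i)] (ξ i)) (N : ℕ) :
    StronglyMeasurable[ℱ (s N)] (incSum β I J s ξ N) := by
  unfold incSum
  refine Finset.stronglyMeasurable_fun_sum _ fun i hi => ?_
  have hi' : i + 1 ≤ N := Finset.mem_range.1 hi
  exact ((hξ i).mono (ℱ.mono (hs (by omega)))).mul (Complex.continuous_ofReal.comp_stronglyMeasurable
    ((hβ.measurable_incProd I J (hs (Nat.le_succ i))).mono (ℱ.mono (hs hi'))))

variable [IsProbabilityMeasure μ]

lemma IsComplexBrownian.memLp_mul_incProd (hβ : IsComplexBrownian ℱ μ β) (I J : Λ ⊕ Λ)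
    (hξ : ∀ i, StronglyMeasurable[ℱ (s i)] (ξ i)) (hK : ∀ i ω, ‖ξ i ω‖ ≤ K) (i : ℕ) :
    MemLp (fun ω => ξ i ω * (incProd β I J (s i) (s (i + 1)) ω : ℂ)) 2 μ :=
  (((hβ.memLp_incProd I J (s i) (s (i + 1))).ofReal (K := ℂ)).mul
    (memLp_top_of_bound ((hξ i).mono (ℱ.le _)).aestronglyMeasurable K
      (Eventually.of_forall fun ω => hK i ω)))

lemma IsComplexBrownian.memLp_incSum (hβ : IsComplexBrownian ℱ μ β) (I J : Λ ⊕ Λ)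
    (hξ : ∀ i, StronglyMeasurable[ℱ (s i)] (ξ i)) (hK : ∀ i ω, ‖ξ i ω‖ ≤ K) (N : ℕ) :
    MemLp (incSum β I J s ξ N) 2 μ :=
  memLp_finsetSum _ fun i _ => hβ.memLp_mul_incProd I J hξ hK i

/-- The summands are martingale increments: each centred product is independent of the past, so the
cross terms have zero mean and the variances add. Induction on the number of terms replaces
conditional expectations. -/
lemma IsComplexBrownian.integral_norm_incSum_sq_le (hβ : IsComplexBrownian ℱ μ β) (I J : Λ ⊕ Λ)
    (hs : Monotone s) (hξ : ∀ i, StronglyMeasurable[ℱ (s i)] (ξ i)) (hK : ∀ i ω, ‖ξ i ω‖ ≤ K)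
    (N : ℕ) :
    ∫ ω, ‖incSum β I J s ξ N ω‖ ^ 2 ∂μ ≤
      K ^ 2 * (2 * gaussMoment + 2) * ∑ i ∈ Finset.range N, ((s (i + 1) : ℝ) - s i) ^ 2 := by
  induction N with
  | zero => simp [incSum]
  | succ N ih =>
    set S := incSum β I J s ξ N
    set η := incProd β I J (s N) (s (N + 1))
    set ζ : Ω → ℝ := fun ω => 2 * (S ω * (starRingEnd ℂ) (ξ N ω)).re
    have hst := hs (Nat.le_succ N)
    have hS := hβ.memLp_incSum I J (s := s) hξ hK N
    have hη := hβ.memLp_incProd I J (s N) (s (N + 1))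
    have hSm := hβ.measurable_incSum I J hs hξ N
    have hζm : StronglyMeasurable[ℱ (s N)] ζ :=
      (Complex.continuous_re.comp_stronglyMeasurable
        (hSm.mul (Complex.continuous_conj.comp_stronglyMeasurable (hξ N)))).const_mul 2
    have hζ : MemLp ζ 2 μ := by
      refine (hS.norm.const_mul (2 * K)).mono ((hζm.mono (ℱ.le _)).aestronglyMeasurable)
        (Eventually.of_forall fun ω => ?_)
      have hK0 : 0 ≤ K := (norm_nonneg _).trans (hK 0 ω)
      have h1 := Complex.abs_re_le_norm (S ω * (starRingEnd ℂ) (ξ N ω))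
      rw [norm_mul, RCLike.norm_conj] at h1
      have h2 := mul_le_mul_of_nonneg_left (hK N ω) (norm_nonneg (S ω))
      rw [Real.norm_eq_abs, Real.norm_eq_abs, abs_mul, abs_two,
        abs_of_nonneg (mul_nonneg (by positivity) (norm_nonneg _))]
      change _ ≤ 2 * K * ‖S ω‖
      linarith
    -- `ζ` collects everything known at time `s N`, and `η` is a centred function of the next
    -- increment.
    have hcross : ∫ ω, ζ ω * η ω ∂μ = 0 := by
      have hind : IndepFun ζ η μ := by
        have := hβ.indepFun_past hst hζm.measurable
          (h := fun a => coord I a * coord J a - if I = J then ((s (N + 1) : ℝ≥0) : ℝ) - s N else 0)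
          (((continuous_coord I).mul (continuous_coord J)).sub continuous_const).measurable
        exact this
      rw [hind.integral_fun_mul_eq_mul_integral hζ.1 hη.1, hβ.integral_incProd I J hst, mul_zero]
    have hexp : ∀ ω, ‖incSum β I J s ξ (N + 1) ω‖ ^ 2 =
        ‖S ω‖ ^ 2 + ζ ω * η ω + ‖ξ N ω‖ ^ 2 * η ω ^ 2 := fun ω => by
      have : incSum β I J s ξ (N + 1) ω = S ω + ξ N ω * (η ω : ℂ) := Finset.sum_range_succ _ _
      rw [this, ← Complex.normSq_eq_norm_sq, Complex.normSq_add, Complex.normSq_eq_norm_sq,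
        Complex.normSq_eq_norm_sq, norm_mul, mul_pow, Complex.norm_real, Real.norm_eq_abs, sq_abs,
        map_mul, Complex.conj_ofReal, ← mul_assoc, Complex.re_mul_ofReal]
      ring
    have hi1 : Integrable (fun ω => ‖S ω‖ ^ 2) μ := hS.integrable_norm_pow (p := 2) (by norm_num)
    have hi2 : Integrable (fun ω => ζ ω * η ω) μ := hζ.integrable_mul hη
    have hi3 : Integrable (fun ω => ‖ξ N ω‖ ^ 2 * η ω ^ 2) μ := by
      refine hη.integrable_sq.bdd_mul
        (((hξ N).mono (ℱ.le _)).norm.pow 2).aestronglyMeasurable (c := K ^ 2)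
        (Eventually.of_forall fun ω => ?_)
      rw [Real.norm_eq_abs, abs_of_nonneg (by positivity)]
      exact pow_le_pow_left₀ (norm_nonneg _) (hK N ω) 2
    have h3 : ∫ ω, ‖ξ N ω‖ ^ 2 * η ω ^ 2 ∂μ ≤
        K ^ 2 * ((2 * gaussMoment + 2) * ((s (N + 1) : ℝ) - s N) ^ 2) := by
      refine (integral_mono hi3 (hη.integrable_sq.const_mul (K ^ 2)) fun ω => ?_).trans ?_
      · exact mul_le_mul_of_nonneg_right (pow_le_pow_left₀ (norm_nonneg _) (hK N ω) 2) (sq_nonneg _)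
      · rw [integral_const_mul]
        exact mul_le_mul_of_nonneg_left (hβ.integral_incProd_sq_le I J hst) (sq_nonneg _)
    have e := integral_add (f := fun ω => ‖S ω‖ ^ 2 + ζ ω * η ω) (hi1.add hi2) hi3
    simp only [hexp]
    rw [e, integral_add hi1 hi2, hcross, Finset.sum_range_succ]
    linarith

end Orthogonality

/-! ### Convergence in probability -/

section InMeasure

variable {Ω : Type*} {mΩ : MeasurableSpace Ω} {μ : Measure Ω}

lemma tendstoInMeasure_zero_of_integral_sq {f : ℕ → Ω → ℂ} (hf : ∀ n, MemLp (f n) 2 μ)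
    (h : Tendsto (fun n => ∫ ω, ‖f n ω‖ ^ 2 ∂μ) atTop (𝓝 0)) :
    TendstoInMeasure μ f atTop 0 := by
  refine tendstoInMeasure_of_tendsto_eLpNorm (p := 2) (by norm_num) (fun n => (hf n).1)
    aestronglyMeasurable_zero ?_
  simp only [sub_zero]
  have e : ∀ n, eLpNorm (f n) 2 μ = ENNReal.ofReal ((∫ ω, ‖f n ω‖ ^ 2 ∂μ) ^ ((1 : ℝ) / 2)) := by
    intro n
    have := (hf n).eLpNorm_eq_integral_rpow_norm (by norm_num) (by norm_num)
    rw [this]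
    norm_num
  simp only [e]
  have h2 := (h.rpow_const (p := (1 : ℝ) / 2) (Or.inr (by norm_num)))
  rw [Real.zero_rpow (by norm_num)] at h2
  have h3 := (ENNReal.continuous_ofReal.tendsto 0).comp h2
  rw [ENNReal.ofReal_zero] at h3
  exact h3

lemma tendstoInMeasure_zero_add {f g : ℕ → Ω → ℂ} (hf : TendstoInMeasure μ f atTop 0)
    (hg : TendstoInMeasure μ g atTop 0) : TendstoInMeasure μ (fun n ω => f n ω + g n ω) atTop 0 := by
  rw [tendstoInMeasure_iff_norm] at hf hg ⊢
  intro δ hδ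
  refine tendsto_of_tendsto_of_tendsto_of_le_of_le tendsto_const_nhds
    (h := fun n => μ {ω | δ / 2 ≤ ‖f n ω - (0 : Ω → ℂ) ω‖} + μ {ω | δ / 2 ≤ ‖g n ω - (0 : Ω → ℂ) ω‖})
    ?_ (fun _ => zero_le) fun n => ?_
  · simpa using (hf (δ / 2) (half_pos hδ)).add (hg (δ / 2) (half_pos hδ))
  · refine (measure_mono fun ω hω => ?_).trans (measure_union_le _ _)
    simp only [Set.mem_union, Set.mem_ofPred_eq, Pi.zero_apply, sub_zero] at hω ⊢
    by_contra hcon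
    rw [not_or, not_le, not_le] at hcon
    linarith [norm_add_le (f n ω) (g n ω)]

lemma tendstoInMeasure_zero_sum {ι : Type*} (A : Finset ι) {f : ι → ℕ → Ω → ℂ}
    (hf : ∀ i, TendstoInMeasure μ (f i) atTop 0) :
    TendstoInMeasure μ (fun n ω => ∑ i ∈ A, f i n ω) atTop 0 := by
  classical
  induction A using Finset.induction_on with
  | empty =>
    simp only [Finset.sum_empty]
    intro δ hδ
    simp [hδ.ne']
  | insert i A hi ih =>
    simp only [Finset.sum_insert hi]
    exact tendstoInMeasure_zero_add (hf i) ih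

/-- A bounded mean makes the factors `q n` tight by Markov's inequality: outside an event of
probability `θ / 2` they are below `M`, and there the product is large only if `f n` exceeds `δ /
M`. -/
lemma tendstoInMeasure_zero_mul [IsProbabilityMeasure μ] {f : ℕ → Ω → ℂ} {q : ℕ → Ω → ℝ} {C : ℝ}
    (hf : TendstoInMeasure μ f atTop 0) (hq0 : ∀ n ω, 0 ≤ q n ω) (hq : ∀ n, Integrable (q n) μ)
    (hC : ∀ n, ∫ ω, q n ω ∂μ ≤ C) :
    TendstoInMeasure μ (fun n ω => f n ω * (q n ω : ℂ)) atTop 0 := by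
  rw [tendstoInMeasure_iff_norm] at hf ⊢
  intro δ hδ
  rw [ENNReal.tendsto_atTop_zero]
  intro θ hθ
  rcases eq_or_ne θ ⊤ with rfl | hθt
  · exact ⟨0, fun n _ => le_top⟩
  have hθ' : 0 < θ.toReal := ENNReal.toReal_pos hθ.ne' hθt
  have hC0 : 0 ≤ C := (integral_nonneg (hq0 0)).trans (hC 0)
  set M := 2 * (C + 1) / θ.toReal with hM
  have hM0 : 0 < M := by positivity
  obtain ⟨n₀, hn₀⟩ := ENNReal.tendsto_atTop_zero.1 (hf (δ / M) (by positivity)) (θ / 2)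
    (ENNReal.half_pos hθ.ne')
  refine ⟨n₀, fun n hn => ?_⟩
  have hsub : {ω | δ ≤ ‖f n ω * (q n ω : ℂ) - (0 : Ω → ℂ) ω‖} ⊆
      {ω | δ / M ≤ ‖f n ω - (0 : Ω → ℂ) ω‖} ∪ {ω | M ≤ q n ω} := by
    intro ω hω
    by_contra hcon
    simp only [Set.mem_union, Set.mem_ofPred_eq, not_or, not_le, Pi.zero_apply, sub_zero, norm_mul,
      Complex.norm_real, Real.norm_eq_abs, abs_of_nonneg (hq0 n ω)] at hcon hω
    have h1 := mul_lt_mul'' hcon.1 hcon.2 (norm_nonneg _) (hq0 n ω)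
    rw [div_mul_cancel₀ _ hM0.ne'] at h1
    linarith
  have hmark : μ {ω | M ≤ q n ω} ≤ θ / 2 := by
    have h1 := mul_meas_ge_le_integral_of_nonneg (Eventually.of_forall (hq0 n)) (hq n) M
    have h2 : μ.real {ω | M ≤ q n ω} ≤ θ.toReal / 2 := by
      have h3 : M * μ.real {ω | M ≤ q n ω} ≤ C + 1 := h1.trans ((hC n).trans (by linarith))
      rw [hM, div_mul_eq_mul_div, div_le_iff₀ hθ'] at h3
      have : 0 < C + 1 := by linarith
      nlinarith
    have h4 := (measureReal_def μ {ω | M ≤ q n ω})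
    rw [h4] at h2
    have h5 : θ / 2 = ENNReal.ofReal (θ.toReal / 2) := by
      rw [ENNReal.ofReal_div_of_pos two_pos, ENNReal.ofReal_toReal hθt, ENNReal.ofReal_ofNat]
    rw [h5]
    exact (ENNReal.le_ofReal_iff_toReal_le (measure_ne_top _ _) (by positivity)).2 h2
  calc μ _ ≤ _ := measure_mono hsub
    _ ≤ _ := measure_union_le _ _
    _ ≤ θ / 2 + θ / 2 := add_le_add (hn₀ n hn) hmark
    _ = θ := ENNReal.add_halves θ

end InMeasure

end Rotators

namespace Rotators

/-! ### Second order Taylor expansion along individual paths -/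

section Paths

variable {E : Type*} [NormedAddCommGroup E] [NormedSpace ℝ E]
  {φ : E → ℂ}

/-- Two applications of the mean value inequality, first to the derivative and then along the
segment. Only the oscillation of the second derivative enters, so no third derivative is required.
-/
lemma norm_taylor_two_le (hφ : ContDiff ℝ 2 φ) {x y : E} {η δ : ℝ} (hδ : ‖y - x‖ ≤ δ)
    (h : ∀ z, ‖z - x‖ ≤ δ → ‖fderiv ℝ (fderiv ℝ φ) z - fderiv ℝ (fderiv ℝ φ) x‖ ≤ η) :
    ‖φ y - φ x - fderiv ℝ φ x (y - x) - (1 / 2 : ℝ) • fderiv ℝ (fderiv ℝ φ) x (y - x) (y - x)‖ ≤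
      η * ‖y - x‖ ^ 2 := by
  set v := y - x with hv
  have hd1 : Differentiable ℝ φ := hφ.differentiable (by norm_num)
  have hd2 : Differentiable ℝ (fderiv ℝ φ) :=
    (hφ.fderiv_right (m := 1) (by norm_num)).differentiable (by norm_num)
  have hη : 0 ≤ η :=
    (norm_nonneg (fderiv ℝ (fderiv ℝ φ) x - fderiv ℝ (fderiv ℝ φ) x)).trans
      (h x (by simpa using (norm_nonneg _).trans hδ))
  have hin : ∀ t ∈ Set.Icc (0 : ℝ) 1, ‖t • v‖ ≤ ‖v‖ := fun t ht => by
    rw [norm_smul, Real.norm_eq_abs, abs_of_nonneg ht.1]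
    exact mul_le_of_le_one_left (norm_nonneg _) ht.2
  have hfirst : ∀ t ∈ Set.Icc (0 : ℝ) 1, ‖fderiv ℝ φ (x + t • v) - fderiv ℝ φ x -
      fderiv ℝ (fderiv ℝ φ) x (t • v)‖ ≤ η * ‖v‖ := fun t ht => by
    have hder : ∀ z ∈ Metric.closedBall x δ, HasFDerivWithinAt
        (fun z => fderiv ℝ φ z - fderiv ℝ (fderiv ℝ φ) x z)
        (fderiv ℝ (fderiv ℝ φ) z - fderiv ℝ (fderiv ℝ φ) x) (Metric.closedBall x δ) z := fun z _ =>
      ((hd2 z).hasFDerivAt.sub (fderiv ℝ (fderiv ℝ φ) x).hasFDerivAt).hasFDerivWithinAt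
    have hmv := (convex_closedBall x δ).norm_image_sub_le_of_norm_hasFDerivWithin_le hder
      (fun z hz => h z (by rwa [← mem_closedBall_iff_norm]))
      (Metric.mem_closedBall_self ((norm_nonneg _).trans hδ)) (y := x + t • v)
      (by rw [mem_closedBall_iff_norm, add_sub_cancel_left]; exact (hin t ht).trans hδ)
    rw [add_sub_cancel_left, map_add] at hmv
    calc _ = _ := by congr 1; abel
      _ ≤ _ := hmv
      _ ≤ _ := mul_le_mul_of_nonneg_left (hin t ht) hη
  have hder : ∀ t ∈ Set.Icc (0 : ℝ) 1, HasDerivWithinAt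
      (fun t : ℝ => φ (x + t • v) - t • fderiv ℝ φ x v -
        (t ^ 2 / 2) • fderiv ℝ (fderiv ℝ φ) x v v)
      (fderiv ℝ φ (x + t • v) v - fderiv ℝ φ x v - t • fderiv ℝ (fderiv ℝ φ) x v v)
      (Set.Icc 0 1) t := fun t _ => by
    have h1 : HasDerivAt (fun t : ℝ => x + t • v) v t := by
      simpa using ((hasDerivAt_id t).smul_const v).const_add x
    have h2 : HasDerivAt (fun t : ℝ => φ (x + t • v)) (fderiv ℝ φ (x + t • v) v) t :=
      (hd1 _).hasFDerivAt.comp_hasDerivAt t h1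
    have h3 : HasDerivAt (fun t : ℝ => t • fderiv ℝ φ x v) (fderiv ℝ φ x v) t := by
      simpa using (hasDerivAt_id t).smul_const (fderiv ℝ φ x v)
    have h4 : HasDerivAt (fun t : ℝ => (t ^ 2 / 2) • fderiv ℝ (fderiv ℝ φ) x v v)
        (t • fderiv ℝ (fderiv ℝ φ) x v v) t := by
      have : HasDerivAt (fun t : ℝ => t ^ 2 / 2) t t := by
        simpa using (hasDerivAt_pow 2 t).div_const 2
      exact this.smul_const _
    exact ((h2.fun_sub h3).fun_sub h4).hasDerivWithinAt
  have hmv := norm_image_sub_le_of_norm_deriv_le_segment_01' (C := η * ‖v‖ ^ 2) hder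
    (fun t ht => by
      have := (fderiv ℝ φ (x + t • v) - fderiv ℝ φ x -
        fderiv ℝ (fderiv ℝ φ) x (t • v)).le_of_opNorm_le (hfirst t ⟨ht.1, ht.2.le⟩) v
      simp only [map_smul, sub_apply, smul_apply] at this
      exact this.trans (le_of_eq (by ring)))
  have hy : x + v = y := by rw [hv, add_sub_cancel]
  simp only [one_smul, hy, zero_smul, add_zero, one_pow, ne_eq, OfNat.ofNat_ne_zero,
    not_false_eq_true, zero_pow, zero_div, sub_zero] at hmv
  refine le_trans (le_of_eq ?_) hmv
  congr 1
  abel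

/-- The error of the stochastic Taylor expansion of order two over the interval `[s, t]`. -/
noncomputable def itoError (φ L : E → ℂ) (b : E → E) (x w : ℝ → E) (s t : ℝ) : ℂ :=
  φ (x t) - φ (x s) - (∫ r in s..t, (fderiv ℝ φ (x r) (b (x r)) + L (x r))) -
    fderiv ℝ φ (x s) (w t - w s) -
    ((1 / 2 : ℝ) • fderiv ℝ (fderiv ℝ φ) (x s) (w t - w s) (w t - w s) - (t - s) • L (x s))

variable {L : E → ℂ} {b : E → E} {x w : ℝ → E} {T : ℝ}

lemma exists_norm_sub_le_of_continuous {V : Type*} [NormedAddCommGroup V] {f : ℝ → V}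
    (hf : Continuous f) {κ : ℝ} (hκ : 0 < κ) :
    ∃ δ > 0, ∀ s ∈ Set.Icc 0 T, ∀ t ∈ Set.Icc 0 T, |t - s| ≤ δ → ‖f t - f s‖ ≤ κ := by
  obtain ⟨δ, hδ, h⟩ := Metric.uniformContinuousOn_iff_le.1
    (isCompact_Icc.uniformContinuousOn_of_continuous (hf.continuousOn (s := Set.Icc 0 T))) κ hκ
  exact ⟨δ, hδ, fun s hs t ht hst => by simpa [dist_eq_norm] using h t ht s hs hst⟩

/-- With the increment split as `B + W` into drift and noise, four errors remain: the Taylor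
remainder, freezing `Dφ` in the drift integral, the terms of the quadratic form containing `B`, and
freezing `L`. Each is small by uniform continuity of a fixed path, times `‖W‖²` or the length of the
interval. -/
lemma exists_norm_itoError_le [FiniteDimensional ℝ E] (hφ : ContDiff ℝ 2 φ) (hL : Continuous L) (hb : Continuous b)
    (hx : Continuous x) (hw : Continuous w)
    (hxw : ∀ s t, 0 ≤ s → s ≤ t → x t - x s = (∫ r in s..t, b (x r)) + (w t - w s))
    {η : ℝ} (hη : 0 < η) :
    ∃ δ > 0, ∀ s t, 0 ≤ s → s ≤ t → t ≤ T → t - s ≤ δ →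
      ‖itoError φ L b x w s t‖ ≤ η * (‖w t - w s‖ ^ 2 + (t - s)) := by
  have hD1 : Continuous (fderiv ℝ φ) := hφ.continuous_fderiv (by norm_num)
  have hD2 : Continuous (fderiv ℝ (fderiv ℝ φ)) :=
    (hφ.fderiv_right (m := 1) (by norm_num)).continuous_fderiv (by norm_num)
  have hDn : Continuous fun r => ‖fderiv ℝ (fderiv ℝ φ) (x r)‖ :=
    (continuous_norm (E := E →L[ℝ] E →L[ℝ] ℂ)).comp (hD2.comp hx)
  obtain ⟨R, hR⟩ := isCompact_Icc.exists_bound_of_continuousOn (hx.continuousOn (s := Set.Icc 0 T))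
  obtain ⟨M₁, hM₁⟩ := isCompact_Icc.exists_bound_of_continuousOn
    ((hb.comp hx).continuousOn (s := Set.Icc 0 T))
  obtain ⟨M₂, hM₂⟩ := isCompact_Icc.exists_bound_of_continuousOn
    (hDn.continuousOn (s := Set.Icc 0 T))
  set M := max 1 (max M₁ M₂) with hM
  have hM1 : 1 ≤ M := le_max_left _ _
  have hMb : ∀ r ∈ Set.Icc 0 T, ‖b (x r)‖ ≤ M := fun r hr =>
    (hM₁ r hr).trans ((le_max_left _ _).trans (le_max_right _ _))
  have hMD : ∀ r ∈ Set.Icc 0 T, ‖fderiv ℝ (fderiv ℝ φ) (x r)‖ ≤ M := fun r hr =>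
    ((le_abs_self _).trans (hM₂ r hr)).trans ((le_max_right _ _).trans (le_max_right _ _))
  -- The sum of the coefficients of the four errors: `2 + 2M²` from the Taylor remainder, then `M`,
  -- `M²` and `1`.
  set κ := 2 + 2 * M ^ 2 + M + M ^ 2 + 1 with hκ
  have hκ0 : 0 < κ := by positivity
  set η₁ := η / κ with hη₁
  have hη₁0 : 0 < η₁ := by positivity
  have hU : UniformContinuousOn (fderiv ℝ (fderiv ℝ φ)) (Metric.closedBall (0 : E) (R + 1)) :=
    (isCompact_closedBall (0 : E) (R + 1)).uniformContinuousOn_of_continuous hD2.continuousOn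
  obtain ⟨δ₀, hδ₀, h₀⟩ :=
    (Metric.uniformContinuousOn_iff_le (β := E →L[ℝ] E →L[ℝ] ℂ)).1 hU η₁ hη₁0
  -- The increment of the path must be small itself for the mixed terms, within `δ₀` for the uniform
  -- continuity of the second derivative, and at most `1` to stay in the ball of radius `R + 1`.
  set δ₁ := min η₁ (min δ₀ 1) with hδ₁
  have hδ₁0 : 0 < δ₁ := lt_min hη₁0 (lt_min hδ₀ one_pos)
  obtain ⟨δ₂, hδ₂, h₂⟩ := exists_norm_sub_le_of_continuous (T := T) hx hδ₁0
  obtain ⟨δ₃, hδ₃, h₃⟩ := exists_norm_sub_le_of_continuous (T := T) hw hη₁0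
  obtain ⟨δ₄, hδ₄, h₄⟩ := exists_norm_sub_le_of_continuous (T := T) (hD1.comp hx) hη₁0
  obtain ⟨δ₅, hδ₅, h₅⟩ := exists_norm_sub_le_of_continuous (T := T) (hL.comp hx) hη₁0
  refine ⟨min 1 (min δ₂ (min δ₃ (min δ₄ δ₅))), by positivity, fun s t hs hst htT hδ => ?_⟩
  simp only [le_min_iff] at hδ
  obtain ⟨hτ1, hτ2, hτ3, hτ4, hτ5⟩ := hδ
  have hsI : s ∈ Set.Icc 0 T := ⟨hs, hst.trans htT⟩
  have htI : t ∈ Set.Icc 0 T := ⟨hs.trans hst, htT⟩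
  have hrI : ∀ r ∈ Set.uIoc s t, r ∈ Set.Icc 0 T ∧ s ≤ r ∧ r ≤ t := fun r hr => by
    rw [Set.uIoc_of_le hst] at hr
    exact ⟨⟨hs.trans hr.1.le, hr.2.trans htT⟩, hr.1.le, hr.2⟩
  have habs : ∀ r, s ≤ r → r ≤ t → |r - s| ≤ t - s := fun r h1 h2 => by
    rw [abs_of_nonneg (sub_nonneg.2 h1)]
    linarith
  have hτ0 : 0 ≤ t - s := sub_nonneg.2 hst
  set τ := t - s with hτ
  set B := ∫ r in s..t, b (x r) with hB
  set W := w t - w s with hW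
  set Δ := x t - x s with hΔ
  have hΔe : Δ = B + W := hxw s t hs hst
  have hBn : ‖B‖ ≤ M * τ := by
    have := intervalIntegral.norm_integral_le_of_norm_le_const (a := s) (b := t)
      (f := fun r => b (x r)) (C := M) fun r hr => hMb r (hrI r hr).1
    rwa [abs_of_nonneg hτ0] at this
  have hWn : ‖W‖ ≤ η₁ := h₃ s hsI t htI ((habs t hst le_rfl).trans hτ3)
  have hΔn : ‖Δ‖ ≤ δ₁ := h₂ s hsI t htI ((habs t hst le_rfl).trans hτ2)
  have hT1 : ‖φ (x t) - φ (x s) - fderiv ℝ φ (x s) Δ -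
      (1 / 2 : ℝ) • fderiv ℝ (fderiv ℝ φ) (x s) Δ Δ‖ ≤ η₁ * ‖Δ‖ ^ 2 := by
    refine norm_taylor_two_le hφ hΔn fun z hz => ?_
    have hxs := hR s hsI
    have hz1 : ‖z - x s‖ ≤ 1 := hz.trans ((min_le_right _ _).trans (min_le_right _ _))
    have hz2 : ‖z - x s‖ ≤ δ₀ := hz.trans ((min_le_right _ _).trans (min_le_left _ _))
    refine (le_of_eq (dist_eq_norm (E := E →L[ℝ] E →L[ℝ] ℂ) _ _).symm).trans
      (h₀ z ?_ (x s) ?_ (by rwa [dist_eq_norm]))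
    · rw [mem_closedBall_zero_iff]
      calc ‖z‖ = ‖x s + (z - x s)‖ := by rw [add_sub_cancel]
        _ ≤ _ := norm_add_le _ _
        _ ≤ _ := add_le_add hxs hz1
    · rw [mem_closedBall_zero_iff]
      linarith
  have hbx : Continuous fun r => b (x r) := hb.comp hx
  have hLx : Continuous fun r => L (x r) := hL.comp hx
  have hcb : Continuous fun r => fderiv ℝ φ (x r) (b (x r)) :=
    (hD1.comp hx).clm_apply (hb.comp hx)
  have hT2 : ‖fderiv ℝ φ (x s) B - ∫ r in s..t, fderiv ℝ φ (x r) (b (x r))‖ ≤ η₁ * M * τ := by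
    have e : fderiv ℝ φ (x s) B = ∫ r in s..t, fderiv ℝ φ (x s) (b (x r)) :=
      (ContinuousLinearMap.intervalIntegral_comp_comm _
        (hbx.intervalIntegrable _ _)).symm
    rw [e, ← intervalIntegral.integral_sub
      ((continuous_const.clm_apply hbx).intervalIntegrable _ _)
      (hcb.intervalIntegrable _ _)]
    have := intervalIntegral.norm_integral_le_of_norm_le_const (a := s) (b := t)
      (f := fun r => fderiv ℝ φ (x s) (b (x r)) - fderiv ℝ φ (x r) (b (x r))) (C := η₁ * M)
      fun r hr => by
        obtain ⟨h1, h2, h3⟩ := hrI r hr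
        have h4' := h₄ s hsI r h1 ((habs r h2 h3).trans hτ4)
        rw [norm_sub_rev, ← sub_apply]
        exact (ContinuousLinearMap.le_of_opNorm_le _ h4' _).trans
          (mul_le_mul_of_nonneg_left (hMb r h1) hη₁0.le)
    rwa [abs_of_nonneg hτ0] at this
  have hT3 : ‖(1 / 2 : ℝ) • fderiv ℝ (fderiv ℝ φ) (x s) Δ Δ -
      (1 / 2 : ℝ) • fderiv ℝ (fderiv ℝ φ) (x s) W W‖ ≤ η₁ * M ^ 2 * τ := by
    set Q := fderiv ℝ (fderiv ℝ φ) (x s)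
    have hQ := hMD s hsI
    have e : (1 / 2 : ℝ) • Q Δ Δ - (1 / 2 : ℝ) • Q W W = (1 / 2 : ℝ) • (Q B Δ + Q W B) := by
      rw [← smul_sub]
      congr 1
      nth_rw 1 [hΔe]
      rw [map_add, add_apply]
      nth_rw 2 [hΔe]
      rw [map_add]
      abel
    have h1 : ‖Q B Δ‖ ≤ M * (M * τ) * η₁ :=
      (Q.le_opNorm₂ B Δ).trans (mul_le_mul (mul_le_mul hQ hBn (norm_nonneg _) (by positivity))
        (hΔn.trans (min_le_left _ _)) (norm_nonneg _) (by positivity))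
    have h2 : ‖Q W B‖ ≤ M * η₁ * (M * τ) :=
      (Q.le_opNorm₂ W B).trans (mul_le_mul (mul_le_mul hQ hWn (norm_nonneg _) (by positivity))
        hBn (norm_nonneg _) (by positivity))
    rw [e, norm_smul, Real.norm_eq_abs, abs_of_pos (by norm_num)]
    linarith [norm_add_le (Q B Δ) (Q W B)]
  have hT4 : ‖τ • L (x s) - ∫ r in s..t, L (x r)‖ ≤ η₁ * τ := by
    have e : τ • L (x s) = ∫ r in s..t, L (x s) := by rw [intervalIntegral.integral_const]
    rw [e, ← intervalIntegral.integral_sub (continuous_const.intervalIntegrable _ _)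
      (hLx.intervalIntegrable _ _)]
    have := intervalIntegral.norm_integral_le_of_norm_le_const (a := s) (b := t)
      (f := fun r => L (x s) - L (x r)) (C := η₁) fun r hr => by
        obtain ⟨h1, h2, h3⟩ := hrI r hr
        rw [norm_sub_rev]
        exact h₅ s hsI r h1 ((habs r h2 h3).trans hτ5)
    rwa [abs_of_nonneg hτ0] at this
  have hΔ2 : ‖Δ‖ ^ 2 ≤ 2 * ‖W‖ ^ 2 + 2 * M ^ 2 * τ := by
    have h1 : ‖Δ‖ ≤ ‖B‖ + ‖W‖ := hΔe ▸ norm_add_le B W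
    have h2 : ‖B‖ ^ 2 ≤ M ^ 2 * τ := by
      calc ‖B‖ ^ 2 ≤ (M * τ) ^ 2 := pow_le_pow_left₀ (norm_nonneg _) hBn 2
        _ = M ^ 2 * τ * τ := by ring
        _ ≤ M ^ 2 * τ * 1 := mul_le_mul_of_nonneg_left hτ1 (by positivity)
        _ = _ := mul_one _
    nlinarith [sq_nonneg (‖B‖ - ‖W‖), pow_le_pow_left₀ (norm_nonneg _) h1 2]
  have hsplit : itoError φ L b x w s t =
      (φ (x t) - φ (x s) - fderiv ℝ φ (x s) Δ -
        (1 / 2 : ℝ) • fderiv ℝ (fderiv ℝ φ) (x s) Δ Δ) +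
      (fderiv ℝ φ (x s) B - ∫ r in s..t, fderiv ℝ φ (x r) (b (x r))) +
      ((1 / 2 : ℝ) • fderiv ℝ (fderiv ℝ φ) (x s) Δ Δ -
        (1 / 2 : ℝ) • fderiv ℝ (fderiv ℝ φ) (x s) W W) +
      (τ • L (x s) - ∫ r in s..t, L (x r)) := by
    have e : fderiv ℝ φ (x s) Δ = fderiv ℝ φ (x s) B + fderiv ℝ φ (x s) W := by rw [hΔe, map_add]
    rw [itoError, e, intervalIntegral.integral_add (hcb.intervalIntegrable _ _)
      (hLx.intervalIntegrable _ _)]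
    abel
  rw [hsplit]
  have h1 := norm_add₄_le (a := φ (x t) - φ (x s) - fderiv ℝ φ (x s) Δ -
        (1 / 2 : ℝ) • fderiv ℝ (fderiv ℝ φ) (x s) Δ Δ)
      (b := fderiv ℝ φ (x s) B - ∫ r in s..t, fderiv ℝ φ (x r) (b (x r)))
      (c := (1 / 2 : ℝ) • fderiv ℝ (fderiv ℝ φ) (x s) Δ Δ -
        (1 / 2 : ℝ) • fderiv ℝ (fderiv ℝ φ) (x s) W W)
      (d := τ • L (x s) - ∫ r in s..t, L (x r))
  have h2 := mul_le_mul_of_nonneg_left hΔ2 hη₁0.le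
  have h3 : η₁ * (2 * ‖W‖ ^ 2 + 2 * M ^ 2 * τ) + η₁ * M * τ + η₁ * M ^ 2 * τ + η₁ * τ ≤
      η₁ * κ * (‖W‖ ^ 2 + τ) := by
    have : 0 ≤ η₁ * (2 * M ^ 2 + M + M ^ 2 + 1) * ‖W‖ ^ 2 + η₁ * 2 * τ := by positivity
    rw [hκ]
    linarith
  rw [hη₁, div_mul_cancel₀ _ hκ0.ne'] at h3
  linarith

/-- The stochastic Taylor expansion along a partition. -/
lemma norm_sum_itoError_le {s : ℕ → ℝ} {N : ℕ} {η : ℝ} (hφ : ContDiff ℝ 2 φ) (hL : Continuous L) (hb : Continuous b) (hx : Continuous x)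
    (h : ∀ i, ‖itoError φ L b x w (s i) (s (i + 1))‖ ≤
      η * (‖w (s (i + 1)) - w (s i)‖ ^ 2 + (s (i + 1) - s i))) :
    ‖φ (x (s N)) - φ (x (s 0)) - (∫ r in (s 0)..(s N), (fderiv ℝ φ (x r) (b (x r)) + L (x r))) -
      (∑ i ∈ Finset.range N, fderiv ℝ φ (x (s i)) (w (s (i + 1)) - w (s i))) -
      ∑ i ∈ Finset.range N, ((1 / 2 : ℝ) • fderiv ℝ (fderiv ℝ φ) (x (s i))
        (w (s (i + 1)) - w (s i)) (w (s (i + 1)) - w (s i)) - (s (i + 1) - s i) • L (x (s i)))‖ ≤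
      η * ((∑ i ∈ Finset.range N, ‖w (s (i + 1)) - w (s i)‖ ^ 2) + (s N - s 0)) := by
  have hc : Continuous fun r => fderiv ℝ φ (x r) (b (x r)) + L (x r) :=
    (((hφ.continuous_fderiv (by norm_num)).comp hx).clm_apply (hb.comp hx)).add (hL.comp hx)
  have h1 := Finset.sum_range_sub (fun i => φ (x (s i))) N
  have h2 := intervalIntegral.sum_integral_adjacent_intervals (μ := volume) (a := s) (n := N)
    (f := fun r => fderiv ℝ φ (x r) (b (x r)) + L (x r))
    fun i _ => hc.intervalIntegrable _ _
  have h3 := Finset.sum_range_sub s N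
  rw [← h1, ← h2, ← h3, ← Finset.sum_sub_distrib, ← Finset.sum_sub_distrib,
    ← Finset.sum_sub_distrib, ← Finset.sum_add_distrib, Finset.mul_sum]
  exact norm_sum_le_of_le _ fun i _ => h i

end Paths

end Rotators

namespace Rotators

/-! ### Approximation of continuous adapted integrands by simple ones -/

section GridIntegrand

variable {d : ℕ} {Λ : Finset (Fin d → ℤ)} {Ω : Type*} {mΩ : MeasurableSpace Ω}
  {ℱ : Filtration ℝ≥0 mΩ} {μ : Measure Ω} {u : ℝ≥0 → Ω → Phase Λ}

/-- Joint measurability in time and chance needs continuity of every path. The replacement need not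
be adapted; it only serves measurability and limits of integrals. -/
lemma exists_continuous_modification (hu : ∀ t, StronglyMeasurable (u t))
    (hc : ∀ᵐ ω ∂μ, Continuous fun t => u t ω) :
    ∃ v : ℝ≥0 → Ω → Phase Λ, (∀ t, StronglyMeasurable (v t)) ∧ (∀ ω, Continuous fun t => v t ω) ∧
      ∀ᵐ ω ∂μ, ∀ t, v t ω = u t ω := by
  obtain ⟨A, hA, hAm, hA0⟩ := exists_measurable_superset_of_null (ae_iff.1 hc)
  refine ⟨fun t => Aᶜ.indicator (u t), fun t => (hu t).indicator hAm.compl, fun ω => ?_, ?_⟩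
  · by_cases h : ω ∈ A
    · have : (fun t => Aᶜ.indicator (u t) ω) = fun _ => 0 := by
        funext t
        exact Set.indicator_of_notMem (by simpa using h) _
      rw [this]
      exact continuous_const
    · have : (fun t => Aᶜ.indicator (u t) ω) = fun t => u t ω := by
        funext t
        exact Set.indicator_of_mem h _
      rw [this]
      by_contra hn
      exact h (hA hn)
  · filter_upwards [measure_eq_zero_iff_ae_notMem.1 hA0] with ω hω t
    exact Set.indicator_of_mem hω _

lemma measurable_uncurry_path (hu : ∀ t, StronglyMeasurable (u t))
    (hc : ∀ ω, Continuous fun t => u t ω) :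
    Measurable fun q : ℝ × Ω => u q.1.toNNReal q.2 :=
  (stronglyMeasurable_uncurry_of_continuous_of_stronglyMeasurable hc hu).measurable.comp
    ((measurable_real_toNNReal.comp measurable_fst).prodMk measurable_snd)

lemma aestronglyMeasurable_integral_path (hu : ∀ t, StronglyMeasurable (u t))
    (hc : ∀ᵐ ω ∂μ, Continuous fun t => u t ω) {h : Phase Λ → ℂ} (hh : Continuous h) (T : ℝ≥0) :
    AEStronglyMeasurable (fun ω => ∫ s in (0 : ℝ)..T, h (u s.toNNReal ω)) μ := by
  obtain ⟨v, hv, hvc, hvu⟩ := exists_continuous_modification hu hc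
  refine ⟨fun ω => ∫ s in (0 : ℝ)..T, h (v s.toNNReal ω), ?_, ?_⟩
  · simp only [intervalIntegral.integral_of_le T.coe_nonneg]
    exact StronglyMeasurable.integral_prod_left
      (f := fun (s : ℝ) ω => h (v s.toNNReal ω))
      (hh.measurable.comp (measurable_uncurry_path hv hvc)).stronglyMeasurable
  · filter_upwards [hvu] with ω hω
    simp only [hω]

/-- The points `i / (n + 1)`. -/
noncomputable def gridTime (n i : ℕ) : ℝ≥0 := i / (n + 1)

lemma gridTime_mono (n : ℕ) : Monotone (gridTime n) := fun i j h => by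
  unfold gridTime
  gcongr

lemma gridTime_succ (n i : ℕ) : gridTime n (i + 1) = gridTime n i + 1 / (n + 1) := by
  simp [gridTime, add_div]

/-- The simple integrand obtained by freezing the process `H(u)` at the times `i / (n + 1)`. -/
noncomputable def gridIntegrand (hu : StronglyAdapted ℱ u) {H : Phase Λ → ℂ} (hH : Continuous H)
    (hb : ∃ K : ℝ, ∀ x, ‖H x‖ ≤ K) (n : ℕ) : SimpleIntegrand ℱ where
  n := (n + 1) ^ 2
  t := gridTime n
  ξ := fun i ω => H (u (gridTime n i) ω)
  mono := gridTime_mono n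
  adapted := fun i => hH.comp_stronglyMeasurable (hu (gridTime n i))
  bounded := ⟨hb.choose, fun _ _ => hb.choose_spec _⟩

/-- The process `H(u)` frozen at the times `i / (n + 1)`. -/
noncomputable def gridVal (u : ℝ≥0 → Ω → Phase Λ) (H : Phase Λ → ℂ) (n : ℕ) (s : ℝ≥0) (ω : Ω) : ℂ :=
  ∑ i ∈ Finset.range ((n + 1) ^ 2), (Set.Ioc (gridTime n i) (gridTime n (i + 1))).indicator
    (fun _ => H (u (gridTime n i) ω)) s

/-- The `(n + 1)²` intervals of length `1 / (n + 1)` cover `(0, n + 1]`, so both the mesh and the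
horizon improve with `n`. The intervals are open on the left, which is why the index is a ceiling
minus one and time zero is excluded. -/
lemma exists_gridVal_eq (H : Phase Λ → ℂ) {n : ℕ} {s : ℝ≥0} (hs : 0 < s) (hsn : s ≤ n + 1) :
    ∃ t ≤ s, s ≤ t + 1 / (n + 1) ∧ ∀ ω, gridVal u H n s ω = H (u t ω) := by
  have hn : (0 : ℝ≥0) < n + 1 := by positivity
  set m := ⌈s * (n + 1)⌉₊ with hm
  have hm0 : 0 < m := Nat.ceil_pos.2 (mul_pos hs hn)
  obtain ⟨i, hi⟩ : ∃ i, m = i + 1 := ⟨m - 1, by omega⟩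
  have h1 : (i : ℝ≥0) < s * (n + 1) := by
    rw [← Nat.lt_ceil, ← hm, hi]
    omega
  have h2 : s * (n + 1) ≤ ((i + 1 : ℕ) : ℝ≥0) := by
    rw [← hi, hm]
    exact Nat.le_ceil _
  have h1' : gridTime n i < s := (div_lt_iff₀ hn).2 h1
  have h2' : s ≤ gridTime n (i + 1) := (le_div_iff₀ hn).2 h2
  have hiN : i < (n + 1) ^ 2 := by
    have : (i : ℝ≥0) < ((n + 1) ^ 2 : ℕ) := by
      refine h1.trans_le ?_
      push_cast
      rw [sq]
      gcongr
    exact_mod_cast this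
  refine ⟨gridTime n i, h1'.le, gridTime_succ n i ▸ h2', fun ω => ?_⟩
  unfold gridVal
  rw [Finset.sum_eq_single i, Set.indicator_of_mem
    (show s ∈ Set.Ioc (gridTime n i) (gridTime n (i + 1)) from ⟨h1', h2'⟩)]
  · intro j _ hj
    refine Set.indicator_of_notMem (fun h => ?_) _
    rcases lt_or_gt_of_ne hj with h' | h'
    · exact absurd (h.2.trans (gridTime_mono n h')) (not_le.2 h1')
    · exact absurd (h2'.trans (gridTime_mono n h')) (not_le.2 h.1)
  · exact fun h => absurd (Finset.mem_range.2 hiN) h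

lemma tendsto_gridVal {H : Phase Λ → ℂ} (hH : Continuous H) {ω : Ω}
    (hc : Continuous fun t => u t ω) {s : ℝ≥0} (hs : 0 < s) :
    Tendsto (fun n => gridVal u H n s ω) atTop (𝓝 (H (u s ω))) := by
  have hcont : ContinuousAt (fun t => H (u t ω)) s := (hH.comp hc).continuousAt
  rw [Metric.tendsto_atTop]
  intro θ hθ
  obtain ⟨δ, hδ, h⟩ := Metric.continuousAt_iff.1 hcont θ hθ
  obtain ⟨n₀, hn₀⟩ := exists_nat_gt (max (s : ℝ) (1 / δ))
  refine ⟨n₀, fun n hn => ?_⟩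
  have hn' : (n₀ : ℝ) ≤ n := by exact_mod_cast hn
  have hsn : s ≤ n + 1 := by
    rw [← NNReal.coe_le_coe]
    push_cast
    linarith [(le_max_left (s : ℝ) (1 / δ))]
  obtain ⟨t, ht, hst, he⟩ := exists_gridVal_eq (u := u) H hs hsn
  rw [he]
  refine h ?_
  have h1 : (t : ℝ) ≤ s := by exact_mod_cast ht
  have h2 : (s : ℝ) ≤ t + 1 / (n + 1) := by exact_mod_cast hst
  rw [NNReal.dist_eq, abs_of_nonpos (by linarith)]
  have h3 : (1 : ℝ) / (n + 1) < δ := by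
    rw [div_lt_iff₀ (by positivity)]
    have := (div_lt_iff₀ hδ).1 ((le_max_right (s : ℝ) (1 / δ)).trans_lt hn₀)
    nlinarith
  linarith

lemma measurable_gridVal (hu : ∀ t, StronglyMeasurable (u t)) {H : Phase Λ → ℂ}
    (hH : Continuous H) (n : ℕ) :
    Measurable fun q : ℝ × Ω => gridVal u H n q.1.toNNReal q.2 := by
  unfold gridVal
  refine Finset.measurable_fun_sum _ fun i _ => ?_
  have : (fun q : ℝ × Ω => (Set.Ioc (gridTime n i) (gridTime n (i + 1))).indicator
      (fun _ => H (u (gridTime n i) q.2)) q.1.toNNReal) =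
      ((fun q : ℝ × Ω => q.1.toNNReal) ⁻¹' Set.Ioc (gridTime n i) (gridTime n (i + 1))).indicator
        (fun q => H (u (gridTime n i) q.2)) := by
    funext q
    rfl
  rw [this]
  exact (hH.measurable.comp ((hu _).measurable.comp measurable_snd)).indicator
    ((measurable_real_toNNReal.comp measurable_fst) measurableSet_Ioc)

/-- The error of the approximation of `H(u)` by the frozen process. -/
noncomputable def gridError (u : ℝ≥0 → Ω → Phase Λ) (H : Phase Λ → ℂ) (T : ℝ≥0) (n : ℕ) (ω : Ω) :
    ℝ≥0∞ :=
  ∫⁻ s in Set.Ioc (0 : ℝ) T, ‖gridVal u H n s.toNNReal ω - H (u s.toNNReal ω)‖ₑ ^ 2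

section

variable {H : Phase Λ → ℂ} {K : ℝ} {T : ℝ≥0}

lemma measurable_gridVal_sub (hu : ∀ t, StronglyMeasurable (u t))
    (hc : ∀ ω, Continuous fun t => u t ω) (hH : Continuous H) (n : ℕ) :
    Measurable fun q : ℝ × Ω => ‖gridVal u H n q.1.toNNReal q.2 - H (u q.1.toNNReal q.2)‖ₑ ^ 2 :=
  ((measurable_gridVal hu hH n).sub
    (hH.measurable.comp (measurable_uncurry_path hu hc))).enorm.pow_const 2

lemma enorm_gridVal_sub_le (hK : ∀ x, ‖H x‖ ≤ K) {n : ℕ} (hn : T ≤ n + 1) (ω : Ω) {s : ℝ}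
    (hs : s ∈ Set.Ioc (0 : ℝ) T) :
    ‖gridVal u H n s.toNNReal ω - H (u s.toNNReal ω)‖ₑ ^ 2 ≤ ENNReal.ofReal (2 * K) ^ 2 := by
  obtain ⟨t, -, -, he⟩ := exists_gridVal_eq (u := u) H (n := n) (s := s.toNNReal)
    (Real.toNNReal_pos.2 hs.1) ((Real.toNNReal_le_iff_le_coe.2 hs.2).trans hn)
  rw [he, ← ofReal_norm]
  gcongr
  refine (norm_sub_le _ _).trans ?_
  linarith [hK (u t ω), hK (u s.toNNReal ω)]

lemma gridError_le (hK : ∀ x, ‖H x‖ ≤ K) {n : ℕ} (hn : T ≤ n + 1) (ω : Ω) :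
    gridError u H T n ω ≤ ENNReal.ofReal (2 * K) ^ 2 * volume (Set.Ioc (0 : ℝ) T) := by
  rw [← setLIntegral_const]
  exact setLIntegral_mono measurable_const fun s hs => enorm_gridVal_sub_le hK hn ω hs

lemma eventually_le_natCast_add_one (T : ℝ≥0) : ∀ᶠ n : ℕ in atTop, T ≤ (n : ℝ≥0) + 1 := by
  obtain ⟨n₀, hn₀⟩ := exists_nat_ge T
  exact eventually_atTop.2 ⟨n₀, fun n hn =>
    hn₀.trans ((Nat.cast_le.2 hn).trans (le_add_of_nonneg_right zero_le_one))⟩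

lemma tendsto_gridError (hu : ∀ t, StronglyMeasurable (u t)) (hc : ∀ ω, Continuous fun t => u t ω)
    (hH : Continuous H) (hK : ∀ x, ‖H x‖ ≤ K) (ω : Ω) :
    Tendsto (fun n => gridError u H T n ω) atTop (𝓝 0) := by
  have hms : ∀ n, Measurable fun s : ℝ =>
      ‖gridVal u H n s.toNNReal ω - H (u s.toNNReal ω)‖ₑ ^ 2 := fun n => by
    have h : Measurable fun s : ℝ => (s, ω) := measurable_prodMk_right
    have h2 := (measurable_gridVal_sub hu hc hH n).comp h
    rw [Function.comp_def] at h2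
    exact h2
  have hlim : ∀ s ∈ Set.Ioc (0 : ℝ) T, Tendsto (fun n =>
      ‖gridVal u H n s.toNNReal ω - H (u s.toNNReal ω)‖ₑ ^ 2) atTop (𝓝 0) := fun s hs => by
    have h1 := (tendsto_gridVal hH (hc ω) (Real.toNNReal_pos.2 hs.1)).sub_const
      (H (u s.toNNReal ω))
    rw [sub_self] at h1
    have h2 : Tendsto (fun n => ‖gridVal u H n s.toNNReal ω - H (u s.toNNReal ω)‖ₑ) atTop (𝓝 0) := by
      have := h1.enorm
      rwa [enorm_zero] at this
    have h3 := ((ENNReal.continuous_pow 2).tendsto 0).comp h2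
    rw [zero_pow two_ne_zero] at h3
    exact h3
  have hfin : ∫⁻ _ in Set.Ioc (0 : ℝ) T, ENNReal.ofReal (2 * K) ^ 2 ≠ ⊤ := by
    rw [setLIntegral_const, Real.volume_Ioc]
    exact ENNReal.mul_ne_top (ENNReal.pow_ne_top ENNReal.ofReal_ne_top) ENNReal.ofReal_ne_top
  have := tendsto_lintegral_filter_of_dominated_convergence
    (μ := volume.restrict (Set.Ioc (0 : ℝ) T)) (l := atTop) (f := fun _ => 0)
    (F := fun (n : ℕ) (s : ℝ) => ‖gridVal u H n s.toNNReal ω - H (u s.toNNReal ω)‖ₑ ^ 2)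
    (fun _ => ENNReal.ofReal (2 * K) ^ 2) (Eventually.of_forall hms)
    ((eventually_le_natCast_add_one T).mono fun n hn => (ae_restrict_iff' measurableSet_Ioc).2
      (Eventually.of_forall fun s hs => enorm_gridVal_sub_le hK hn ω hs))
    hfin
    ((ae_restrict_iff' measurableSet_Ioc).2 (Eventually.of_forall hlim))
  rw [lintegral_zero] at this
  exact this

lemma tendsto_lintegral_gridError [IsProbabilityMeasure μ] (hu : ∀ t, StronglyMeasurable (u t))
    (hc : ∀ ω, Continuous fun t => u t ω) (hH : Continuous H) (hK : ∀ x, ‖H x‖ ≤ K) :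
    Tendsto (fun n => ∫⁻ ω, gridError u H T n ω ∂μ) atTop (𝓝 0) := by
  have hfin : ∫⁻ _, ENNReal.ofReal (2 * K) ^ 2 * volume (Set.Ioc (0 : ℝ) T) ∂μ ≠ ⊤ := by
    rw [lintegral_const, Real.volume_Ioc]
    exact ENNReal.mul_ne_top (ENNReal.mul_ne_top (ENNReal.pow_ne_top ENNReal.ofReal_ne_top)
      ENNReal.ofReal_ne_top) (measure_ne_top _ _)
  have := tendsto_lintegral_filter_of_dominated_convergence
    (μ := μ) (l := atTop) (f := fun _ => 0) (F := gridError u H T)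
    (fun _ => ENNReal.ofReal (2 * K) ^ 2 * volume (Set.Ioc (0 : ℝ) T))
    (Eventually.of_forall fun n => (measurable_gridVal_sub hu hc hH n).lintegral_prod_left')
    ((eventually_le_natCast_add_one T).mono fun n hn =>
      Eventually.of_forall fun ω => gridError_le hK hn ω)
    hfin
    (Eventually.of_forall fun ω => tendsto_gridError hu hc hH hK ω)
  rwa [lintegral_zero] at this

/-- Dominated convergence in time and then in chance gives convergence of the mean error, and
Markov's inequality concludes. Boundedness of `H` provides the domination. -/
lemma tendsto_measure_gridError [IsProbabilityMeasure μ] (hu : ∀ t, StronglyMeasurable (u t))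
    (hc : ∀ᵐ ω ∂μ, Continuous fun t => u t ω) (hH : Continuous H)
    (hK : ∀ x, ‖H x‖ ≤ K) {δ : ℝ≥0∞} (hδ : 0 < δ) :
    Tendsto (fun n => μ {ω | δ ≤ gridError u H T n ω}) atTop (𝓝 0) := by
  obtain ⟨v, hv, hvc, hvu⟩ := exists_continuous_modification hu hc
  -- The threshold may be infinite, and Markov's inequality needs a finite one.
  set δ' := min δ 1
  have hδ' : δ' ≠ 0 := (lt_min hδ one_pos).ne'
  have hδt : δ' ≠ ⊤ := ((min_le_right _ _).trans_lt ENNReal.one_lt_top).ne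
  refine tendsto_of_tendsto_of_tendsto_of_le_of_le tendsto_const_nhds
    (h := fun n => (∫⁻ ω, gridError v H T n ω ∂μ) / δ') ?_ (fun _ => zero_le) fun n => ?_
  · have := ENNReal.Tendsto.div_const (tendsto_lintegral_gridError (μ := μ) (T := T) hv hvc hH hK)
      (b := δ') (Or.inr hδ')
    rwa [ENNReal.zero_div] at this
  · refine le_trans ?_ (meas_ge_le_lintegral_div
      ((measurable_gridVal_sub hv hvc hH n).lintegral_prod_left').aemeasurable hδ' hδt)
    refine measure_mono_ae ?_
    filter_upwards [hvu] with ω hω h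
    refine (min_le_left _ _).trans (le_trans h (le_of_eq ?_))
    simp only [gridError, gridVal, hω]

end

end GridIntegrand

end Rotators

namespace Rotators

/-! ### Quadratic variation along partitions -/

section ItoFormula

variable {d : ℕ} {Λ : Finset (Fin d → ℤ)} {Ω : Type*} {mΩ : MeasurableSpace Ω}
  {ℱ : Filtration ℝ≥0 mΩ} {μ : Measure Ω} {β u : ℝ≥0 → Ω → Phase Λ} {b : Phase Λ → Phase Λ}
  {c : Λ → ℝ} {φ : Phase Λ → ℂ} {K : ℝ} {T : ℝ≥0}

/-- Multiplication of the coordinates by the real numbers `c_j`. -/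
noncomputable def scaleL (c : Λ → ℝ) : Phase Λ →L[ℝ] Phase Λ :=
  ContinuousLinearMap.pi fun j => c j • ContinuousLinearMap.proj j

lemma scaleL_apply (c : Λ → ℝ) (a : Phase Λ) (j : Λ) : scaleL c a j = c j * a j := by
  simp [scaleL]

/-- The second order part of the generator of `c β`. -/
noncomputable def halfTrace (c : Λ → ℝ) (φ : Phase Λ → ℂ) (x : Phase Λ) : ℂ :=
  (1 / 2 : ℝ) • ∑ I : Λ ⊕ Λ,
    fderiv ℝ (fderiv ℝ φ) x (scaleL c (coordVec I)) (scaleL c (coordVec I))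

lemma continuous_hessian (hφ : ContDiff ℝ 2 φ) (a a' : Phase Λ) :
    Continuous fun x => fderiv ℝ (fderiv ℝ φ) x a a' :=
  (((hφ.fderiv_right (m := 1) (by norm_num)).continuous_fderiv (by norm_num)).clm_apply
    continuous_const).clm_apply continuous_const

lemma continuous_halfTrace (hφ : ContDiff ℝ 2 φ) : Continuous (halfTrace c φ) :=
  (continuous_finsetSum _ fun _ _ => continuous_hessian hφ _ _).fun_const_smul _

lemma norm_scaleL_sq_le (c : Λ → ℝ) (a : Phase Λ) :
    ‖scaleL c a‖ ^ 2 ≤ ‖scaleL c‖ ^ 2 * ∑ I, coord I a ^ 2 := by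
  have h : ‖a‖ ^ 2 ≤ ∑ I, coord I a ^ 2 := by
    have hs : 0 ≤ ∑ I, coord I a ^ 2 := Finset.sum_nonneg fun _ _ => sq_nonneg _
    rw [← Real.sq_sqrt hs]
    refine pow_le_pow_left₀ (norm_nonneg _) ((pi_norm_le_iff_of_nonneg (Real.sqrt_nonneg _)).2
      fun j => Real.le_sqrt_of_sq_le ?_) 2
    rw [Fintype.sum_sum_type, ← Complex.normSq_eq_norm_sq, Complex.normSq_apply, ← sq, ← sq]
    exact add_le_add
      (Finset.single_le_sum (f := fun j => coord (Sum.inl j) a ^ 2) (fun _ _ => sq_nonneg _)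
        (Finset.mem_univ j))
      (Finset.single_le_sum (f := fun j => coord (Sum.inr j) a ^ 2) (fun _ _ => sq_nonneg _)
        (Finset.mem_univ j))
  calc ‖scaleL c a‖ ^ 2 ≤ (‖scaleL c‖ * ‖a‖) ^ 2 :=
        pow_le_pow_left₀ (norm_nonneg _) ((scaleL c).le_opNorm a) 2
    _ = ‖scaleL c‖ ^ 2 * ‖a‖ ^ 2 := mul_pow _ _ _
    _ ≤ _ := mul_le_mul_of_nonneg_left h (sq_nonneg _)

/-- In real coordinates the diagonal products of increments have mean `t - s` and the others mean
zero. Subtracting the half trace therefore centres each product. -/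
lemma hessian_sub_halfTrace_eq (β : ℝ≥0 → Ω → Phase Λ) (x : Phase Λ) (s t : ℝ≥0) (ω : Ω) :
    (1 / 2 : ℝ) • fderiv ℝ (fderiv ℝ φ) x (scaleL c (β t ω - β s ω)) (scaleL c (β t ω - β s ω)) -
      ((t : ℝ) - s) • halfTrace c φ x =
    ∑ I : Λ ⊕ Λ, ∑ J : Λ ⊕ Λ, ((1 / 2 : ℝ) • fderiv ℝ (fderiv ℝ φ) x (scaleL c (coordVec I))
      (scaleL c (coordVec J))) * (incProd β I J s t ω : ℂ) := by
  set Q := fderiv ℝ (fderiv ℝ φ) x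
  set a := β t ω - β s ω with ha
  have h1 : Q (scaleL c a) (scaleL c a) = ∑ I, ∑ J, (coord I a * coord J a) •
      Q (scaleL c (coordVec I)) (scaleL c (coordVec J)) := by
    conv_lhs => rw [← sum_coord_smul_coordVec a]
    simp only [map_sum, map_smul, sum_apply, smul_apply, Finset.smul_sum, mul_smul]
    rw [Finset.sum_comm]
    refine Finset.sum_congr rfl fun I _ => Finset.sum_congr rfl fun J _ => ?_
    rw [smul_comm]
  have h2 : ∀ I J, ((1 / 2 : ℝ) • Q (scaleL c (coordVec I)) (scaleL c (coordVec J))) *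
      (incProd β I J s t ω : ℂ) = (1 / 2 : ℝ) • ((coord I a * coord J a) •
      Q (scaleL c (coordVec I)) (scaleL c (coordVec J))) - (if I = J then (((t : ℝ) - s) •
      (1 / 2 : ℝ) • Q (scaleL c (coordVec I)) (scaleL c (coordVec I))) else 0) := by
    intro I J
    by_cases h : I = J
    · subst h
      simp only [incProd, if_true, Complex.real_smul, ← ha]
      push_cast
      ring
    · simp only [incProd, if_neg h, Complex.real_smul, ← ha]
      push_cast
      ring
  simp only [h2, Finset.sum_sub_distrib, Finset.sum_ite_eq, Finset.mem_univ, if_true]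
  rw [h1, halfTrace]
  simp only [Finset.smul_sum]
  rfl

/-- The points of the partition of mesh `1 / (n + 1)`, stopped at `T`. -/
noncomputable def stopTime (T : ℝ≥0) (n i : ℕ) : ℝ≥0 := min (gridTime n i) T

lemma stopTime_mono (T : ℝ≥0) (n : ℕ) : Monotone (stopTime T n) := fun _ _ h =>
  min_le_min_right T (gridTime_mono n h)

lemma stopTime_zero (T : ℝ≥0) (n : ℕ) : stopTime T n 0 = 0 := by simp [stopTime, gridTime]

lemma stopTime_last {n : ℕ} (hn : T ≤ n + 1) : stopTime T n ((n + 1) ^ 2) = T := by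
  refine min_eq_right (hn.trans (le_of_eq ?_))
  unfold gridTime
  push_cast
  field_simp

lemma stopTime_succ_sub_le (T : ℝ≥0) (n i : ℕ) :
    (stopTime T n (i + 1) : ℝ) - stopTime T n i ≤ 1 / (n + 1) := by
  have h : (gridTime n (i + 1) : ℝ) = gridTime n i + 1 / (n + 1) := by
    rw [gridTime_succ]
    push_cast
    rfl
  have h0 : (0 : ℝ) ≤ 1 / (n + 1) := by positivity
  simp only [stopTime, NNReal.coe_min, h]
  rw [sub_le_iff_le_add, ← min_add_add_left]
  exact le_min ((min_le_left _ _).trans (by linarith)) ((min_le_right _ _).trans (by linarith))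

/-- The elementary stochastic integral of `Dφ(u)` frozen at the times of the partition. -/
noncomputable def itoSum (c : Λ → ℝ) (φ : Phase Λ → ℂ) (β u : ℝ≥0 → Ω → Phase Λ) (T : ℝ≥0) (n : ℕ)
    (ω : Ω) : ℂ :=
  ∑ i ∈ Finset.range ((n + 1) ^ 2), fderiv ℝ φ (u (stopTime T n i) ω)
    (scaleL c (β (stopTime T n (i + 1)) ω - β (stopTime T n i) ω))

/-- The fluctuation of the quadratic variation. -/
noncomputable def quadSum (c : Λ → ℝ) (φ : Phase Λ → ℂ) (β u : ℝ≥0 → Ω → Phase Λ) (T : ℝ≥0) (n : ℕ)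
    (ω : Ω) : ℂ :=
  ∑ i ∈ Finset.range ((n + 1) ^ 2), ((1 / 2 : ℝ) • fderiv ℝ (fderiv ℝ φ) (u (stopTime T n i) ω)
    (scaleL c (β (stopTime T n (i + 1)) ω - β (stopTime T n i) ω))
    (scaleL c (β (stopTime T n (i + 1)) ω - β (stopTime T n i) ω)) -
    ((stopTime T n (i + 1) : ℝ) - stopTime T n i) • halfTrace c φ (u (stopTime T n i) ω))

/-- The quadratic variation of `β` along the partition, increased by `1 + T`. -/
noncomputable def quadVar (β : ℝ≥0 → Ω → Phase Λ) (T : ℝ≥0) (n : ℕ) (ω : Ω) : ℝ :=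
  1 + T + ∑ i ∈ Finset.range ((n + 1) ^ 2), ∑ I : Λ ⊕ Λ,
    coord I (β (stopTime T n (i + 1)) ω - β (stopTime T n i) ω) ^ 2

variable [IsProbabilityMeasure μ]

/-- Each pair of coordinates gives a sum of orthogonal fluctuations with bounded coefficients. Its
second moment is of the order of the sum of squared steps, at most `T` times the mesh. -/
lemma tendstoInMeasure_quadSum (hβ : IsComplexBrownian ℱ μ β) (hu : StronglyAdapted ℱ u)
    (hφ : ContDiff ℝ 2 φ) (hK : ∀ x, ‖fderiv ℝ (fderiv ℝ φ) x‖ ≤ K) :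
    TendstoInMeasure μ (quadSum c φ β u T) atTop 0 := by
  set m : Λ ⊕ Λ → Λ ⊕ Λ → Phase Λ → ℂ := fun I J x => (1 / 2 : ℝ) •
    fderiv ℝ (fderiv ℝ φ) x (scaleL c (coordVec I)) (scaleL c (coordVec J)) with hm
  have e : quadSum c φ β u T = fun n ω => ∑ I, ∑ J,
      incSum β I J (stopTime T n) (fun i ω => m I J (u (stopTime T n i) ω)) ((n + 1) ^ 2) ω := by
    funext n ω
    simp only [quadSum, hessian_sub_halfTrace_eq, incSum]
    rw [Finset.sum_comm]
    exact Finset.sum_congr rfl fun I _ => Finset.sum_comm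
  rw [e]
  refine tendstoInMeasure_zero_sum _ fun I => tendstoInMeasure_zero_sum _ fun J => ?_
  set K' := 1 / 2 * (K * ‖scaleL c (coordVec I)‖ * ‖scaleL c (coordVec J)‖) with hK'
  have hmK : ∀ x, ‖m I J x‖ ≤ K' := fun x => by
    rw [hm, norm_smul, Real.norm_eq_abs, abs_of_pos (by norm_num), hK']
    refine mul_le_mul_of_nonneg_left ?_ (by norm_num)
    refine ((fderiv ℝ (fderiv ℝ φ) x).le_opNorm₂ _ _).trans ?_
    exact mul_le_mul_of_nonneg_right (mul_le_mul_of_nonneg_right (hK x) (norm_nonneg _))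
      (norm_nonneg _)
  have hmm : ∀ n i, StronglyMeasurable[ℱ (stopTime T n i)]
      (fun ω => m I J (u (stopTime T n i) ω)) := fun n i =>
    (show Continuous (m I J) from
      (continuous_hessian hφ _ _).fun_const_smul _).comp_stronglyMeasurable (hu _)
  refine tendstoInMeasure_zero_of_integral_sq
    (fun n => hβ.memLp_incSum I J (hmm n) (fun i ω => hmK _) _) ?_
  have hg : 0 ≤ gaussMoment := integral_nonneg fun x => by positivity
  refine squeeze_zero (fun n => integral_nonneg fun ω => sq_nonneg _)
    (g := fun n : ℕ => K' ^ 2 * (2 * gaussMoment + 2) * (T * (1 / ((n : ℝ) + 1)))) (fun n => ?_) ?_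
  · refine (hβ.integral_norm_incSum_sq_le I J (stopTime_mono T n) (hmm n)
      (fun i ω => hmK _) _).trans (mul_le_mul_of_nonneg_left ?_ (by positivity))
    calc _ ≤ ∑ i ∈ Finset.range ((n + 1) ^ 2),
          ((stopTime T n (i + 1) : ℝ) - stopTime T n i) * (1 / (n + 1)) := by
          refine Finset.sum_le_sum fun i _ => ?_
          rw [sq]
          exact mul_le_mul_of_nonneg_left (stopTime_succ_sub_le T n i)
            (sub_nonneg.2 (stopTime_mono T n (Nat.le_succ i)))
      _ ≤ _ := by
          rw [← Finset.sum_mul, Finset.sum_range_sub (fun i => (stopTime T n i : ℝ)), stopTime_zero]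
          refine mul_le_mul_of_nonneg_right ?_ (by positivity)
          rw [NNReal.coe_zero, sub_zero]
          exact_mod_cast min_le_right _ _
  · have := (tendsto_one_div_add_atTop_nhds_zero_nat (𝕜 := ℝ)).const_mul (T : ℝ) |>.const_mul
      (K' ^ 2 * (2 * gaussMoment + 2))
    simpa using this

lemma integrable_quadVar (hβ : IsComplexBrownian ℱ μ β) (T : ℝ≥0) (n : ℕ) :
    Integrable (quadVar β T n) μ := by
  refine (integrable_const _).add (integrable_finsetSum _ fun i _ =>
    integrable_finsetSum _ fun I _ => ?_)
  exact ((hβ.memLp_coord I _ _).mono_exponent (p := 2) (by norm_num)).integrable_sq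

/-- The variances of the increments telescope to at most `T` for each coordinate, uniformly in the
partition. -/
lemma integral_quadVar_le (hβ : IsComplexBrownian ℱ μ β) (T : ℝ≥0) (n : ℕ) :
    ∫ ω, quadVar β T n ω ∂μ ≤ 1 + T + Fintype.card (Λ ⊕ Λ) * T := by
  have hi : ∀ i (I : Λ ⊕ Λ), Integrable (fun ω =>
      coord I (β (stopTime T n (i + 1)) ω - β (stopTime T n i) ω) ^ 2) μ := fun i I =>
    ((hβ.memLp_coord I _ _).mono_exponent (p := 2) (by norm_num)).integrable_sq
  unfold quadVar
  rw [integral_add (integrable_const _) (integrable_finsetSum _ fun i _ =>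
    integrable_finsetSum _ fun I _ => hi i I), integral_const, probReal_univ, one_smul,
    integral_finsetSum _ fun i _ => integrable_finsetSum _ fun I _ => hi i I]
  refine add_le_add_right ?_ _
  have e : ∀ i, ∫ ω, ∑ I : Λ ⊕ Λ, coord I (β (stopTime T n (i + 1)) ω - β (stopTime T n i) ω) ^ 2 ∂μ =
      Fintype.card (Λ ⊕ Λ) * ((stopTime T n (i + 1) : ℝ) - stopTime T n i) := fun i => by
    rw [integral_finsetSum _ fun I _ => hi i I]
    simp only [hβ.integral_coord_sq _ (stopTime_mono T n (Nat.le_succ i))]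
    rw [Finset.sum_const, nsmul_eq_mul, Finset.card_univ]
  simp only [e]
  rw [← Finset.mul_sum, Finset.sum_range_sub (fun i => (stopTime T n i : ℝ)), stopTime_zero]
  refine mul_le_mul_of_nonneg_left ?_ (by positivity)
  rw [NNReal.coe_zero, sub_zero]
  exact_mod_cast min_le_right _ _

end ItoFormula

end Rotators

namespace Rotators

/-! ### Itô's formula -/

section ItoFormula

variable {d : ℕ} {Λ : Finset (Fin d → ℤ)} {Ω : Type*} {mΩ : MeasurableSpace Ω}
  {ℱ : Filtration ℝ≥0 mΩ} {μ : Measure Ω} {β u : ℝ≥0 → Ω → Phase Λ} {b : Phase Λ → Phase Λ}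
  {c : Λ → ℝ} {φ : Phase Λ → ℂ} {K : ℝ} {T : ℝ≥0}

/-- The difference between the increment of `φ(u)` minus its drift and its discretization. -/
noncomputable def itoRem (b : Phase Λ → Phase Λ) (c : Λ → ℝ) (φ : Phase Λ → ℂ)
    (β u : ℝ≥0 → Ω → Phase Λ) (T : ℝ≥0) (n : ℕ) (ω : Ω) : ℂ :=
  φ (u T ω) - φ (u 0 ω) -
    (∫ s in (0 : ℝ)..T, (fderiv ℝ φ (u s.toNNReal ω) (b (u s.toNNReal ω)) +
      halfTrace c φ (u s.toNNReal ω))) -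
    itoSum c φ β u T n ω - quadSum c φ β u T n ω

lemma IsComplexBrownian.ae_continuous (hβ : IsComplexBrownian ℱ μ β) :
    ∀ᵐ ω ∂μ, Continuous fun t => β t ω := by
  have h1 : ∀ᵐ ω ∂μ, ∀ j, Continuous fun t => (β t ω j).re := ae_all_iff.2 fun j => (hβ.re j).cont
  have h2 : ∀ᵐ ω ∂μ, ∀ j, Continuous fun t => (β t ω j).im := ae_all_iff.2 fun j => (hβ.im j).cont
  filter_upwards [h1, h2] with ω hr hi
  refine continuous_pi fun j => ?_
  have : (fun t => β t ω j) = fun t => ((β t ω j).re : ℂ) + (β t ω j).im * Complex.I := by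
    funext t
    rw [Complex.re_add_im]
  rw [this]
  exact (Complex.continuous_ofReal.comp (hr j)).add
    ((Complex.continuous_ofReal.comp (hi j)).mul continuous_const)

lemma SolvesAdditive.ae_sub_eq (hu : SolvesAdditive ℱ μ β b c u) (hb : Continuous b) :
    ∀ᵐ ω ∂μ, ∀ s t : ℝ, 0 ≤ s → s ≤ t → u t.toNNReal ω - u s.toNNReal ω =
      (∫ r in s..t, b (u r.toNNReal ω)) +
        (scaleL c (β t.toNNReal ω) - scaleL c (β s.toNNReal ω)) := by
  filter_upwards [hu.cont, hu.eqn] with ω hc heq s t hs hst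
  have hcont : Continuous fun r : ℝ => b (u r.toNNReal ω) :=
    hb.comp (hc.comp continuous_real_toNNReal)
  funext j
  have hcj : Continuous fun r : ℝ => b (u r.toNNReal ω) j := (continuous_apply j).comp hcont
  have e1 := heq t.toNNReal j
  have e2 := heq s.toNNReal j
  rw [Real.coe_toNNReal _ (hs.trans hst)] at e1
  rw [Real.coe_toNNReal _ hs] at e2
  have e3 : (∫ r in s..t, b (u r.toNNReal ω)) j = ∫ r in s..t, b (u r.toNNReal ω) j :=
    ((ContinuousLinearMap.proj (R := ℝ) (φ := fun _ : Λ => ℂ) j).intervalIntegral_comp_comm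
      (hcont.intervalIntegrable s t)).symm
  have e4 := intervalIntegral.integral_add_adjacent_intervals (μ := volume)
    (hcj.intervalIntegrable 0 s) (hcj.intervalIntegrable s t)
  rw [Pi.sub_apply, Pi.add_apply, Pi.sub_apply, e3, scaleL_apply, scaleL_apply, e1, e2, ← e4]
  ring

/-- The pathwise Taylor errors are summed over the grid as soon as the mesh is below the modulus `δ`
of the given path. The threshold for `n` depends on the path, which the next lemma overcomes. -/
lemma ae_eventually_norm_itoRem_le (hβ : IsComplexBrownian ℱ μ β)
    (hu : SolvesAdditive ℱ μ β b c u) (hb : Continuous b) (hφ : ContDiff ℝ 2 φ) (T : ℝ≥0) :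
    ∀ᵐ ω ∂μ, ∀ η > 0, ∀ᶠ n : ℕ in atTop, ‖itoRem b c φ β u T n ω‖ ≤ η * quadVar β T n ω := by
  filter_upwards [hβ.ae_continuous, hu.cont, hu.ae_sub_eq hb] with ω hβc huc heq η hη
  set κ := ‖scaleL c‖ ^ 2 + 1
  have hκ : 0 < κ := by positivity
  set x : ℝ → Phase Λ := fun r => u r.toNNReal ω with hx
  set w : ℝ → Phase Λ := fun r => scaleL c (β r.toNNReal ω) with hw
  obtain ⟨δ, hδ, h⟩ := exists_norm_itoError_le (T := T) hφ (continuous_halfTrace (c := c) hφ) hb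
    (huc.comp continuous_real_toNNReal : Continuous x)
    ((scaleL c).continuous.comp (hβc.comp continuous_real_toNNReal) : Continuous w) heq
    (div_pos hη hκ)
  have hmesh : ∀ᶠ n : ℕ in atTop, 1 / ((n : ℝ) + 1) ≤ δ :=
    (tendsto_one_div_add_atTop_nhds_zero_nat (𝕜 := ℝ)).eventually (eventually_le_nhds hδ)
  filter_upwards [hmesh, eventually_le_natCast_add_one T] with n hn hnT
  have hsum := norm_sum_itoError_le (s := fun i => (stopTime T n i : ℝ)) (N := (n + 1) ^ 2)
    (x := x) (w := w) hφ (continuous_halfTrace (c := c) hφ) hb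
    (huc.comp continuous_real_toNNReal) fun i =>
      h _ _ (NNReal.coe_nonneg _) (NNReal.coe_le_coe.2 (stopTime_mono T n (Nat.le_succ i)))
        (NNReal.coe_le_coe.2 (min_le_right _ _)) ((stopTime_succ_sub_le T n i).trans hn)
  simp only [hx, hw, Real.toNNReal_coe, stopTime_zero, stopTime_last hnT, NNReal.coe_zero, sub_zero,
    Real.toNNReal_zero, ← map_sub] at hsum
  refine hsum.trans ?_
  have hq : ∑ i ∈ Finset.range ((n + 1) ^ 2),
      ‖scaleL c (β (stopTime T n (i + 1)) ω - β (stopTime T n i) ω)‖ ^ 2 + (T : ℝ) ≤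
      κ * quadVar β T n ω := by
    have h1 : ∑ i ∈ Finset.range ((n + 1) ^ 2),
        ‖scaleL c (β (stopTime T n (i + 1)) ω - β (stopTime T n i) ω)‖ ^ 2 ≤
        ‖scaleL c‖ ^ 2 * ∑ i ∈ Finset.range ((n + 1) ^ 2), ∑ I : Λ ⊕ Λ,
          coord I (β (stopTime T n (i + 1)) ω - β (stopTime T n i) ω) ^ 2 := by
      rw [Finset.mul_sum]
      exact Finset.sum_le_sum fun i _ => norm_scaleL_sq_le c _
    have h2 : 0 ≤ ∑ i ∈ Finset.range ((n + 1) ^ 2), ∑ I : Λ ⊕ Λ,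
          coord I (β (stopTime T n (i + 1)) ω - β (stopTime T n i) ω) ^ 2 :=
      Finset.sum_nonneg fun _ _ => Finset.sum_nonneg fun _ _ => sq_nonneg _
    have h3 : 0 ≤ ‖scaleL c‖ ^ 2 * (1 + (T : ℝ)) := by positivity
    unfold quadVar
    linarith
  calc _ ≤ η / κ * (κ * quadVar β T n ω) := mul_le_mul_of_nonneg_left hq (by positivity)
    _ = _ := by field_simp

lemma one_le_quadVar (β : ℝ≥0 → Ω → Phase Λ) (T : ℝ≥0) (n : ℕ) (ω : Ω) : 1 ≤ quadVar β T n ω := by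
  have h2 : 0 ≤ ∑ i ∈ Finset.range ((n + 1) ^ 2), ∑ I : Λ ⊕ Λ,
      coord I (β (stopTime T n (i + 1)) ω - β (stopTime T n i) ω) ^ 2 :=
    Finset.sum_nonneg fun _ _ => Finset.sum_nonneg fun _ _ => sq_nonneg _
  have := T.coe_nonneg
  unfold quadVar
  linarith

lemma stronglyMeasurable_itoSum (hβ : ∀ t, StronglyMeasurable (β t))
    (hu : ∀ t, StronglyMeasurable (u t)) (hφ : ContDiff ℝ 2 φ) (T : ℝ≥0) (n : ℕ) :
    StronglyMeasurable (itoSum c φ β u T n) := by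
  unfold itoSum
  refine Finset.stronglyMeasurable_fun_sum _ fun i _ => ?_
  have h : Continuous fun q : Phase Λ × Phase Λ => fderiv ℝ φ q.1 (scaleL c q.2) :=
    ((hφ.continuous_fderiv (by norm_num)).comp continuous_fst).clm_apply
      ((scaleL c).continuous.comp continuous_snd)
  exact h.comp_stronglyMeasurable ((hu _).prodMk ((hβ _).sub (hβ _)))

lemma continuous_hessian_apply (hφ : ContDiff ℝ 2 φ) (L : Phase Λ →L[ℝ] Phase Λ) :
    Continuous fun q : Phase Λ × Phase Λ => fderiv ℝ (fderiv ℝ φ) q.1 (L q.2) (L q.2) := by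
  have h1 : Continuous fun q : Phase Λ × Phase Λ => fderiv ℝ (fderiv ℝ φ) q.1 :=
    ((hφ.fderiv_right (m := 1) (by norm_num)).continuous_fderiv (by norm_num)).comp continuous_fst
  have h2 : Continuous fun q : Phase Λ × Phase Λ => L q.2 := L.continuous.comp continuous_snd
  exact (h1.clm_apply h2).clm_apply h2

lemma stronglyMeasurable_quadSum (hβ : ∀ t, StronglyMeasurable (β t))
    (hu : ∀ t, StronglyMeasurable (u t)) (hφ : ContDiff ℝ 2 φ) (T : ℝ≥0) (n : ℕ) :
    StronglyMeasurable (quadSum c φ β u T n) := by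
  unfold quadSum
  refine Finset.stronglyMeasurable_fun_sum _ fun i _ => ?_
  have h1 : StronglyMeasurable fun ω => fderiv ℝ (fderiv ℝ φ) (u (stopTime T n i) ω)
      (scaleL c (β (stopTime T n (i + 1)) ω - β (stopTime T n i) ω))
      (scaleL c (β (stopTime T n (i + 1)) ω - β (stopTime T n i) ω)) :=
    (continuous_hessian_apply hφ (scaleL c)).comp_stronglyMeasurable
      ((hu (stopTime T n i)).prodMk
        ((hβ (stopTime T n (i + 1))).sub (hβ (stopTime T n i))))
  have h2 : StronglyMeasurable fun ω => halfTrace c φ (u (stopTime T n i) ω) :=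
    (continuous_halfTrace hφ).comp_stronglyMeasurable (hu _)
  exact (h1.fun_const_smul (1 / 2 : ℝ)).sub (h2.fun_const_smul _)

variable [IsProbabilityMeasure μ]

/-- The remainder divided by the quadratic variation tends to zero almost surely, hence in
probability; multiplying back is harmless because the quadratic variations have bounded means. -/
lemma tendstoInMeasure_itoRem (hβ : IsComplexBrownian ℱ μ β)
    (hu : SolvesAdditive ℱ μ β b c u) (hb : Continuous b) (hφ : ContDiff ℝ 2 φ) (T : ℝ≥0) :
    TendstoInMeasure μ (itoRem b c φ β u T) atTop 0 := by
  have hβm : ∀ t, StronglyMeasurable (β t) := fun t => (hβ.adapted t).mono (ℱ.le t)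
  have hum : ∀ t, StronglyMeasurable (u t) := fun t => (hu.adapted t).mono (ℱ.le t)
  have hdc : Continuous fun x => fderiv ℝ φ x (b x) + halfTrace c φ x :=
    ((hφ.continuous_fderiv (by norm_num)).clm_apply hb).add (continuous_halfTrace hφ)
  have hq0 : ∀ n ω, 0 < quadVar β T n ω := fun n ω => one_pos.trans_le (one_le_quadVar β T n ω)
  have hRm : ∀ n, AEStronglyMeasurable (itoRem b c φ β u T n) μ := fun n =>
    ((((hφ.continuous.comp_stronglyMeasurable (hum T)).sub
      (hφ.continuous.comp_stronglyMeasurable (hum 0))).aestronglyMeasurable.sub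
      (aestronglyMeasurable_integral_path hum hu.cont hdc T)).sub
      (stronglyMeasurable_itoSum hβm hum hφ T n).aestronglyMeasurable).sub
      (stronglyMeasurable_quadSum hβm hum hφ T n).aestronglyMeasurable
  have hZ : TendstoInMeasure μ (fun n ω => (quadVar β T n ω)⁻¹ • itoRem b c φ β u T n ω) atTop 0 := by
    refine tendstoInMeasure_of_tendsto_ae (fun n =>
      ((integrable_quadVar hβ T n).aestronglyMeasurable.aemeasurable.inv.aestronglyMeasurable).smul
        (hRm n)) ?_
    filter_upwards [ae_eventually_norm_itoRem_le hβ hu hb hφ T] with ω hω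
    rw [Pi.zero_apply, Metric.tendsto_nhds]
    intro η hη
    filter_upwards [hω (η / 2) (half_pos hη)] with n hn
    rw [dist_zero_right, norm_smul, norm_inv, Real.norm_eq_abs, abs_of_pos (hq0 n ω),
      inv_mul_lt_iff₀ (hq0 n ω)]
    refine hn.trans_lt ?_
    rw [mul_comm]
    exact mul_lt_mul_of_pos_left (half_lt_self hη) (hq0 n ω)
  have := tendstoInMeasure_zero_mul hZ (fun n ω => (hq0 n ω).le) (integrable_quadVar hβ T)
    (integral_quadVar_le hβ T)
  refine this.congr_left fun n => Eventually.of_forall fun ω => ?_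
  have hne : (quadVar β T n ω : ℂ) ≠ 0 := by exact_mod_cast (hq0 n ω).ne'
  simp only [Complex.real_smul, Complex.ofReal_inv]
  field_simp

lemma tendstoInMeasure_itoSum (hβ : IsComplexBrownian ℱ μ β)
    (hu : SolvesAdditive ℱ μ β b c u) (hb : Continuous b) (hφ : ContDiff ℝ 2 φ)
    (hK : ∀ x, ‖fderiv ℝ (fderiv ℝ φ) x‖ ≤ K) (T : ℝ≥0) :
    TendstoInMeasure μ (itoSum c φ β u T) atTop (fun ω => φ (u T ω) - φ (u 0 ω) -
      ∫ s in (0 : ℝ)..T, (fderiv ℝ φ (u s.toNNReal ω) (b (u s.toNNReal ω)) +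
        halfTrace c φ (u s.toNNReal ω))) := by
  have h := tendstoInMeasure_zero_add (tendstoInMeasure_itoRem hβ hu hb hφ T)
    (tendstoInMeasure_quadSum (c := c) (T := T) hβ hu.adapted hφ hK)
  rw [tendstoInMeasure_iff_norm] at h ⊢
  intro δ hδ
  refine (h δ hδ).congr fun n => ?_
  congr 1
  ext ω
  simp only [Set.mem_ofPred_eq, Pi.zero_apply, sub_zero]
  rw [norm_sub_rev, itoRem, sub_add_cancel]

lemma fderiv_eq_sum_dz (φ : Phase Λ → ℂ) (x a : Phase Λ) :
    fderiv ℝ φ x a = ∑ l, (dz φ x l * a l + dzbar φ x l * (starRingEnd ℂ) (a l)) := by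
  conv_lhs => rw [← sum_coord_smul_coordVec a]
  rw [map_sum, Fintype.sum_sum_type, ← Finset.sum_add_distrib]
  refine Finset.sum_congr rfl fun l _ => ?_
  simp only [map_smul, coord, coordVec, Sum.elim_inl, Sum.elim_inr, Complex.real_smul, dz, dzbar]
  have h1 := Complex.re_add_im (a l)
  have h2 : (starRingEnd ℂ) (a l) = (a l).re - (a l).im * Complex.I := by
    apply Complex.ext <;> simp
  rw [h2]
  nth_rw 3 [← h1]
  linear_combination ((a l).im * fderiv ℝ φ x (Pi.single l Complex.I)) * Complex.I_sq

/-- **Itô's formula** for functions with bounded first and second derivatives. -/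
theorem isItoIntegral_comp (hβ : IsComplexBrownian ℱ μ β) (hu : SolvesAdditive ℱ μ β b c u)
    (hb : Continuous b) (hφ : ContDiff ℝ 2 φ) (hK : ∀ x, ‖fderiv ℝ φ x‖ ≤ K)
    (hK₂ : ∀ x, ‖fderiv ℝ (fderiv ℝ φ) x‖ ≤ K) :
    IsItoIntegral ℱ μ
      (Sum.elim (fun l t ω => β t ω l) (fun l t ω => (starRingEnd ℂ) (β t ω l)))
      (Sum.elim (fun l t ω => (c l : ℂ) * dz φ (u t ω) l)
        (fun l t ω => (c l : ℂ) * dzbar φ (u t ω) l))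
      (fun t ω => φ (u t ω) - φ (u 0 ω) -
        ∫ s in (0 : ℝ)..t, (fderiv ℝ φ (u s.toNNReal ω) (b (u s.toNNReal ω)) +
          halfTrace c φ (u s.toNNReal ω))) := by
  set H : Λ ⊕ Λ → Phase Λ → ℂ := Sum.elim (fun l x => (c l : ℂ) * dz φ x l)
    (fun l x => (c l : ℂ) * dzbar φ x l) with hH
  have hD : ∀ a : Phase Λ, Continuous fun x => fderiv ℝ φ x a := fun a =>
    (hφ.continuous_fderiv (by norm_num)).clm_apply continuous_const
  have hHc : ∀ I, Continuous (H I) := by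
    rintro (l | l)
    · exact continuous_const.mul (((hD _).sub (continuous_const.mul (hD _))).div_const 2)
    · exact continuous_const.mul (((hD _).add (continuous_const.mul (hD _))).div_const 2)
  have hDK : ∀ x (l : Λ) (z : ℂ), ‖z‖ = 1 → ‖fderiv ℝ φ x (Pi.single l z)‖ ≤ K := fun x l z hz => by
    refine ((fderiv ℝ φ x).le_of_opNorm_le (hK x) _).trans (le_of_eq ?_)
    rw [Pi.norm_single, hz, mul_one]
  have hHb : ∀ I, ∃ K' : ℝ, ∀ x, ‖H I x‖ ≤ K' := by
    rintro (l | l)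
    · refine ⟨|c l| * K, fun x => ?_⟩
      simp only [hH, Sum.elim_inl, norm_mul, Complex.norm_real, Real.norm_eq_abs, dz, norm_div,
        Complex.norm_two]
      refine mul_le_mul_of_nonneg_left ?_ (abs_nonneg _)
      have h1 := hDK x l 1 norm_one
      have h2 := hDK x l Complex.I Complex.norm_I
      have h3 := norm_sub_le (fderiv ℝ φ x (Pi.single l 1))
        (Complex.I * fderiv ℝ φ x (Pi.single l Complex.I))
      rw [norm_mul, Complex.norm_I, one_mul] at h3
      linarith
    · refine ⟨|c l| * K, fun x => ?_⟩
      simp only [hH, Sum.elim_inr, norm_mul, Complex.norm_real, Real.norm_eq_abs, dzbar, norm_div,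
        Complex.norm_two]
      refine mul_le_mul_of_nonneg_left ?_ (abs_nonneg _)
      have h1 := hDK x l 1 norm_one
      have h2 := hDK x l Complex.I Complex.norm_I
      have h3 := norm_add_le (fderiv ℝ φ x (Pi.single l 1))
        (Complex.I * fderiv ℝ φ x (Pi.single l Complex.I))
      rw [norm_mul, Complex.norm_I, one_mul] at h3
      linarith
  refine ⟨fun n I => gridIntegrand hu.adapted (hHc I) (hHb I) n, fun T => ⟨fun I δ hδ => ?_, ?_⟩⟩
  · obtain ⟨K', hK'⟩ := hHb I
    have h := tendsto_measure_gridError (T := T) (fun t => (hu.adapted t).mono (ℱ.le t)) hu.cont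
      (hHc I) hK' hδ
    refine h.congr fun n => ?_
    rcases I with l | l <;> rfl
  -- The elementary integrals of the frozen Wirtinger derivatives are the sums of frozen
  -- differentials; grid intervals beyond `T` contribute nothing on either side.
  · refine (tendstoInMeasure_itoSum hβ hu hb hφ hK₂ T).congr_left fun n =>
      Eventually.of_forall fun ω => ?_
    simp only [SimpleIntegrand.integral, gridIntegrand, itoSum]
    rw [Finset.sum_comm]
    refine Finset.sum_congr rfl fun i _ => ?_
    change _ = ∑ I, H I (u (gridTime n i) ω) * _
    rw [Fintype.sum_sum_type, ← Finset.sum_add_distrib]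
    rcases le_total (gridTime n i) T with hT | hT
    · rw [fderiv_eq_sum_dz]
      refine Finset.sum_congr rfl fun l _ => ?_
      simp only [hH, Sum.elim_inl, Sum.elim_inr, scaleL_apply, stopTime, min_eq_left hT,
        Pi.sub_apply, map_mul, map_sub, Complex.conj_ofReal]
      ring
    · have hT' := hT.trans (gridTime_mono n (Nat.le_succ i))
      simp only [stopTime, min_eq_right hT, min_eq_right hT', sub_self, map_zero, mul_zero,
        add_zero, Finset.sum_const_zero, Sum.elim_inl, Sum.elim_inr]

end ItoFormula

end Rotators

namespace Rotators

/-! ### Itô's formula for the components of a change of variables -/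

section ChangeOfVariables

variable {d : ℕ} {Λ : Finset (Fin d → ℤ)}

lemma fderiv_coord_apply {Ψ : Phase Λ → Phase Λ} (hΨ : Differentiable ℝ Ψ) (x a : Phase Λ) (k : Λ) :
    fderiv ℝ (fun u => Ψ u k) x a = fderiv ℝ Ψ x a k := by
  have h : HasFDerivAt (fun u => Ψ u k)
      ((ContinuousLinearMap.proj (R := ℝ) (φ := fun _ : Λ => ℂ) k).comp (fderiv ℝ Ψ x)) x :=
    (ContinuousLinearMap.proj (R := ℝ) (φ := fun _ : Λ => ℂ) k).hasFDerivAt.comp x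
      (hΨ x).hasFDerivAt
  rw [h.fderiv]
  rfl

lemma fderiv_fderiv_coord_apply {Ψ : Phase Λ → Phase Λ} (hΨ : ContDiff ℝ 2 Ψ) (x a a' : Phase Λ)
    (k : Λ) : fderiv ℝ (fderiv ℝ (fun u => Ψ u k)) x a a' = fderiv ℝ (fderiv ℝ Ψ) x a a' k := by
  have hφ : ContDiff ℝ 2 fun u => Ψ u k := contDiff_pi.1 hΨ k
  have hd : Differentiable ℝ (fderiv ℝ Ψ) :=
    (hΨ.fderiv_right (m := 1) (by norm_num)).differentiable (by norm_num)
  have hd' : Differentiable ℝ (fderiv ℝ (fun u => Ψ u k)) :=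
    (hφ.fderiv_right (m := 1) (by norm_num)).differentiable (by norm_num)
  have h1 : HasDerivAt (fun t : ℝ => fderiv ℝ (fun u => Ψ u k) (x + t • a) a')
      (fderiv ℝ (fderiv ℝ (fun u => Ψ u k)) x a a') 0 := by
    have h := HasDerivAt.clm_apply (hd' x |>.hasFDerivAt.hasLineDerivAt a :)
      (hasDerivAt_const (0 : ℝ) a')
    rwa [map_zero, add_zero] at h
  have h2 : HasDerivAt (fun t : ℝ => fderiv ℝ Ψ (x + t • a) a' k)
      (fderiv ℝ (fderiv ℝ Ψ) x a a' k) 0 := by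
    have h := HasDerivAt.clm_apply (hd x |>.hasFDerivAt.hasLineDerivAt a :)
      (hasDerivAt_const (0 : ℝ) a')
    rw [map_zero, add_zero] at h
    exact hasDerivAt_pi.1 h k
  simp only [fderiv_coord_apply (hΨ.differentiable (by norm_num))] at h1
  exact h1.unique h2

/-- The noise acts with the same real factor on both real coordinates of a site, so the trace of the
Hessian becomes a sum of Laplacians over the planes of the sites. -/
lemma halfTrace_coord {Ψ : Phase Λ → Phase Λ} (hΨ : ContDiff ℝ 2 Ψ) (c : Λ → ℝ) (x : Phase Λ)
    (k : Λ) : halfTrace c (fun u => Ψ u k) x =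
      ∑ l, ((c l ^ 2 / 2 : ℝ) : ℂ) * siteLaplacian Ψ l x k := by
  have hs : ∀ (l : Λ) (z : ℂ), scaleL c (Pi.single l z) = c l • (Pi.single l z : Phase Λ) := by
    intro l z
    funext j
    rw [scaleL_apply, Pi.smul_apply, Complex.real_smul]
    rcases eq_or_ne j l with rfl | h
    · rfl
    · rw [Pi.single_eq_of_ne h, mul_zero, mul_zero]
  rw [halfTrace, Fintype.sum_sum_type, ← Finset.sum_add_distrib, Finset.smul_sum]
  refine Finset.sum_congr rfl fun l _ => ?_
  simp only [coordVec, Sum.elim_inl, Sum.elim_inr, hs, map_smul, smul_apply,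
    fderiv_fderiv_coord_apply hΨ, siteLaplacian, Pi.add_apply, Complex.real_smul]
  push_cast
  ring

/-- Itô's formula for a `C²` map with bounded first and second derivatives. -/
theorem solvesIto_comp {Ω : Type*} {mΩ : MeasurableSpace Ω} {ℱ : Filtration ℝ≥0 mΩ} {μ : Measure Ω}
    [IsProbabilityMeasure μ] {β u : ℝ≥0 → Ω → Phase Λ} {b b' : Phase Λ → Phase Λ} {c : Λ → ℝ}
    {Γ : Phase Λ ≃ Phase Λ} {σ₁ σ₂ : Phase Λ → Matrix Λ Λ ℂ} {K : ℝ}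
    (hβ : IsComplexBrownian ℱ μ β) (hu : SolvesAdditive ℱ μ β b c u) (hb : Continuous b)
    (hΓ : ContDiff ℝ 2 Γ.symm) (hK : ∀ k x, ‖fderiv ℝ (fun u => Γ.symm u k) x‖ ≤ K)
    (hK₂ : ∀ k x, ‖fderiv ℝ (fderiv ℝ (fun u => Γ.symm u k)) x‖ ≤ K)
    (hdrift : ∀ v k, fderiv ℝ Γ.symm (Γ v) (b (Γ v)) k +
      ∑ l, ((c l ^ 2 / 2 : ℝ) : ℂ) * siteLaplacian Γ.symm l (Γ v) k = b' v k)
    (h₁ : ∀ v k l, σ₁ v k l = c l * dz (fun u => Γ.symm u k) (Γ v) l)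
    (h₂ : ∀ v k l, σ₂ v k l = c l * dzbar (fun u => Γ.symm u k) (Γ v) l) :
    SolvesIto ℱ μ β b' σ₁ σ₂ (fun t ω => Γ.symm (u t ω)) where
  adapted t := hΓ.continuous.comp_stronglyMeasurable (hu.adapted t)
  cont := hu.cont.mono fun ω h => hΓ.continuous.comp h
  eqn k := by
    have h := isItoIntegral_comp hβ hu hb (contDiff_pi.1 hΓ k) (hK k) (hK₂ k)
    simp only [fderiv_coord_apply (hΓ.differentiable (by norm_num)), halfTrace_coord hΓ] at h
    simp only [h₁, h₂, ← hdrift, Equiv.apply_symm_apply]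
    exact h

/-- A constant depending on `Λ`. It is used only for the boundedness required in Itô's formula,
where uniformity is irrelevant. -/
lemma exists_one_le_mul_decay (Λ : Finset (Fin d → ℤ)) :
    ∃ M : ℝ, 0 ≤ M ∧ ∀ j k : Λ, 1 ≤ M * decay j k := by
  have h0 : ∀ q : Λ × Λ, 0 ≤ (decay q.1 q.2)⁻¹ := fun q => inv_nonneg.2 (decay_nonneg _ _)
  refine ⟨∑ q : Λ × Λ, (decay q.1 q.2)⁻¹, Finset.sum_nonneg fun q _ => h0 q, fun j k => ?_⟩
  rw [← inv_mul_cancel₀ (decay_pos j k).ne']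
  exact mul_le_mul_of_nonneg_right
    (Finset.single_le_sum (f := fun q : Λ × Λ => (decay q.1 q.2)⁻¹) (fun q _ => h0 q)
      (Finset.mem_univ (j, k))) (decay_nonneg _ _)

/-- Any vector is dominated by a multiple of the decay profile of a site, so the weighted estimates
give qualitative bounds. The second derivative is estimated on the diagonal only and recovered by
polarization, with factor `3 = (4 + 1 + 1) / 2`. -/
lemma LocalField.exists_norm_fderiv_flow_le {W : Phase Λ → Phase Λ} {κ : ℝ}
    {X : ℝ → Phase Λ → Phase Λ} (hW : LocalField W κ) (hκ : κ ≤ 1 / 4) (hX : IsFlow W X) {s : ℝ}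
    (hs : s ∈ Set.Icc (0 : ℝ) 1) :
    ∃ K : ℝ, ∀ k v, ‖fderiv ℝ (fun u => X s u k) v‖ ≤ K ∧
      ‖fderiv ℝ (fderiv ℝ (fun u => X s u k)) v‖ ≤ K := by
  obtain ⟨M, hM0, hM⟩ := exists_one_le_mul_decay Λ
  have hΨ := hW.contDiff_flow hκ hX hs
  have hκ0 := hW.nonneg
  have ha : ∀ (a : Phase Λ) (k j : Λ), ‖a j‖ ≤ ‖a‖ * M * decay j k := fun a k j => by
    rw [mul_assoc]
    exact (norm_le_pi_norm a j).trans (le_mul_of_one_le_right (norm_nonneg _) (hM j k))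
  set C := 288 * κ * M ^ 2 with hC
  have hC0 : 0 ≤ C := by positivity
  refine ⟨max (3 * M) (3 * C), fun k v => ⟨(le_max_left _ _).trans' ?_,
    (le_max_right _ _).trans' ?_⟩⟩
  · refine ContinuousLinearMap.opNorm_le_bound _ (by positivity) fun a => ?_
    rw [fderiv_coord_apply (hΨ.differentiable (by norm_num))]
    refine (hW.fderiv_flow_apply_le hκ hX hs v (by positivity) (ha a k) k).1.trans (le_of_eq ?_)
    rw [decay_self]
    ring
  · set Q := fderiv ℝ (fderiv ℝ (fun u => X s u k)) v with hQ
    have hdiag : ∀ a, ‖Q a a‖ ≤ C * ‖a‖ ^ 2 := fun a => by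
      rw [hQ, fderiv_fderiv_coord_apply hΨ]
      refine (hW.fderiv_fderiv_flow_apply_le hκ hX hs v (by positivity) (ha a k) k).trans
        (le_of_eq ?_)
      rw [decay_self, hC]
      ring
    have hsymm : ∀ a a', Q a a' = Q a' a := fun a a' =>
      (((contDiff_pi.1 hΨ k).contDiffAt (x := v)).isSymmSndFDerivAt (by simp)).eq a a'
    refine ContinuousLinearMap.opNorm_le_of_unit_norm (by positivity) fun a h1 =>
      ContinuousLinearMap.opNorm_le_of_unit_norm (by positivity) fun a' h2 => ?_
    have hpol : Q a a' = (1 / 2 : ℝ) • (Q (a + a') (a + a') - Q a a - Q a' a') := by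
      simp only [map_add, add_apply, hsymm a' a, Complex.real_smul]
      push_cast
      ring
    have h3 := hdiag (a + a')
    have h4 : ‖a + a'‖ ^ 2 ≤ 2 ^ 2 :=
      pow_le_pow_left₀ (norm_nonneg _) ((norm_add_le a a').trans (by rw [h1, h2]; norm_num)) 2
    have h5 := hdiag a
    have h6 := hdiag a'
    rw [h1] at h5
    rw [h2] at h6
    rw [hpol, norm_smul, Real.norm_eq_abs, abs_of_pos (by norm_num)]
    have h7 := norm_sub_le (Q (a + a') (a + a') - Q a a) (Q a' a')
    have h8 := norm_sub_le (Q (a + a') (a + a')) (Q a a)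
    have h9 := mul_le_mul_of_nonneg_left h4 hC0
    linarith

end ChangeOfVariables

end Rotators

namespace Rotators

/-! ### Assembly of the theorem -/

section Assembly

variable {d p : ℕ} {Λ : Finset (Fin d → ℤ)} {F : (Fin d → ℤ) → ℝ → ℝ} {G : ℝ → ℝ} {ε K : ℝ}

lemma contDiff_hamiltonian {n : WithTop ℕ∞} (hF : ContDiff ℝ n (freeHam F : Phase Λ → ℝ))
    (hG : ContDiff ℝ n (pairPot G)) : ContDiff ℝ n (hamiltonian F G ε Λ) := by
  have : hamiltonian F G ε Λ = fun u => freeHam F u + √ε * pairSum (fun _ => 1) (pairPot G) u :=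
    funext hamiltonian_eq
  rw [this]
  exact hF.add (contDiff_const.mul (contDiff_pairSum hG))

lemma contDiff_hamiltonian0 {n : WithTop ℕ∞} (hF : ContDiff ℝ n (freeHam F : Phase Λ → ℝ))
    (hG : Continuous (pairPot G)) (hA : ContDiff ℝ n (pairAvg (fun _ => 1) (pairPot G))) :
    ContDiff ℝ n (hamiltonian0 F G ε Λ) := by
  have : hamiltonian0 F G ε Λ = fun v => freeHam F v +
      √ε * pairSum (fun _ => 1) (pairAvg (fun _ => 1) (pairPot G)) v :=
    funext (hamiltonian0_eq hG)
  rw [this]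
  exact hF.add (contDiff_const.mul (contDiff_pairSum hA))

lemma hamiltonian_eq_add_ham3 (hε : 0 < ε) (hG : Continuous (pairPot G)) (B : ℂ × ℂ → ℝ)
    (Γ : Phase Λ → Phase Λ) (v : Phase Λ) :
    hamiltonian F G ε Λ (Γ v) = hamiltonian0 F G ε Λ v +
      ε * ham2 Λ (pairPot G) (pairAvg (fun _ => 1) (pairPot G)) B v +
      ε * √ε * ham3 F ε (pairPot G) (pairAvg (fun _ => 1) (pairPot G)) B Γ v := by
  have h : ε * √ε ≠ 0 := (mul_pos hε (Real.sqrt_pos.2 hε)).ne'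
  rw [ham3, mul_inv_cancel_left₀ h, hamiltonian_eq, hamiltonian0_eq hG]
  ring

variable {W : Phase Λ → Phase Λ} {κ : ℝ} {X : ℝ → Phase Λ → Phase Λ}

/-- The equation in the new variables. -/
theorem solvesIto_flow {Ω : Type*} {mΩ : MeasurableSpace Ω} {ℱ : Filtration ℝ≥0 mΩ} {μ : Measure Ω}
    [IsProbabilityMeasure μ] {β u : ℝ≥0 → Ω → Phase Λ} {b b' : Phase Λ → Phase Λ} {T : Λ → ℝ}
    (hε : 0 < ε) (hW : LocalField W κ) (hκ : κ ≤ 1 / 4) (hX : IsFlow W X)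
    (hβ : IsComplexBrownian ℱ μ β) (hu : SolvesAdditive ℱ μ β b (fun j => √(ε * T j)) u)
    (hb : Continuous b)
    (hdrift : ∀ v k, fderiv ℝ (hX.equiv hW.lipschitz 1).symm (hX.equiv hW.lipschitz 1 v)
      (b (hX.equiv hW.lipschitz 1 v)) k + ∑ l, ((√(ε * T l) ^ 2 / 2 : ℝ) : ℂ) *
        siteLaplacian (hX.equiv hW.lipschitz 1).symm l (hX.equiv hW.lipschitz 1 v) k = b' v k) :
    SolvesIto ℱ μ β b' (fun v => (√ε : ℂ) • W1 T (hX.equiv hW.lipschitz 1) v)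
      (fun v => (√ε : ℂ) • W2 T (hX.equiv hW.lipschitz 1) v)
      (fun t ω => (hX.equiv hW.lipschitz 1).symm (u t ω)) := by
  have h01 : (1 : ℝ) ∈ Set.Icc (0 : ℝ) 1 := Set.right_mem_Icc.2 zero_le_one
  have hY : IsFlow (fun u => -W u) fun s => X (-s) := hX.neg
  obtain ⟨K, hK⟩ := hW.neg.exists_norm_fderiv_flow_le hκ hY h01
  have hs : ∀ l, (√(ε * T l) : ℂ) = √ε * √(T l) := fun l => by
    rw [Real.sqrt_mul hε.le, Complex.ofReal_mul]
  have hΨ := hW.neg.contDiff_flow hκ hY h01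
  refine solvesIto_comp hβ hu hb hΨ (fun k x => (hK k x).1)
    (fun k x => (hK k x).2) hdrift (fun v k l => ?_) fun v k l => ?_
  · rw [hs, mul_assoc]
    rfl
  · rw [hs, mul_assoc]
    rfl

/-- The coefficients are Wirtinger derivatives of `Γ⁻¹`, the time-one map of the reversed flow,
which is within `12κ` of the identity with decay. As `κ ≤ 1 / 4`, this is at most `3`, as the
quadratic terms require. -/
lemma norm_diff_flow_sub_le {T : Λ → ℝ} {Tm : ℝ} (hT : ∀ m, 0 < T m ∧ T m ≤ Tm)
    (hW : LocalField W κ) (hκ : κ ≤ 1 / 4) (hX : IsFlow W X) (v : Phase Λ) (k l : Λ) :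
    ‖diff1 (W1 T (hX.equiv hW.lipschitz 1) v) (W2 T (hX.equiv hW.lipschitz 1) v) k l -
        (if k = l then (T k : ℂ) else 0)‖ ≤ diffConst d Tm * (12 * κ) ∧
      ‖diff2 (W1 T (hX.equiv hW.lipschitz 1) v) (W2 T (hX.equiv hW.lipschitz 1) v) k l‖ ≤
        diffConst d Tm * (12 * κ) := by
  have h01 : (1 : ℝ) ∈ Set.Icc (0 : ℝ) 1 := Set.right_mem_Icc.2 zero_le_one
  have hY : IsFlow (fun u => -W u) fun s => X (-s) := hX.neg
  have hΨ := hW.neg.contDiff_flow hκ hY h01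
  have hκ0 := hW.nonneg
  set Γ := hX.equiv hW.lipschitz 1
  have hdz : ∀ k m, ‖dz (fun u => Γ.symm u k) (Γ v) m - (if k = m then 1 else 0)‖ ≤
      12 * κ * decay k m ∧ ‖dzbar (fun u => Γ.symm u k) (Γ v) m‖ ≤ 12 * κ * decay k m := fun k m =>
    norm_dz_sub_le (Ψ := Γ.symm) (hΨ.differentiable (by norm_num)) (Γ v) k m fun z =>
      (hW.neg.fderiv_flow_apply_le hκ hY h01 (Γ v) (norm_nonneg z)
        (fun j => LocalField.norm_single_apply_le m j z) k).2
  exact norm_diff_sub_le (fun m => ⟨(hT m).1.le, (hT m).2⟩) (by positivity) (by linarith)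
    (fun _ _ => rfl) (fun _ _ => rfl) (fun k m => (hdz k m).1) (fun k m => (hdz k m).2) k l

end Assembly

end Rotators

theorem mainTheorem3 (d p : ℕ) (hp : 2 ≤ p) (ς : ℝ) (hς : 0 < ς)
    (f G : ℝ → ℝ) (F : (Fin d → ℤ) → ℝ → ℝ)
    (hf : AssumptionHF p ς f) (hG : AssumptionHG p ς G)
    (hF : ∀ j, ∀ x : ℝ, 0 ≤ x →
      HasDerivWithinAt (F j) ((-1) ^ siteNorm j * f x) (Set.Ici 0) x)
    (Tmax Cg : ℝ) :
    ∃ (ε₀ C : ℝ) (C₁ C₂ : ℝ → ℝ) (C₃ : ℝ → ℝ → ℝ), 0 < ε₀ ∧ 0 < C ∧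
      ∀ (Λ : Finset (Fin d → ℤ)) (T : Λ → ℝ) (g : Phase Λ → Phase Λ),
        (∀ j, 0 < T j ∧ T j ≤ Tmax) → AssumptionHg p Cg Λ g →
        ∃ Φ H₂ : Phase Λ → ℝ, ContDiff ℝ 3 Φ ∧ ContDiff ℝ 2 H₂ ∧
          -- `|(i∇H₂ · v)_j| ≤ (1 - γ) C ‖v‖_{j,p}^p + C(γ)`
          (∀ j : Λ, ∀ γ : ℝ, 1 / 2 < γ → γ < 1 → ∀ v : Phase Λ,
            |wInner γ j (fun k => Complex.I * grad H₂ v k) v| ≤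
              (1 - γ) * C * wNormPow γ j p v + C₁ γ) ∧
          -- locality and growth of `∇H₂`
          (∀ j : Λ, ∀ v w : Phase Λ, (∀ n, dist1 n j ≤ 2 → v n = w n) →
            grad H₂ v j = grad H₂ w j) ∧
          (∀ j : Λ, ∀ v : Phase Λ,
            ‖grad H₂ v j‖ ≤ C * (∑ n with dist1 n j ≤ 2, ‖v n‖ ^ (p - 1)) + C) ∧
          ∀ ε : ℝ, 0 < ε → ε ≤ ε₀ →
            ∃ (Γ : Phase Λ ≃ Phase Λ) (H₃ : Phase Λ → ℝ) (r : Phase Λ → Phase Λ),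
              -- the change of variables `u = Γ v`
              IsCanonical Γ ∧ IsTimeOneMap (fun v => √ε * Φ v) Γ ∧
              -- the Hamiltonian in the new variables, with `H₃` standing for `H_>`
              (∀ v, hamiltonian F G ε Λ (Γ v) =
                hamiltonian0 F G ε Λ v + ε * H₂ v + ε * √ε * H₃ v) ∧
              (∀ v w : Phase Λ, (∀ k, ‖v k‖ = ‖w k‖) →
                hamiltonian0 F G ε Λ v = hamiltonian0 F G ε Λ w) ∧
              ContDiff ℝ 4 (hamiltonian0 F G ε Λ) ∧ ContDiff ℝ 2 H₃ ∧ Continuous r ∧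
              -- the stochastic system in the new variables
              (∀ (Ω : Type*) (mΩ : MeasurableSpace Ω) (μ : Measure Ω) (_ : IsProbabilityMeasure μ)
                (ℱ : Filtration ℝ≥0 mΩ) (β u : ℝ≥0 → Ω → Phase Λ),
                IsComplexBrownian ℱ μ β →
                SolvesAdditive ℱ μ β
                  (fun w j => Complex.I * grad (hamiltonian F G ε Λ) w j + ε * g w j)
                  (fun j => √(ε * T j)) u →
                SolvesIto ℱ μ β
                  (fun v j => Complex.I * grad (hamiltonian0 F G ε Λ) v j +
                    ε * (Complex.I * grad H₂ v j) + ε * g v j + ε * √ε * r v j)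
                  (fun v => (√ε : ℂ) • W1 T Γ v) (fun v => (√ε : ℂ) • W2 T Γ v)
                  (fun t ω => Γ.symm (u t ω))) ∧
              -- `‖r‖_{j,q}^q ≤ C(γ, q) + C(q) ‖v‖_{j,q(p-1)}^{q(p-1)}`
              (∀ j : Λ, ∀ γ : ℝ, 1 / 2 < γ → γ < 1 → ∀ q : ℝ, 1 ≤ q → ∀ v : Phase Λ,
                wNormPow γ j q (r v) ≤ C₃ γ q + C₂ q * wNormPow γ j (q * (p - 1)) v) ∧
              -- the diffusion coefficients are `√ε`-close to those of `diag T`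
              (∀ v : Phase Λ, ∀ k l : Λ,
                ‖diff1 (W1 T Γ v) (W2 T Γ v) k l - (if k = l then (T k : ℂ) else 0)‖ ≤ C * √ε ∧
                ‖diff2 (W1 T Γ v) (W2 T Γ v) k l‖ ≤ C * √ε) ∧
              -- closeness to the identity, also for the actions
              (∀ v : Phase Λ, ∀ j : Λ, ‖Γ v j - v j‖ ≤ C * √ε ∧
                |‖Γ v j‖ ^ 2 / 2 - ‖v j‖ ^ 2 / 2| ≤ C * √ε) := by
  obtain ⟨K, hK, hP⟩ := exists_pairBounds hp hς hf hG
  set A := pairPot G with hA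
  set A₀ := pairAvg (fun _ => 1) A with hA₀
  set B := pairHom f G with hB
  have hfc := fieldConst_nonneg (d := d) hK
  have hic := innerConst_nonneg (d := d) hK
  have hlc := lieConst_nonneg (d := d) hK
  have hnb := nbhdConst_nonneg d 1
  have hdc := driftConst_nonneg (d := d) (p := p) hK Cg Tmax
  have hlat := latticeConst_nonneg (d := d) (x := 1 / 4) (by norm_num) (by norm_num)
  -- The constants are fixed before the temperatures, so nothing yet forces `Tmax` to be
  -- nonnegative; the absolute value does.
  have hdiff : 0 ≤ diffConst d |Tmax| := mul_nonneg (abs_nonneg _) (by positivity)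
  set c := driftConst d p K Cg Tmax
  set a₁ := innerConst d K * (2 * nbhdConst d 1)
  set a₂ := nbhdConst d 1 * (2 * lieConst d K)
  set a₃ := diffConst d |Tmax| * (12 * fieldConst d K)
  set a₄ := nbhdConst d 1 * K
  have h1 : 0 ≤ a₁ := by positivity
  have h2 : 0 ≤ a₂ := by positivity
  have h3 : 0 ≤ a₃ := by positivity
  have h4 : 0 ≤ a₄ := by positivity
  -- One constant for all estimates: the product with `v`, the growth of `∇H₂`, the diffusion, the
  -- actions and the displacement. The final `1` makes it positive.
  set C := a₁ + a₂ + a₃ + a₄ + fieldConst d K + 1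
  have hone : 0 < 4 * (fieldConst d K + 1) := by positivity
  -- The threshold ensures `√ε * fieldConst d K ≤ 1 / 4`, the smallness needed for both the Picard
  -- map and the weighted Grönwall estimate; the added `1` avoids a vanishing denominator.
  refine ⟨(1 / (4 * (fieldConst d K + 1))) ^ 2, C, fun γ => innerConst d K * latticeConst d γ,
    fun q => normConst d c q, fun γ q => normConst d c q * latticeConst d γ, by positivity,
    by positivity, fun Λ T g hT hg => ?_⟩
  have hT' : ∀ m, 0 < T m ∧ T m ≤ |Tmax| := fun m => ⟨(hT m).1, (hT m).2.trans (le_abs_self _)⟩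
  have hFree : ContDiff ℝ 4 (freeHam F : Phase Λ → ℝ) := contDiff_freeHam hς hf.smooth hF
  refine ⟨pairSum (signs Λ) B, ham2 Λ A A₀ B, contDiff_pairSum hP.contDiff_hom, contDiff_ham2 hP,
    fun j γ hγ hγ' v => ?_, fun j v w h => grad_ham2_congr hP h, fun j v => ?_,
    fun ε hε hεle => ?_⟩
  · refine (abs_wInner_ham2_le (by omega) hP j hγ hγ' v).trans (add_le_add_left
      (mul_le_mul_of_nonneg_right (mul_le_mul_of_nonneg_left (by linarith) (by linarith)) ?_) _)
    exact Finset.sum_nonneg fun k _ => by positivity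
  · refine (norm_grad_ham2_le hP v j).trans (add_le_add
      (mul_le_mul_of_nonneg_right (by linarith) ?_) (by linarith))
    exact Finset.sum_nonneg fun k _ => by positivity
  · have hsε : 0 < √ε := Real.sqrt_pos.2 hε
    have hsle : √ε ≤ 1 / (4 * (fieldConst d K + 1)) := by
      rw [← Real.sqrt_sq (by positivity : 0 ≤ 1 / (4 * (fieldConst d K + 1)))]
      exact Real.sqrt_le_sqrt hεle
    have hκ : √ε * fieldConst d K ≤ 1 / 4 := by
      calc √ε * fieldConst d K ≤ 1 / (4 * (fieldConst d K + 1)) * (fieldConst d K + 1) :=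
            mul_le_mul hsle (by linarith) hfc (by positivity)
        _ = 1 / 4 := by field_simp
    have hW : LocalField (smallField ε Λ B) (√ε * fieldConst d K) :=
      localField_smallField hP.contDiff_hom hP.jet_hom hK
    obtain ⟨X, hX⟩ := hW.exists_isFlow
    have h01 : (1 : ℝ) ∈ Set.Icc (0 : ℝ) 1 := Set.right_mem_Icc.2 zero_le_one
    have hfield : ∀ u j, smallField ε Λ B u j =
        Complex.I * grad (fun v => √ε * pairSum (signs Λ) B v) u j :=
      smallField_eq hP.contDiff_hom
    have hΦ : ContDiff ℝ 2 fun v : Phase Λ => √ε * pairSum (signs Λ) B v :=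
      contDiff_const.mul ((contDiff_pairSum hP.contDiff_hom).of_le (by norm_num))
    set Γ := hX.equiv hW.lipschitz 1 with hΓdef
    have hΓ : IsCanonical Γ := isCanonical_flow hW hκ hX hΦ hfield
    set H₃ : Phase Λ → ℝ := ham3 F ε A A₀ B (X 1) with hH₃def
    have hH₃ : ContDiff ℝ 2 H₃ := contDiff_ham3 hP (hFree.of_le (by norm_num)) hΓ.smooth
    have hH : ContDiff ℝ 4 (hamiltonian F G ε Λ) := contDiff_hamiltonian hFree hP.contDiff
    have hH₀ : ContDiff ℝ 4 (hamiltonian0 F G ε Λ) :=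
      contDiff_hamiltonian0 hFree hP.contDiff.continuous hP.contDiff_avg
    have heq : ∀ v, hamiltonian F G ε Λ (Γ v) =
        hamiltonian0 F G ε Λ v + ε * ham2 Λ A A₀ B v + ε * √ε * H₃ v :=
      hamiltonian_eq_add_ham3 hε hP.contDiff.continuous B (X 1)
    have hgc : Continuous g := continuous_pi fun l => (hg.smooth l).continuous
    refine ⟨Γ, H₃, driftRem H₃ ε T g Γ, hΓ, ⟨X, hX.zero, fun _ => rfl, fun v s => ?_⟩, heq,
      fun v w h => hamiltonian0_congr h, hH₀, hH₃, continuous_driftRem hΓ hH₃ hgc, ?_, ?_, ?_, ?_⟩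
    · have := hX.hasDerivAt v s
      rwa [show smallField ε Λ B (X s v) = fun j => Complex.I *
        grad (fun v => √ε * pairSum (signs Λ) B v) (X s v) j from funext (hfield _)] at this
    · intro Ω mΩ μ hμ ℱ β u hβ hu
      refine solvesIto_flow hε hW hκ hX hβ hu ?_ ?_
      · exact continuous_pi fun j => (continuous_const.mul
          (continuous_grad (hH.of_le (by norm_num)) j)).add
          (continuous_const.mul ((continuous_apply j).comp hgc))
      · exact ito_drift_eq hΓ hε (fun l => (hT l).1) (hH.differentiable (by norm_num))
          (hH₀.differentiable (by norm_num)) ((contDiff_ham2 hP).differentiable (by norm_num))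
          (hH₃.differentiable (by norm_num)) heq
    · intro j γ hγ hγ' q hq v
      exact wNormPow_le (by omega) hdc (norm_driftRem_le hε hP (hFree.of_le (by norm_num)) hF hκ hX
        hW.lipschitz hg hT v) j hγ hγ' hq
    · intro v k l
      have h := norm_diff_flow_sub_le hT' hW hκ hX v k l
      have hle : diffConst d |Tmax| * (12 * (√ε * fieldConst d K)) ≤ C * √ε := by
        calc _ = a₃ * √ε := by ring
          _ ≤ _ := mul_le_mul_of_nonneg_right (by linarith) hsε.le
      exact ⟨h.1.trans hle, h.2.trans hle⟩
    · intro v j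
      constructor
      · refine (norm_le_pi_norm (X 1 v - v) j).trans ((hW.norm_flow_sub_le hX h01 v).trans ?_)
        rw [mul_comm]
        exact mul_le_mul_of_nonneg_right (by linarith) hsε.le
      · exact (abs_action_sub_le hP hX v j).trans
          (mul_le_mul_of_nonneg_right (by linarith) hsε.le)
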